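/- Let $\varepsilon,\mu\in(0,1]$. The one-dimensional classical (Amick–Schonbek) Boussinesq system for $U=(\zeta,V)^T$, with $\zeta,V$ real-valued functions of $t\in[0,T]$ and $x\in\mathbb R$, is $$\varepsilon\,\partial_t\zeta+\partial_x\big([1+\varepsilon\zeta]V\big)=0,\qquad \varepsilon\Big(1-\frac{\mu}{3}\partial_x^2\Big)\partial_tV+\partial_x\zeta+\varepsilon V\partial_xV=0 .$$ Put $$A(\partial_x)=\begin{pmatrix}0&\partial_x\\ (1-\frac{\mu}{3}\partial_x^2)^{-1}\partial_x&0\end{pmatrix},$$ and let $e^{\tau A(\partial_x)}$, $\tau\in\mathbb R$, be the Fourier multiplier whose matrix symbol is the exponential of $\tau$ times the symbol of $A(\partial_x)$. **Theorem.** There exists a constant $C>0$ such that the following holds for all $M>0$, $T>0$, $\varepsilon\in(0,1]$, $\mu\in(0,1]$ (so $C$ does not depend on $M,T,\varepsilon,\mu$). Let $(\zeta,V)\in C([0,T];H^3(\mathbb R)\times H^3(\mathbb R))$ be a solution of the Boussinesq system with initial datum $(\zeta_0,V_0)$ and $$\|(\zeta,V)\|_{L^\infty(0,T;H^3(\mathbb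 R)\times H^3(\mathbb R))}\le M .$$ Then for all $q,r\in[2,\infty]$ with $\frac1q+\frac1{2r}=\frac14$ and all $\tilde q,\tilde r\in[2,\infty]$ with $\frac1{\tilde q}+\frac1{3\tilde r}=\frac16$, $$\Big\|\begin{pmatrix}\zeta\\V\end{pmatrix}-e^{-\frac t\varepsilon A(\partial_x)}\begin{pmatrix}\zeta_0\\V_0\end{pmatrix}\Big\|_{L^q_t(0,T;L^r_x(\mathbb R))}\le C\Big(\frac\varepsilon\mu\Big)^{\frac14+\frac1q}M^2T^{\frac34},$$ $$\Big\|\begin{pmatrix}\zeta\\V\end{pmatrix}-e^{-\frac t\varepsilon A(\partial_x)}\begin{pmatrix}\zeta_0\\V_0\end{pmatrix}\Big\|_{L^{\tilde q}_t(0,T;L^{\tilde r}_x(\mathbb R))}\le C\Big(\frac\varepsilon\mu\Big)^{\frac16+\frac1{\tilde q}}M^2T^{\frac56},$$ $$\Big\|\begin{pmatrix}\zeta\\V\end{pmatrix}\Big\|_{L^{\tilde q}_t(0,T;L^{\tilde r}_x(\mathbb R))}\le C\Big(\frac\varepsilon\mu\Big)^{\frac1{\tilde q}}\Big(M+M^2T^{\frac56}\Big(\frac\varepsilon\mu\Big)^{\frac16}\Big),$$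 $$\sup_{x_0\in\mathbb R}\Big\|e^{-(x-x_0)^2}\begin{pmatrix}\zeta\\V\end{pmatrix}\Big\|_{L^2_t(0,T;L^2_x(\mathbb R))}\le C\,\varepsilon^{\frac12}\,(M+M^2T).$$ -/

import Mathlib

open MeasureTheory Set Filter Topology
open scoped ENNReal Matrix SchwartzMap FourierTransform

namespace Boussinesq

noncomputable section

open scoped Classical in
/-- The `L²` (Plancherel) Fourier transform of a real function `f ∈ L²(ℝ)`, with Mathlib's
normalization: `f̂(ξ) = ∫ exp(-2πi x ξ) f(x) dx` when `f` is also integrable, so that the operator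
`D = -i ∂ₓ` acts as multiplication by `2πξ`. It is set to `0` when `f ∉ L²(ℝ)`. -/
def fourierL2 (f : ℝ → ℝ) : ℝ → ℂ :=
  if h : MemLp (fun x => (f x : ℂ)) 2 (volume : Measure ℝ) then
    ((𝓕 (h.toLp (fun x => (f x : ℂ))) : Lp ℂ 2 (volume : Measure ℝ)) : ℝ → ℂ)
  else 0

open scoped Classical in
/-- The norm `‖f‖_{H^s(ℝ)} = ‖(1 + D²)^{s/2} f‖_{L²}` for `s ≥ 0`, equal to `∞` when
`f ∉ H^s(ℝ)`. -/
def sobolevNorm (s : ℝ) (f : ℝ → ℝ) : ℝ≥0∞ :=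
  if MemLp f 2 (volume : Measure ℝ) then
    eLpNorm (fun ξ : ℝ => (((1 + (2 * Real.pi * ξ) ^ 2) ^ (s / 2) : ℝ) : ℂ) * fourierL2 f ξ) 2
      volume
  else ⊤

/-- `u ∈ C([0,T]; H^s(ℝ))`. -/
def ContinuousInSobolev (s T : ℝ) (u : ℝ → ℝ → ℝ) : Prop :=
  (∀ t ∈ Icc 0 T, sobolevNorm s (u t) < ⊤) ∧
    ∀ t ∈ Icc 0 T,
      Tendsto (fun t' => sobolevNorm s (fun x => u t' x - u t x)) (𝓝[Icc 0 T] t) (𝓝 0)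

/-- `(ζ, V) ∈ C([0,T]; H³(ℝ) × H³(ℝ))` solves the one-dimensional classical Boussinesq system
  `ε ∂ₜζ + ∂ₓ((1 + εζ)V) = 0`,
  `ε (1 - (μ/3) ∂ₓ²) ∂ₜV + ∂ₓζ + ε V ∂ₓV = 0`
on `[0,T]`. The equations are tested in `x` against Schwartz functions, with
`V ∂ₓV = ∂ₓ(V²)/2`. -/
structure IsSolution (ε μ T : ℝ) (ζ V : ℝ → ℝ → ℝ) : Prop where
  continuous_zeta : ContinuousInSobolev 3 T ζ
  continuous_V : ContinuousInSobolev 3 T V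
  mass : ∀ φ : 𝓢(ℝ, ℂ), ∀ t ∈ Icc 0 T,
    HasDerivWithinAt (fun t' => (ε : ℂ) * ∫ x, (ζ t' x : ℂ) * φ x)
      (∫ x, (((1 + ε * ζ t x) * V t x : ℝ) : ℂ) * deriv φ x) (Icc 0 T) t
  momentum : ∀ φ : 𝓢(ℝ, ℂ), ∀ t ∈ Icc 0 T,
    HasDerivWithinAt
      (fun t' => (ε : ℂ) * ∫ x, (V t' x : ℂ) * (φ x - (μ / 3 : ℂ) * iteratedDeriv 2 φ x))
      (∫ x, ((ζ t x + ε * (V t x) ^ 2 / 2 : ℝ) : ℂ) * deriv φ x) (Icc 0 T) t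

/-- The symbol at frequency `k` (that is, `∂ₓ` replaced by `ik`) of the operator
`A(∂ₓ) = [[0, ∂ₓ], [(1 - (μ/3) ∂ₓ²)⁻¹ ∂ₓ, 0]]`. -/
def symbolA (μ k : ℝ) : Matrix (Fin 2) (Fin 2) ℂ :=
  !![0, Complex.I * k; Complex.I * k / ((1 + μ / 3 * k ^ 2 : ℝ) : ℂ), 0]

/-- The function `x ↦ (e^{τ A(∂ₓ)} (f, g))(x)`: the Fourier multiplier whose matrix-valued symbol
is `exp(τ A(ik))`, `k = 2πξ`. For `f, g ∈ H³(ℝ)` the inverse Fourier integrals below converge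
absolutely. -/
def linearFlow (μ τ : ℝ) (f g : ℝ → ℝ) (x : ℝ) : EuclideanSpace ℂ (Fin 2) :=
  WithLp.toLp 2 fun i =>
    𝓕⁻ (fun ξ : ℝ =>
      (NormedSpace.exp ((τ : ℂ) • symbolA μ (2 * Real.pi * ξ)) *ᵥ
        ![fourierL2 f ξ, fourierL2 g ξ]) i) x

/-- The vector `(ζ, V)(t, x)`, with complex scalars. -/
def state (ζ V : ℝ → ℝ → ℝ) (t x : ℝ) : EuclideanSpace ℂ (Fin 2) :=
  !₂[(ζ t x : ℂ), (V t x : ℂ)]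

/-- The norm of `L^q(0,T; L^r(ℝ))`. -/
def mixedNorm (T : ℝ) (q r : ℝ≥0∞) (W : ℝ → ℝ → EuclideanSpace ℂ (Fin 2)) : ℝ≥0∞ :=
  eLpNorm (fun t => eLpNorm (W t) r (volume : Measure ℝ)) q (volume.restrict (Ioo 0 T))

end

end Boussinesq

/-! Put m = μ/3, λ(k) = (1 + mk²)^{-1/2} and ω(k) = kλ(k). The Riemann invariants ζ̂ ± λ⁻¹V̂
diagonalize the linear part: they evolve by e^{∓itω/ε} and are forced by -∂ₓ(ζV) ∓ ½λ∂ₓ(V²). The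
forcing carries no factor 1/ε, while the phase of a wave emitted at time s is (t-s)ω/ε. The
difference between the solution and the linear flow is therefore a Duhamel integral in which
dispersion produces powers of ε/μ (`duhamel_riem`, `state_ae_eq`).

The curvature ω'' = -3mkλ⁵ vanishes at k = 0 and decays at infinity; H³ regularity pays for the
decay at infinity. Write ∂ₓ(fg) as ∂ₓ(1+∂ₓ³)⁻¹ applied to (1+∂ₓ³)(fg). The latter lies in L¹ with a
norm quadratic in the H³ norms, and the symbol ik/(1+(ik)³) is O(k) at 0 and O(k⁻²) at infinity. Van
der Corput estimates, uniform in x and in m ≤ 1, bound the resulting kernel by C(m|τ|)^{-p} for p =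
1/2 and for p = 1/3 (`kernel_al`). For p = 1/2 the zero of the symbol at k = 0 is essential.

Integrating the kernel bound over emission times gives a sup bound M²(ε/m)^p t^{1-p}
(`corrPart_sup`). The squared L² norm of the Duhamel term is a double time integral of inner
products of emitted waves, each controlled by the same kernel and two L¹ norms, so the L² bound is
M²(ε/m)^{p/2} t^{1-p/2} (`corrPart_energy`). Interpolation in x and integration in t give the first
estimate with p = 1/2 and the second with p = 1/3.

For the third estimate the linear flow is bounded in L⁶L^∞ by a TT* argument, with the t^{-1/3}
kernel decay and the Hardy–Littlewood–Sobolev inequality (`strichartz`), and is then interpolated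
with the energy bound.

The fourth is Kato smoothing (`local_smoothing`): at a fixed x the time frequency is ω/ε, so
Plancherel in t and the substitution y = ω(k) gain ε and cost 1/ω' = λ⁻³, which H³ data can afford.
The Duhamel term is treated by applying this to each emission time, and the Gaussian weight only
makes the bound integrable in x.

All functions are represented by their weighted Fourier transforms (1+k²)^{3/2}f̂ in L². Since ω is
bounded for m > 0, the evolution there is an ODE with a bounded generator. -/

namespace Boussinesq

/-! ### Van der Corput estimates -/

/-- The oscillating factor `exp(i φ)`. -/
noncomputable def osc (φ : ℝ → ℝ) (k : ℝ) : ℂ := Complex.exp (Complex.I * (φ k : ℂ))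

theorem norm_osc (φ : ℝ → ℝ) (k : ℝ) : ‖osc φ k‖ = 1 := by
  rw [osc, mul_comm]; exact Complex.norm_exp_ofReal_mul_I _

theorem continuousOn_osc {φ : ℝ → ℝ} {s : Set ℝ} (h : ContinuousOn φ s) :
    ContinuousOn (osc φ) s := by
  unfold osc; fun_prop

theorem conj_osc (φ : ℝ → ℝ) (k : ℝ) :
    (starRingEnd ℂ) (osc φ k) = osc (fun k => -φ k) k := by
  simp [osc, ← Complex.exp_conj]

theorem norm_integral_osc_neg (φ : ℝ → ℝ) (α β : ℝ) :
    ‖∫ k in α..β, osc (fun k => -φ k) k‖ = ‖∫ k in α..β, osc φ k‖ := by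
  simp_rw [← conj_osc]
  rw [intervalIntegral.intervalIntegral_eq_integral_uIoc,
    intervalIntegral.intervalIntegral_eq_integral_uIoc, integral_conj, norm_smul, norm_smul,
    RCLike.norm_conj]

/-- Integration by parts against the primitive of `f` that vanishes at `β`, so only the boundary
term at `α` survives. The bound `g` is allowed to depend on the lower limit because the phases used
later degenerate at one end. -/
theorem norm_integral_mul_le_left {a a' f : ℝ → ℂ} {g : ℝ → ℝ} {α β : ℝ} (hαβ : α ≤ β)
    (ha : ∀ k ∈ Icc α β, HasDerivAt a (a' k) k) (ha' : ContinuousOn a' (Icc α β))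
    (hf : ContinuousOn f (Icc α β))
    (hE : ∀ k ∈ Icc α β, ‖∫ s in k..β, f s‖ ≤ g k)
    (hg : IntervalIntegrable (fun k => ‖a' k‖ * g k) volume α β) :
    ‖∫ k in α..β, a k * f k‖ ≤ ‖a α‖ * g α + ∫ k in α..β, ‖a' k‖ * g k := by
  have hI : ∀ p ∈ Icc α β, ∀ q ∈ Icc α β, IntervalIntegrable f volume p q := fun p hp q hq =>
    (hf.mono (uIcc_subset_Icc hp hq)).intervalIntegrable
  have hl : α ∈ Icc α β := ⟨le_rfl, hαβ⟩
  have hr : β ∈ Icc α β := ⟨hαβ, le_rfl⟩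
  have hv : ContinuousOn (fun k => -∫ s in k..β, f s) (uIcc α β) := by
    have h1 := intervalIntegral.continuousOn_primitive_interval'
      (hI α hl β hr) (left_mem_uIcc)
    have : ContinuousOn (fun k => (∫ s in α..k, f s) - ∫ s in α..β, f s) (uIcc α β) :=
      h1.sub continuousOn_const
    refine this.congr fun k hk => ?_
    rw [uIcc_of_le hαβ] at hk
    have := intervalIntegral.integral_add_adjacent_intervals (hI α hl k hk) (hI k hk β hr)
    simp only [← this]; ring
  have key := intervalIntegral.integral_mul_deriv_eq_deriv_mul_of_hasDerivAt
    (u := a) (u' := a') (v := fun k => -∫ s in k..β, f s) (v' := f) (a := α) (b := β)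
    (by
      rw [uIcc_of_le hαβ]
      exact fun k hk => (ha k hk).continuousAt.continuousWithinAt)
    hv
    (by
      rw [min_eq_left hαβ, max_eq_right hαβ]
      exact fun k hk => ha k (Ioo_subset_Icc_self hk))
    (by
      rw [min_eq_left hαβ, max_eq_right hαβ]
      intro k hk
      have := intervalIntegral.integral_hasDerivAt_left (hI k (Ioo_subset_Icc_self hk) β hr)
        ((hf.mono Ioo_subset_Icc_self).stronglyMeasurableAtFilter isOpen_Ioo k hk)
        (hf.continuousAt (Icc_mem_nhds hk.1 hk.2))
      have h5 := this.neg
      rw [neg_neg] at h5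
      exact h5)
    (by
      apply ContinuousOn.intervalIntegrable
      rwa [uIcc_of_le hαβ])
    (hI α hl β hr)
  rw [key]
  simp only [intervalIntegral.integral_same, neg_zero, mul_zero, zero_sub, mul_neg, neg_neg]
  have h2 : ‖∫ k in α..β, a' k * -∫ s in k..β, f s‖ ≤ ∫ k in α..β, ‖a' k‖ * g k := by
    apply intervalIntegral.norm_integral_le_of_norm_le hαβ _ hg
    refine Eventually.of_forall fun k hk => ?_
    rw [norm_mul, norm_neg]
    exact mul_le_mul_of_nonneg_left (hE k (Ioc_subset_Icc_self hk)) (norm_nonneg _)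
  have h3 : ‖a α * ∫ s in α..β, f s‖ ≤ ‖a α‖ * g α := by
    rw [norm_mul]
    exact mul_le_mul_of_nonneg_left (hE α hl) (norm_nonneg _)
  simp only [mul_neg] at h2
  exact (norm_sub_le _ _).trans (add_le_add h3 h2)

/-- The mirror image of `norm_integral_mul_le_left` under `k ↦ -k`. -/
theorem norm_integral_mul_le_right {a a' f : ℝ → ℂ} {g : ℝ → ℝ} {α β : ℝ} (hαβ : α ≤ β)
    (ha : ∀ k ∈ Icc α β, HasDerivAt a (a' k) k) (ha' : ContinuousOn a' (Icc α β))
    (hf : ContinuousOn f (Icc α β))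
    (hE : ∀ k ∈ Icc α β, ‖∫ s in α..k, f s‖ ≤ g k)
    (hg : IntervalIntegrable (fun k => ‖a' k‖ * g k) volume α β) :
    ‖∫ k in α..β, a k * f k‖ ≤ ‖a β‖ * g β + ∫ k in α..β, ‖a' k‖ * g k := by
  have hm : ∀ k ∈ Icc (-β) (-α), -k ∈ Icc α β := fun k hk => ⟨by linarith [hk.2], by linarith [hk.1]⟩
  have key := norm_integral_mul_le_left (a := fun k => a (-k)) (a' := fun k => -a' (-k))
    (f := fun k => f (-k)) (g := fun k => g (-k)) (neg_le_neg hαβ)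
    (fun k hk => by
      have h5 := (ha (-k) (hm k hk)).scomp k (hasDerivAt_neg k)
      rw [neg_one_smul] at h5
      exact h5)
    ((ha'.comp continuousOn_neg hm).neg) (hf.comp continuousOn_neg hm)
    (fun k hk => by
      have := hE (-k) (hm k hk)
      rwa [intervalIntegral.integral_comp_neg, neg_neg])
    (by
      have := (hg.comp_sub_left 0).symm
      simpa only [norm_neg, zero_sub] using this)
  simp only [neg_neg, norm_neg] at key
  rw [intervalIntegral.integral_comp_neg (fun k => a k * f k),
    intervalIntegral.integral_comp_neg (fun k => ‖a' k‖ * g k)] at key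
  simpa using key

/-- First derivative test, for a positive derivative. -/
theorem norm_integral_osc_le_of_pos {φ φ' φ'' : ℝ → ℝ} {α β ρ : ℝ} (hαβ : α ≤ β) (hρ : 0 < ρ)
    (h1 : ∀ k ∈ Icc α β, HasDerivAt φ (φ' k) k) (h2 : ∀ k ∈ Icc α β, HasDerivAt φ' (φ'' k) k)
    (h3 : ContinuousOn φ'' (Icc α β)) (hlow : ∀ k ∈ Icc α β, ρ ≤ φ' k)
    (hsgn : (∀ k ∈ Icc α β, 0 ≤ φ'' k) ∨ ∀ k ∈ Icc α β, φ'' k ≤ 0) :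
    ‖∫ k in α..β, osc φ k‖ ≤ 4 / ρ := by
  have hl : α ∈ Icc α β := ⟨le_rfl, hαβ⟩
  have hr : β ∈ Icc α β := ⟨hαβ, le_rfl⟩
  have hpos : ∀ k ∈ Icc α β, 0 < φ' k := fun k hk => hρ.trans_le (hlow k hk)
  have c0 : ContinuousOn φ (Icc α β) := fun k hk => (h1 k hk).continuousAt.continuousWithinAt
  have c1 : ContinuousOn φ' (Icc α β) := fun k hk => (h2 k hk).continuousAt.continuousWithinAt
  have cosc := continuousOn_osc c0
  have cq : ContinuousOn (fun k => φ'' k / φ' k ^ 2) (Icc α β) :=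
    h3.div (c1.pow 2) fun k hk => (pow_pos (hpos k hk) 2).ne'
  have hc1 : ∀ k ∈ Icc α β, (φ' k : ℂ) ≠ 0 := fun k hk => by exact_mod_cast (hpos k hk).ne'
  have hF : ∀ k ∈ uIcc α β, HasDerivAt (fun k => osc φ k / (Complex.I * φ' k))
      (osc φ k + Complex.I * osc φ k * ((φ'' k / φ' k ^ 2 : ℝ) : ℂ)) k := by
    intro k hk
    rw [uIcc_of_le hαβ] at hk
    have e1 : HasDerivAt (osc φ) (osc φ k * (Complex.I * φ' k)) k :=
      ((h1 k hk).ofReal_comp.const_mul Complex.I).cexp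
    have e2 : HasDerivAt (fun k => Complex.I * (φ' k : ℂ)) (Complex.I * φ'' k) k :=
      (h2 k hk).ofReal_comp.const_mul Complex.I
    have := e1.div e2 (mul_ne_zero Complex.I_ne_zero (hc1 k hk))
    refine this.congr_deriv ?_
    have := hc1 k hk
    push_cast
    field_simp
    linear_combination (-osc φ k * φ'' k) * Complex.I_sq
  have i1 : IntervalIntegrable (osc φ) volume α β :=
    ContinuousOn.intervalIntegrable (by rwa [uIcc_of_le hαβ])
  have i2 : IntervalIntegrable (fun k => φ'' k / φ' k ^ 2) volume α β :=
    ContinuousOn.intervalIntegrable (by rwa [uIcc_of_le hαβ])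
  have i3 : IntervalIntegrable (fun k => Complex.I * osc φ k * ((φ'' k / φ' k ^ 2 : ℝ) : ℂ))
      volume α β := by
    apply ContinuousOn.intervalIntegrable
    rw [uIcc_of_le hαβ]
    exact (continuousOn_const.mul cosc).mul (Complex.continuous_ofReal.comp_continuousOn cq)
  have hFTC := intervalIntegral.integral_eq_sub_of_hasDerivAt hF (i1.add i3)
  rw [intervalIntegral.integral_add i1 i3] at hFTC
  have hG : ∀ k ∈ uIcc α β, HasDerivAt (fun k => -(φ' k)⁻¹) (φ'' k / φ' k ^ 2) k := by
    intro k hk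
    rw [uIcc_of_le hαβ] at hk
    have := ((h2 k hk).inv (hpos k hk).ne').neg
    exact this.congr_deriv (by ring)
  have hFTC2 := intervalIntegral.integral_eq_sub_of_hasDerivAt hG i2
  have hinv : ∀ k ∈ Icc α β, (φ' k)⁻¹ ≤ 1 / ρ ∧ 0 ≤ (φ' k)⁻¹ := fun k hk =>
    ⟨by rw [one_div]; exact inv_anti₀ hρ (hlow k hk), (inv_pos.2 (hpos k hk)).le⟩
  -- As `φ''` has a constant sign, `1/φ'` is monotone and its total variation is the difference of
  -- its end values.
  have habs : ∫ k in α..β, |φ'' k / φ' k ^ 2| ≤ 2 / ρ := by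
    have key : ∫ k in α..β, |φ'' k / φ' k ^ 2| = |∫ k in α..β, φ'' k / φ' k ^ 2| := by
      rcases hsgn with h | h
      · have : ∀ k ∈ uIcc α β, |φ'' k / φ' k ^ 2| = φ'' k / φ' k ^ 2 := fun k hk => by
          rw [uIcc_of_le hαβ] at hk
          exact abs_of_nonneg (div_nonneg (h k hk) (sq_nonneg _))
        rw [← intervalIntegral.integral_congr this, abs_of_nonneg]
        exact intervalIntegral.integral_nonneg hαβ fun k _ => abs_nonneg _
      · have : ∀ k ∈ uIcc α β, |φ'' k / φ' k ^ 2| = -(φ'' k / φ' k ^ 2) := fun k hk => by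
          rw [uIcc_of_le hαβ] at hk
          exact abs_of_nonpos (div_nonpos_of_nonpos_of_nonneg (h k hk) (sq_nonneg _))
        rw [intervalIntegral.integral_congr this, intervalIntegral.integral_neg, abs_of_nonpos]
        rw [← neg_nonneg, ← intervalIntegral.integral_neg, ← intervalIntegral.integral_congr this]
        exact intervalIntegral.integral_nonneg hαβ fun k _ => abs_nonneg _
    rw [key, hFTC2]
    have := hinv α hl
    have := hinv β hr
    have e : (2 : ℝ) / ρ = 1 / ρ + 1 / ρ := by ring
    rw [e, abs_le]
    constructor <;> linarith
  have hb : ∀ k ∈ Icc α β, ‖osc φ k / (Complex.I * φ' k)‖ ≤ 1 / ρ := by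
    intro k hk
    rw [norm_div, norm_osc, norm_mul, Complex.norm_I, one_mul, Complex.norm_real, Real.norm_eq_abs,
      abs_of_pos (hpos k hk)]
    exact one_div_le_one_div_of_le hρ (hlow k hk)
  have h4 : ‖∫ k in α..β, Complex.I * osc φ k * ((φ'' k / φ' k ^ 2 : ℝ) : ℂ)‖ ≤ 2 / ρ := by
    refine le_trans ?_ habs
    apply intervalIntegral.norm_integral_le_of_norm_le hαβ _ i2.abs
    refine Eventually.of_forall fun k hk => ?_
    rw [norm_mul, norm_mul, norm_osc, Complex.norm_I, Complex.norm_real, Real.norm_eq_abs]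
    simp
  have : ∫ k in α..β, osc φ k = osc φ β / (Complex.I * φ' β) - osc φ α / (Complex.I * φ' α)
      - ∫ k in α..β, Complex.I * osc φ k * ((φ'' k / φ' k ^ 2 : ℝ) : ℂ) := by
    rw [← hFTC]; ring
  rw [this]
  calc _ ≤ 1 / ρ + 1 / ρ + 2 / ρ :=
        (norm_sub_le _ _).trans (add_le_add ((norm_sub_le _ _).trans (add_le_add (hb β hr) (hb α hl))) h4)
    _ = 4 / ρ := by ring

/-- First derivative test, for a negative derivative. -/
theorem norm_integral_osc_le_of_neg {φ φ' φ'' : ℝ → ℝ} {α β ρ : ℝ} (hαβ : α ≤ β) (hρ : 0 < ρ)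
    (h1 : ∀ k ∈ Icc α β, HasDerivAt φ (φ' k) k) (h2 : ∀ k ∈ Icc α β, HasDerivAt φ' (φ'' k) k)
    (h3 : ContinuousOn φ'' (Icc α β)) (hlow : ∀ k ∈ Icc α β, φ' k ≤ -ρ)
    (hsgn : (∀ k ∈ Icc α β, 0 ≤ φ'' k) ∨ ∀ k ∈ Icc α β, φ'' k ≤ 0) :
    ‖∫ k in α..β, osc φ k‖ ≤ 4 / ρ := by
  rw [← norm_integral_osc_neg]
  refine norm_integral_osc_le_of_pos hαβ hρ (fun k hk => (h1 k hk).neg) (fun k hk => (h2 k hk).neg)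
    h3.neg (fun k hk => le_neg_of_le_neg (hlow k hk)) ?_
  rcases hsgn with h | h
  · exact Or.inr fun k hk => by simpa using h k hk
  · exact Or.inl fun k hk => by simpa using h k hk

/-- Van der Corput's second derivative test. -/
theorem norm_integral_osc_le_of_convex {φ φ' φ'' : ℝ → ℝ} {α β ρ : ℝ} (hαβ : α ≤ β) (hρ : 0 < ρ)
    (h1 : ∀ k ∈ Icc α β, HasDerivAt φ (φ' k) k) (h2 : ∀ k ∈ Icc α β, HasDerivAt φ' (φ'' k) k)
    (h3 : ContinuousOn φ'' (Icc α β)) (hlow : ∀ k ∈ Icc α β, ρ ≤ φ'' k) :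
    ‖∫ k in α..β, osc φ k‖ ≤ 10 / √ρ := by
  have hs : 0 < √ρ := Real.sqrt_pos.2 hρ
  have hss : √ρ * √ρ = ρ := Real.mul_self_sqrt hρ.le
  have c0 : ContinuousOn φ (Icc α β) := fun k hk => (h1 k hk).continuousAt.continuousWithinAt
  have c1 : ContinuousOn φ' (Icc α β) := fun k hk => (h2 k hk).continuousAt.continuousWithinAt
  have mvt : ∀ p ∈ Icc α β, ∀ q ∈ Icc α β, p ≤ q → ρ * (q - p) ≤ φ' q - φ' p := by
    intro p hp q hq hpq
    refine (convex_Icc α β).mul_sub_le_image_sub_of_le_deriv c1 ?_ ?_ p hp q hq hpq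
    · exact fun k hk => (h2 k (interior_subset hk)).differentiableAt.differentiableWithinAt
    · intro k hk
      rw [(h2 k (interior_subset hk)).deriv]
      exact hlow k (interior_subset hk)
  have hl : α ∈ Icc α β := ⟨le_rfl, hαβ⟩
  have hr : β ∈ Icc α β := ⟨hαβ, le_rfl⟩
  -- `c` is the zero of `φ'`, or the endpoint at which `φ'` is closest to zero. Away from `c` the
  -- derivative grows at least linearly.
  obtain ⟨c, hc, hcr, hcl⟩ : ∃ c ∈ Icc α β, (∀ k ∈ Icc α β, c < k → ρ * (k - c) ≤ φ' k) ∧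
      ∀ k ∈ Icc α β, k < c → φ' k ≤ ρ * (k - c) := by
    rcases le_or_gt 0 (φ' α) with h | h
    · exact ⟨α, hl, fun k hk hk' => by linarith [mvt α hl k hk hk'.le],
        fun k hk hk' => absurd hk.1 (not_le.2 hk')⟩
    rcases le_or_gt (φ' β) 0 with h' | h'
    · exact ⟨β, hr, fun k hk hk' => absurd hk.2 (not_le.2 hk'),
        fun k hk hk' => by linarith [mvt k hk β hr hk'.le]⟩
    obtain ⟨c, hc, hc0⟩ := intermediate_value_Icc hαβ c1 ⟨h.le, h'.le⟩
    exact ⟨c, hc, fun k hk hk' => by linarith [mvt c hc k hk hk'.le],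
      fun k hk hk' => by linarith [mvt k hk c hc hk'.le]⟩
  -- At distance `h` from `c` one has `|φ'| ≥ ρh = √ρ`, so the two outer pieces cost `4/√ρ` each by
  -- the first derivative test, and the middle piece of length at most `2h` is bounded trivially.
  set h := 1 / √ρ with hh
  have hpos : 0 < h := by positivity
  have hρh : ρ * h = √ρ := by rw [hh, mul_one_div, div_eq_iff hs.ne', hss]
  set p := max α (c - h)
  set q := min β (c + h)
  have hp : p ∈ Icc α β := ⟨le_max_left _ _, max_le hαβ (by linarith [hc.2])⟩
  have hq : q ∈ Icc α β := ⟨le_min hαβ (by linarith [hc.1]), min_le_left _ _⟩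
  have hpc : p ≤ c := max_le hc.1 (by linarith)
  have hcq : c ≤ q := le_min hc.2 (by linarith)
  have hI : ∀ p ∈ Icc α β, ∀ q ∈ Icc α β, IntervalIntegrable (osc φ) volume p q :=
    fun p hp q hq => ((continuousOn_osc c0).mono (uIcc_subset_Icc hp hq)).intervalIntegrable
  have b1 : ‖∫ k in α..p, osc φ k‖ ≤ 4 / √ρ := by
    rcases le_or_gt (c - h) α with hca | hca
    · rw [show p = α from max_eq_left hca]
      simp only [intervalIntegral.integral_same, norm_zero]; positivity
    have hpe : p = c - h := max_eq_right hca.le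
    have hsub : Icc α p ⊆ Icc α β := Icc_subset_Icc_right hp.2
    refine norm_integral_osc_le_of_neg hp.1 hs (fun k hk => h1 k (hsub hk))
      (fun k hk => h2 k (hsub hk)) (h3.mono hsub) (fun k hk => ?_)
      (Or.inl fun k hk => hρ.le.trans (hlow k (hsub hk)))
    have hk2 := hk.2
    rw [hpe] at hk2
    refine (hcl k (hsub hk) (by linarith)).trans ?_
    rw [← hρh, ← mul_neg]
    exact mul_le_mul_of_nonneg_left (by linarith) hρ.le
  have b3 : ‖∫ k in q..β, osc φ k‖ ≤ 4 / √ρ := by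
    rcases le_or_gt β (c + h) with hca | hca
    · rw [show q = β from min_eq_left hca]
      simp only [intervalIntegral.integral_same, norm_zero]; positivity
    have hqe : q = c + h := min_eq_right hca.le
    have hsub : Icc q β ⊆ Icc α β := Icc_subset_Icc_left hq.1
    refine norm_integral_osc_le_of_pos hq.2 hs (fun k hk => h1 k (hsub hk))
      (fun k hk => h2 k (hsub hk)) (h3.mono hsub) (fun k hk => ?_)
      (Or.inl fun k hk => hρ.le.trans (hlow k (hsub hk)))
    have hk1 := hk.1
    rw [hqe] at hk1
    refine le_trans ?_ (hcr k (hsub hk) (by linarith))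
    rw [← hρh]
    exact mul_le_mul_of_nonneg_left (by linarith) hρ.le
  have b2 : ‖∫ k in p..q, osc φ k‖ ≤ 2 / √ρ := by
    have := intervalIntegral.norm_integral_le_of_norm_le_const (a := p) (b := q)
      (f := osc φ) (C := 1) fun k _ => (norm_osc φ k).le
    refine this.trans ?_
    rw [abs_of_nonneg (by linarith), one_mul]
    have e1 : c - h ≤ p := le_max_right _ _
    have e2 : q ≤ c + h := min_le_right _ _
    have : (2 : ℝ) / √ρ = 2 * h := by rw [hh]; ring
    linarith
  rw [← intervalIntegral.integral_add_adjacent_intervals (hI α hl p hp) (hI p hp β hr),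
    ← intervalIntegral.integral_add_adjacent_intervals (hI p hp q hq) (hI q hq β hr)]
  calc _ ≤ 4 / √ρ + (2 / √ρ + 4 / √ρ) :=
        (norm_add_le _ _).trans (add_le_add b1 ((norm_add_le _ _).trans (add_le_add b2 b3)))
    _ = 10 / √ρ := by ring

/-! ### The dispersion relation and the phase -/

/-- The factor `(1 + m k²)^{-1/2}`. -/
noncomputable def lam (m k : ℝ) : ℝ := (√(1 + m * k ^ 2))⁻¹

/-- The dispersion relation `ω(k) = k (1 + m k²)^{-1/2}`. -/
noncomputable def om (m k : ℝ) : ℝ := k * lam m k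

theorem lam_pos {m : ℝ} (hm : 0 ≤ m) (k : ℝ) : 0 < lam m k := by
  unfold lam; positivity

theorem lam_sq {m : ℝ} (hm : 0 ≤ m) (k : ℝ) : lam m k ^ 2 = (1 + m * k ^ 2)⁻¹ := by
  unfold lam; rw [inv_pow, Real.sq_sqrt (by positivity)]

theorem lam_sq_mul {m : ℝ} (hm : 0 ≤ m) (k : ℝ) : lam m k ^ 2 * (1 + m * k ^ 2) = 1 := by
  rw [lam_sq hm]; exact inv_mul_cancel₀ (by positivity)

theorem lam_le_one {m : ℝ} (hm : 0 ≤ m) (k : ℝ) : lam m k ≤ 1 := by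
  have h := lam_sq_mul hm k
  have h0 := lam_pos hm k
  nlinarith [mul_nonneg (sq_nonneg (lam m k)) (mul_nonneg hm (sq_nonneg k))]

theorem lam_neg (m k : ℝ) : lam m (-k) = lam m k := by simp [lam]

theorem om_neg (m k : ℝ) : om m (-k) = -om m k := by simp [om, lam_neg]

theorem hasDerivAt_lam {m : ℝ} (hm : 0 ≤ m) (k : ℝ) :
    HasDerivAt (lam m) (-(m * k * lam m k ^ 3)) k := by
  have h0 : 0 < 1 + m * k ^ 2 := by positivity
  have h1 : HasDerivAt (fun k => 1 + m * k ^ 2) (m * (2 * k)) k := by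
    simpa using ((hasDerivAt_pow 2 k).const_mul m).const_add 1
  have h2 := (h1.sqrt h0.ne').inv (Real.sqrt_pos.2 h0).ne'
  refine h2.congr_deriv ?_
  unfold lam
  have := (Real.sqrt_pos.2 h0).ne'
  field_simp

theorem continuous_lam {m : ℝ} (hm : 0 ≤ m) : Continuous (lam m) :=
  continuous_iff_continuousAt.2 fun k => (hasDerivAt_lam hm k).continuousAt

/-- The group velocity is a pure power of `lam` because `λ²(1 + mk²) = 1`; its positivity makes `om`
injective, which the smoothing estimate uses. -/
theorem hasDerivAt_om {m : ℝ} (hm : 0 ≤ m) (k : ℝ) : HasDerivAt (om m) (lam m k ^ 3) k := by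
  have h := (hasDerivAt_id k).mul (hasDerivAt_lam hm k)
  refine h.congr_deriv ?_
  simp only [id]
  linear_combination (-lam m k) * lam_sq_mul hm k

theorem continuous_om {m : ℝ} (hm : 0 ≤ m) : Continuous (om m) :=
  continuous_id.mul (continuous_lam hm)

theorem hasDerivAt_lam_cube {m : ℝ} (hm : 0 ≤ m) (k : ℝ) :
    HasDerivAt (fun k => lam m k ^ 3) (-(3 * m * k * lam m k ^ 5)) k := by
  refine ((hasDerivAt_lam hm k).pow 3).congr_deriv ?_
  push_cast; ring

/-- The phase `k x - τ ω(k)`. -/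
noncomputable def phase (m x τ k : ℝ) : ℝ := k * x - τ * om m k

theorem hasDerivAt_phase {m : ℝ} (hm : 0 ≤ m) (x τ k : ℝ) :
    HasDerivAt (phase m x τ) (x - τ * lam m k ^ 3) k := by
  have := ((hasDerivAt_id k).mul_const x).sub ((hasDerivAt_om hm k).const_mul τ)
  refine this.congr_deriv (by simp)

theorem hasDerivAt_deriv_phase {m : ℝ} (hm : 0 ≤ m) (x τ k : ℝ) :
    HasDerivAt (fun k => x - τ * lam m k ^ 3) (3 * τ * m * k * lam m k ^ 5) k := by
  have := ((hasDerivAt_lam_cube hm k).const_mul τ).const_sub x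
  refine this.congr_deriv (by ring)

theorem continuous_phase {m : ℝ} (hm : 0 ≤ m) (x τ : ℝ) : Continuous (phase m x τ) :=
  continuous_iff_continuousAt.2 fun k => (hasDerivAt_phase hm x τ k).continuousAt

theorem continuous_osc_phase {m : ℝ} (hm : 0 ≤ m) (x τ : ℝ) :
    Continuous (osc (phase m x τ)) := by
  have := continuous_phase hm x τ
  unfold osc; fun_prop

/-! ### Oscillatory integrals with decaying amplitudes, uniformly in `x` and `m` -/

/-- Smooth amplitudes on the positive half line which decay like `k⁻²`, with the regularity at
infinity expressed for `β(u) = α(1/u)/u²`. -/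
structure IsAmplitude (m A : ℝ) (α α' β β' : ℝ → ℂ) : Prop where
  deriv : ∀ k, 0 < k → HasDerivAt α (α' k) k
  cont : ContinuousOn α' (Ioi 0)
  bound : ∀ k, 0 < k → ‖α k‖ ≤ A
  bound_sq : ∀ k, 0 < k → k ^ 2 * ‖α k‖ ≤ A
  dbound : ∀ k, 0 < k → ‖α' k‖ ≤ A
  dbound_cube : ∀ k, 0 < k → k ^ 3 * ‖α' k‖ ≤ A
  inv : ∀ u, 0 < u → α u⁻¹ = (u : ℂ) ^ 2 * β u
  deriv_inv : ∀ u, 0 < u → HasDerivAt β (β' u) u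
  cont_inv : ContinuousOn β' (Ioi 0)
  bound_inv : ∀ u, 0 < u → ‖β u‖ ≤ A
  -- The loss `1/√m` is harmless: `β'` is only integrated over an interval of length at most `√m/2`.
  -- It is forced by the factors `λ(1/u)`, which vary at scale `√m`.
  dbound_inv : ∀ u, 0 < u → u ≤ 1 → ‖β' u‖ ≤ A / √m

theorem IsAmplitude.nonneg {m A : ℝ} {α α' β β' : ℝ → ℂ} (h : IsAmplitude m A α α' β β') :
    0 ≤ A := (norm_nonneg _).trans (h.bound 1 one_pos)

theorem IsAmplitude.continuousOn {m A : ℝ} {α α' β β' : ℝ → ℂ} (h : IsAmplitude m A α α' β β') :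
    ContinuousOn α (Ioi 0) := fun k hk => (h.deriv k hk).continuousAt.continuousWithinAt

theorem sqrt_le_one_of {m : ℝ} (hm1 : m ≤ 1) : √m ≤ 1 := Real.sqrt_le_one.2 hm1

/-- For `k ≤ 2/√m` the factor `lam` is bounded below, so the second derivative `3τmkλ⁵` of the phase
is at least `mτs/25` on `[s, 2/√m]`. The factor `s^{-1/2}` reflects the inflection point of the
phase at `k = 0`. -/
theorem norm_integral_osc_phase_low {m x τ s : ℝ} (hm : 0 < m) (hτ : 0 < τ) (hs : 0 < s)
    (hsK : s ≤ 2 / √m) :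
    ‖∫ k in s..(2 / √m), osc (phase m x τ) k‖ ≤ 50 / √(m * τ) * (√s)⁻¹ := by
  have hρ : 0 < m * τ * s / 25 := by positivity
  have key := norm_integral_osc_le_of_convex hsK hρ (fun k _ => hasDerivAt_phase hm.le x τ k)
    (fun k _ => hasDerivAt_deriv_phase hm.le x τ k)
    (by have := continuous_lam hm.le; fun_prop) (by
      intro k hk
      have hk0 : 0 < k := hs.trans_le hk.1
      have h0 := lam_pos hm.le k
      have hk2 : m * k ^ 2 ≤ 4 := by
        have h1 : k ^ 2 ≤ (2 / √m) ^ 2 := by gcongr; exact hk.2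
        rw [div_pow, Real.sq_sqrt hm.le, le_div_iff₀ hm] at h1
        linarith
      have h2 : 1 / 5 ≤ lam m k ^ 2 := by
        rw [lam_sq hm.le, one_div]
        exact inv_anti₀ (by positivity) (by linarith)
      have h3 : 2 / 5 ≤ lam m k := by nlinarith
      have h5 : 1 / 75 ≤ lam m k ^ 5 := by
        calc (1 : ℝ) / 75 ≤ 1 / 5 * (1 / 5) * (2 / 5) := by norm_num
          _ ≤ lam m k ^ 2 * lam m k ^ 2 * lam m k := by gcongr
          _ = lam m k ^ 5 := by ring
      calc m * τ * s / 25 = 3 * τ * m * s * (1 / 75) := by ring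
        _ ≤ 3 * τ * m * k * lam m k ^ 5 := by gcongr; exact hk.1)
  refine key.trans (le_of_eq ?_)
  rw [Real.sqrt_div' _ (by norm_num), Real.sqrt_mul (by positivity),
    show √(25 : ℝ) = 5 by rw [show (25 : ℝ) = 5 ^ 2 by norm_num]; exact Real.sqrt_sq (by norm_num)]
  have : 0 < √s := Real.sqrt_pos.2 hs
  have : 0 < √(m * τ) := Real.sqrt_pos.2 (by positivity)
  field_simp
  norm_num

theorem hasDerivAt_arctan_sqrt {s : ℝ} (hs : 0 < s) :
    HasDerivAt (fun s => Real.arctan √s) (1 / (2 * √s * (1 + s))) s := by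
  have := (Real.hasDerivAt_sqrt hs.ne').arctan
  refine this.congr_deriv ?_
  rw [Real.sq_sqrt hs.le]
  have := (Real.sqrt_pos.2 hs).ne'
  field_simp

/-- Integrating by parts produces `∫ |α'| k^{-1/2}`. Since `|α'| ≤ 4A/(1+k)`, it is controlled by
the integral of `1/(√k(1+k))`, whose primitive is `2 arctan √k`. -/
theorem IsAmplitude.norm_integral_low {m A : ℝ} {α α' β β' : ℝ → ℂ}
    (h : IsAmplitude m A α α' β β') {x τ δ : ℝ} (hm : 0 < m) (hτ : 0 < τ) (hδ : 0 < δ)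
    (hδK : δ ≤ 2 / √m) :
    ‖∫ k in δ..(2 / √m), α k * osc (phase m x τ) k‖ ≤
      50 / √(m * τ) * (‖α δ‖ / √δ + 16 * A) := by
  have hA := h.nonneg
  have hsub : Icc δ (2 / √m) ⊆ Ioi 0 := fun k hk => hδ.trans_le hk.1
  have csq : ContinuousOn (fun k : ℝ => (√k)⁻¹) (Icc δ (2 / √m)) :=
    Real.continuous_sqrt.continuousOn.inv₀ fun k hk => (Real.sqrt_pos.2 (hsub hk)).ne'
  have ig : IntervalIntegrable (fun k => ‖α' k‖ * (50 / √(m * τ) * (√k)⁻¹)) volume δ (2 / √m) := by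
    apply ContinuousOn.intervalIntegrable
    rw [uIcc_of_le hδK]
    exact (h.cont.mono hsub).norm.mul (continuousOn_const.mul csq)
  refine (norm_integral_mul_le_left hδK (fun k hk => h.deriv k (hsub hk)) (h.cont.mono hsub)
    (continuous_osc_phase hm.le x τ).continuousOn
    (fun k hk => norm_integral_osc_phase_low hm hτ (hsub hk) hk.2) ig).trans ?_
  have hI : ∫ k in δ..(2 / √m), ‖α' k‖ * (50 / √(m * τ) * (√k)⁻¹) ≤
      50 / √(m * τ) * (16 * A) := by
    have i2 : IntervalIntegrable (fun s => 1 / (2 * √s * (1 + s))) volume δ (2 / √m) := by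
      apply ContinuousOn.intervalIntegrable
      rw [uIcc_of_le hδK]
      refine continuousOn_const.div (by fun_prop) fun k hk => ?_
      have hk0 : 0 < k := hsub hk
      positivity
    have e := intervalIntegral.integral_eq_sub_of_hasDerivAt
      (fun s hs => hasDerivAt_arctan_sqrt (hsub (by rwa [uIcc_of_le hδK] at hs))) i2
    have hle : ∫ k in δ..(2 / √m), ‖α' k‖ * (50 / √(m * τ) * (√k)⁻¹) ≤
        ∫ k in δ..(2 / √m), 50 / √(m * τ) * (8 * A) * (1 / (2 * √k * (1 + k))) := by
      refine intervalIntegral.integral_mono_on hδK ig (i2.const_mul _) fun k hk => ?_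
      have hk0 : 0 < k := hsub hk
      have h1 := h.dbound k hk0
      have h2 := h.dbound_cube k hk0
      have h3 : ‖α' k‖ * (1 + k) ≤ 4 * A := by
        rcases le_or_gt k 1 with hk1 | hk1
        · nlinarith [norm_nonneg (α' k)]
        · have : k ≤ k ^ 3 := le_self_pow₀ hk1.le (by norm_num)
          nlinarith [norm_nonneg (α' k)]
      have hsk := Real.sqrt_pos.2 hk0
      have h4 : ‖α' k‖ ≤ 4 * A / (1 + k) := by rwa [le_div_iff₀ (by positivity)]
      calc ‖α' k‖ * (50 / √(m * τ) * (√k)⁻¹) ≤ 4 * A / (1 + k) * (50 / √(m * τ) * (√k)⁻¹) := by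
            gcongr
        _ = _ := by field_simp; ring
    refine hle.trans ?_
    rw [intervalIntegral.integral_const_mul, e, mul_assoc]
    have hp : Real.arctan √(2 / √m) - Real.arctan √δ ≤ 2 := by
      have h1 := Real.arctan_lt_pi_div_two √(2 / √m)
      have h2 : 0 ≤ Real.arctan √δ := Real.arctan_nonneg.2 (Real.sqrt_nonneg _)
      linarith [Real.pi_lt_four]
    have : 8 * A * (Real.arctan √(2 / √m) - Real.arctan √δ) ≤ 16 * A := by nlinarith
    gcongr
  calc _ ≤ ‖α δ‖ * (50 / √(m * τ) * (√δ)⁻¹) + 50 / √(m * τ) * (16 * A) := by gcongr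
    _ = _ := by ring

theorem hasDerivAt_inv_sqrt_add {m : ℝ} (hm : 0 < m) (u : ℝ) :
    HasDerivAt (fun u => (√(u ^ 2 + m))⁻¹) (-(u * (√(u ^ 2 + m))⁻¹ ^ 3)) u := by
  have h0 : 0 < u ^ 2 + m := by positivity
  have h1 : HasDerivAt (fun u => u ^ 2 + m) (2 * u) u := by
    simpa using (hasDerivAt_pow 2 u).add_const m
  refine ((h1.sqrt h0.ne').inv (Real.sqrt_pos.2 h0).ne').congr_deriv ?_
  have := (Real.sqrt_pos.2 h0).ne'
  field_simp

theorem lam_inv {m u : ℝ} (hu : 0 < u) : lam m u⁻¹ = u * (√(u ^ 2 + m))⁻¹ := by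
  have h1 : 1 + m * u⁻¹ ^ 2 = (u ^ 2 + m) / u ^ 2 := by field_simp
  rw [lam, h1, Real.sqrt_div' _ (by positivity), Real.sqrt_sq hu.le, inv_div, div_eq_mul_inv]

/-- At high frequency the curvature of the phase decays like `k⁻⁴`. The substitution `u = 1/k`
removes this degeneracy: the phase becomes `x/u - τ(u²+m)^{-1/2}`. The first term is convex because
`x ≥ 0`, and the second has second derivative at least `mτ/4` for `u ≤ √m/2` and `m ≤ 1`. -/
theorem IsAmplitude.norm_integral_high_of_nonneg {m A : ℝ} {α α' β β' : ℝ → ℂ}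
    (h : IsAmplitude m A α α' β β') {x τ R : ℝ} (hm : 0 < m) (hm1 : m ≤ 1) (hτ : 0 < τ)
    (hx : 0 ≤ x) (hR : 2 / √m ≤ R) :
    ‖∫ k in (2 / √m)..R, α k * osc (phase m x τ) k‖ ≤ 50 / √(m * τ) * A := by
  have hA := h.nonneg
  have hsm : 0 < √m := Real.sqrt_pos.2 hm
  have hK : 0 < 2 / √m := by positivity
  have hR0 : 0 < R := hK.trans_le hR
  have hab : R⁻¹ ≤ (2 / √m)⁻¹ := inv_anti₀ hK hR
  have hKinv : (2 / √m)⁻¹ = √m / 2 := by rw [inv_div]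
  have hsub : Icc R⁻¹ (2 / √m)⁻¹ ⊆ Ioi 0 := fun k hk => (inv_pos.2 hR0).trans_le hk.1
  set q : ℝ → ℝ := fun u => (√(u ^ 2 + m))⁻¹ with hq
  have hqpos : ∀ u, 0 < q u := fun u => by simp only [hq]; positivity
  have hqc : Continuous q :=
    continuous_iff_continuousAt.2 fun u => (hasDerivAt_inv_sqrt_add hm u).continuousAt
  set ψ : ℝ → ℝ := fun u => x * u⁻¹ - τ * q u with hψ
  have hchange : ∫ k in (2 / √m)..R, α k * osc (phase m x τ) k =
      ∫ u in R⁻¹..(2 / √m)⁻¹, β u * osc ψ u := by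
    have := intervalIntegral.integral_deriv_smul_comp'' (a := (2 / √m)⁻¹) (b := R⁻¹)
      (f := fun u => u⁻¹) (f' := fun u => -(u ^ 2)⁻¹) (g := fun k => α k * osc (phase m x τ) k)
      (by
        rw [uIcc_of_ge hab]
        exact continuousOn_id.inv₀ fun u hu => (hsub hu).ne')
      (by
        rw [min_eq_right hab, max_eq_left hab]
        exact fun u hu => (hasDerivAt_inv (hsub (Ioo_subset_Icc_self hu)).ne').hasDerivWithinAt)
      (by
        rw [uIcc_of_ge hab]
        exact ((continuousOn_pow 2).inv₀ fun u hu => (pow_pos (hsub hu) 2).ne').neg)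
      (by
        rw [uIcc_of_ge hab]
        refine (h.continuousOn.mono ?_).mul (continuous_osc_phase hm.le x τ).continuousOn
        rintro _ ⟨u, hu, rfl⟩
        have hu0 : 0 < u := hsub hu
        exact inv_pos.2 hu0)
    simp only [inv_inv] at this
    rw [← this, intervalIntegral.integral_symm, ← intervalIntegral.integral_neg]
    refine intervalIntegral.integral_congr fun u hu => ?_
    rw [uIcc_of_le hab] at hu
    have hu0 : 0 < u := hsub hu
    have e1 : phase m x τ u⁻¹ = ψ u := by
      simp only [phase, om, lam_inv hu0, hψ, hq]
      field_simp
    have hu1 : (u : ℂ) ≠ 0 := by exact_mod_cast hu0.ne'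
    simp only [Function.comp, h.inv u hu0, osc, e1, Complex.real_smul]
    push_cast
    field_simp
  rw [hchange]
  have hE : ∀ s ∈ Icc R⁻¹ (2 / √m)⁻¹, ‖∫ u in s..(2 / √m)⁻¹, osc ψ u‖ ≤ 20 / √(m * τ) := by
    intro s hs
    have hsub2 : Icc s (2 / √m)⁻¹ ⊆ Ioi 0 := fun k hk => (hsub hs).trans_le hk.1
    have key := norm_integral_osc_le_of_convex (φ := ψ)
      (φ' := fun u => -(x * (u ^ 2)⁻¹) + τ * (u * q u ^ 3))
      (φ'' := fun u => 2 * x * (u ^ 3)⁻¹ + τ * (q u ^ 3 - 3 * u ^ 2 * q u ^ 5))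
      (ρ := m * τ / 4) hs.2 (by positivity)
      (fun u hu => by
        have := ((hasDerivAt_inv (hsub2 hu).ne').const_mul x).sub
          ((hasDerivAt_inv_sqrt_add hm u).const_mul τ)
        exact this.congr_deriv (by simp only [hq]; ring))
      (fun u hu => by
        have hu0 : u ≠ 0 := (hsub2 hu).ne'
        have e1 := (((hasDerivAt_pow 2 u).inv (pow_ne_zero 2 hu0)).const_mul x).neg
        have e2 := (((hasDerivAt_id u).mul ((hasDerivAt_inv_sqrt_add hm u).pow 3))).const_mul τ
        refine (e1.add e2).congr_deriv ?_
        simp only [hq, id, Pi.pow_apply]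
        push_cast
        field_simp
        ring)
      (by
        refine ContinuousOn.add (continuousOn_const.mul
          ((continuousOn_pow 3).inv₀ fun u hu => (pow_pos (hsub2 hu) 3).ne')) ?_
        exact Continuous.continuousOn (by fun_prop))
      (by
        intro u hu
        have hu0 : 0 < u := hsub2 hu
        have h1 : u ≤ √m / 2 := hKinv ▸ hu.2
        have h2 : u ^ 2 ≤ m / 4 := by
          calc u ^ 2 ≤ (√m / 2) ^ 2 := by gcongr
            _ = m / 4 := by rw [div_pow, Real.sq_sqrt hm.le]; norm_num
        have hqs : q u ^ 2 * (u ^ 2 + m) = 1 := by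
          simp only [hq]
          rw [inv_pow, Real.sq_sqrt (by positivity)]
          exact inv_mul_cancel₀ (by positivity)
        have hq2 : 4 / 5 ≤ q u ^ 2 := by nlinarith [sq_nonneg (q u)]
        have hq1 : 4 / 5 ≤ q u := by nlinarith [hqpos u]
        have hq5 : 1 / 2 ≤ q u ^ 5 := by
          calc (1 : ℝ) / 2 ≤ 4 / 5 * (4 / 5) * (4 / 5) := by norm_num
            _ ≤ q u ^ 2 * q u ^ 2 * q u := by gcongr
            _ = q u ^ 5 := by ring
        have e : q u ^ 3 - 3 * u ^ 2 * q u ^ 5 = q u ^ 5 * (m - 2 * u ^ 2) := by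
          linear_combination (-q u ^ 3) * hqs
        have h4 : m / 4 ≤ q u ^ 5 * (m - 2 * u ^ 2) := by nlinarith
        have h5 : 0 ≤ 2 * x * (u ^ 3)⁻¹ := by positivity
        rw [e]
        nlinarith)
    refine key.trans (le_of_eq ?_)
    rw [Real.sqrt_div' _ (by norm_num),
      show √(4 : ℝ) = 2 by rw [show (4 : ℝ) = 2 ^ 2 by norm_num]; exact Real.sqrt_sq (by norm_num)]
    have : 0 < √(m * τ) := Real.sqrt_pos.2 (by positivity)
    field_simp
    norm_num
  have hc := h.cont_inv.mono hsub
  have ig : IntervalIntegrable (fun u => ‖β' u‖ * (20 / √(m * τ))) volume R⁻¹ (2 / √m)⁻¹ := by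
    apply ContinuousOn.intervalIntegrable
    rw [uIcc_of_le hab]
    exact hc.norm.mul continuousOn_const
  have hψc : ContinuousOn ψ (Icc R⁻¹ (2 / √m)⁻¹) :=
    (continuousOn_const.mul (continuousOn_id.inv₀ fun u hu => (hsub hu).ne')).sub
      (by fun_prop)
  refine (norm_integral_mul_le_left hab (fun u hu => h.deriv_inv u (hsub hu)) hc
    (continuousOn_osc hψc) hE ig).trans ?_
  have hI : ∫ u in R⁻¹..(2 / √m)⁻¹, ‖β' u‖ * (20 / √(m * τ)) ≤ A / 2 * (20 / √(m * τ)) := by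
    rw [intervalIntegral.integral_mul_const]
    gcongr
    have h1 := intervalIntegral.norm_integral_le_of_norm_le_const (a := R⁻¹) (b := (2 / √m)⁻¹)
      (f := fun u => ‖β' u‖) (C := A / √m) fun u hu => by
        rw [uIoc_of_le hab] at hu
        rw [norm_norm]
        refine h.dbound_inv u (hsub (Ioc_subset_Icc_self hu)) (hu.2.trans ?_)
        rw [hKinv]
        have := sqrt_le_one_of hm1
        linarith
    refine (le_abs_self _).trans (h1.trans ?_)
    have h2 : |(2 / √m)⁻¹ - R⁻¹| ≤ √m / 2 := by
      rw [abs_of_nonneg (by linarith), hKinv]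
      linarith [inv_pos.2 hR0]
    calc A / √m * |(2 / √m)⁻¹ - R⁻¹| ≤ A / √m * (√m / 2) := by gcongr
      _ = A / 2 := by field_simp
  have hb := h.bound_inv R⁻¹ (inv_pos.2 hR0)
  calc _ ≤ A * (20 / √(m * τ)) + A / 2 * (20 / √(m * τ)) := by gcongr
    _ = 30 * (A / √(m * τ)) := by ring
    _ ≤ 50 * (A / √(m * τ)) := by gcongr; norm_num
    _ = _ := by ring

theorem IsAmplitude.norm_integral_tail {m A : ℝ} {α α' β β' : ℝ → ℂ}
    (h : IsAmplitude m A α α' β β') (φ : ℝ → ℝ) {L R : ℝ} (hL : 0 < L) (hLR : L ≤ R) :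
    ‖∫ k in L..R, α k * osc φ k‖ ≤ A / L := by
  have hsub : Icc L R ⊆ Ioi 0 := fun k hk => hL.trans_le hk.1
  have hi : IntervalIntegrable (fun k : ℝ => A * (k ^ 2)⁻¹) volume L R := by
    apply ContinuousOn.intervalIntegrable
    rw [uIcc_of_le hLR]
    exact continuousOn_const.mul ((continuousOn_pow 2).inv₀ fun u hu => (pow_pos (hsub hu) 2).ne')
  have h1 : ‖∫ k in L..R, α k * osc φ k‖ ≤ ∫ k in L..R, A * (k ^ 2)⁻¹ := by
    refine intervalIntegral.norm_integral_le_of_norm_le hLR (Eventually.of_forall fun k hk => ?_) hi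
    have hk0 : 0 < k := hsub (Ioc_subset_Icc_self hk)
    rw [norm_mul, norm_osc, mul_one, ← div_eq_mul_inv, le_div_iff₀ (by positivity), mul_comm]
    exact h.bound_sq k hk0
  refine h1.trans ?_
  have e := intervalIntegral.integral_eq_sub_of_hasDerivAt (f := fun k => -(A * k⁻¹)) (fun k hk => by
    rw [uIcc_of_le hLR] at hk
    exact ((hasDerivAt_inv (hsub hk).ne').const_mul A).neg.congr_deriv (by ring)) hi
  rw [e]
  have : 0 ≤ A * R⁻¹ := mul_nonneg h.nonneg (inv_nonneg.2 (hL.trans_le hLR).le)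
  rw [div_eq_mul_inv]
  linarith

/-- For `x ≤ 0` there is no stationary point, and on `[2/√m, s]` the phase derivative is at most
`-mτ/(2s³)`. The resulting growth `s³` is absorbed by the bound on `k³α'`, leaving a total of order
`R/(mτ)`; this is why `R ≤ √(mτ)` is imposed. -/
theorem IsAmplitude.norm_integral_high_of_neg_aux {m A : ℝ} {α α' β β' : ℝ → ℂ}
    (h : IsAmplitude m A α α' β β') {x τ R : ℝ} (hm : 0 < m) (hm1 : m ≤ 1) (hτ : 0 < τ)
    (hx : x ≤ 0) (hR : 2 / √m ≤ R) (hRL : R ≤ √(m * τ)) :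
    ‖∫ k in (2 / √m)..R, α k * osc (phase m x τ) k‖ ≤ 16 / √(m * τ) * A := by
  have hA := h.nonneg
  have hsm : 0 < √m := Real.sqrt_pos.2 hm
  have hK : 0 < 2 / √m := by positivity
  have hR0 : 0 < R := hK.trans_le hR
  have hsub : Icc (2 / √m) R ⊆ Ioi 0 := fun k hk => hK.trans_le hk.1
  have hE : ∀ s ∈ Icc (2 / √m) R, ‖∫ u in (2 / √m)..s, osc (phase m x τ) u‖ ≤
      8 * s ^ 3 / (m * τ) := by
    intro s hs
    have hs0 : 0 < s := hsub hs
    have hρ : 0 < m * τ / (2 * s ^ 3) := by positivity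
    refine (norm_integral_osc_le_of_neg hs.1 hρ (fun k _ => hasDerivAt_phase hm.le x τ k)
      (fun k _ => hasDerivAt_deriv_phase hm.le x τ k)
      (by have := continuous_lam hm.le; fun_prop) ?_ (Or.inl ?_)).trans (le_of_eq ?_)
    · intro k hk
      have hk0 : 0 < k := hK.trans_le hk.1
      have h0 := lam_pos hm.le k
      have hk2 : 4 ≤ m * k ^ 2 := by
        have h1 : (2 / √m) ^ 2 ≤ k ^ 2 := by gcongr; exact hk.1
        rw [div_pow, Real.sq_sqrt hm.le, div_le_iff₀ hm] at h1
        linarith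
      have h2 : 4 / 5 ≤ lam m k ^ 2 * k ^ 2 := by
        have := lam_sq_mul hm.le k
        nlinarith [sq_nonneg (lam m k), sq_nonneg k, mul_nonneg (sq_nonneg (lam m k)) (sq_nonneg k)]
      have h3 : 4 / 5 ≤ lam m k * k := by nlinarith [mul_pos h0 hk0]
      have h4 : 1 / 2 ≤ lam m k ^ 3 * k ^ 3 := by
        calc (1 : ℝ) / 2 ≤ 4 / 5 * (4 / 5) := by norm_num
          _ ≤ (lam m k ^ 2 * k ^ 2) * (lam m k * k) := by gcongr
          _ = _ := by ring
      have h5 : 1 / (2 * s ^ 3) ≤ lam m k ^ 3 := by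
        rw [div_le_iff₀ (by positivity)]
        have : lam m k ^ 3 * k ^ 3 ≤ lam m k ^ 3 * s ^ 3 := by gcongr; exact hk.2
        linarith
      have h6 : m * τ / (2 * s ^ 3) ≤ τ * lam m k ^ 3 := by
        calc m * τ / (2 * s ^ 3) = m * (τ * (1 / (2 * s ^ 3))) := by ring
          _ ≤ 1 * (τ * lam m k ^ 3) := by gcongr
          _ = _ := one_mul _
      linarith
    · intro k hk
      have hk0 : 0 < k := hK.trans_le hk.1
      have h0 := lam_pos hm.le k
      positivity
    · field_simp
      norm_num
  have ig : IntervalIntegrable (fun k => ‖α' k‖ * (8 * k ^ 3 / (m * τ))) volume (2 / √m) R := by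
    apply ContinuousOn.intervalIntegrable
    rw [uIcc_of_le hR]
    exact (h.cont.mono hsub).norm.mul (Continuous.continuousOn (by fun_prop))
  refine (norm_integral_mul_le_right hR (fun u hu => h.deriv u (hsub hu)) (h.cont.mono hsub)
    (continuous_osc_phase hm.le x τ).continuousOn hE ig).trans ?_
  have hI : ∫ k in (2 / √m)..R, ‖α' k‖ * (8 * k ^ 3 / (m * τ)) ≤ 8 * A / (m * τ) * R := by
    have h1 := intervalIntegral.norm_integral_le_of_norm_le_const (a := 2 / √m) (b := R)
      (f := fun k => ‖α' k‖ * (8 * k ^ 3 / (m * τ))) (C := 8 * A / (m * τ)) fun u hu => by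
        rw [uIoc_of_le hR] at hu
        have hu0 : 0 < u := hsub (Ioc_subset_Icc_self hu)
        rw [Real.norm_of_nonneg (by positivity)]
        calc ‖α' u‖ * (8 * u ^ 3 / (m * τ)) = 8 * (u ^ 3 * ‖α' u‖) / (m * τ) := by ring
          _ ≤ 8 * A / (m * τ) := by gcongr; exact h.dbound_cube u hu0
    refine (le_abs_self _).trans (h1.trans ?_)
    gcongr
    rw [abs_of_nonneg (by linarith)]
    linarith
  have hb : ‖α R‖ * (8 * R ^ 3 / (m * τ)) ≤ 8 * A / (m * τ) * R := by
    calc ‖α R‖ * (8 * R ^ 3 / (m * τ)) = 8 * (R ^ 2 * ‖α R‖) / (m * τ) * R := by ring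
      _ ≤ _ := by gcongr; exact h.bound_sq R hR0
  have hs : √(m * τ) * √(m * τ) = m * τ := Real.mul_self_sqrt (by positivity)
  calc _ ≤ 8 * A / (m * τ) * R + 8 * A / (m * τ) * R := add_le_add hb hI
    _ ≤ 8 * A / (m * τ) * √(m * τ) + 8 * A / (m * τ) * √(m * τ) := by gcongr
    _ = 16 * A * (√(m * τ) / (m * τ)) := by ring
    _ = 16 * A * (√(m * τ))⁻¹ := by rw [Real.sqrt_div_self]
    _ = _ := by ring

/-- For `x ≤ 0` the cut at `√(mτ)` balances the bound `R/(mτ)` for frequencies up to `R` with the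
tail bound `A/R` coming from the `k⁻²` decay. -/
theorem IsAmplitude.norm_integral_high {m A : ℝ} {α α' β β' : ℝ → ℂ}
    (h : IsAmplitude m A α α' β β') {x τ R : ℝ} (hm : 0 < m) (hm1 : m ≤ 1) (hτ : 0 < τ)
    (hR : 2 / √m ≤ R) :
    ‖∫ k in (2 / √m)..R, α k * osc (phase m x τ) k‖ ≤ 50 / √(m * τ) * A := by
  have hA := h.nonneg
  rcases le_total 0 x with hx | hx
  · exact h.norm_integral_high_of_nonneg hm hm1 hτ hx hR
  have hsm : 0 < √m := Real.sqrt_pos.2 hm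
  have hK : 0 < 2 / √m := by positivity
  have hL : 0 < √(m * τ) := Real.sqrt_pos.2 (by positivity)
  rcases le_total R (√(m * τ)) with h1 | h1
  · refine (h.norm_integral_high_of_neg_aux hm hm1 hτ hx hR h1).trans ?_
    gcongr
    norm_num
  rcases le_total (√(m * τ)) (2 / √m) with h2 | h2
  · refine (h.norm_integral_tail _ hK hR).trans ?_
    calc A / (2 / √m) ≤ A / √(m * τ) := by gcongr
      _ ≤ 50 * (A / √(m * τ)) := le_mul_of_one_le_left (by positivity) (by norm_num)
      _ = _ := by ring
  · have hI : ∀ p q, 0 < p → 0 < q → IntervalIntegrable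
        (fun k => α k * osc (phase m x τ) k) volume p q := fun p q hp hq => by
      apply ContinuousOn.intervalIntegrable
      refine (h.continuousOn.mono fun k hk => ?_).mul (continuous_osc_phase hm.le x τ).continuousOn
      exact (lt_min hp hq).trans_le hk.1
    rw [← intervalIntegral.integral_add_adjacent_intervals (hI _ _ hK hL)
      (hI _ _ hL (hL.trans_le h1))]
    refine (norm_add_le _ _).trans ((add_le_add
      (h.norm_integral_high_of_neg_aux hm hm1 hτ hx h2 le_rfl)
      (h.norm_integral_tail _ hL h1)).trans ?_)
    calc 16 / √(m * τ) * A + A / √(m * τ) = 17 * (A / √(m * τ)) := by ring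
      _ ≤ 50 * (A / √(m * τ)) := by gcongr; norm_num
      _ = _ := by ring

/-- The half-line oscillatory integral, uniformly in all parameters. -/
theorem IsAmplitude.norm_integral_half {m A : ℝ} {α α' β β' : ℝ → ℂ}
    (h : IsAmplitude m A α α' β β') {x τ δ R : ℝ} (hm : 0 < m) (hm1 : m ≤ 1) (hτ : 0 < τ)
    (hδ : 0 < δ) (hδK : δ ≤ 2 / √m) (hR : 2 / √m ≤ R) :
    ‖∫ k in δ..R, α k * osc (phase m x τ) k‖ ≤ 850 / √(m * τ) * (‖α δ‖ / √δ + A) := by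
  have hA := h.nonneg
  have hsm : 0 < √m := Real.sqrt_pos.2 hm
  have hK : 0 < 2 / √m := by positivity
  have hI : ∀ p q, 0 < p → 0 < q → IntervalIntegrable
      (fun k => α k * osc (phase m x τ) k) volume p q := fun p q hp hq => by
    apply ContinuousOn.intervalIntegrable
    refine (h.continuousOn.mono fun k hk => ?_).mul (continuous_osc_phase hm.le x τ).continuousOn
    exact (lt_min hp hq).trans_le hk.1
  rw [← intervalIntegral.integral_add_adjacent_intervals (hI _ _ hδ hK)
    (hI _ _ hK (hK.trans_le hR))]
  refine (norm_add_le _ _).trans ((add_le_add (h.norm_integral_low hm hτ hδ hδK)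
    (h.norm_integral_high hm hm1 hτ hR)).trans ?_)
  have h1 : 0 ≤ ‖α δ‖ / √δ := by positivity
  calc _ = 1 / √(m * τ) * (50 * (‖α δ‖ / √δ) + 850 * A) := by ring
    _ ≤ 1 / √(m * τ) * (850 * (‖α δ‖ / √δ) + 850 * A) := by gcongr; norm_num
    _ = _ := by ring

theorem IsAmplitude.conj {m A : ℝ} {α α' β β' : ℝ → ℂ} (h : IsAmplitude m A α α' β β') :
    IsAmplitude m A (fun k => (starRingEnd ℂ) (α k)) (fun k => (starRingEnd ℂ) (α' k))
      (fun k => (starRingEnd ℂ) (β k)) (fun k => (starRingEnd ℂ) (β' k)) where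
  deriv k hk := (h.deriv k hk).star
  cont := Complex.continuous_conj.comp_continuousOn h.cont
  bound k hk := by simpa using h.bound k hk
  bound_sq k hk := by simpa using h.bound_sq k hk
  dbound k hk := by simpa using h.dbound k hk
  dbound_cube k hk := by simpa using h.dbound_cube k hk
  inv u hu := by simp [h.inv u hu]
  deriv_inv u hu := (h.deriv_inv u hu).star
  cont_inv := Complex.continuous_conj.comp_continuousOn h.cont_inv
  bound_inv u hu := by simpa using h.bound_inv u hu
  dbound_inv u hu hu1 := by simpa using h.dbound_inv u hu hu1

theorem IsAmplitude.norm_le {m A : ℝ} {α α' β β' : ℝ → ℂ} (h : IsAmplitude m A α α' β β')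
    {k : ℝ} (hk : 0 < k) : ‖α k‖ ≤ 2 * A * (1 + k ^ 2)⁻¹ := by
  rw [← div_eq_mul_inv, le_div_iff₀ (by positivity)]
  linarith [h.bound k hk, h.bound_sq k hk]

theorem IsAmplitude.integrableOn {m A : ℝ} {α α' β β' : ℝ → ℂ} (h : IsAmplitude m A α α' β β')
    (hm : 0 ≤ m) (x τ : ℝ) :
    IntegrableOn (fun k => α k * osc (phase m x τ) k) (Ioi 0) := by
  refine Integrable.mono' ((integrable_inv_one_add_sq.const_mul (2 * A)).integrableOn (s := Ioi 0))
    ((h.continuousOn.mul (continuous_osc_phase hm x τ).continuousOn).aestronglyMeasurable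
      measurableSet_Ioi) ((ae_restrict_iff' measurableSet_Ioi).2 (Eventually.of_forall fun k hk => ?_))
  rw [norm_mul, norm_osc, mul_one]
  exact h.norm_le hk

theorem IsAmplitude.norm_integral_Ioi_trivial {m A : ℝ} {α α' β β' : ℝ → ℂ}
    (h : IsAmplitude m A α α' β β') (x τ : ℝ) :
    ‖∫ k in Ioi 0, α k * osc (phase m x τ) k‖ ≤ 8 * A := by
  have hA := h.nonneg
  have hi := integrable_inv_one_add_sq.const_mul (2 * A)
  calc _ ≤ ∫ k in Ioi (0 : ℝ), 2 * A * (1 + k ^ 2)⁻¹ := by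
        refine norm_integral_le_of_norm_le hi.integrableOn
          ((ae_restrict_iff' measurableSet_Ioi).2 (Eventually.of_forall fun k hk => ?_))
        rw [norm_mul, norm_osc, mul_one]
        exact h.norm_le hk
    _ ≤ ∫ k : ℝ, 2 * A * (1 + k ^ 2)⁻¹ :=
        setIntegral_le_integral hi (Eventually.of_forall fun k => by positivity)
    _ = 2 * A * Real.pi := by rw [integral_const_mul, integral_univ_inv_one_add_sq]
    _ ≤ 2 * A * 4 := by gcongr; exact Real.pi_lt_four.le
    _ = _ := by ring

/-- Below the free cut-off `δ` the integral is bounded trivially, above it by oscillation; `δ` is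
optimized according to the size of the amplitude at 0. -/
theorem IsAmplitude.norm_integral_Ioi {m A : ℝ} {α α' β β' : ℝ → ℂ}
    (h : IsAmplitude m A α α' β β') {x τ δ : ℝ} (hm : 0 < m) (hm1 : m ≤ 1) (hτ : 0 < τ)
    (hδ : 0 < δ) (hδ1 : δ ≤ 1) :
    ‖∫ k in Ioi 0, α k * osc (phase m x τ) k‖ ≤
      A * δ + 850 / √(m * τ) * (‖α δ‖ / √δ + A) := by
  have hi := h.integrableOn hm.le x τ
  have hsm : 0 < √m := Real.sqrt_pos.2 hm
  have hδK : δ ≤ 2 / √m := by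
    rw [le_div_iff₀ hsm]
    nlinarith [sqrt_le_one_of hm1]
  have hlim := intervalIntegral_tendsto_integral_Ioi 0 hi tendsto_id
  refine le_of_tendsto hlim.norm ?_
  filter_upwards [eventually_ge_atTop (2 / √m)] with R hR
  have hI : ∀ p q, 0 ≤ p → 0 ≤ q → IntervalIntegrable
      (fun k => α k * osc (phase m x τ) k) volume p q := fun p q hp hq =>
    intervalIntegrable_iff.2 (hi.mono_set fun k hk => (le_min hp hq).trans_lt hk.1)
  simp only [id]
  rw [← intervalIntegral.integral_add_adjacent_intervals (hI 0 δ le_rfl hδ.le)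
    (hI δ R hδ.le (hδ.le.trans (hδK.trans hR)))]
  refine (norm_add_le _ _).trans (add_le_add ?_ (h.norm_integral_half hm hm1 hτ hδ hδK hR))
  have := intervalIntegral.norm_integral_le_of_norm_le_const (a := 0) (b := δ)
    (f := fun k => α k * osc (phase m x τ) k) (C := A) fun k hk => by
      rw [uIoc_of_le hδ.le] at hk
      rw [norm_mul, norm_osc, mul_one]
      exact h.bound k hk.1
  simpa [abs_of_pos hδ] using this

/-- Linear vanishing at 0 makes the boundary term `‖α δ‖/√δ` at most `A√δ`, so `δ` may be as small
as `(mτ)^{-1/2}` and the inflection point at 0 causes no loss. The constant is `1 + 2·850`. -/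
theorem IsAmplitude.norm_integral_Ioi_of_linear {m A : ℝ} {α α' β β' : ℝ → ℂ}
    (h : IsAmplitude m A α α' β β') (hlin : ∀ k, 0 < k → ‖α k‖ ≤ A * k) {x τ : ℝ} (hm : 0 < m)
    (hm1 : m ≤ 1) (hτ : 0 < τ) :
    ‖∫ k in Ioi 0, α k * osc (phase m x τ) k‖ ≤ 1701 * A / √(m * τ) := by
  have hA := h.nonneg
  have hs : 0 < √(m * τ) := Real.sqrt_pos.2 (by positivity)
  set δ := min 1 (1 / √(m * τ))
  have hδ : 0 < δ := by positivity
  refine (h.norm_integral_Ioi hm hm1 hτ hδ (min_le_left _ _)).trans ?_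
  have h1 : ‖α δ‖ / √δ ≤ A := by
    have h3 : 0 < √δ := Real.sqrt_pos.2 hδ
    rw [div_le_iff₀ h3]
    refine (hlin δ hδ).trans ?_
    gcongr
    have h4 : δ ≤ 1 := min_le_left _ _
    exact Real.le_sqrt_of_sq_le (by nlinarith)
  calc _ ≤ A * (1 / √(m * τ)) + 850 / √(m * τ) * (A + A) := by
        gcongr; exact min_le_right _ _
    _ = _ := by ring

/-- Without vanishing at 0 the terms `Aδ` and `A(mτδ)^{-1/2}` balance at `δ = (mτ)^{-1/3}`. For `mτ
≤ 1` the trivial bound suffices. -/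
theorem IsAmplitude.norm_integral_Ioi_third {m A : ℝ} {α α' β β' : ℝ → ℂ}
    (h : IsAmplitude m A α α' β β') {x τ : ℝ} (hm : 0 < m)
    (hm1 : m ≤ 1) (hτ : 0 < τ) :
    ‖∫ k in Ioi 0, α k * osc (phase m x τ) k‖ ≤ 1701 * A * (m * τ) ^ (-(1 / 3 : ℝ)) := by
  have hA := h.nonneg
  have hp : 0 < m * τ := by positivity
  rcases le_total (m * τ) 1 with h1 | h1
  · refine (h.norm_integral_Ioi_trivial x τ).trans ?_
    have := Real.one_le_rpow_of_pos_of_le_one_of_nonpos hp h1 (z := -(1 / 3 : ℝ)) (by norm_num)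
    nlinarith
  · set δ := (m * τ) ^ (-(1 / 3 : ℝ)) with hδd
    have hδ : 0 < δ := Real.rpow_pos_of_pos hp _
    have hδ1 : δ ≤ 1 := Real.rpow_le_one_of_one_le_of_nonpos h1 (by norm_num)
    refine (h.norm_integral_Ioi hm hm1 hτ hδ hδ1).trans ?_
    have e1 : 1 / √(m * τ) * (1 / √δ) = δ := by
      rw [Real.sqrt_eq_rpow, Real.sqrt_eq_rpow, hδd, ← Real.rpow_mul hp.le]
      simp only [one_div, ← Real.rpow_neg hp.le]
      rw [← Real.rpow_add hp]
      norm_num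
    have e2 : 1 / √(m * τ) ≤ δ := by
      rw [← e1]
      refine le_mul_of_one_le_right (by positivity) ?_
      rw [le_div_iff₀ (Real.sqrt_pos.2 hδ), one_mul]
      exact sqrt_le_one_of hδ1
    calc _ ≤ A * δ + 850 / √(m * τ) * (A / √δ + A) := by gcongr; exact h.bound δ hδ
      _ = A * δ + 850 * A * (1 / √(m * τ) * (1 / √δ)) + 850 * A * (1 / √(m * τ)) := by ring
      _ ≤ A * δ + 850 * A * δ + 850 * A * δ := by rw [e1]; gcongr
      _ = _ := by ring

theorem osc_phase_neg (m x τ k : ℝ) :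
    osc (phase m x τ) (-k) = (starRingEnd ℂ) (osc (phase m x τ) k) := by
  rw [conj_osc]
  simp only [osc, phase, om_neg]
  congr 3
  ring

/-- The full-line integral reduces to half-line integrals when the amplitude is Hermitian. -/
theorem norm_integral_le_of_hermitian {α : ℝ → ℂ} (hα : ∀ k, α (-k) = (starRingEnd ℂ) (α k))
    {m x τ B : ℝ} (hi : Integrable (fun k => α k * osc (phase m x τ) k))
    (hB : ‖∫ k in Ioi 0, α k * osc (phase m x τ) k‖ ≤ B) :
    ‖∫ k, α k * osc (phase m x τ) k‖ ≤ 2 * B := by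
  rw [← intervalIntegral.integral_Iic_add_Ioi (b := 0) hi.integrableOn hi.integrableOn]
  have e : ∫ k in Iic 0, α k * osc (phase m x τ) k =
      (starRingEnd ℂ) (∫ k in Ioi 0, α k * osc (phase m x τ) k) := by
    rw [← integral_conj]
    have := integral_comp_neg_Ioi 0 (fun k => α k * osc (phase m x τ) k)
    rw [neg_zero] at this
    rw [← this]
    refine integral_congr_ae (Eventually.of_forall fun k => ?_)
    simp only [hα, osc_phase_neg, map_mul]
  rw [e]
  refine (norm_add_le _ _).trans ?_
  rw [RCLike.norm_conj]
  linarith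

/-- Complex conjugation reverses time and space together, which reduces negative `τ` to positive
`τ`. -/
theorem integral_osc_phase_neg_time {α : ℝ → ℂ} {m x τ : ℝ} (s : Set ℝ) :
    ‖∫ k in s, α k * osc (phase m x τ) k‖ =
      ‖∫ k in s, (starRingEnd ℂ) (α k) * osc (phase m (-x) (-τ)) k‖ := by
  rw [← RCLike.norm_conj, ← integral_conj]
  simp only [map_mul, conj_osc]
  have : (fun k => -phase m x τ k) = phase m (-x) (-τ) := by
    ext k; simp only [phase]; ring
  rw [this]

theorem IsAmplitude.integrable {m A : ℝ} {α α' β β' : ℝ → ℂ} (h : IsAmplitude m A α α' β β')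
    (hα : ∀ k, α (-k) = (starRingEnd ℂ) (α k)) (hm : 0 ≤ m) (x τ : ℝ) :
    Integrable (fun k => α k * osc (phase m x τ) k) := by
  have h1 := h.integrableOn hm x τ
  have h2 : IntegrableOn (fun k => α k * osc (phase m x τ) k) (Iio 0) := by
    have : IntegrableOn (fun k => α (-k) * osc (phase m x τ) (-k)) (Ioi 0) := by
      refine (h1.norm).mono' ?_ (Eventually.of_forall fun k => ?_)
      · refine AEStronglyMeasurable.congr
          (Complex.continuous_conj.comp_aestronglyMeasurable h1.aestronglyMeasurable)
          (Eventually.of_forall fun k => ?_)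
        simp only [hα, osc_phase_neg, map_mul]
      · simp only [hα, osc_phase_neg, norm_mul, RCLike.norm_conj, le_refl]
    have h3 := this.comp_neg
    simpa using h3
  rw [← integrableOn_univ, ← Iic_union_Ioi (a := (0 : ℝ))]
  exact ((integrableOn_Iic_iff_integrableOn_Iio enorm_ne_top).2 h2).union h1

theorem IsAmplitude.norm_integral_third {m A : ℝ} {α α' β β' : ℝ → ℂ}
    (h : IsAmplitude m A α α' β β') (hα : ∀ k, α (-k) = (starRingEnd ℂ) (α k))
    {x τ : ℝ} (hm : 0 < m) (hm1 : m ≤ 1) (hτ : τ ≠ 0) :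
    ‖∫ k, α k * osc (phase m x τ) k‖ ≤ 3402 * A * (m * |τ|) ^ (-(1 / 3 : ℝ)) := by
  have key : ‖∫ k in Ioi 0, α k * osc (phase m x τ) k‖ ≤
      1701 * A * (m * |τ|) ^ (-(1 / 3 : ℝ)) := by
    rcases lt_or_gt_of_ne hτ with h0 | h0
    · rw [abs_of_neg h0, integral_osc_phase_neg_time]
      exact h.conj.norm_integral_Ioi_third hm hm1 (neg_pos.2 h0)
    · rw [abs_of_pos h0]
      exact h.norm_integral_Ioi_third hm hm1 h0
  exact (norm_integral_le_of_hermitian hα (h.integrable hα hm.le x τ) key).trans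
    (by linarith)

theorem IsAmplitude.norm_integral_half_power {m A : ℝ} {α α' β β' : ℝ → ℂ}
    (h : IsAmplitude m A α α' β β') (hα : ∀ k, α (-k) = (starRingEnd ℂ) (α k))
    (hlin : ∀ k, 0 < k → ‖α k‖ ≤ A * k)
    {x τ : ℝ} (hm : 0 < m) (hm1 : m ≤ 1) (hτ : τ ≠ 0) :
    ‖∫ k, α k * osc (phase m x τ) k‖ ≤ 3402 * A * (m * |τ|) ^ (-(1 / 2 : ℝ)) := by
  have key : ‖∫ k in Ioi 0, α k * osc (phase m x τ) k‖ ≤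
      1701 * A * (m * |τ|) ^ (-(1 / 2 : ℝ)) := by
    rw [Real.rpow_neg (by positivity), ← Real.sqrt_eq_rpow, ← div_eq_mul_inv]
    rcases lt_or_gt_of_ne hτ with h0 | h0
    · rw [abs_of_neg h0, integral_osc_phase_neg_time]
      exact h.conj.norm_integral_Ioi_of_linear (fun k hk => by simpa using hlin k hk) hm hm1
        (neg_pos.2 h0)
    · rw [abs_of_pos h0]
      exact h.norm_integral_Ioi_of_linear hlin hm hm1 h0
  exact (norm_integral_le_of_hermitian hα (h.integrable hα hm.le x τ) key).trans
    (by linarith)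

/-! ### The concrete amplitudes and their kernels -/

/-- The amplitude `a(k) = ik / (1 + (ik)³)`. -/
noncomputable def amp (k : ℝ) : ℂ := Complex.I * k / (1 + (Complex.I * k) ^ 3)

theorem amp_denom_eq (k : ℝ) : 1 + (Complex.I * k) ^ 3 = 1 - Complex.I * (k : ℂ) ^ 3 := by
  rw [mul_pow, Complex.I_pow_three]; ring

theorem normSq_amp_denom (k : ℝ) : ‖1 + (Complex.I * k) ^ 3‖ ^ 2 = 1 + k ^ 6 := by
  rw [amp_denom_eq, ← Complex.ofReal_pow, Complex.sq_norm, Complex.normSq_apply]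
  simp [-Complex.ofReal_pow]
  ring

theorem amp_denom_ne_zero (k : ℝ) : 1 + (Complex.I * k) ^ 3 ≠ 0 := by
  intro h
  have := normSq_amp_denom k
  rw [h] at this
  have h6 : 0 ≤ k ^ 6 := by positivity
  norm_num at this
  linarith

theorem one_le_norm_amp_denom (k : ℝ) : 1 ≤ ‖1 + (Complex.I * k) ^ 3‖ := by
  have := normSq_amp_denom k
  have h6 : 0 ≤ k ^ 6 := by positivity
  nlinarith [norm_nonneg (1 + (Complex.I * k) ^ 3)]

theorem abs_cube_le_norm_amp_denom (k : ℝ) : |k| ^ 3 ≤ ‖1 + (Complex.I * k) ^ 3‖ := by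
  have := normSq_amp_denom k
  have h6 : |k| ^ 6 = k ^ 6 := by rw [show |k| ^ 6 = (|k| ^ 2) ^ 3 by ring, sq_abs]; ring
  refine le_of_sq_le_sq ?_ (norm_nonneg _)
  rw [this, ← h6]
  nlinarith

theorem abs_le_norm_amp_denom (k : ℝ) : |k| ≤ ‖1 + (Complex.I * k) ^ 3‖ := by
  rcases le_total |k| 1 with h | h
  · exact h.trans (one_le_norm_amp_denom k)
  · exact (le_self_pow₀ h (by norm_num)).trans (abs_cube_le_norm_amp_denom k)

theorem norm_amp (k : ℝ) : ‖amp k‖ = |k| / ‖1 + (Complex.I * k) ^ 3‖ := by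
  rw [amp, norm_div, norm_mul, Complex.norm_I, one_mul, Complex.norm_real, Real.norm_eq_abs]

theorem norm_amp_le_abs (k : ℝ) : ‖amp k‖ ≤ |k| := by
  rw [norm_amp]
  exact div_le_self (abs_nonneg _) (one_le_norm_amp_denom k)

theorem norm_amp_le_one (k : ℝ) : ‖amp k‖ ≤ 1 := by
  rw [norm_amp]
  exact div_le_one_of_le₀ (abs_le_norm_amp_denom k) (norm_nonneg _)

theorem sq_mul_norm_amp_le_one (k : ℝ) : k ^ 2 * ‖amp k‖ ≤ 1 := by
  rw [norm_amp, ← sq_abs, ← mul_div_assoc]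
  refine div_le_one_of_le₀ ?_ (norm_nonneg _)
  exact (by ring : |k| ^ 2 * |k| = |k| ^ 3).le.trans (abs_cube_le_norm_amp_denom k)

theorem continuous_amp : Continuous amp := by
  unfold amp
  exact Continuous.div (by fun_prop) (by fun_prop) amp_denom_ne_zero

theorem amp_neg (k : ℝ) : amp (-k) = (starRingEnd ℂ) (amp k) := by
  simp [amp]

theorem hasDerivAt_amp (k : ℝ) : HasDerivAt amp
    ((Complex.I - 2 * (k : ℂ) ^ 3) / (1 + (Complex.I * k) ^ 3) ^ 2) k := by
  have h1 : HasDerivAt (fun k : ℝ => Complex.I * (k : ℂ)) Complex.I k := by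
    simpa using (hasDerivAt_id k).ofReal_comp.const_mul Complex.I
  have h2 := (h1.pow 3).const_add 1
  refine (h1.div h2 (amp_denom_ne_zero k)).congr_deriv ?_
  congr 1
  have h3 := Complex.I_pow_three
  simp only [Pi.pow_apply]
  push_cast
  linear_combination (-2 * (k : ℂ) ^ 3 * Complex.I) * h3 + (2 * (k : ℂ) ^ 3) * Complex.I_sq

theorem cube_sub_I_ne_zero (u : ℝ) : (u : ℂ) ^ 3 - Complex.I ≠ 0 := by
  intro h
  have := congrArg Complex.im h
  simp [← Complex.ofReal_pow] at this

theorem one_le_norm_cube_sub_I (u : ℝ) : 1 ≤ ‖(u : ℂ) ^ 3 - Complex.I‖ := by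
  have := Complex.abs_im_le_norm ((u : ℂ) ^ 3 - Complex.I)
  simpa [← Complex.ofReal_pow] using this

/-- The choice of `1 + (ik)³ = 1 - ik³` gives a denominator of modulus `√(1 + k⁶)`, hence no real
zeros. Under `k = 1/u` the amplitude becomes `u² · i/(u³ - i)`, smooth up to `u = 0`. -/
theorem isAmplitude_amp {m : ℝ} (hm : 0 < m) (hm1 : m ≤ 1) :
    IsAmplitude m 3 amp (fun k => (Complex.I - 2 * (k : ℂ) ^ 3) / (1 + (Complex.I * k) ^ 3) ^ 2)
      (fun u => Complex.I / ((u : ℂ) ^ 3 - Complex.I))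
      (fun u => -(3 * Complex.I * (u : ℂ) ^ 2) / ((u : ℂ) ^ 3 - Complex.I) ^ 2) where
  deriv k _ := hasDerivAt_amp k
  cont := (Continuous.div (by fun_prop) (by fun_prop)
    fun k => pow_ne_zero 2 (amp_denom_ne_zero k)).continuousOn
  bound k _ := (norm_amp_le_one k).trans (by norm_num)
  bound_sq k _ := (sq_mul_norm_amp_le_one k).trans (by norm_num)
  dbound k hk := by
    rw [norm_div, norm_pow, normSq_amp_denom, div_le_iff₀ (by positivity)]
    have h1 : ‖Complex.I - 2 * (k : ℂ) ^ 3‖ ≤ 1 + 2 * k ^ 3 := by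
      refine (norm_sub_le _ _).trans ?_
      simp [abs_of_pos hk]
    nlinarith [sq_nonneg (k ^ 3 - 1), sq_nonneg (k ^ 3)]
  dbound_cube k hk := by
    rw [norm_div, norm_pow, normSq_amp_denom, ← mul_div_assoc, div_le_iff₀ (by positivity)]
    have h1 : ‖Complex.I - 2 * (k : ℂ) ^ 3‖ ≤ 1 + 2 * k ^ 3 := by
      refine (norm_sub_le _ _).trans ?_
      simp [abs_of_pos hk]
    have h2 : k ^ 3 * ‖Complex.I - 2 * (k : ℂ) ^ 3‖ ≤ k ^ 3 * (1 + 2 * k ^ 3) := by gcongr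
    nlinarith [sq_nonneg (k ^ 3 - 1)]
  inv u hu := by
    have hu1 : (u : ℂ) ≠ 0 := by exact_mod_cast hu.ne'
    have h1 := amp_denom_ne_zero u⁻¹
    rw [amp_denom_eq] at h1
    have h2 := cube_sub_I_ne_zero u
    rw [amp, amp_denom_eq]
    push_cast at h1 ⊢
    field_simp
  deriv_inv u hu := by
    have h1 : HasDerivAt (fun u : ℝ => (u : ℂ) ^ 3 - Complex.I) (3 * (u : ℂ) ^ 2) u := by
      have := ((hasDerivAt_id u).ofReal_comp.pow 3).sub_const Complex.I
      refine this.congr_deriv (by simp)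
    refine ((hasDerivAt_const u Complex.I).div h1 (cube_sub_I_ne_zero u)).congr_deriv ?_
    ring
  cont_inv := (Continuous.div (by fun_prop) (by fun_prop)
    fun k => pow_ne_zero 2 (cube_sub_I_ne_zero k)).continuousOn
  bound_inv u _ := by
    rw [norm_div, Complex.norm_I]
    refine (div_le_one_of_le₀ (one_le_norm_cube_sub_I u) (norm_nonneg _)).trans (by norm_num)
  dbound_inv u hu hu1 := by
    have hs := sqrt_le_one_of hm1
    have hs0 := Real.sqrt_pos.2 hm
    have h1 := one_le_norm_cube_sub_I u
    rw [norm_div, norm_neg, norm_pow]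
    have h2 : ‖3 * Complex.I * (u : ℂ) ^ 2‖ ≤ 3 := by
      simp only [norm_mul, norm_pow, Complex.norm_I, Complex.norm_real, Real.norm_eq_abs, sq_abs,
        Complex.norm_ofNat]
      nlinarith
    calc _ ≤ ‖3 * Complex.I * (u : ℂ) ^ 2‖ := div_le_self (norm_nonneg _) (one_le_pow₀ h1)
      _ ≤ 3 := h2
      _ ≤ 3 / √m := by rw [le_div_iff₀ hs0]; linarith

/-- The derivative of `lam` is `-mkλ³`, and `mk²λ³ ≤ 1`. The linear bound on `α` near 0, or the
decay of `k²α` in the cubic estimate, supplies the missing power of `k`. In the inverted variable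
the factor is `u(u²+m)^{-1/2}`, whose derivative is at most `1/√m`. -/
theorem IsAmplitude.mul_lam {m A : ℝ} {α α' β β' : ℝ → ℂ} (h : IsAmplitude m A α α' β β')
    (hm : 0 < m) (hlin : ∀ k, 0 < k → ‖α k‖ ≤ A * k) :
    IsAmplitude m (2 * A) (fun k => α k * lam m k)
      (fun k => α' k * lam m k + α k * ((-(m * k * lam m k ^ 3) : ℝ) : ℂ))
      (fun u => β u * ((u * (√(u ^ 2 + m))⁻¹ : ℝ) : ℂ))
      (fun u => β' u * ((u * (√(u ^ 2 + m))⁻¹ : ℝ) : ℂ) +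
        β u * ((m * (√(u ^ 2 + m))⁻¹ ^ 3 : ℝ) : ℂ)) := by
  have hA := h.nonneg
  have hl0 := fun k => (lam_pos hm.le k).le
  have hl1 := lam_le_one hm.le
  have hn : ∀ k, ‖(lam m k : ℂ)‖ = lam m k := fun k => by
    rw [Complex.norm_real, Real.norm_of_nonneg (hl0 k)]
  have hle : ∀ k, ‖α k * lam m k‖ ≤ ‖α k‖ := fun k => by
    rw [norm_mul, hn]; exact mul_le_of_le_one_right (norm_nonneg _) (hl1 k)
  have hd : ∀ k, 0 < k → m * k * lam m k ^ 3 * k ≤ 1 := fun k hk => by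
    have e := lam_sq_mul hm.le k
    have : m * k ^ 2 * lam m k ^ 2 ≤ 1 := by nlinarith [sq_nonneg (lam m k)]
    calc m * k * lam m k ^ 3 * k = m * k ^ 2 * lam m k ^ 2 * lam m k := by ring
      _ ≤ 1 * 1 := mul_le_mul this (hl1 k) (hl0 k) zero_le_one
      _ = 1 := one_mul 1
  have hdn : ∀ k, 0 < k → ‖((-(m * k * lam m k ^ 3) : ℝ) : ℂ)‖ = m * k * lam m k ^ 3 :=
    fun k hk => by
      rw [Complex.norm_real, norm_neg, Real.norm_of_nonneg]
      have := hl0 k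
      positivity
  have hq0 : ∀ u, 0 < (√(u ^ 2 + m))⁻¹ := fun u => by positivity
  have hqs : ∀ u, (√(u ^ 2 + m))⁻¹ ^ 2 * (u ^ 2 + m) = 1 := fun u => by
    rw [inv_pow, Real.sq_sqrt (by positivity)]
    exact inv_mul_cancel₀ (by positivity)
  have hν : ∀ u, 0 < u → ‖((u * (√(u ^ 2 + m))⁻¹ : ℝ) : ℂ)‖ ≤ 1 := fun u hu => by
    have := hqs u
    rw [Complex.norm_real, Real.norm_of_nonneg (mul_pos hu (hq0 u)).le]
    have h2 : (u * (√(u ^ 2 + m))⁻¹) ^ 2 ≤ 1 := by nlinarith [sq_nonneg (√(u ^ 2 + m))⁻¹]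
    nlinarith [mul_pos hu (hq0 u)]
  exact {
    deriv := fun k hk => (h.deriv k hk).mul (hasDerivAt_lam hm.le k).ofReal_comp
    cont := by
      have c1 := continuous_lam hm.le
      refine (h.cont.mul (Continuous.continuousOn (by fun_prop))).add
        (h.continuousOn.mul (Continuous.continuousOn (by fun_prop)))
    bound := fun k hk => (hle k).trans ((h.bound k hk).trans (by linarith))
    bound_sq := fun k hk => by
      have := h.bound_sq k hk
      have := mul_le_mul_of_nonneg_left (hle k) (sq_nonneg k)
      linarith
    dbound := fun k hk => by
      refine (norm_add_le _ _).trans ?_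
      rw [norm_mul, norm_mul, hn, hdn k hk]
      have e1 : ‖α' k‖ * lam m k ≤ A * 1 := by
        gcongr
        · exact hl0 k
        · exact h.dbound k hk
        · exact hl1 k
      have hmk : 0 ≤ m * k * lam m k ^ 3 := by have := hl0 k; positivity
      have e2 : ‖α k‖ * (m * k * lam m k ^ 3) ≤ A := by
        calc _ ≤ A * k * (m * k * lam m k ^ 3) := by gcongr; exact hlin k hk
          _ = A * (m * k * lam m k ^ 3 * k) := by ring
          _ ≤ A * 1 := by gcongr; exact hd k hk
          _ = A := mul_one A
      linarith
    dbound_cube := fun k hk => by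
      have hk3 : 0 ≤ k ^ 3 := by positivity
      refine (mul_le_mul_of_nonneg_left (norm_add_le _ _) hk3).trans ?_
      rw [norm_mul, norm_mul, hn, hdn k hk]
      have e1 : k ^ 3 * ‖α' k‖ * lam m k ≤ A * 1 := by
        gcongr
        · exact hl0 k
        · exact h.dbound_cube k hk
        · exact hl1 k
      have hmk : 0 ≤ m * k * lam m k ^ 3 := by have := hl0 k; positivity
      have e2 : k ^ 3 * (‖α k‖ * (m * k * lam m k ^ 3)) ≤ A := by
        calc _ = (k ^ 2 * ‖α k‖) * (m * k * lam m k ^ 3 * k) := by ring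
          _ ≤ A * 1 := by
            gcongr
            · exact h.bound_sq k hk
            · exact hd k hk
          _ = A := mul_one A
      linarith
    inv := fun u hu => by
      rw [h.inv u hu, lam_inv hu]; ring
    deriv_inv := fun u hu => by
      have e := (hasDerivAt_id u).mul (hasDerivAt_inv_sqrt_add hm u)
      refine (h.deriv_inv u hu).mul (HasDerivAt.ofReal_comp (e.congr_deriv ?_))
      simp only [id]
      linear_combination (-(√(u ^ 2 + m))⁻¹) * hqs u
    cont_inv := by
      have hqc : Continuous fun u : ℝ => (√(u ^ 2 + m))⁻¹ :=
        continuous_iff_continuousAt.2 fun u => (hasDerivAt_inv_sqrt_add hm u).continuousAt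
      refine (h.cont_inv.mul (Continuous.continuousOn (by fun_prop))).add
        (ContinuousOn.mul (fun k hk => (h.deriv_inv k hk).continuousAt.continuousWithinAt)
          (Continuous.continuousOn (by fun_prop)))
    bound_inv := fun u hu => by
      rw [norm_mul]
      calc _ ≤ A * 1 := mul_le_mul (h.bound_inv u hu) (hν u hu) (norm_nonneg _) hA
        _ ≤ _ := by linarith
    dbound_inv := fun u hu hu1 => by
      refine (norm_add_le _ _).trans ?_
      rw [norm_mul, norm_mul]
      have hs := Real.sqrt_pos.2 hm
      have e1 : ‖((m * (√(u ^ 2 + m))⁻¹ ^ 3 : ℝ) : ℂ)‖ ≤ 1 / √m := by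
        have hq := hq0 u
        rw [Complex.norm_real, Real.norm_of_nonneg (by positivity)]
        have e2 : (√(u ^ 2 + m))⁻¹ ≤ 1 / √m := by
          rw [one_div]
          exact inv_anti₀ hs (Real.sqrt_le_sqrt (by nlinarith [sq_nonneg u]))
        have e3 : m * (√(u ^ 2 + m))⁻¹ ^ 2 ≤ 1 := by
          have := hqs u
          nlinarith [mul_nonneg (sq_nonneg (√(u ^ 2 + m))⁻¹) (sq_nonneg u)]
        calc m * (√(u ^ 2 + m))⁻¹ ^ 3 = m * (√(u ^ 2 + m))⁻¹ ^ 2 * (√(u ^ 2 + m))⁻¹ := by ring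
          _ ≤ 1 * (1 / √m) := mul_le_mul e3 e2 hq.le zero_le_one
          _ = _ := one_mul _
      calc _ ≤ A / √m * 1 + A * (1 / √m) := add_le_add
            (mul_le_mul (h.dbound_inv u hu hu1) (hν u hu) (norm_nonneg _) (by positivity))
            (mul_le_mul (h.bound_inv u hu) e1 (norm_nonneg _) hA)
        _ = _ := by ring }

theorem norm_amp_mul_lam_pow_le {m : ℝ} (hm : 0 ≤ m) (j : ℕ) (k : ℝ) :
    ‖amp k * (lam m k : ℂ) ^ j‖ ≤ ‖amp k‖ := by
  rw [norm_mul, norm_pow, Complex.norm_real, Real.norm_of_nonneg (lam_pos hm k).le]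
  exact mul_le_of_le_one_right (norm_nonneg _)
    (pow_le_one₀ (lam_pos hm k).le (lam_le_one hm k))

/-- Powers of `lam` accompany `amp` twice over: one from the velocity nonlinearity in a Riemann
invariant, one from recovering `V`. Hence `j ≤ 2` in what follows. -/
theorem isAmplitude_amp_mul_lam_pow {m : ℝ} (hm : 0 < m) (hm1 : m ≤ 1) (j : ℕ) :
    ∃ α' β β', IsAmplitude m (2 ^ j * 3) (fun k => amp k * (lam m k : ℂ) ^ j) α' β β' := by
  induction j with
  | zero => exact ⟨_, _, _, by simpa using isAmplitude_amp hm hm1⟩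
  | succ j ih =>
    obtain ⟨_, _, _, h⟩ := ih
    have hlin : ∀ k, 0 < k → ‖amp k * (lam m k : ℂ) ^ j‖ ≤ 2 ^ j * 3 * k := fun k hk => by
      refine (norm_amp_mul_lam_pow_le hm.le j k).trans ((norm_amp_le_abs k).trans ?_)
      rw [abs_of_pos hk]
      have : (1 : ℝ) ≤ 2 ^ j := one_le_pow₀ (by norm_num)
      nlinarith
    have h2 := h.mul_lam hm hlin
    rw [show (2 : ℝ) * (2 ^ j * 3) = 2 ^ (j + 1) * 3 by ring] at h2
    simp only [mul_assoc, ← pow_succ] at h2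
    exact ⟨_, _, _, h2⟩

theorem amp_mul_lam_pow_neg (m : ℝ) (j : ℕ) (k : ℝ) : amp (-k) * (lam m (-k) : ℂ) ^ j =
    (starRingEnd ℂ) (amp k * (lam m k : ℂ) ^ j) := by
  rw [amp_neg, lam_neg]
  simp

/-- The amplitude constant is at most `2²·3 = 12`, and `3402·12 ≤ 50000`. -/
theorem kernel_amp_half {m : ℝ} (hm : 0 < m) (hm1 : m ≤ 1) {j : ℕ} (hj : j ≤ 2) (x : ℝ) {τ : ℝ}
    (hτ : τ ≠ 0) : ‖∫ k, amp k * (lam m k : ℂ) ^ j * osc (phase m x τ) k‖ ≤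
      50000 * (m * |τ|) ^ (-(1 / 2 : ℝ)) := by
  obtain ⟨_, _, _, h⟩ := isAmplitude_amp_mul_lam_pow hm hm1 j
  have h1 : (1 : ℝ) ≤ 2 ^ j := one_le_pow₀ (by norm_num)
  have h4 : (2 : ℝ) ^ j ≤ 2 ^ 2 := pow_le_pow_right₀ (by norm_num) hj
  refine (h.norm_integral_half_power (amp_mul_lam_pow_neg m j) (fun k hk => ?_) hm hm1 hτ).trans ?_
  · refine (norm_amp_mul_lam_pow_le hm.le j k).trans ((norm_amp_le_abs k).trans ?_)
    rw [abs_of_pos hk]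
    nlinarith
  · gcongr
    linarith

theorem kernel_amp_third {m : ℝ} (hm : 0 < m) (hm1 : m ≤ 1) {j : ℕ} (hj : j ≤ 2) (x : ℝ) {τ : ℝ}
    (hτ : τ ≠ 0) : ‖∫ k, amp k * (lam m k : ℂ) ^ j * osc (phase m x τ) k‖ ≤
      50000 * (m * |τ|) ^ (-(1 / 3 : ℝ)) := by
  obtain ⟨_, _, _, h⟩ := isAmplitude_amp_mul_lam_pow hm hm1 j
  have h4 : (2 : ℝ) ^ j ≤ 2 ^ 2 := pow_le_pow_right₀ (by norm_num) hj
  refine (h.norm_integral_third (amp_mul_lam_pow_neg m j) hm hm1 hτ).trans ?_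
  gcongr
  linarith

/-- This is the TT* weight of `H¹` data. It is self-dual under inversion, `(1+u⁻²)⁻¹ = u²(1+u²)⁻¹`,
so `β = α`. It does not vanish at 0, and only the decay of order `1/3` is available. -/
theorem isAmplitude_inv_one_add_sq {m : ℝ} (hm : 0 < m) (hm1 : m ≤ 1) :
    IsAmplitude m 2 (fun k => (((1 + k ^ 2)⁻¹ : ℝ) : ℂ))
      (fun k => ((-(2 * k) / (1 + k ^ 2) ^ 2 : ℝ) : ℂ))
      (fun k => (((1 + k ^ 2)⁻¹ : ℝ) : ℂ))
      (fun k => ((-(2 * k) / (1 + k ^ 2) ^ 2 : ℝ) : ℂ)) := by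
  have hd : ∀ k : ℝ, HasDerivAt (fun k : ℝ => (((1 + k ^ 2)⁻¹ : ℝ) : ℂ))
      ((-(2 * k) / (1 + k ^ 2) ^ 2 : ℝ) : ℂ) k := fun k => by
    have h0 : 1 + k ^ 2 ≠ 0 := by positivity
    have h1 : HasDerivAt (fun k : ℝ => 1 + k ^ 2) (2 * k) k := by
      simpa using (hasDerivAt_pow 2 k).const_add 1
    exact (h1.inv h0).ofReal_comp
  have hc : Continuous fun k : ℝ => ((-(2 * k) / (1 + k ^ 2) ^ 2 : ℝ) : ℂ) := by
    refine Complex.continuous_ofReal.comp ?_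
    exact Continuous.div (by fun_prop) (by fun_prop) fun k => by positivity
  have hb : ∀ k : ℝ, ‖(((1 + k ^ 2)⁻¹ : ℝ) : ℂ)‖ = (1 + k ^ 2)⁻¹ := fun k => by
    rw [Complex.norm_real, Real.norm_of_nonneg (by positivity)]
  have hb1 : ∀ k : ℝ, ‖(((1 + k ^ 2)⁻¹ : ℝ) : ℂ)‖ ≤ 2 := fun k => by
    rw [hb]
    exact (inv_le_one_of_one_le₀ (by nlinarith [sq_nonneg k])).trans (by norm_num)
  have hdb : ∀ k : ℝ, 0 < k → ‖((-(2 * k) / (1 + k ^ 2) ^ 2 : ℝ) : ℂ)‖ =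
      2 * k / (1 + k ^ 2) ^ 2 := fun k hk => by
    rw [Complex.norm_real, neg_div, norm_neg, Real.norm_of_nonneg (by positivity)]
  have hdb1 : ∀ k : ℝ, 0 < k → ‖((-(2 * k) / (1 + k ^ 2) ^ 2 : ℝ) : ℂ)‖ ≤ 2 := fun k hk => by
    rw [hdb k hk, div_le_iff₀ (by positivity)]
    nlinarith [sq_nonneg (k - 1), sq_nonneg (k ^ 2)]
  exact {
    deriv := fun k _ => hd k
    cont := hc.continuousOn
    bound := fun k _ => hb1 k
    bound_sq := fun k _ => by
      rw [hb, ← div_eq_mul_inv, div_le_iff₀ (by positivity)]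
      nlinarith [sq_nonneg k]
    dbound := hdb1
    dbound_cube := fun k hk => by
      rw [hdb k hk, ← mul_div_assoc, div_le_iff₀ (by positivity)]
      nlinarith [sq_nonneg k, sq_nonneg (k ^ 2)]
    inv := fun u hu => by
      rw [← Complex.ofReal_pow, ← Complex.ofReal_mul]
      congr 1
      field_simp
      ring
    deriv_inv := fun k _ => hd k
    cont_inv := hc.continuousOn
    bound_inv := fun k _ => hb1 k
    dbound_inv := fun k hk _ => (hdb1 k hk).trans (by
      rw [le_div_iff₀ (Real.sqrt_pos.2 hm)]
      linarith [sqrt_le_one_of hm1]) }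

theorem kernel_inv_one_add_sq {m : ℝ} (hm : 0 < m) (hm1 : m ≤ 1) (x : ℝ) {τ : ℝ}
    (hτ : τ ≠ 0) : ‖∫ k, (((1 + k ^ 2)⁻¹ : ℝ) : ℂ) * osc (phase m x τ) k‖ ≤
      50000 * (m * |τ|) ^ (-(1 / 3 : ℝ)) := by
  refine ((isAmplitude_inv_one_add_sq hm hm1).norm_integral_third (fun k => ?_) hm hm1 hτ).trans ?_
  · simp
  · gcongr
    norm_num

/-! ### The Hardy–Littlewood–Sobolev inequality -/

theorem lintegral_comp_abs_sub (h : ℝ → ℝ≥0∞) (hh : Measurable h) (t : ℝ) :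
    ∫⁻ s, h |s - t| = 2 * ∫⁻ s in Ioi 0, h s := by
  rw [lintegral_sub_right_eq_self (fun s => h |s|) t, ← lintegral_add_compl _ measurableSet_Ioi
    (A := Ioi (0 : ℝ)), two_mul]
  congr 1
  · exact setLIntegral_congr_fun measurableSet_Ioi fun s hs => by rw [abs_of_pos hs]
  · rw [compl_Ioi, ← setLIntegral_congr (Iio_ae_eq_Iic (a := (0 : ℝ)))]
    have hmp := (Measure.measurePreserving_neg (volume : Measure ℝ)).setLIntegral_comp_preimage
      (measurableSet_Ioi (a := (0 : ℝ))) hh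
    rw [← hmp]
    have : (Neg.neg ⁻¹' Ioi (0 : ℝ)) = Iio 0 := by ext; simp
    rw [this]
    exact setLIntegral_congr_fun measurableSet_Iio fun s hs => by rw [abs_of_neg hs]

theorem lintegral_Ioc_rpow_third {r : ℝ} (hr : 0 < r) :
    ∫⁻ s in Ioc 0 r, ENNReal.ofReal (s ^ (-(1 / 3 : ℝ))) = ENNReal.ofReal (3 / 2 * r ^ (2 / 3 : ℝ)) := by
  have hi : IntervalIntegrable (fun s : ℝ => s ^ (-(1 / 3 : ℝ))) volume 0 r :=
    intervalIntegral.intervalIntegrable_rpow' (by norm_num)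
  rw [← ofReal_integral_eq_lintegral_ofReal ((intervalIntegrable_iff_integrableOn_Ioc_of_le hr.le).1 hi)
    ((ae_restrict_iff' measurableSet_Ioc).2 (Eventually.of_forall fun s hs =>
      Real.rpow_nonneg hs.1.le _)), ← intervalIntegral.integral_of_le hr.le,
    integral_rpow (Or.inl (by norm_num))]
  congr 1
  rw [show -(1 / 3 : ℝ) + 1 = 2 / 3 by norm_num, Real.zero_rpow (by norm_num)]
  ring

theorem lintegral_Ioi_rpow_neg_two {r : ℝ} (hr : 0 < r) :
    ∫⁻ s in Ioi r, ENNReal.ofReal (s ^ (-2 : ℝ)) = ENNReal.ofReal (1 / r) := by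
  rw [← ofReal_integral_eq_lintegral_ofReal (integrableOn_Ioi_rpow_of_lt (by norm_num) hr)
    ((ae_restrict_iff' measurableSet_Ioi).2 (Eventually.of_forall fun s hs =>
      Real.rpow_nonneg (hr.le.trans (le_of_lt hs)) _)),
    integral_Ioi_rpow_of_lt (by norm_num) hr]
  congr 1
  rw [show (-2 : ℝ) + 1 = -1 by norm_num, Real.rpow_neg_one]
  ring

/-- Pointwise truncation of the fractional integral kernel. -/
theorem mul_rpow_third_le {a y d κ r : ℝ} (ha : 0 ≤ a) (hay : a ≤ y) (hd : 0 < d) (hκ : 0 < κ) :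
    a * d ^ (-(1 / 3 : ℝ)) ≤ κ * a ^ (6 / 5 : ℝ) +
      if d ≤ r then y * d ^ (-(1 / 3 : ℝ)) else (κ ^ 5)⁻¹ * d ^ (-2 : ℝ) := by
  have hd3 : 0 < d ^ (-(1 / 3 : ℝ)) := Real.rpow_pos_of_pos hd _
  have h65 : 0 ≤ a ^ (6 / 5 : ℝ) := Real.rpow_nonneg ha _
  split_ifs with h
  · have : a * d ^ (-(1 / 3 : ℝ)) ≤ y * d ^ (-(1 / 3 : ℝ)) := by gcongr
    have : 0 ≤ κ * a ^ (6 / 5 : ℝ) := by positivity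
    linarith
  · have h2 : 0 ≤ (κ ^ 5)⁻¹ * d ^ (-2 : ℝ) := by positivity
    have e1 : a ^ (6 / 5 : ℝ) = a * a ^ (1 / 5 : ℝ) := by
      rcases ha.eq_or_lt with h0 | h0
      · rw [← h0, zero_mul, Real.zero_rpow (by norm_num)]
      · rw [show (6 / 5 : ℝ) = 1 + 1 / 5 by norm_num, Real.rpow_add h0, Real.rpow_one]
    -- Young's inequality with exponents 6/5 and 6, by comparing the two factors; the power `d⁻²` is
    -- integrable at infinity.
    rcases le_total (d ^ (-(1 / 3 : ℝ))) (κ * a ^ (1 / 5 : ℝ)) with h3 | h3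
    · have : a * d ^ (-(1 / 3 : ℝ)) ≤ a * (κ * a ^ (1 / 5 : ℝ)) := by gcongr
      rw [e1]
      nlinarith
    · have h4 : a ^ (1 / 5 : ℝ) ≤ d ^ (-(1 / 3 : ℝ)) / κ := by
        rw [le_div_iff₀ hκ]; linarith
      have h5 : a ≤ (d ^ (-(1 / 3 : ℝ)) / κ) ^ 5 := by
        calc a = (a ^ (1 / 5 : ℝ)) ^ 5 := by
              rw [← Real.rpow_natCast, ← Real.rpow_mul ha]; norm_num
          _ ≤ _ := by gcongr
      have h6 : a * d ^ (-(1 / 3 : ℝ)) ≤ (κ ^ 5)⁻¹ * d ^ (-2 : ℝ) := by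
        calc a * d ^ (-(1 / 3 : ℝ)) ≤ (d ^ (-(1 / 3 : ℝ)) / κ) ^ 5 * d ^ (-(1 / 3 : ℝ)) := by gcongr
          _ = (κ ^ 5)⁻¹ * (d ^ (-(1 / 3 : ℝ))) ^ 6 := by rw [div_pow]; ring
          _ = _ := by
            congr 1
            rw [← Real.rpow_natCast, ← Real.rpow_mul hd.le]; norm_num
      have : 0 ≤ κ * a ^ (6 / 5 : ℝ) := by positivity
      linarith

/-- On the set where `f ≤ y` the singularity of the kernel is handled by the bound `y` near `t` and
by `∫ f^{6/5}` away from it, through `mul_rpow_third_le`. -/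
theorem lintegral_fractional_inner {f : ℝ → ℝ} (hf : Measurable f) (hf0 : ∀ s, 0 ≤ f s) {P y : ℝ}
    (hP : 0 < P) (hfP : ∫⁻ s, ENNReal.ofReal (f s ^ (6 / 5 : ℝ)) ≤ ENNReal.ofReal P) (hy : 0 < y)
    (t : ℝ) :
    ∫⁻ s, (if f s ≤ y then ENNReal.ofReal (f s * |s - t| ^ (-(1 / 3 : ℝ))) else 0) ≤
      ENNReal.ofReal (6 * (y ^ (1 / 5 : ℝ) * P ^ (2 / 3 : ℝ))) := by
  -- The radius and the Young parameter are chosen so that the three contributions are all multiples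
  -- of `y^{1/5} P^{2/3}`; the multiples are 1, 2·(3/2) and 2·1.
  set r := P * y ^ (-(6 / 5) : ℝ) with hr
  set κ := y ^ (1 / 5 : ℝ) * P ^ (-(1 / 3) : ℝ) with hκ
  have hr0 : 0 < r := by positivity
  have hκ0 : 0 < κ := by positivity
  have e1 : κ * P = y ^ (1 / 5 : ℝ) * P ^ (2 / 3 : ℝ) := by
    rw [hκ, mul_assoc, ← Real.rpow_add_one hP.ne']; norm_num
  have e2 : y * r ^ (2 / 3 : ℝ) = y ^ (1 / 5 : ℝ) * P ^ (2 / 3 : ℝ) := by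
    rw [hr, Real.mul_rpow hP.le (by positivity), ← Real.rpow_mul hy.le, mul_left_comm,
      mul_comm (y ^ _), mul_comm y, ← Real.rpow_add_one hy.ne']
    norm_num
  have e3 : (κ ^ 5)⁻¹ * (1 / r) = y ^ (1 / 5 : ℝ) * P ^ (2 / 3 : ℝ) := by
    have h5 : κ ^ 5 = y * P ^ (-(5 / 3) : ℝ) := by
      rw [hκ, mul_pow, ← Real.rpow_natCast, ← Real.rpow_natCast, ← Real.rpow_mul hy.le,
        ← Real.rpow_mul hP.le]
      norm_num
    have h6 : y ^ (1 / 5 : ℝ) * y ^ (-(6 / 5) : ℝ) * y = 1 := by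
      rw [← Real.rpow_add hy, ← Real.rpow_add_one hy.ne']; norm_num
    have h7 : P ^ (2 / 3 : ℝ) * P ^ (-(5 / 3) : ℝ) * P = 1 := by
      rw [← Real.rpow_add hP, ← Real.rpow_add_one hP.ne']; norm_num
    rw [one_div, ← mul_inv]
    refine inv_eq_of_mul_eq_one_right ?_
    rw [h5, hr]
    linear_combination (P ^ (2 / 3 : ℝ) * P ^ (-(5 / 3) : ℝ) * P) * h6 + h7
  set h : ℝ → ℝ≥0∞ := fun d => ENNReal.ofReal
    (if d ≤ r then y * d ^ (-(1 / 3 : ℝ)) else (κ ^ 5)⁻¹ * d ^ (-2 : ℝ)) with hh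
  have hmeas : Measurable h := by
    refine ENNReal.measurable_ofReal.comp (Measurable.ite measurableSet_Iic ?_ ?_) <;> fun_prop
  have hint : ∫⁻ s in Ioi 0, h s ≤ ENNReal.ofReal (5 / 2 * (y ^ (1 / 5 : ℝ) * P ^ (2 / 3 : ℝ))) := by
    rw [← Ioc_union_Ioi_eq_Ioi hr0.le]
    refine (lintegral_union_le _ _ _).trans ?_
    have i1 : ∫⁻ s in Ioc 0 r, h s = ENNReal.ofReal (y * (3 / 2 * r ^ (2 / 3 : ℝ))) := by
      rw [ENNReal.ofReal_mul hy.le, ← lintegral_Ioc_rpow_third hr0, ← lintegral_const_mul _ (by fun_prop)]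
      refine setLIntegral_congr_fun measurableSet_Ioc fun s hs => ?_
      simp only [hh, if_pos hs.2, ENNReal.ofReal_mul hy.le]
    have i2 : ∫⁻ s in Ioi r, h s = ENNReal.ofReal ((κ ^ 5)⁻¹ * (1 / r)) := by
      rw [ENNReal.ofReal_mul (by positivity), ← lintegral_Ioi_rpow_neg_two hr0,
        ← lintegral_const_mul _ (by fun_prop)]
      refine setLIntegral_congr_fun measurableSet_Ioi fun s hs => ?_
      simp only [hh, if_neg (not_le.2 (mem_Ioi.1 hs))]
      rw [ENNReal.ofReal_mul (by positivity)]
    rw [i1, i2, ← ENNReal.ofReal_add (by positivity) (by positivity)]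
    apply ENNReal.ofReal_le_ofReal
    rw [e3]
    linarith
  have hae : ∀ᵐ s : ℝ, s ≠ t := by simp [ae_iff, measure_singleton]
  calc _ ≤ ∫⁻ s, (ENNReal.ofReal κ * ENNReal.ofReal (f s ^ (6 / 5 : ℝ)) + h |s - t|) := by
        refine lintegral_mono_ae (hae.mono fun s hs => ?_)
        split_ifs with hfy
        · have hd : 0 < |s - t| := abs_pos.2 (sub_ne_zero.2 hs)
          rw [hh, ← ENNReal.ofReal_mul hκ0.le]
          refine (ENNReal.ofReal_le_ofReal (mul_rpow_third_le (r := r) (hf0 s) hfy hd hκ0)).trans ?_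
          exact ENNReal.ofReal_add_le
        · exact zero_le
    _ = ENNReal.ofReal κ * (∫⁻ s, ENNReal.ofReal (f s ^ (6 / 5 : ℝ))) + 2 * ∫⁻ s in Ioi 0, h s := by
        rw [lintegral_add_left (by fun_prop), lintegral_const_mul _ (by fun_prop),
          lintegral_comp_abs_sub h hmeas]
    _ ≤ ENNReal.ofReal κ * ENNReal.ofReal P +
        2 * ENNReal.ofReal (5 / 2 * (y ^ (1 / 5 : ℝ) * P ^ (2 / 3 : ℝ))) := by gcongr
    _ = _ := by
        rw [← ENNReal.ofReal_mul hκ0.le, e1,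
          show (2 : ℝ≥0∞) = ENNReal.ofReal 2 by simp, ← ENNReal.ofReal_mul (by norm_num),
          ← ENNReal.ofReal_add (by positivity) (by positivity)]
        congr 1
        ring

/-- The Hardy–Littlewood–Sobolev inequality on the line for `|s - t|^{-1/3}` and `L^{6/5}`. -/
theorem lintegral_fractional_le {f : ℝ → ℝ} (hf : Measurable f) (hf0 : ∀ s, 0 ≤ f s) {P : ℝ}
    (hP : 0 < P) (hfP : ∫⁻ s, ENNReal.ofReal (f s ^ (6 / 5 : ℝ)) ≤ ENNReal.ofReal P) :
    ∫⁻ t, ∫⁻ s, ENNReal.ofReal (f s * f t * |s - t| ^ (-(1 / 3 : ℝ))) ≤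
      ENNReal.ofReal (12 * P ^ (5 / 3 : ℝ)) := by
  -- By symmetry it suffices to integrate where `f s ≤ f t`. There the inner integral is at most `6
  -- f(t)^{1/5} P^{2/3}`, and the remaining factor `f(t)` completes the power `6/5`.
  set G : ℝ → ℝ → ℝ≥0∞ := fun t s =>
    if f s ≤ f t then ENNReal.ofReal (f s * f t * |s - t| ^ (-(1 / 3 : ℝ))) else 0 with hG
  have hGm : Measurable (Function.uncurry G) := by
    simp only [hG, Function.uncurry_def]
    refine Measurable.ite (measurableSet_le (by fun_prop) (by fun_prop)) (by fun_prop) (by fun_prop)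
  have hle : ∀ t s, ENNReal.ofReal (f s * f t * |s - t| ^ (-(1 / 3 : ℝ))) ≤ G t s + G s t := by
    intro t s
    rcases le_total (f s) (f t) with h | h
    · simp only [hG, if_pos h]; exact le_self_add
    · simp only [hG, if_pos h]
      rw [mul_comm (f t) (f s), abs_sub_comm t s]
      exact le_add_self
  have hhalf : ∫⁻ t, ∫⁻ s, G t s ≤ ENNReal.ofReal (6 * P ^ (5 / 3 : ℝ)) := by
    have hinner : ∀ t, ∫⁻ s, G t s ≤
        ENNReal.ofReal (6 * P ^ (2 / 3 : ℝ)) * ENNReal.ofReal (f t ^ (6 / 5 : ℝ)) := by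
      intro t
      rcases (hf0 t).eq_or_lt with h0 | h0
      · have : ∀ s, G t s = 0 := fun s => by
          simp only [hG, ← h0, mul_zero, zero_mul, ENNReal.ofReal_zero, ite_self]
        simp [this]
      have e : ∀ s, G t s = ENNReal.ofReal (f t) *
          (if f s ≤ f t then ENNReal.ofReal (f s * |s - t| ^ (-(1 / 3 : ℝ))) else 0) := fun s => by
        simp only [hG]
        split_ifs
        · rw [← ENNReal.ofReal_mul h0.le]; congr 1; ring
        · simp
      simp_rw [e]
      rw [lintegral_const_mul _ (Measurable.ite (measurableSet_le hf (by fun_prop)) (by fun_prop)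
        (by fun_prop))]
      refine (mul_le_mul_right (lintegral_fractional_inner hf hf0 hP hfP h0 t) _).trans (le_of_eq ?_)
      rw [← ENNReal.ofReal_mul h0.le, ← ENNReal.ofReal_mul (by positivity)]
      congr 1
      rw [show (6 / 5 : ℝ) = 1 + 1 / 5 by norm_num, Real.rpow_add h0, Real.rpow_one]
      ring
    calc _ ≤ ∫⁻ t, ENNReal.ofReal (6 * P ^ (2 / 3 : ℝ)) * ENNReal.ofReal (f t ^ (6 / 5 : ℝ)) :=
          lintegral_mono hinner
      _ = ENNReal.ofReal (6 * P ^ (2 / 3 : ℝ)) * ∫⁻ t, ENNReal.ofReal (f t ^ (6 / 5 : ℝ)) :=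
          lintegral_const_mul _ (by fun_prop)
      _ ≤ ENNReal.ofReal (6 * P ^ (2 / 3 : ℝ)) * ENNReal.ofReal P := by gcongr
      _ = _ := by
          rw [← ENNReal.ofReal_mul (by positivity), mul_assoc, ← Real.rpow_add_one hP.ne']
          norm_num
  calc _ ≤ ∫⁻ t, ∫⁻ s, (G t s + G s t) := lintegral_mono fun t => lintegral_mono fun s => hle t s
    _ = ∫⁻ t, ((∫⁻ s, G t s) + ∫⁻ s, G s t) := by
        refine lintegral_congr fun t => lintegral_add_left ?_ _
        exact hGm.of_uncurry_left
    _ = (∫⁻ t, ∫⁻ s, G t s) + ∫⁻ t, ∫⁻ s, G s t := lintegral_add_left hGm.lintegral_prod_right' _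
    _ = (∫⁻ t, ∫⁻ s, G t s) + ∫⁻ t, ∫⁻ s, G t s := by
        rw [lintegral_lintegral_swap (f := fun t s => G s t) (hGm.comp measurable_swap).aemeasurable]
    _ ≤ ENNReal.ofReal (6 * P ^ (5 / 3 : ℝ)) + ENNReal.ofReal (6 * P ^ (5 / 3 : ℝ)) :=
        add_le_add hhalf hhalf
    _ = _ := by
        rw [← ENNReal.ofReal_add (by positivity) (by positivity)]
        congr 1
        ring

/-! ### The Strichartz estimate by TT* -/

/-- The plane wave `exp(i(kx - τ ω(k)))` at `k = 2πξ`. -/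
noncomputable def wave (m x τ ξ : ℝ) : ℂ := osc (phase m x τ) (2 * Real.pi * ξ)

theorem norm_wave (m x τ ξ : ℝ) : ‖wave m x τ ξ‖ = 1 := norm_osc _ _

theorem continuous_wave {m : ℝ} (hm : 0 ≤ m) :
    Continuous fun p : ℝ × ℝ × ℝ => wave m p.1 p.2.1 p.2.2 := by
  have := continuous_om hm
  unfold wave osc phase
  fun_prop

theorem wave_mul_conj (m x τ y s ξ : ℝ) :
    wave m x τ ξ * (starRingEnd ℂ) (wave m y s ξ) = wave m (x - y) (τ - s) ξ := by
  rw [wave, wave, wave, conj_osc, osc, osc, osc, ← Complex.exp_add]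
  congr 1
  simp only [phase]
  push_cast
  ring

theorem integral_comp_two_pi (f : ℝ → ℂ) :
    ∫ ξ : ℝ, f (2 * Real.pi * ξ) = (((2 * Real.pi)⁻¹ : ℝ) : ℂ) * ∫ k, f k := by
  rw [Measure.integral_comp_mul_left, abs_of_pos (by positivity), Complex.real_smul]

theorem norm_integral_comp_two_pi_le {f : ℝ → ℂ} {B : ℝ} (hB : ‖∫ k, f k‖ ≤ B) :
    ‖∫ ξ : ℝ, f (2 * Real.pi * ξ)‖ ≤ B := by
  rw [integral_comp_two_pi, norm_mul, Complex.norm_real, Real.norm_of_nonneg (by positivity)]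
  have h1 : (2 * Real.pi)⁻¹ ≤ 1 := inv_le_one_of_one_le₀ (by linarith [Real.pi_gt_three])
  exact (mul_le_of_le_one_left (norm_nonneg _) h1).trans hB

theorem integrable_inv_one_add_sq_two_pi :
    Integrable fun ξ : ℝ => (1 + (2 * Real.pi * ξ) ^ 2)⁻¹ :=
  integrable_inv_one_add_sq.comp_mul_left' (by positivity)

/-- Strichartz estimate in `L⁶(0,T; L^∞)`, tested along a measurable choice of points. -/
theorem strichartz_aux {m : ℝ} (hm : 0 < m) (hm1 : m ≤ 1) {c : ℝ} (hc : c ≠ 0) {F : ℝ → ℂ}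
    (hF : Measurable F) {N : ℝ}
    (hFN : ∫⁻ ξ, ENNReal.ofReal (‖F ξ‖ ^ 2 * (1 + (2 * Real.pi * ξ) ^ 2)) ≤ ENNReal.ofReal (N ^ 2))
    (hF1 : Integrable F) {x : ℝ → ℝ} (hx : Measurable x) (T : ℝ) :
    ∫⁻ t in Ioo 0 T, ENNReal.ofReal (‖∫ ξ, F ξ * wave m (x t) (c * t) ξ‖ ^ 6) ≤
      ENNReal.ofReal (600000 ^ 3 * (m * |c|)⁻¹ * N ^ 6) := by
  have hwm : Continuous fun p : ℝ × ℝ × ℝ => wave m p.1 p.2.1 p.2.2 := continuous_wave hm.le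
  have hEm : Measurable fun p : ℝ × ℝ => wave m (x p.1) (c * p.1) p.2 :=
    hwm.measurable.comp (f := fun p : ℝ × ℝ => (x p.1, c * p.1, p.2)) (by fun_prop)
  set u : ℝ → ℂ := fun t => ∫ ξ, F ξ * wave m (x t) (c * t) ξ with hu
  have hum : Measurable u := by
    have h1 : Measurable fun p : ℝ × ℝ => F p.2 * wave m (x p.1) (c * p.1) p.2 :=
      (hF.comp measurable_snd).mul hEm
    exact h1.stronglyMeasurable.integral_prod_right'.measurable
  set D := ∫ ξ, ‖F ξ‖
  have hub : ∀ t, ‖u t‖ ≤ D := fun t => by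
    refine (norm_integral_le_integral_norm _).trans (le_of_eq ?_)
    simp only [norm_mul, norm_wave, mul_one, D]
  have hD : 0 ≤ D := (norm_nonneg _).trans (hub 0)
  set w : ℝ → ℂ := (Ioo 0 T).indicator u with hw
  have hwm' : Measurable w := hum.indicator measurableSet_Ioo
  have hwb : ∀ t, ‖w t‖ ≤ D := fun t => by
    rw [hw, norm_indicator_eq_indicator_norm]
    exact indicator_le_self' (fun _ _ => norm_nonneg _) t |>.trans (hub t)
  have hsupp : ∀ t, t ∉ Ioo 0 T → w t = 0 := fun t ht => indicator_of_notMem ht _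
  have hbi : ∀ {E : Type} [NormedAddCommGroup E] (f : ℝ → E), AEStronglyMeasurable f volume →
      ∀ B, (∀ t, ‖f t‖ ≤ B) → (∀ t, t ∉ Ioo 0 T → f t = 0) → Integrable f := by
    intro E _ f hf B hB hs
    have h1 : IntegrableOn f (Ioo 0 T) := by
      refine Integrable.mono' (integrable_const B) hf.restrict (Eventually.of_forall hB)
    exact h1.integrable_of_forall_notMem_eq_zero hs
  -- The extremal dual function for `L⁶`: `h w = |w|⁶`, and `|h|^{6/5} = |w|⁶`.
  set h : ℝ → ℂ := fun t => (‖w t‖ : ℂ) ^ 4 * (starRingEnd ℂ) (w t) with hh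
  have hhm : Measurable h := by
    have h1 : Measurable fun t => (starRingEnd ℂ) (w t) :=
      Complex.continuous_conj.measurable.comp hwm'
    have h2 : Measurable fun t => (‖w t‖ : ℂ) := Complex.measurable_ofReal.comp hwm'.norm
    exact (h2.pow_const 4).mul h1
  have hhn : ∀ t, ‖h t‖ = ‖w t‖ ^ 5 := fun t => by
    simp only [hh, norm_mul, norm_pow, Complex.norm_real, norm_norm, RCLike.norm_conj]
    ring
  have hhi : Integrable h := by
    refine hbi h hhm.aestronglyMeasurable (D ^ 5) (fun t => ?_) fun t ht => ?_
    · rw [hhn]; exact pow_le_pow_left₀ (norm_nonneg _) (hwb t) 5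
    · simp [hh, hsupp t ht]
  have hJi : Integrable fun t => ‖w t‖ ^ 6 := by
    refine hbi _ (hwm'.norm.pow_const 6).aestronglyMeasurable (D ^ 6) (fun t => ?_) fun t ht => ?_
    · rw [norm_pow, norm_norm]; exact pow_le_pow_left₀ (norm_nonneg _) (hwb t) 6
    · simp [hsupp t ht]
  set J := ∫ t, ‖w t‖ ^ 6 with hJ
  have hJ0 : 0 ≤ J := integral_nonneg fun t => by positivity
  have hgoal : ∫⁻ t in Ioo 0 T, ENNReal.ofReal (‖u t‖ ^ 6) = ENNReal.ofReal J := by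
    rw [hJ, ofReal_integral_eq_lintegral_ofReal hJi (Eventually.of_forall fun t => by positivity),
      ← lintegral_indicator measurableSet_Ioo]
    refine lintegral_congr fun t => ?_
    by_cases ht : t ∈ Ioo 0 T
    · simp [hw, ht]
    · simp [hw, ht]
  rw [hgoal]
  -- The positive case is needed because the final inequality is divided by `J^{5/3}`.
  rcases hJ0.eq_or_lt with hJz | hJpos
  · rw [← hJz, ENNReal.ofReal_zero]; exact zero_le
  set H : ℝ → ℂ := fun ξ => ∫ t, h t * wave m (x t) (c * t) ξ with hH
  have hHm : Measurable H := by
    have h1 : Measurable fun p : ℝ × ℝ => h p.2 * wave m (x p.2) (c * p.2) p.1 :=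
      (hhm.comp measurable_snd).mul (hEm.comp measurable_swap)
    exact h1.stronglyMeasurable.integral_prod_right'.measurable
  set D2 := ∫ t, ‖h t‖
  have hHb : ∀ ξ, ‖H ξ‖ ≤ D2 := fun ξ => by
    refine (norm_integral_le_integral_norm _).trans (le_of_eq ?_)
    simp only [norm_mul, norm_wave, mul_one, D2]
  -- the duality identity
  have hdual : (J : ℂ) = ∫ ξ, F ξ * H ξ := by
    have h1 : (J : ℂ) = ∫ t, ∫ ξ, h t * (F ξ * wave m (x t) (c * t) ξ) := by
      rw [hJ, ← integral_complex_ofReal]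
      refine integral_congr_ae (Eventually.of_forall fun t => ?_)
      simp only
      rw [integral_const_mul]
      by_cases ht : t ∈ Ioo 0 T
      · have : w t = u t := indicator_of_mem ht _
        change _ = h t * u t
        rw [hh, ← this]
        simp only
        rw [mul_assoc, ← Complex.normSq_eq_conj_mul_self, Complex.normSq_eq_norm_sq]
        push_cast
        ring
      · simp [hh, hsupp t ht]
    rw [h1, integral_integral_swap]
    · refine integral_congr_ae (Eventually.of_forall fun ξ => ?_)
      simp only [hH]
      rw [← integral_const_mul]
      refine integral_congr_ae (Eventually.of_forall fun t => ?_)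
      simp only
      ring
    · refine (hhi.mul_prod hF1).norm.mono' ?_ (Eventually.of_forall fun p => ?_)
      · exact ((hhm.comp measurable_fst).mul
          ((hF.comp measurable_snd).mul hEm)).aestronglyMeasurable
      · simp [Function.uncurry, norm_wave]
  -- Cauchy–Schwarz
  have hK := integrable_inv_one_add_sq_two_pi
  set A2 := ∫ ξ, ‖H ξ‖ ^ 2 * (1 + (2 * Real.pi * ξ) ^ 2)⁻¹ with hA2
  have hHi : Integrable fun ξ => ‖H ξ‖ ^ 2 * (1 + (2 * Real.pi * ξ) ^ 2)⁻¹ := by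
    refine (hK.const_mul (D2 ^ 2)).mono' (by fun_prop) (Eventually.of_forall fun ξ => ?_)
    rw [Real.norm_of_nonneg (by positivity)]
    have := hHb ξ
    gcongr
  have hFi : Integrable fun ξ => ‖F ξ‖ ^ 2 * (1 + (2 * Real.pi * ξ) ^ 2) := by
    refine ⟨by fun_prop, ?_⟩
    rw [hasFiniteIntegral_iff_ofReal (Eventually.of_forall fun ξ => by positivity)]
    exact hFN.trans_lt ENNReal.ofReal_lt_top
  have hFr : ∫ ξ, ‖F ξ‖ ^ 2 * (1 + (2 * Real.pi * ξ) ^ 2) ≤ N ^ 2 := by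
    rw [← ENNReal.ofReal_le_ofReal_iff (by positivity),
      ofReal_integral_eq_lintegral_ofReal hFi (Eventually.of_forall fun ξ => by positivity)]
    exact hFN
  have hA20 : 0 ≤ A2 := integral_nonneg fun ξ => by positivity
  have hCS : J ^ 2 ≤ N ^ 2 * A2 := by
    have h1 : J ≤ ∫ ξ, (‖F ξ‖ * √(1 + (2 * Real.pi * ξ) ^ 2)) *
        (‖H ξ‖ * √((1 + (2 * Real.pi * ξ) ^ 2)⁻¹)) := by
      calc J = ‖(J : ℂ)‖ := by rw [Complex.norm_real, Real.norm_of_nonneg hJ0]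
        _ ≤ ∫ ξ, ‖F ξ * H ξ‖ := by rw [hdual]; exact norm_integral_le_integral_norm _
        _ = _ := by
          refine integral_congr_ae (Eventually.of_forall fun ξ => ?_)
          have h0 : 0 < √(1 + (2 * Real.pi * ξ) ^ 2) := Real.sqrt_pos.2 (by positivity)
          simp only [norm_mul, Real.sqrt_inv]
          field_simp
    have h2 := integral_mul_le_Lp_mul_Lq_of_nonneg (μ := volume) Real.HolderConjugate.two_two
      (f := fun ξ => ‖F ξ‖ * √(1 + (2 * Real.pi * ξ) ^ 2))
      (g := fun ξ => ‖H ξ‖ * √((1 + (2 * Real.pi * ξ) ^ 2)⁻¹))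
      (Eventually.of_forall fun ξ => by positivity) (Eventually.of_forall fun ξ => by positivity)
      (by
        rw [show ENNReal.ofReal 2 = 2 by simp]
        refine (memLp_two_iff_integrable_sq (by fun_prop)).2 (hFi.congr (Eventually.of_forall fun ξ => ?_))
        simp only [mul_pow]
        rw [Real.sq_sqrt (by positivity)])
      (by
        rw [show ENNReal.ofReal 2 = 2 by simp]
        refine (memLp_two_iff_integrable_sq (by fun_prop)).2 (hHi.congr (Eventually.of_forall fun ξ => ?_))
        simp only [mul_pow]
        rw [Real.sq_sqrt (by positivity)])
    have e1 : ∀ ξ, (‖F ξ‖ * √(1 + (2 * Real.pi * ξ) ^ 2)) ^ (2 : ℝ) =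
        ‖F ξ‖ ^ 2 * (1 + (2 * Real.pi * ξ) ^ 2) := fun ξ => by
      rw [Real.rpow_two, mul_pow, Real.sq_sqrt (by positivity)]
    have e2 : ∀ ξ, (‖H ξ‖ * √((1 + (2 * Real.pi * ξ) ^ 2)⁻¹)) ^ (2 : ℝ) =
        ‖H ξ‖ ^ 2 * (1 + (2 * Real.pi * ξ) ^ 2)⁻¹ := fun ξ => by
      rw [Real.rpow_two, mul_pow, Real.sq_sqrt (by positivity)]
    simp only [e1, e2, ← Real.sqrt_eq_rpow] at h2
    have h3 := h1.trans h2
    calc J ^ 2 ≤ (√(∫ ξ, ‖F ξ‖ ^ 2 * (1 + (2 * Real.pi * ξ) ^ 2)) * √A2) ^ 2 := by gcongr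
      _ = (∫ ξ, ‖F ξ‖ ^ 2 * (1 + (2 * Real.pi * ξ) ^ 2)) * A2 := by
          rw [mul_pow, Real.sq_sqrt (integral_nonneg fun ξ => by positivity), Real.sq_sqrt hA20]
      _ ≤ _ := by gcongr
  -- the `TT*` kernel
  have hmc : 0 < m * |c| := mul_pos hm (abs_pos.2 hc)
  set K : ℝ × ℝ → ℂ := fun z => ∫ ξ, (((1 + (2 * Real.pi * ξ) ^ 2)⁻¹ : ℝ) : ℂ) *
    wave m (x z.1 - x z.2) (c * z.1 - c * z.2) ξ with hKd
  have hKb : ∀ z : ℝ × ℝ, z.1 ≠ z.2 →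
      ‖K z‖ ≤ 50000 * ((m * |c|) ^ (-(1 / 3 : ℝ)) * |z.1 - z.2| ^ (-(1 / 3 : ℝ))) := by
    intro z hz
    have h1 : c * z.1 - c * z.2 ≠ 0 := by
      rw [← mul_sub]; exact mul_ne_zero hc (sub_ne_zero.2 hz)
    have h2 := norm_integral_comp_two_pi_le (kernel_inv_one_add_sq hm hm1 (x z.1 - x z.2) h1)
    refine h2.trans (le_of_eq ?_)
    rw [← mul_sub, abs_mul, ← mul_assoc m, Real.mul_rpow hmc.le (abs_nonneg _)]
  have hA2eq : (A2 : ℂ) = ∫ z : ℝ × ℝ, h z.1 * (starRingEnd ℂ) (h z.2) * K z := by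
    have h1 : (A2 : ℂ) = ∫ ξ, ∫ z : ℝ × ℝ, (((1 + (2 * Real.pi * ξ) ^ 2)⁻¹ : ℝ) : ℂ) *
        ((h z.1 * wave m (x z.1) (c * z.1) ξ) *
          (starRingEnd ℂ) (h z.2 * wave m (x z.2) (c * z.2) ξ)) := by
      rw [hA2, ← integral_complex_ofReal]
      refine integral_congr_ae (Eventually.of_forall fun ξ => ?_)
      simp only
      rw [integral_const_mul, Measure.volume_eq_prod, integral_prod_mul
        (fun t => h t * wave m (x t) (c * t) ξ)
        (fun t => (starRingEnd ℂ) (h t * wave m (x t) (c * t) ξ)), integral_conj]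
      change _ = _ * (H ξ * (starRingEnd ℂ) (H ξ))
      rw [Complex.mul_conj, Complex.normSq_eq_norm_sq]
      push_cast
      ring
    rw [h1, integral_integral_swap]
    · refine integral_congr_ae (Eventually.of_forall fun z => ?_)
      simp only [hKd]
      rw [← integral_const_mul]
      refine integral_congr_ae (Eventually.of_forall fun ξ => ?_)
      simp only [map_mul]
      rw [← wave_mul_conj]
      ring
    · have hi2 : Integrable (fun z : ℝ × ℝ => ‖h z.1‖ * ‖h z.2‖) := hhi.norm.mul_prod hhi.norm
      refine (hK.mul_prod hi2).mono' ?_ (Eventually.of_forall fun p => ?_)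
      · have c1 : Measurable fun p : ℝ × ℝ × ℝ => wave m (x p.2.1) (c * p.2.1) p.1 :=
          hEm.comp (f := fun p : ℝ × ℝ × ℝ => (p.2.1, p.1)) (by fun_prop)
        have c2 : Measurable fun p : ℝ × ℝ × ℝ => wave m (x p.2.2) (c * p.2.2) p.1 :=
          hEm.comp (f := fun p : ℝ × ℝ × ℝ => (p.2.2, p.1)) (by fun_prop)
        have c3 : Measurable fun p : ℝ × ℝ × ℝ =>
            (starRingEnd ℂ) (h p.2.2 * wave m (x p.2.2) (c * p.2.2) p.1) :=
          Complex.continuous_conj.measurable.comp ((hhm.comp (by fun_prop)).mul c2)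
        have c4 : Measurable fun p : ℝ × ℝ × ℝ => (((1 + (2 * Real.pi * p.1) ^ 2)⁻¹ : ℝ) : ℂ) := by
          fun_prop
        exact (c4.mul (((hhm.comp (by fun_prop)).mul c1).mul c3)).aestronglyMeasurable
      · simp only [Function.uncurry, norm_mul, norm_wave, RCLike.norm_conj, Complex.norm_real,
          mul_one, norm_inv, Real.norm_eq_abs]
        rw [abs_of_nonneg (by positivity)]
  -- Hardy–Littlewood–Sobolev for `|w|⁵`, whose power `6/5` integrates to `J`. The constant is
  -- `50000·12`.
  have hA2le : A2 ≤ 600000 * (m * |c|) ^ (-(1 / 3 : ℝ)) * J ^ (5 / 3 : ℝ) := by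
    rw [← ENNReal.ofReal_le_ofReal_iff (by positivity)]
    have hB0 : 0 ≤ 50000 * (m * |c|) ^ (-(1 / 3 : ℝ)) := by positivity
    have hHLS := lintegral_fractional_le (f := fun t => ‖w t‖ ^ 5) (hwm'.norm.pow_const 5)
      (fun t => by positivity) hJpos (by
        rw [hJ, ofReal_integral_eq_lintegral_ofReal hJi (Eventually.of_forall fun t => by positivity)]
        refine lintegral_mono fun t => le_of_eq ?_
        rw [← Real.rpow_natCast, ← Real.rpow_natCast, ← Real.rpow_mul (norm_nonneg _)]
        norm_num)
    have hdiag : ∀ᵐ z : ℝ × ℝ, z.1 ≠ z.2 := by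
      have hms : MeasurableSet {z : ℝ × ℝ | z.1 ≠ z.2} :=
        (measurableSet_eq_fun measurable_fst measurable_snd).compl
      rw [Measure.volume_eq_prod, Measure.ae_prod_iff_ae_ae hms]
      exact Eventually.of_forall fun a => by
        simp only [ae_iff, not_not]
        have : {b : ℝ | a = b} = {a} := by ext; simp [eq_comm]
        simp [this]
    calc ENNReal.ofReal A2 = ‖(A2 : ℂ)‖ₑ := by
          rw [← ofReal_norm, Complex.norm_real, Real.norm_of_nonneg hA20]
      _ ≤ ∫⁻ z : ℝ × ℝ, ‖h z.1 * (starRingEnd ℂ) (h z.2) * K z‖ₑ := by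
          rw [hA2eq]; exact enorm_integral_le_lintegral_enorm _
      _ ≤ ∫⁻ z : ℝ × ℝ, ENNReal.ofReal (50000 * (m * |c|) ^ (-(1 / 3 : ℝ))) *
            ENNReal.ofReal (‖w z.2‖ ^ 5 * ‖w z.1‖ ^ 5 * |z.2 - z.1| ^ (-(1 / 3 : ℝ))) := by
          refine lintegral_mono_ae (hdiag.mono fun z hz => ?_)
          rw [← ENNReal.ofReal_mul hB0, ← ofReal_norm]
          apply ENNReal.ofReal_le_ofReal
          rw [norm_mul, norm_mul, RCLike.norm_conj, hhn, hhn, abs_sub_comm]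
          calc _ ≤ ‖w z.1‖ ^ 5 * ‖w z.2‖ ^ 5 *
                (50000 * ((m * |c|) ^ (-(1 / 3 : ℝ)) * |z.1 - z.2| ^ (-(1 / 3 : ℝ)))) := by
                gcongr; exact hKb z hz
            _ = _ := by ring
      _ = ENNReal.ofReal (50000 * (m * |c|) ^ (-(1 / 3 : ℝ))) *
            ∫⁻ t, ∫⁻ s, ENNReal.ofReal (‖w s‖ ^ 5 * ‖w t‖ ^ 5 * |s - t| ^ (-(1 / 3 : ℝ))) := by
          rw [lintegral_const_mul _ (by fun_prop), Measure.volume_eq_prod, lintegral_prod _ (by fun_prop)]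
      _ ≤ ENNReal.ofReal (50000 * (m * |c|) ^ (-(1 / 3 : ℝ))) *
            ENNReal.ofReal (12 * J ^ (5 / 3 : ℝ)) := by gcongr
      _ = _ := by
          rw [← ENNReal.ofReal_mul hB0]
          congr 1
          ring
  apply ENNReal.ofReal_le_ofReal
  have h3 : J ^ 2 ≤ N ^ 2 * (600000 * (m * |c|) ^ (-(1 / 3 : ℝ)) * J ^ (5 / 3 : ℝ)) :=
    hCS.trans (by gcongr)
  -- Absorbing `J^{5/3}` leaves the power `1/3`; cubing turns `(m|c|)^{-1/3}` into the factor
  -- `(m|c|)⁻¹`.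
  have h4 : J ^ (1 / 3 : ℝ) ≤ N ^ 2 * (600000 * (m * |c|) ^ (-(1 / 3 : ℝ))) := by
    have e : J ^ 2 = J ^ (1 / 3 : ℝ) * J ^ (5 / 3 : ℝ) := by
      rw [← Real.rpow_add hJpos, ← Real.rpow_natCast]; norm_num
    rw [e, ← mul_assoc] at h3
    exact le_of_mul_le_mul_right h3 (by positivity)
  calc J = (J ^ (1 / 3 : ℝ)) ^ 3 := by
        rw [← Real.rpow_natCast, ← Real.rpow_mul hJ0]; norm_num
    _ ≤ (N ^ 2 * (600000 * (m * |c|) ^ (-(1 / 3 : ℝ)))) ^ 3 := by gcongr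
    _ = 600000 ^ 3 * ((m * |c|) ^ (-(1 / 3 : ℝ))) ^ 3 * N ^ 6 := by ring
    _ = _ := by
        congr 2
        rw [← Real.rpow_natCast, ← Real.rpow_mul hmc.le]
        norm_num [Real.rpow_neg_one]

/-- Measurable selection of a maximizing index among finitely many. It linearizes the supremum over
`x`, so that `strichartz_aux` applies along the selected points. -/
theorem exists_measurable_argmax {v : ℕ → ℝ → ℝ} (hv : ∀ n, Measurable (v n)) (n : ℕ) :
    ∃ i : ℝ → ℕ, Measurable i ∧ ∀ t, ∀ k ≤ n, v k t ≤ v (i t) t := by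
  have hvi : ∀ i : ℝ → ℕ, Measurable i → Measurable fun t => v (i t) t := fun i hi =>
    (measurable_from_prod_countable_right (f := fun p : ℕ × ℝ => v p.1 p.2) hv).comp
      (hi.prodMk measurable_id)
  induction n with
  | zero => exact ⟨fun _ => 0, measurable_const, fun t k hk => by rw [Nat.le_zero.1 hk]⟩
  | succ n ih =>
    obtain ⟨i, hi, him⟩ := ih
    refine ⟨fun t => if v (n + 1) t ≤ v (i t) t then i t else n + 1,
      Measurable.ite (measurableSet_le (hv _) (hvi i hi)) hi measurable_const, fun t k hk => ?_⟩
    dsimp only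
    split_ifs with h
    · rcases Nat.le_succ_iff.1 hk with h1 | h1
      · exact him t k h1
      · rw [h1]; exact h
    · rcases Nat.le_succ_iff.1 hk with h1 | h1
      · exact (him t k h1).trans (not_le.1 h).le
      · rw [h1]

theorem continuous_integral_wave {m : ℝ} (hm : 0 ≤ m) {F : ℝ → ℂ} (hF : Integrable F) :
    Continuous fun p : ℝ × ℝ => ∫ ξ, F ξ * wave m p.1 p.2 ξ := by
  have hw := continuous_wave hm
  refine continuous_of_dominated (bound := fun ξ => ‖F ξ‖) (fun p => ?_) (fun p => ?_) hF.norm ?_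
  · refine hF.aestronglyMeasurable.mul (Continuous.aestronglyMeasurable ?_)
    exact hw.comp (f := fun ξ : ℝ => (p.1, p.2, ξ)) (by fun_prop)
  · exact Eventually.of_forall fun ξ => by simp [norm_wave]
  · refine Eventually.of_forall fun ξ => continuous_const.mul ?_
    exact hw.comp (f := fun p : ℝ × ℝ => (p.1, p.2, ξ)) (by fun_prop)

/-- Strichartz estimate in `L⁶(0,T; L^∞)`. -/
theorem strichartz {m : ℝ} (hm : 0 < m) (hm1 : m ≤ 1) {c : ℝ} (hc : c ≠ 0) {F : ℝ → ℂ} {N : ℝ}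
    (hFN : ∫⁻ ξ, ENNReal.ofReal (‖F ξ‖ ^ 2 * (1 + (2 * Real.pi * ξ) ^ 2)) ≤ ENNReal.ofReal (N ^ 2))
    (hF1 : Integrable F) (T : ℝ) :
    ∃ S : ℝ → ℝ≥0∞, Measurable S ∧ (∀ t x, ‖∫ ξ, F ξ * wave m x (c * t) ξ‖ₑ ≤ S t) ∧
      ∫⁻ t in Ioo 0 T, S t ^ 6 ≤ ENNReal.ofReal (600000 ^ 3 * (m * |c|)⁻¹ * N ^ 6) := by
  wlog hF : Measurable F generalizing F
  · have hae : F =ᵐ[volume] hF1.aestronglyMeasurable.mk F := hF1.aestronglyMeasurable.ae_eq_mk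
    have e : ∀ t x, ∫ ξ, F ξ * wave m x (c * t) ξ =
        ∫ ξ, hF1.aestronglyMeasurable.mk F ξ * wave m x (c * t) ξ := fun t x =>
      integral_congr_ae (hae.mono fun ξ h => by dsimp only; rw [h])
    simp only [e]
    refine this ?_ (hF1.congr hae) hF1.aestronglyMeasurable.stronglyMeasurable_mk.measurable
    have e2 : ∫⁻ ξ, ENNReal.ofReal (‖F ξ‖ ^ 2 * (1 + (2 * Real.pi * ξ) ^ 2)) =
        ∫⁻ ξ, ENNReal.ofReal (‖hF1.aestronglyMeasurable.mk F ξ‖ ^ 2 * (1 + (2 * Real.pi * ξ) ^ 2)) :=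
      lintegral_congr_ae (hae.mono fun ξ h => by dsimp only; rw [h])
    rwa [← e2]
  set u : ℝ → ℝ → ℂ := fun t x => ∫ ξ, F ξ * wave m x (c * t) ξ with hu
  have huc : Continuous fun p : ℝ × ℝ => u p.1 p.2 :=
    (continuous_integral_wave hm.le hF1).comp (f := fun p : ℝ × ℝ => (p.2, c * p.1)) (by fun_prop)
  -- Finite maxima over the points of a dense sequence are covered by `strichartz_aux`. Monotone
  -- convergence gives the supremum over the sequence, and continuity in `x` gives it over the whole
  -- line.
  set y : ℕ → ℝ := TopologicalSpace.denseSeq ℝ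
  have hym : ∀ n, Measurable fun t => ‖u t (y n)‖ := fun n =>
    (huc.comp (f := fun t => (t, y n)) (by fun_prop)).norm.measurable
  set f : ℕ → ℝ → ℝ≥0∞ := fun n t => ENNReal.ofReal (‖u t (y n)‖ ^ 6) with hf
  have hfm : ∀ n, Measurable (f n) := fun n => ((hym n).pow_const 6).ennreal_ofReal
  have hfin : ∀ n, ∫⁻ t in Ioo 0 T, (Finset.range (n + 1)).sup (fun k => f k t) ≤
      ENNReal.ofReal (600000 ^ 3 * (m * |c|)⁻¹ * N ^ 6) := by
    intro n
    obtain ⟨i, hi, him⟩ := exists_measurable_argmax hym n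
    refine le_trans (lintegral_mono fun t => ?_) (strichartz_aux hm hm1 hc hF hFN hF1
      (x := fun t => y (i t)) ((measurable_of_countable y).comp hi) T)
    refine Finset.sup_le fun k hk => ENNReal.ofReal_le_ofReal ?_
    exact pow_le_pow_left₀ (norm_nonneg _) (him t k (Nat.lt_succ_iff.1 (Finset.mem_range.1 hk))) 6
  have hS0 : Measurable fun t => ⨆ n, f n t := Measurable.iSup hfm
  refine ⟨fun t => (⨆ n, f n t) ^ (1 / 6 : ℝ), hS0.pow_const _, fun t => ?_, ?_⟩
  · have hk : ∀ k, ‖u t (y k)‖ₑ ≤ (⨆ n, f n t) ^ (1 / 6 : ℝ) := fun k => by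
      have h1 : f k t ≤ ⨆ n, f n t := le_iSup (fun n => f n t) k
      calc ‖u t (y k)‖ₑ = (f k t) ^ (1 / 6 : ℝ) := by
            simp only [hf]
            rw [ENNReal.ofReal_pow (norm_nonneg _), ofReal_norm, ← ENNReal.rpow_natCast,
              ← ENNReal.rpow_mul]
            norm_num
        _ ≤ _ := by gcongr
    have hclosed : IsClosed {x | ‖u t x‖ₑ ≤ (⨆ n, f n t) ^ (1 / 6 : ℝ)} :=
      isClosed_le (huc.comp (f := fun x => (t, x)) (by fun_prop)).enorm continuous_const
    have : closure (range y) ⊆ {x | ‖u t x‖ₑ ≤ (⨆ n, f n t) ^ (1 / 6 : ℝ)} :=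
      hclosed.closure_subset_iff.2 (by rintro _ ⟨k, rfl⟩; exact hk k)
    rw [(TopologicalSpace.denseRange_denseSeq ℝ).closure_range] at this
    exact fun x => this (mem_univ x)
  · have e1 : ∀ t, ((⨆ n, f n t) ^ (1 / 6 : ℝ)) ^ 6 =
        ⨆ n, (Finset.range (n + 1)).sup (fun k => f k t) := fun t => by
      rw [← ENNReal.rpow_natCast, ← ENNReal.rpow_mul]
      norm_num
      refine le_antisymm (iSup_le fun n => ?_) (iSup_le fun n => Finset.sup_le fun k _ => ?_)
      · refine le_trans ?_ (le_iSup _ n)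
        exact Finset.le_sup (f := fun k => f k t) (Finset.self_mem_range_succ n)
      · exact le_iSup (fun n => f n t) k
    simp_rw [e1]
    rw [lintegral_iSup]
    · exact iSup_le hfin
    · intro n
      simp only [Finset.sup_eq_iSup]
      exact Measurable.iSup fun k => Measurable.iSup fun _ => hfm k
    · intro a b hab t
      exact Finset.sup_mono (Finset.range_mono (by omega))

/-! ### Kato smoothing -/

/-- The Fourier transform of a wide Gaussian. -/
noncomputable def gaussHat (T z : ℝ) : ℝ := √(Real.pi * T ^ 2) * Real.exp (-(T ^ 2 / 4) * z ^ 2)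

theorem gaussHat_nonneg (T z : ℝ) : 0 ≤ gaussHat T z := by unfold gaussHat; positivity

theorem norm_integral_gaussian_mul {T : ℝ} (hT : 0 < T) (z : ℝ) :
    ‖∫ t : ℝ, Complex.exp (Complex.I * z * t) * ((Real.exp (-(1 / T ^ 2) * t ^ 2) : ℝ) : ℂ)‖ =
      gaussHat T z := by
  have hb : 0 < (((1 / T ^ 2 : ℝ) : ℂ)).re := by
    rw [Complex.ofReal_re]; positivity
  have h := fourierIntegral_gaussian hb (z : ℂ)
  have e : ∀ t : ℝ, ((Real.exp (-(1 / T ^ 2) * t ^ 2) : ℝ) : ℂ) =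
      Complex.exp (-((1 / T ^ 2 : ℝ) : ℂ) * (t : ℂ) ^ 2) := fun t => by push_cast; rfl
  simp_rw [e]
  rw [h, norm_mul, gaussHat]
  congr 1
  · rw [← Complex.ofReal_div, Complex.norm_cpow_eq_rpow_re_of_pos (by positivity), Real.sqrt_eq_rpow]
    congr 1
    · field_simp
    · norm_num
  · rw [Complex.norm_exp]
    congr 1
    have : (-(z : ℂ) ^ 2 / (4 * ((1 / T ^ 2 : ℝ) : ℂ))) =
        ((-(z : ℝ) ^ 2 / (4 * (1 / T ^ 2)) : ℝ) : ℂ) := by push_cast; rfl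
    rw [this, Complex.ofReal_re]
    field_simp

theorem lintegral_gaussHat {T c : ℝ} (hT : 0 < T) (hc : c ≠ 0) (z : ℝ) :
    ∫⁻ y, ENNReal.ofReal (gaussHat T (c * (z - y))) = ENNReal.ofReal (2 * Real.pi / |c|) := by
  have h1 : ∀ f : ℝ → ℝ≥0∞, ∫⁻ y, f (z - y) = ∫⁻ y, f y := fun f =>
    lintegral_sub_left_eq_self f z
  rw [h1 (fun y => ENNReal.ofReal (gaussHat T (c * y)))]
  have e : ∀ y, gaussHat T (c * y) =
      √(Real.pi * T ^ 2) * Real.exp (-(T ^ 2 / 4 * c ^ 2) * y ^ 2) := fun y => by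
    rw [gaussHat]; congr 2; ring
  simp_rw [e]
  have hb : 0 < T ^ 2 / 4 * c ^ 2 := by positivity
  rw [← ofReal_integral_eq_lintegral_ofReal ((integrable_exp_neg_mul_sq hb).const_mul _)
    (Eventually.of_forall fun y => by positivity), integral_const_mul, integral_gaussian]
  congr 1
  rw [← Real.sqrt_mul (by positivity)]
  have : Real.pi * T ^ 2 * (Real.pi / (T ^ 2 / 4 * c ^ 2)) = (2 * Real.pi / |c|) ^ 2 := by
    rw [div_pow, sq_abs]
    field_simp
    ring
  rw [this, Real.sqrt_sq (by positivity)]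

/-- The weight `λ³` is, up to `2π`, the Jacobian of the injective map `ξ ↦ ω(2πξ)`, so the integral
is at most the total mass of the Gaussian, which is independent of `T`. -/
theorem lintegral_group_velocity {m T c : ℝ} (hm : 0 ≤ m) (hT : 0 < T) (hc : c ≠ 0) (z : ℝ) :
    ∫⁻ ξ, ENNReal.ofReal (lam m (2 * Real.pi * ξ) ^ 3 *
      gaussHat T (c * (z - om m (2 * Real.pi * ξ)))) ≤ ENNReal.ofReal (1 / |c|) := by
  have hpi : 0 < 2 * Real.pi := by positivity
  have hd : ∀ ξ : ℝ, HasDerivAt (fun ξ => om m (2 * Real.pi * ξ))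
      (2 * Real.pi * lam m (2 * Real.pi * ξ) ^ 3) ξ := fun ξ => by
    have h1 : HasDerivAt (fun ξ : ℝ => 2 * Real.pi * ξ) (2 * Real.pi) ξ := by
      simpa using (hasDerivAt_id ξ).const_mul (2 * Real.pi)
    refine ((hasDerivAt_om hm _).comp ξ h1).congr_deriv (by ring)
  have hpos : ∀ ξ : ℝ, 0 < 2 * Real.pi * lam m (2 * Real.pi * ξ) ^ 3 := fun ξ => by
    have := lam_pos hm (2 * Real.pi * ξ)
    positivity
  have hinj : Function.Injective (fun ξ => om m (2 * Real.pi * ξ)) :=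
    (strictMono_of_deriv_pos fun ξ => by rw [(hd ξ).deriv]; exact hpos ξ).injective
  have key := lintegral_image_eq_lintegral_abs_deriv_mul MeasurableSet.univ
    (fun ξ _ => (hd ξ).hasDerivWithinAt) hinj.injOn
    (fun y => ENNReal.ofReal (gaussHat T (c * (z - y))))
  rw [setLIntegral_univ] at key
  have e : ∫⁻ ξ, ENNReal.ofReal (lam m (2 * Real.pi * ξ) ^ 3 *
      gaussHat T (c * (z - om m (2 * Real.pi * ξ)))) = ENNReal.ofReal (1 / (2 * Real.pi)) *
      ∫⁻ ξ, ENNReal.ofReal |2 * Real.pi * lam m (2 * Real.pi * ξ) ^ 3| *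
        ENNReal.ofReal (gaussHat T (c * (z - om m (2 * Real.pi * ξ)))) := by
    rw [← lintegral_const_mul' _ _ ENNReal.ofReal_ne_top]
    refine lintegral_congr fun ξ => ?_
    rw [← ENNReal.ofReal_mul (abs_nonneg _), ← ENNReal.ofReal_mul (by positivity),
      abs_of_pos (hpos ξ)]
    congr 1
    field_simp
  rw [e, ← key]
  calc _ ≤ ENNReal.ofReal (1 / (2 * Real.pi)) *
        ∫⁻ y, ENNReal.ofReal (gaussHat T (c * (z - y))) := by
        gcongr
        exact Measure.restrict_le_self
    _ = _ := by
        rw [lintegral_gaussHat hT hc, ← ENNReal.ofReal_mul (by positivity)]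
        congr 1
        field_simp

theorem lintegral_symm_average {A : ℝ → ℝ → ℝ≥0∞} (hA : Measurable (Function.uncurry A)) :
    ∫⁻ z : ℝ × ℝ, (2⁻¹ * A z.1 z.2 + 2⁻¹ * A z.2 z.1) = ∫⁻ ξ, ∫⁻ η, A ξ η := by
  have e1 : ∫⁻ z : ℝ × ℝ, A z.2 z.1 = ∫⁻ z : ℝ × ℝ, A z.1 z.2 := by
    rw [Measure.volume_eq_prod]
    exact lintegral_prod_swap (fun z : ℝ × ℝ => A z.1 z.2)
  have m1 : Measurable fun z : ℝ × ℝ => A z.1 z.2 := hA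
  have m2 : Measurable fun z : ℝ × ℝ => A z.2 z.1 := hA.comp measurable_swap
  rw [lintegral_add_left (m1.const_mul _), lintegral_const_mul _ m1,
    lintegral_const_mul _ m2, e1, ← add_mul, ENNReal.inv_two_add_inv_two, one_mul,
    Measure.volume_eq_prod, lintegral_prod _ m1.aemeasurable]

/-- Kato smoothing: the time-`L²` norm at a fixed point gains the inverse group velocity. -/
theorem local_smoothing {m : ℝ} (hm : 0 ≤ m) {c : ℝ} (hc : c ≠ 0) {F : ℝ → ℂ} {N : ℝ}
    (hFN : ∫⁻ ξ, ENNReal.ofReal (‖F ξ‖ ^ 2 / lam m (2 * Real.pi * ξ) ^ 3) ≤ ENNReal.ofReal N)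
    (hF1 : Integrable F) {T : ℝ} (hT : 0 < T) (x : ℝ) :
    ∫⁻ t in Ioo 0 T, ENNReal.ofReal (‖∫ ξ, F ξ * wave m x (c * t) ξ‖ ^ 2) ≤
      ENNReal.ofReal (3 * |c|⁻¹ * N) := by
  wlog hF : Measurable F generalizing F
  · have hae : F =ᵐ[volume] hF1.aestronglyMeasurable.mk F := hF1.aestronglyMeasurable.ae_eq_mk
    have e : ∀ t x, ∫ ξ, F ξ * wave m x (c * t) ξ =
        ∫ ξ, hF1.aestronglyMeasurable.mk F ξ * wave m x (c * t) ξ := fun t x =>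
      integral_congr_ae (hae.mono fun ξ h => by dsimp only; rw [h])
    simp only [e]
    refine this ?_ (hF1.congr hae) hF1.aestronglyMeasurable.stronglyMeasurable_mk.measurable
    have e2 : ∫⁻ ξ, ENNReal.ofReal (‖F ξ‖ ^ 2 / lam m (2 * Real.pi * ξ) ^ 3) =
        ∫⁻ ξ, ENNReal.ofReal (‖hF1.aestronglyMeasurable.mk F ξ‖ ^ 2 / lam m (2 * Real.pi * ξ) ^ 3) :=
      lintegral_congr_ae (hae.mono fun ξ h => by dsimp only; rw [h])
    rwa [← e2]
  have hw := continuous_wave hm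
  have hlc := continuous_lam hm
  have hoc := continuous_om hm
  set u : ℝ → ℂ := fun t => ∫ ξ, F ξ * wave m x (c * t) ξ with hu
  have huc : Continuous u :=
    (continuous_integral_wave hm hF1).comp (f := fun t : ℝ => (x, c * t)) (by fun_prop)
  set D := ∫ ξ, ‖F ξ‖
  have hub : ∀ t, ‖u t‖ ≤ D := fun t => by
    refine (norm_integral_le_integral_norm _).trans (le_of_eq ?_)
    simp only [norm_mul, norm_wave, mul_one, D]
  have hb : 0 < 1 / T ^ 2 := by positivity
  have hGi := integrable_exp_neg_mul_sq hb
  -- A Gaussian replaces the cut-off to `(0, T)`, since its Fourier transform is positive and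
  -- explicit. On `(0, T)` it is at least `e⁻¹ ≥ 1/3`, whence the factor 3.
  set I2 := ∫ t, ‖u t‖ ^ 2 * Real.exp (-(1 / T ^ 2) * t ^ 2) with hI2
  have hI2i : Integrable fun t => ‖u t‖ ^ 2 * Real.exp (-(1 / T ^ 2) * t ^ 2) := by
    refine (hGi.const_mul (D ^ 2)).mono' (Continuous.aestronglyMeasurable (by fun_prop))
      (Eventually.of_forall fun t => ?_)
    rw [Real.norm_of_nonneg (by positivity)]
    have := hub t
    gcongr
  have hI20 : 0 ≤ I2 := integral_nonneg fun t => by positivity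
  have hstep : ∫⁻ t in Ioo 0 T, ENNReal.ofReal (‖u t‖ ^ 2) ≤ ENNReal.ofReal 3 * ENNReal.ofReal I2 := by
    rw [hI2, ofReal_integral_eq_lintegral_ofReal hI2i (Eventually.of_forall fun t => by positivity),
      ← lintegral_const_mul' _ _ ENNReal.ofReal_ne_top]
    refine le_trans (setLIntegral_mono' measurableSet_Ioo fun t ht => ?_)
      (setLIntegral_le_lintegral (Ioo 0 T) _)
    rw [← ENNReal.ofReal_mul (by norm_num)]
    apply ENNReal.ofReal_le_ofReal
    have h1 : (1 : ℝ) / 3 ≤ Real.exp (-(1 / T ^ 2) * t ^ 2) := by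
      have h2 : -1 ≤ -(1 / T ^ 2) * t ^ 2 := by
        have : t ^ 2 ≤ T ^ 2 := pow_le_pow_left₀ ht.1.le ht.2.le 2
        have : 1 / T ^ 2 * t ^ 2 ≤ 1 := by
          rw [one_div_mul_eq_div, div_le_one (by positivity)]; exact this
        linarith
      refine le_trans ?_ (Real.exp_le_exp.2 h2)
      rw [Real.exp_neg, one_div]
      exact inv_anti₀ (Real.exp_pos _) (by linarith [Real.exp_one_lt_d9])
    nlinarith [sq_nonneg ‖u t‖]
  have hquad : (I2 : ℂ) = ∫ z : ℝ × ℝ, ∫ t : ℝ, (((Real.exp (-(1 / T ^ 2) * t ^ 2) : ℝ) : ℂ)) *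
      ((F z.1 * wave m x (c * t) z.1) * (starRingEnd ℂ) (F z.2 * wave m x (c * t) z.2)) := by
    have h1 : (I2 : ℂ) = ∫ t : ℝ, ∫ z : ℝ × ℝ, (((Real.exp (-(1 / T ^ 2) * t ^ 2) : ℝ) : ℂ)) *
      ((F z.1 * wave m x (c * t) z.1) * (starRingEnd ℂ) (F z.2 * wave m x (c * t) z.2)) := by
      rw [hI2, ← integral_complex_ofReal]
      refine integral_congr_ae (Eventually.of_forall fun t => ?_)
      dsimp only
      rw [integral_const_mul, Measure.volume_eq_prod, integral_prod_mul
        (fun ξ => F ξ * wave m x (c * t) ξ)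
        (fun ξ => (starRingEnd ℂ) (F ξ * wave m x (c * t) ξ)), integral_conj]
      change _ = _ * (u t * (starRingEnd ℂ) (u t))
      rw [Complex.mul_conj, Complex.normSq_eq_norm_sq]
      push_cast
      ring
    rw [h1, integral_integral_swap]
    have hi2 : Integrable (fun z : ℝ × ℝ => ‖F z.1‖ * ‖F z.2‖) := hF1.norm.mul_prod hF1.norm
    refine (hGi.mul_prod hi2).mono' ?_ (Eventually.of_forall fun p => ?_)
    · have c1 : Measurable fun p : ℝ × ℝ × ℝ => wave m x (c * p.1) p.2.1 :=
        hw.measurable.comp (f := fun p : ℝ × ℝ × ℝ => (x, c * p.1, p.2.1)) (by fun_prop)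
      have c2 : Measurable fun p : ℝ × ℝ × ℝ => wave m x (c * p.1) p.2.2 :=
        hw.measurable.comp (f := fun p : ℝ × ℝ × ℝ => (x, c * p.1, p.2.2)) (by fun_prop)
      have c3 : Measurable fun p : ℝ × ℝ × ℝ => (starRingEnd ℂ) (F p.2.2 * wave m x (c * p.1) p.2.2) :=
        Complex.continuous_conj.measurable.comp ((hF.comp (by fun_prop)).mul c2)
      have c4 : Measurable fun p : ℝ × ℝ × ℝ => ((Real.exp (-(1 / T ^ 2) * p.1 ^ 2) : ℝ) : ℂ) := by
        fun_prop
      exact (c4.mul (((hF.comp (by fun_prop)).mul c1).mul c3)).aestronglyMeasurable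
    · simp only [Function.uncurry, norm_mul, norm_wave, RCLike.norm_conj, Complex.norm_real,
        mul_one, Real.norm_eq_abs, Real.abs_exp, le_refl]
  have hlpos : ∀ ξ : ℝ, 0 < lam m (2 * Real.pi * ξ) ^ 3 := fun ξ => pow_pos (lam_pos hm _) 3
  -- Schur's test with the group velocity as weight: by the arithmetic–geometric mean inequality `|F
  -- ξ||F η|` splits into two terms, each with the Jacobian placed at the variable to be integrated
  -- out.
  set A : ℝ → ℝ → ℝ≥0∞ := fun ξ η => ENNReal.ofReal (‖F ξ‖ ^ 2 / lam m (2 * Real.pi * ξ) ^ 3) *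
    ENNReal.ofReal (lam m (2 * Real.pi * η) ^ 3 *
      gaussHat T (c * (om m (2 * Real.pi * ξ) - om m (2 * Real.pi * η)))) with hA
  have hAm : Measurable (Function.uncurry A) := by
    simp only [hA, Function.uncurry_def, gaussHat]
    refine Measurable.mul (Measurable.ennreal_ofReal ?_) (Measurable.ennreal_ofReal ?_)
    · exact ((hF.comp measurable_fst).norm.pow_const 2).div (by fun_prop)
    · exact Continuous.measurable (by fun_prop)
  have hpt : ∀ ξ η : ℝ, ENNReal.ofReal (‖F ξ‖ * ‖F η‖ *
      gaussHat T (c * (om m (2 * Real.pi * ξ) - om m (2 * Real.pi * η)))) ≤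
      2⁻¹ * A ξ η + 2⁻¹ * A η ξ := by
    intro ξ η
    have hg := gaussHat_nonneg T (c * (om m (2 * Real.pi * ξ) - om m (2 * Real.pi * η)))
    have hsym : gaussHat T (c * (om m (2 * Real.pi * η) - om m (2 * Real.pi * ξ))) =
        gaussHat T (c * (om m (2 * Real.pi * ξ) - om m (2 * Real.pi * η))) := by
      simp only [gaussHat]; congr 2; ring
    simp only [hA, hsym]
    rw [← ENNReal.ofReal_mul (div_nonneg (by positivity) (hlpos ξ).le),
      ← ENNReal.ofReal_mul (div_nonneg (by positivity) (hlpos η).le),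
      show (2⁻¹ : ℝ≥0∞) = ENNReal.ofReal 2⁻¹ by
        rw [ENNReal.ofReal_inv_of_pos (by norm_num)]; simp,
      ← ENNReal.ofReal_mul (by norm_num), ← ENNReal.ofReal_mul (by norm_num),
      ← ENNReal.ofReal_add]
    · apply ENNReal.ofReal_le_ofReal
      set p := lam m (2 * Real.pi * ξ) ^ 3
      set q := lam m (2 * Real.pi * η) ^ 3
      have hp : 0 < p := hlpos ξ
      have hq : 0 < q := hlpos η
      have : ‖F ξ‖ * ‖F η‖ ≤ 2⁻¹ * (‖F ξ‖ ^ 2 / p * q) + 2⁻¹ * (‖F η‖ ^ 2 / q * p) := by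
        have h1 : 2⁻¹ * (‖F ξ‖ ^ 2 / p * q) + 2⁻¹ * (‖F η‖ ^ 2 / q * p) - ‖F ξ‖ * ‖F η‖ =
            (‖F ξ‖ * q - ‖F η‖ * p) ^ 2 / (2 * (p * q)) := by
          field_simp
          ring
        have h2 : 0 ≤ (‖F ξ‖ * q - ‖F η‖ * p) ^ 2 / (2 * (p * q)) := by positivity
        linarith
      nlinarith
    · have := hlpos ξ; have := hlpos η; positivity
    · have := hlpos ξ; have := hlpos η; positivity
  have hI2le : ENNReal.ofReal I2 ≤ ENNReal.ofReal (|c|⁻¹ * N) := by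
    calc ENNReal.ofReal I2 = ‖(I2 : ℂ)‖ₑ := by
          rw [← ofReal_norm, Complex.norm_real, Real.norm_of_nonneg hI20]
      _ ≤ ∫⁻ z : ℝ × ℝ, ENNReal.ofReal (‖F z.1‖ * ‖F z.2‖ *
            gaussHat T (c * (om m (2 * Real.pi * z.1) - om m (2 * Real.pi * z.2)))) := by
          rw [hquad]
          refine (enorm_integral_le_lintegral_enorm _).trans (lintegral_mono fun z => ?_)
          rw [← ofReal_norm]
          apply ENNReal.ofReal_le_ofReal
          have e : ∀ t : ℝ, (((Real.exp (-(1 / T ^ 2) * t ^ 2) : ℝ) : ℂ)) *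
              ((F z.1 * wave m x (c * t) z.1) * (starRingEnd ℂ) (F z.2 * wave m x (c * t) z.2)) =
              (F z.1 * (starRingEnd ℂ) (F z.2) * Complex.exp (Complex.I *
                ((2 * Real.pi * z.1 * x - 2 * Real.pi * z.2 * x : ℝ) : ℂ))) *
              (Complex.exp (Complex.I *
                ((c * (om m (2 * Real.pi * z.2) - om m (2 * Real.pi * z.1)) : ℝ) : ℂ) * t) *
                ((Real.exp (-(1 / T ^ 2) * t ^ 2) : ℝ) : ℂ)) := fun t => by
            have e1 : wave m x (c * t) z.1 * (starRingEnd ℂ) (wave m x (c * t) z.2) =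
                Complex.exp (Complex.I *
                ((2 * Real.pi * z.1 * x - 2 * Real.pi * z.2 * x : ℝ) : ℂ)) * Complex.exp (Complex.I *
                ((c * (om m (2 * Real.pi * z.2) - om m (2 * Real.pi * z.1)) : ℝ) : ℂ) * t) := by
              rw [wave, wave, conj_osc, osc, osc, ← Complex.exp_add, ← Complex.exp_add]
              congr 1
              simp only [phase]
              push_cast
              ring
            rw [map_mul]
            linear_combination (((Real.exp (-(1 / T ^ 2) * t ^ 2) : ℝ) : ℂ)) * F z.1 *
              (starRingEnd ℂ) (F z.2) * e1
          simp_rw [e]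
          rw [integral_const_mul, norm_mul, norm_integral_gaussian_mul hT, norm_mul, norm_mul,
            RCLike.norm_conj, mul_comm Complex.I, Complex.norm_exp_ofReal_mul_I, mul_one]
          refine le_of_eq ?_
          congr 1
          simp only [gaussHat]; congr 2; ring
      _ ≤ ∫⁻ z : ℝ × ℝ, (2⁻¹ * A z.1 z.2 + 2⁻¹ * A z.2 z.1) := lintegral_mono fun z => hpt _ _
      _ = ∫⁻ ξ, ∫⁻ η, A ξ η := lintegral_symm_average hAm
      _ ≤ ∫⁻ ξ, ENNReal.ofReal (1 / |c|) * ENNReal.ofReal (‖F ξ‖ ^ 2 / lam m (2 * Real.pi * ξ) ^ 3) := by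
          refine lintegral_mono fun ξ => ?_
          simp only [hA]
          rw [lintegral_const_mul' _ _ ENNReal.ofReal_ne_top, mul_comm]
          gcongr
          exact lintegral_group_velocity hm hT hc _
      _ ≤ ENNReal.ofReal (1 / |c|) * ENNReal.ofReal N := by
          rw [lintegral_const_mul' _ _ ENNReal.ofReal_ne_top]
          gcongr
      _ = _ := by rw [← ENNReal.ofReal_mul (by positivity), one_div]
  calc _ ≤ ENNReal.ofReal 3 * ENNReal.ofReal (|c|⁻¹ * N) := hstep.trans (by gcongr)
    _ = _ := by rw [← ENNReal.ofReal_mul (by norm_num), mul_assoc]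

/-! ### The Fourier transform on `L²` and products -/

/-- Complex `L²` functions on the line. -/
abbrev L2 : Type := Lp ℂ 2 (volume : Measure ℝ)

/-- Pairing with Schwartz functions characterizes the Plancherel transform; this is how it is later
identified with the Fourier integral of functions that are also integrable. -/
theorem integral_fourier_mul_schwartz (f : L2) (ψ : 𝓢(ℝ, ℂ)) :
    ∫ x, (𝓕 f : L2) x * ψ x = ∫ x, f x * 𝓕 (ψ : ℝ → ℂ) x := by
  have h := congrArg (fun S : 𝓢'(ℝ, ℂ) => S ψ) (Lp.fourier_toTemperedDistribution_eq f)
  simp only [TemperedDistribution.fourier_apply, Lp.toTemperedDistribution_apply, smul_eq_mul,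
    SchwartzMap.fourier_coe] at h
  simp only [mul_comm _ (ψ _), mul_comm (f _), ← h]

theorem integral_fourierInv_mul_schwartz (f : L2) (ψ : 𝓢(ℝ, ℂ)) :
    ∫ x, (𝓕⁻ f : L2) x * ψ x = ∫ x, f x * 𝓕⁻ (ψ : ℝ → ℂ) x := by
  have h := congrArg (fun S : 𝓢'(ℝ, ℂ) => S ψ) (Lp.fourierInv_toTemperedDistribution_eq f)
  simp only [TemperedDistribution.fourierInv_apply, Lp.toTemperedDistribution_apply, smul_eq_mul,
    SchwartzMap.fourierInv_coe] at h
  simp only [mul_comm _ (ψ _), mul_comm (f _), ← h]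

theorem ae_eq_of_integral_mul_schwartz {f g : ℝ → ℂ} (hf : LocallyIntegrable f)
    (hg : LocallyIntegrable g) (h : ∀ ψ : 𝓢(ℝ, ℂ), ∫ x, f x * ψ x = ∫ x, g x * ψ x) :
    f =ᵐ[volume] g := by
  refine ae_eq_of_integral_contDiff_smul_eq hf hg fun φ hφ hc => ?_
  have hg₁ : HasCompactSupport (Complex.ofRealCLM ∘ φ) := hc.comp_left rfl
  have hg₂ : ContDiff ℝ (⊤ : ℕ∞) (Complex.ofRealCLM ∘ φ) := by fun_prop
  have := h (hg₁.toSchwartzMap hg₂)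
  simpa [mul_comm] using this

theorem integral_fourier_mul_eq_flip {f g : ℝ → ℂ} (hf : Integrable f) (hg : Integrable g) :
    ∫ x, 𝓕 f x * g x = ∫ x, f x * 𝓕 g x := by
  have := VectorFourier.integral_fourierIntegral_smul_eq_flip (L := innerₗ ℝ)
    Real.continuous_fourierChar continuous_inner hf hg
  simp only [smul_eq_mul, flip_innerₗ] at this
  exact this

theorem integral_fourierInv_mul_eq_flip {f g : ℝ → ℂ} (hf : Integrable f) (hg : Integrable g) :
    ∫ x, 𝓕⁻ f x * g x = ∫ x, f x * 𝓕⁻ g x := by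
  have h1 := integral_fourier_mul_eq_flip hf hg.comp_neg
  have e1 : ∀ x, 𝓕⁻ g x = 𝓕 (fun y => g (-y)) x := fun x => by
    rw [Real.fourierInv_eq_fourier_comp_neg]
  simp only [e1, ← h1]
  rw [← integral_neg_eq_self]
  refine integral_congr_ae (Eventually.of_forall fun x => ?_)
  simp only [Real.fourierInv_eq_fourier_neg, neg_neg]

theorem continuous_fourier {f : ℝ → ℂ} (hf : Integrable f) : Continuous (𝓕 f) :=
  VectorFourier.fourierIntegral_continuous Real.continuous_fourierChar
    (by exact continuous_inner) hf

theorem continuous_fourierInv {f : ℝ → ℂ} (hf : Integrable f) : Continuous (𝓕⁻ f) := by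
  have : 𝓕⁻ f = fun x => 𝓕 f (-x) := funext fun x => Real.fourierInv_eq_fourier_neg _ _
  rw [this]
  exact (continuous_fourier hf).comp continuous_neg

theorem fourier_toLp_ae_eq {f : ℝ → ℂ} (hf : Integrable f) (hf2 : MemLp f 2) :
    ((𝓕 (hf2.toLp f) : L2) : ℝ → ℂ) =ᵐ[volume] 𝓕 f := by
  refine ae_eq_of_integral_mul_schwartz ((Lp.memLp _).locallyIntegrable (by norm_num))
    (continuous_fourier hf).locallyIntegrable fun ψ => ?_
  rw [integral_fourier_mul_schwartz, integral_fourier_mul_eq_flip hf ψ.integrable]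
  exact integral_congr_ae (hf2.coeFn_toLp.mono fun x hx => by dsimp only; rw [hx])

theorem fourierInv_toLp_ae_eq {f : ℝ → ℂ} (hf : Integrable f) (hf2 : MemLp f 2) :
    ((𝓕⁻ (hf2.toLp f) : L2) : ℝ → ℂ) =ᵐ[volume] 𝓕⁻ f := by
  refine ae_eq_of_integral_mul_schwartz ((Lp.memLp _).locallyIntegrable (by norm_num))
    (continuous_fourierInv hf).locallyIntegrable fun ψ => ?_
  rw [integral_fourierInv_mul_schwartz, integral_fourierInv_mul_eq_flip hf ψ.integrable]
  exact integral_congr_ae (hf2.coeFn_toLp.mono fun x hx => by dsimp only; rw [hx])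

theorem fourier_ae_eq {f : L2} (hf : Integrable f) :
    ((𝓕 f : L2) : ℝ → ℂ) =ᵐ[volume] 𝓕 (f : ℝ → ℂ) := by
  have := fourier_toLp_ae_eq hf (Lp.memLp f)
  rwa [Lp.toLp_coeFn] at this

theorem fourierInv_ae_eq {f : L2} (hf : Integrable f) :
    ((𝓕⁻ f : L2) : ℝ → ℂ) =ᵐ[volume] 𝓕⁻ (f : ℝ → ℂ) := by
  have := fourierInv_toLp_ae_eq hf (Lp.memLp f)
  rwa [Lp.toLp_coeFn] at this

/-- The bilinear pairing `∫ f g` on `L²`. -/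
noncomputable def pairing : L2 →L[ℂ] L2 →L[ℂ] ℂ :=
  (ContinuousLinearMap.mul ℂ ℂ).lpPairing volume 2 2

theorem pairing_apply (f g : L2) : pairing f g = ∫ x, f x * g x := by
  rw [pairing, ContinuousLinearMap.lpPairing_eq_integral]
  rfl

/-- Multiplication by a bounded function on `L²`. -/
noncomputable def mulOp (θ : ℝ → ℂ) (hθ : MemLp θ ∞) : L2 →L[ℂ] L2 :=
  (ContinuousLinearMap.mul ℂ ℂ).holderL volume ∞ 2 2 (hθ.toLp θ)

theorem coeFn_mulOp {θ : ℝ → ℂ} (hθ : MemLp θ ∞) (f : L2) :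
    (mulOp θ hθ f : ℝ → ℂ) =ᵐ[volume] fun x => θ x * f x := by
  filter_upwards [ContinuousLinearMap.coeFn_holder (r := 2) (ContinuousLinearMap.mul ℂ ℂ)
    (hθ.toLp θ) f, hθ.coeFn_toLp] with x h1 h2
  rw [mulOp, ContinuousLinearMap.holderL_apply_apply, h1, h2]
  rfl

theorem norm_mulOp_apply_le {θ : ℝ → ℂ} (hθ : MemLp θ ∞) {c : ℝ} (hc : ∀ x, ‖θ x‖ ≤ c) (f : L2) :
    ‖mulOp θ hθ f‖ ≤ c * ‖f‖ := by
  refine Lp.norm_le_mul_norm_of_ae_le_mul ((coeFn_mulOp hθ f).mono fun x hx => ?_)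
  rw [hx, norm_mul]
  exact mul_le_mul_of_nonneg_right (hc x) (norm_nonneg _)

theorem memLp_top_of_le {θ : ℝ → ℂ} (h : Continuous θ) (c : ℝ) (hc : ∀ x, ‖θ x‖ ≤ c) :
    MemLp θ ∞ :=
  memLp_top_of_bound h.aestronglyMeasurable c (Eventually.of_forall hc)

/-- The Fourier transform of a product is the convolution of the Fourier transforms. -/
theorem fourier_mul_fourierInv_eq_integral (F G : L2) (ξ : ℝ) :
    𝓕 (fun x => (𝓕⁻ F : L2) x * (𝓕⁻ G : L2) x) ξ = ∫ η, F (ξ - η) * G η := by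
  have hch : Continuous fun x : ℝ => (Real.fourierChar (-(x * ξ)) : ℂ) := by fun_prop
  have hchm : MemLp (fun x : ℝ => (Real.fourierChar (-(x * ξ)) : ℂ)) ∞ :=
    memLp_top_of_le hch 1 fun x => (Circle.norm_coe _).le
  have hmp : MeasurePreserving (fun η : ℝ => ξ - η) volume volume :=
    Measure.measurePreserving_sub_left volume ξ
  let R : L2 →L[ℂ] L2 := (Lp.compMeasurePreservingₗᵢ ℂ (fun η : ℝ => ξ - η) hmp).toContinuousLinearMap
  have hR : ∀ F : L2, (R F : ℝ → ℂ) =ᵐ[volume] fun η => F (ξ - η) := fun F =>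
    Lp.coeFn_compMeasurePreserving F hmp
  have hl : ∀ F G : L2, 𝓕 (fun x => (𝓕⁻ F : L2) x * (𝓕⁻ G : L2) x) ξ =
      pairing (mulOp _ hchm (𝓕⁻ F)) (𝓕⁻ G) := fun F G => by
    rw [pairing_apply, Real.fourier_real_eq]
    refine integral_congr_ae ((coeFn_mulOp hchm (𝓕⁻ F)).mono fun x hx => ?_)
    dsimp only
    rw [hx, Circle.smul_def, smul_eq_mul, mul_assoc]
  have hr : ∀ F G : L2, ∫ η, F (ξ - η) * G η = pairing (R F) G := fun F G => by
    rw [pairing_apply]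
    refine integral_congr_ae ((hR F).mono fun x hx => ?_)
    dsimp only
    rw [hx]
  rw [hl, hr]
  -- At a fixed `ξ` both sides are continuous bilinear forms on `L²`, so it suffices to compare them
  -- on the dense subspace of Schwartz functions, where the convolution theorem applies.
  have hd := SchwartzMap.denseRange_toLpCLM (E := ℝ) (F := ℂ) (p := 2) (μ := volume) (by norm_num)
  refine hd.induction_on₂ (p := fun F G : L2 =>
    pairing (mulOp _ hchm (𝓕⁻ F)) (𝓕⁻ G) = pairing (R F) G) ?_ ?_ F G
  · have hF : Continuous fun p : L2 × L2 => (𝓕⁻ p.1 : L2) :=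
      (Lp.fourierTransformₗᵢ ℝ ℂ).symm.continuous.comp continuous_fst
    have hG : Continuous fun p : L2 × L2 => (𝓕⁻ p.2 : L2) :=
      (Lp.fourierTransformₗᵢ ℝ ℂ).symm.continuous.comp continuous_snd
    exact isClosed_eq (by fun_prop) (by fun_prop)
  · intro f g
    rw [← hl, ← hr, SchwartzMap.toLpCLM_apply, SchwartzMap.toLpCLM_apply,
      SchwartzMap.toLp_fourierInv_eq, SchwartzMap.toLp_fourierInv_eq]
    have e1 : 𝓕 (fun x => ((𝓕⁻ f).toLp 2 volume : L2) x * ((𝓕⁻ g).toLp 2 volume : L2) x) ξ =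
        𝓕 (SchwartzMap.pairing (ContinuousLinearMap.mul ℂ ℂ) (𝓕⁻ f) (𝓕⁻ g)) ξ := by
      rw [SchwartzMap.fourier_coe, Real.fourier_real_eq, Real.fourier_real_eq]
      refine integral_congr_ae ?_
      filter_upwards [(𝓕⁻ f).coeFn_toLp 2 volume, (𝓕⁻ g).coeFn_toLp 2 volume] with x h1 h2
      rw [h1, h2]
      rfl
    have e2 : SchwartzMap.pairing (ContinuousLinearMap.mul ℂ ℂ) (𝓕⁻ f) (𝓕⁻ g) =
        𝓕⁻ (SchwartzMap.convolution (ContinuousLinearMap.mul ℂ ℂ) g f) := by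
      ext x
      have h1 : ∀ h : 𝓢(ℝ, ℂ), (𝓕⁻ h : 𝓢(ℝ, ℂ)) x = (𝓕 h : 𝓢(ℝ, ℂ)) (-x) := fun h => by
        rw [SchwartzMap.fourierInv_coe, SchwartzMap.fourier_coe, Real.fourierInv_eq_fourier_neg]
      rw [SchwartzMap.pairing_apply_apply, h1, h1, h1, SchwartzMap.fourier_convolution,
        SchwartzMap.pairing_apply_apply]
      simp [mul_comm]
    rw [e1, e2, FourierTransform.fourier_fourierInv_eq, SchwartzMap.convolution_apply]
    rw [MeasureTheory.convolution_def]
    refine integral_congr_ae ?_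
    have h1 := hmp.quasiMeasurePreserving.ae (f.coeFn_toLp 2 volume)
    filter_upwards [h1, g.coeFn_toLp 2 volume] with x h1 h2
    rw [h1, h2]
    simp [mul_comm]

/-! ### Weighted derivatives and the Leibniz rule -/

/-- The symbol `(ik)^j (1 + k²)^{-3/2}`, `k = 2πξ`. -/
noncomputable def sym (j : ℕ) (ξ : ℝ) : ℂ :=
  (Complex.I * (2 * Real.pi * ξ : ℝ)) ^ j * ((lam 1 (2 * Real.pi * ξ) ^ 3 : ℝ) : ℂ)

theorem continuous_sym (j : ℕ) : Continuous (sym j) := by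
  have := continuous_lam (m := 1) zero_le_one
  unfold sym
  fun_prop

theorem abs_mul_lam_one_le (k : ℝ) : |k| * lam 1 k ≤ 1 := by
  have h := lam_sq_mul (m := 1) zero_le_one k
  have hp := lam_pos (m := 1) zero_le_one k
  rw [← abs_of_pos hp, ← abs_mul]
  apply abs_le_one_iff_mul_self_le_one.2
  nlinarith [sq_nonneg (lam 1 k)]

/-- Each factor `|k|` consumes one factor `(1+k²)^{-1/2}`. At least one is left for `j ≤ 2`, which
puts the symbol in `L²` and the derivative in `L^∞`; for `j = 3` only boundedness remains. -/
theorem norm_sym_le {j : ℕ} (hj : j ≤ 3) (ξ : ℝ) :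
    ‖sym j ξ‖ ≤ lam 1 (2 * Real.pi * ξ) ^ (3 - j) := by
  have hp := lam_pos (m := 1) zero_le_one (2 * Real.pi * ξ)
  have h1 := abs_mul_lam_one_le (2 * Real.pi * ξ)
  rw [sym, norm_mul, norm_pow, norm_mul, Complex.norm_I, one_mul, Complex.norm_real,
    Complex.norm_real, Real.norm_eq_abs, Real.norm_of_nonneg (by positivity)]
  calc _ = (|2 * Real.pi * ξ| * lam 1 (2 * Real.pi * ξ)) ^ j * lam 1 (2 * Real.pi * ξ) ^ (3 - j) := by
        rw [mul_pow, mul_assoc _ (_ ^ j) (_ ^ (3 - j)), ← pow_add, Nat.add_sub_cancel' hj]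
    _ ≤ 1 * lam 1 (2 * Real.pi * ξ) ^ (3 - j) := by
        gcongr
        exact pow_le_one₀ (by positivity) h1
    _ = _ := one_mul _

theorem norm_sym_le_one {j : ℕ} (hj : j ≤ 3) (ξ : ℝ) : ‖sym j ξ‖ ≤ 1 :=
  (norm_sym_le hj ξ).trans (pow_le_one₀ (lam_pos zero_le_one _).le (lam_le_one zero_le_one _))

theorem memLp_top_sym {j : ℕ} (hj : j ≤ 3) : MemLp (sym j) ∞ :=
  memLp_top_of_le (continuous_sym j) 1 (norm_sym_le_one hj)

theorem memLp_two_lam_one : MemLp (fun ξ : ℝ => lam 1 (2 * Real.pi * ξ)) 2 := by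
  have hc := continuous_lam (m := 1) zero_le_one
  rw [memLp_two_iff_integrable_sq (Continuous.aestronglyMeasurable (by fun_prop))]
  refine integrable_inv_one_add_sq_two_pi.congr (Eventually.of_forall fun ξ => ?_)
  dsimp only
  rw [lam_sq zero_le_one, one_mul]

theorem memLp_two_sym {j : ℕ} (hj : j ≤ 2) : MemLp (sym j) 2 := by
  refine memLp_two_lam_one.mono (continuous_sym j).aestronglyMeasurable
    (Eventually.of_forall fun ξ => ?_)
  have hp := lam_pos (m := 1) zero_le_one (2 * Real.pi * ξ)
  rw [Real.norm_of_nonneg hp.le]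
  refine (norm_sym_le (by omega) ξ).trans ?_
  exact pow_le_of_le_one hp.le (lam_le_one zero_le_one _) (by omega)

open scoped Classical in
/-- The operator `∂ₓ^j (1 - ∂ₓ²)^{-3/2} 𝓕⁻¹`, `j ≤ 3`. -/
noncomputable def derivOp (j : ℕ) : L2 →L[ℂ] L2 :=
  if hj : j ≤ 3 then
    (Lp.fourierTransformₗᵢ ℝ ℂ).symm.toContinuousLinearEquiv.toContinuousLinearMap ∘L
      mulOp (sym j) (memLp_top_sym hj)
  else 0

theorem derivOp_apply {j : ℕ} (hj : j ≤ 3) (f : L2) :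
    derivOp j f = 𝓕⁻ (mulOp (sym j) (memLp_top_sym hj) f) := by
  rw [derivOp, dif_pos hj]
  rfl

theorem integrable_sym_mul {j : ℕ} (hj : j ≤ 2) (f : L2) : Integrable fun ξ => sym j ξ * f ξ :=
  (memLp_two_sym hj).integrable_mul (Lp.memLp f)

theorem derivOp_ae_eq {j : ℕ} (hj : j ≤ 2) (f : L2) :
    (derivOp j f : ℝ → ℂ) =ᵐ[volume] 𝓕⁻ (fun ξ => sym j ξ * f ξ) := by
  have hj3 : j ≤ 3 := by omega
  have h := coeFn_mulOp (memLp_top_sym hj3) f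
  rw [derivOp_apply hj3]
  refine (fourierInv_ae_eq ((integrable_sym_mul hj f).congr h.symm)).trans
    (Eventually.of_forall fun x => ?_)
  rw [Real.fourierInv_eq, Real.fourierInv_eq]
  exact integral_congr_ae (h.mono fun ξ hξ => by dsimp only; rw [hξ])

theorem norm_fourierInv_le (f : ℝ → ℂ) (x : ℝ) : ‖𝓕⁻ f x‖ ≤ ∫ ξ, ‖f ξ‖ := by
  rw [Real.fourierInv_eq]
  refine (norm_integral_le_integral_norm _).trans (le_of_eq ?_)
  simp

theorem integral_norm_mul_le {θ : ℝ → ℂ} (hθ : MemLp θ 2) (f : L2) :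
    ∫ ξ, ‖θ ξ * f ξ‖ ≤ ‖hθ.toLp θ‖ * ‖f‖ := by
  have h := ContinuousLinearMap.norm_holder_apply_apply_le (r := 1) (ContinuousLinearMap.mul ℂ ℂ)
    (hθ.toLp θ) f
  rw [L1.norm_eq_integral_norm] at h
  have e : ∫ ξ, ‖θ ξ * f ξ‖ =
      ∫ ξ, ‖((ContinuousLinearMap.mul ℂ ℂ).holder 1 (hθ.toLp θ) f : Lp ℂ 1 volume) ξ‖ := by
    refine integral_congr_ae ?_
    filter_upwards [ContinuousLinearMap.coeFn_holder (r := 1) (ContinuousLinearMap.mul ℂ ℂ)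
      (hθ.toLp θ) f, hθ.coeFn_toLp] with x h1 h2
    rw [h1, h2]
    rfl
  rw [e]
  refine h.trans ?_
  have := ContinuousLinearMap.opNorm_mul_le ℂ ℂ
  nlinarith [mul_nonneg (norm_nonneg (hθ.toLp θ)) (norm_nonneg f)]

theorem norm_derivOp_apply_le {j : ℕ} (hj : j ≤ 2) (f : L2) :
    ∀ᵐ x, ‖derivOp j f x‖ ≤ ‖(memLp_two_sym hj).toLp (sym j)‖ * ‖f‖ := by
  filter_upwards [derivOp_ae_eq hj f] with x hx
  rw [hx]
  exact (norm_fourierInv_le _ x).trans (integral_norm_mul_le _ f)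

theorem memLp_top_derivOp {j : ℕ} (hj : j ≤ 2) (f : L2) : MemLp (derivOp j f) ∞ :=
  memLp_top_of_bound (Lp.aestronglyMeasurable _) _ (norm_derivOp_apply_le hj f)

/-- `derivOp j` as an operator into `L^∞`, `j ≤ 2`. -/
noncomputable def derivOpTop (j : ℕ) (hj : j ≤ 2) : L2 →L[ℂ] Lp ℂ ∞ (volume : Measure ℝ) :=
  LinearMap.mkContinuous
    { toFun := fun f => (memLp_top_derivOp hj f).toLp _
      map_add' := fun f g => by
        rw [← MemLp.toLp_add]
        refine MemLp.toLp_congr _ _ ?_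
        rw [map_add]
        exact Lp.coeFn_add _ _
      map_smul' := fun c f => by
        rw [← MemLp.toLp_const_smul]
        refine MemLp.toLp_congr _ _ ?_
        rw [map_smul]
        exact Lp.coeFn_smul _ _ }
    ‖(memLp_two_sym hj).toLp (sym j)‖ fun f => by
      change ‖(memLp_top_derivOp hj f).toLp _‖ ≤ _
      rw [Lp.norm_toLp]
      refine ENNReal.toReal_le_of_le_ofReal (by positivity) ?_
      rw [eLpNorm_exponent_top]
      exact eLpNormEssSup_le_of_ae_bound (norm_derivOp_apply_le hj f)

theorem coeFn_derivOpTop {j : ℕ} (hj : j ≤ 2) (f : L2) :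
    (derivOpTop j hj f : ℝ → ℂ) =ᵐ[volume] derivOp j f :=
  (memLp_top_derivOp hj f).coeFn_toLp

/-- The product `(derivOp i f) (derivOp j g)` in `L²`. -/
noncomputable def prodTwo (i j : ℕ) (hi : i ≤ 2) : L2 →L[ℂ] L2 →L[ℂ] L2 :=
  ((ContinuousLinearMap.mul ℂ ℂ).holderL volume ∞ 2 2).bilinearComp (derivOpTop i hi) (derivOp j)

/-- The product `(derivOp i f) (derivOp j g)` in `L¹`. -/
noncomputable def prodOne (i j : ℕ) : L2 →L[ℂ] L2 →L[ℂ] Lp ℂ 1 (volume : Measure ℝ) :=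
  ((ContinuousLinearMap.mul ℂ ℂ).holderL volume 2 2 1).bilinearComp (derivOp i) (derivOp j)

theorem coeFn_prodTwo {i : ℕ} (j : ℕ) (hi : i ≤ 2) (f g : L2) :
    (prodTwo i j hi f g : ℝ → ℂ) =ᵐ[volume] fun x => derivOp i f x * derivOp j g x := by
  filter_upwards [ContinuousLinearMap.coeFn_holder (r := 2) (ContinuousLinearMap.mul ℂ ℂ)
    (derivOpTop i hi f) (derivOp j g), coeFn_derivOpTop hi f] with x h1 h2
  rw [prodTwo, ContinuousLinearMap.bilinearComp_apply, ContinuousLinearMap.holderL_apply_apply, h1,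
    h2]
  rfl

theorem coeFn_prodOne (i j : ℕ) (f g : L2) :
    (prodOne i j f g : ℝ → ℂ) =ᵐ[volume] fun x => derivOp i f x * derivOp j g x :=
  ContinuousLinearMap.coeFn_holder (r := 1) (ContinuousLinearMap.mul ℂ ℂ) (derivOp i f) (derivOp j g)

/-- `(1 + ∂ₓ³)(fg)` in `L²`, for the `H³` functions with weighted Fourier transforms `f`, `g`. -/
noncomputable def leibnizTwo : L2 →L[ℂ] L2 →L[ℂ] L2 :=
  prodTwo 0 0 (by norm_num) + (3 : ℂ) • prodTwo 1 2 (by norm_num) +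
    (3 : ℂ) • prodTwo 2 1 (by norm_num) + prodTwo 0 3 (by norm_num) +
    -- The factor carrying three derivatives is only in `L²`, so it must stand second; the symmetric
    -- term is obtained by flipping.
    (prodTwo 0 3 (by norm_num)).flip

/-- `(1 + ∂ₓ³)(fg)` in `L¹`. -/
noncomputable def leibnizOne : L2 →L[ℂ] L2 →L[ℂ] Lp ℂ 1 (volume : Measure ℝ) :=
  prodOne 0 0 + (3 : ℂ) • prodOne 1 2 + (3 : ℂ) • prodOne 2 1 + prodOne 0 3 + (prodOne 0 3).flip

/-- `∂ₓ(fg)` in `L¹`. -/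
noncomputable def derivProd : L2 →L[ℂ] L2 →L[ℂ] Lp ℂ 1 (volume : Measure ℝ) :=
  prodOne 1 0 + prodOne 0 1

theorem coeFn_leibnizOne (f g : L2) :
    (leibnizOne f g : ℝ → ℂ) =ᵐ[volume] fun x => derivOp 0 f x * derivOp 0 g x +
      3 * (derivOp 1 f x * derivOp 2 g x) + 3 * (derivOp 2 f x * derivOp 1 g x) +
      derivOp 0 f x * derivOp 3 g x + derivOp 0 g x * derivOp 3 f x := by
  simp only [leibnizOne, add_apply, smul_apply,
    ContinuousLinearMap.flip_apply]
  refine (Lp.coeFn_add _ _).trans ?_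
  refine EventuallyEq.add ((Lp.coeFn_add _ _).trans ?_) (coeFn_prodOne _ _ _ _)
  refine EventuallyEq.add ((Lp.coeFn_add _ _).trans ?_) (coeFn_prodOne _ _ _ _)
  refine EventuallyEq.add ((Lp.coeFn_add _ _).trans ?_) ((Lp.coeFn_smul _ _).trans
    ((coeFn_prodOne _ _ _ _).const_smul _))
  exact EventuallyEq.add (coeFn_prodOne _ _ _ _) ((Lp.coeFn_smul _ _).trans
    ((coeFn_prodOne _ _ _ _).const_smul _))

theorem coeFn_leibnizTwo (f g : L2) :
    (leibnizTwo f g : ℝ → ℂ) =ᵐ[volume] fun x => derivOp 0 f x * derivOp 0 g x +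
      3 * (derivOp 1 f x * derivOp 2 g x) + 3 * (derivOp 2 f x * derivOp 1 g x) +
      derivOp 0 f x * derivOp 3 g x + derivOp 0 g x * derivOp 3 f x := by
  simp only [leibnizTwo, add_apply, smul_apply,
    ContinuousLinearMap.flip_apply]
  refine (Lp.coeFn_add _ _).trans ?_
  refine EventuallyEq.add ((Lp.coeFn_add _ _).trans ?_) (coeFn_prodTwo _ _ _ _)
  refine EventuallyEq.add ((Lp.coeFn_add _ _).trans ?_) (coeFn_prodTwo _ _ _ _)
  refine EventuallyEq.add ((Lp.coeFn_add _ _).trans ?_) ((Lp.coeFn_smul _ _).trans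
    ((coeFn_prodTwo _ _ _ _).const_smul _))
  exact EventuallyEq.add (coeFn_prodTwo _ _ _ _) ((Lp.coeFn_smul _ _).trans
    ((coeFn_prodTwo _ _ _ _).const_smul _))

theorem coeFn_derivProd (f g : L2) :
    (derivProd f g : ℝ → ℂ) =ᵐ[volume] fun x => derivOp 1 f x * derivOp 0 g x +
      derivOp 0 f x * derivOp 1 g x := by
  simp only [derivProd, add_apply]
  exact (Lp.coeFn_add _ _).trans (EventuallyEq.add (coeFn_prodOne _ _ _ _) (coeFn_prodOne _ _ _ _))

/-- The Fourier transform of `fg`. -/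
noncomputable def prodHat (f g : L2) : ℝ → ℂ := 𝓕 (fun x => derivOp 0 f x * derivOp 0 g x)

theorem integrable_derivOp_mul (i j : ℕ) (f g : L2) :
    Integrable fun x => derivOp i f x * derivOp j g x :=
  (Lp.memLp (derivOp i f)).integrable_mul (Lp.memLp (derivOp j g))

/-- The integrand of the convolution of weighted Fourier transforms. -/
noncomputable def convCore (f g : L2) (ξ η : ℝ) : ℂ :=
  ((lam 1 (2 * Real.pi * (ξ - η)) ^ 3 : ℝ) : ℂ) * f (ξ - η) *
    (((lam 1 (2 * Real.pi * η) ^ 3 : ℝ) : ℂ) * g η)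

/-- All products of derivatives are convolutions of the same core `convCore` with polynomial
weights. The Leibniz rule thereby becomes polynomial algebra under one integral, and the product
itself is never differentiated. -/
theorem fourier_derivOp_mul {i j : ℕ} (hi : i ≤ 3) (hj : j ≤ 3) (f g : L2) (ξ : ℝ) :
    (Integrable fun η => (Complex.I * (2 * Real.pi * (ξ - η) : ℝ)) ^ i *
      (Complex.I * (2 * Real.pi * η : ℝ)) ^ j * convCore f g ξ η) ∧
    𝓕 (fun x => derivOp i f x * derivOp j g x) ξ =
      ∫ η, (Complex.I * (2 * Real.pi * (ξ - η) : ℝ)) ^ i *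
        (Complex.I * (2 * Real.pi * η : ℝ)) ^ j * convCore f g ξ η := by
  have hmp : MeasurePreserving (fun η : ℝ => ξ - η) volume volume :=
    Measure.measurePreserving_sub_left volume ξ
  have hae : (fun η => mulOp (sym i) (memLp_top_sym hi) f (ξ - η) *
      mulOp (sym j) (memLp_top_sym hj) g η) =ᵐ[volume]
      fun η => (Complex.I * (2 * Real.pi * (ξ - η) : ℝ)) ^ i *
        (Complex.I * (2 * Real.pi * η : ℝ)) ^ j * convCore f g ξ η := by
    filter_upwards [hmp.quasiMeasurePreserving.ae (coeFn_mulOp (memLp_top_sym hi) f),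
      coeFn_mulOp (memLp_top_sym hj) g] with η h1 h2
    rw [h1, h2, sym, sym, convCore]
    ring
  refine ⟨Integrable.congr ?_ hae, ?_⟩
  · exact ((Lp.memLp _).comp_measurePreserving hmp).integrable_mul (Lp.memLp _)
  · rw [← integral_congr_ae hae, ← fourier_mul_fourierInv_eq_integral, ← derivOp_apply hi,
      ← derivOp_apply hj]

theorem fourier_add_apply {f g : ℝ → ℂ} (hf : Integrable f) (hg : Integrable g) (ξ : ℝ) :
    𝓕 (fun x => f x + g x) ξ = 𝓕 f ξ + 𝓕 g ξ :=
  congrFun (VectorFourier.fourierIntegral_add Real.continuous_fourierChar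
    (by exact continuous_inner) hf hg) ξ

theorem fourier_const_mul_apply (f : ℝ → ℂ) (c : ℂ) (ξ : ℝ) :
    𝓕 (fun x => c * f x) ξ = c * 𝓕 f ξ :=
  congrFun (VectorFourier.fourierIntegral_const_smul _ _ _ f c) ξ

theorem fourier_congr_ae {f g : ℝ → ℂ} (h : f =ᵐ[volume] g) (ξ : ℝ) : 𝓕 f ξ = 𝓕 g ξ := by
  rw [Real.fourier_eq, Real.fourier_eq]
  exact integral_congr_ae (h.mono fun x hx => by dsimp only; rw [hx])

theorem integral_add_five {a b c d e : ℝ → ℂ} (ha : Integrable a) (hb : Integrable b)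
    (hc : Integrable c) (hd : Integrable d) (he : Integrable e) :
    ∫ x, (a x + b x + c x + d x + e x) =
      (∫ x, a x) + (∫ x, b x) + (∫ x, c x) + (∫ x, d x) + ∫ x, e x := by
  rw [integral_add (f := fun x => a x + b x + c x + d x) (((ha.add hb).add hc).add hd) he,
    integral_add (f := fun x => a x + b x + c x) ((ha.add hb).add hc) hd,
    integral_add (f := fun x => a x + b x) (ha.add hb) hc, integral_add ha hb]

/-- The binomial expansion of `(i(k - l) + il)³`, where `l` is the frequency of the second factor,
applied under the convolution integral. -/
theorem fourier_leibnizOne (f g : L2) (ξ : ℝ) :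
    𝓕 (leibnizOne f g : ℝ → ℂ) ξ =
      (1 + (Complex.I * (2 * Real.pi * ξ : ℝ)) ^ 3) * prodHat f g ξ := by
  have hi := fun i j => integrable_derivOp_mul i j f g
  have hi' := fun i j => integrable_derivOp_mul i j g f
  have hF := fun {i j : ℕ} (hi : i ≤ 3) (hj : j ≤ 3) => fourier_derivOp_mul hi hj f g ξ
  have hcomm : (fun x => derivOp 0 g x * derivOp 3 f x) = fun x => derivOp 3 f x * derivOp 0 g x :=
    funext fun x => mul_comm _ _
  have I1 : Integrable fun x => derivOp 0 f x * derivOp 0 g x +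
      3 * (derivOp 1 f x * derivOp 2 g x) := (hi 0 0).add ((hi 1 2).const_mul 3)
  have I2 : Integrable fun x => derivOp 0 f x * derivOp 0 g x +
      3 * (derivOp 1 f x * derivOp 2 g x) + 3 * (derivOp 2 f x * derivOp 1 g x) :=
    I1.add ((hi 2 1).const_mul 3)
  have I3 : Integrable fun x => derivOp 0 f x * derivOp 0 g x +
      3 * (derivOp 1 f x * derivOp 2 g x) + 3 * (derivOp 2 f x * derivOp 1 g x) +
      derivOp 0 f x * derivOp 3 g x := I2.add (hi 0 3)
  rw [fourier_congr_ae (coeFn_leibnizOne f g),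
    fourier_add_apply I3 (hi' 0 3), fourier_add_apply I2 (hi 0 3),
    fourier_add_apply I1 ((hi 2 1).const_mul 3),
    fourier_add_apply (hi 0 0) ((hi 1 2).const_mul 3), fourier_const_mul_apply,
    fourier_const_mul_apply, hcomm, prodHat,
    (hF (by norm_num : 0 ≤ 3) (by norm_num : 0 ≤ 3)).2,
    (hF (by norm_num : 1 ≤ 3) (by norm_num : 2 ≤ 3)).2,
    (hF (by norm_num : 2 ≤ 3) (by norm_num : 1 ≤ 3)).2,
    (hF (by norm_num : 0 ≤ 3) (by norm_num : 3 ≤ 3)).2,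
    (hF (by norm_num : 3 ≤ 3) (by norm_num : 0 ≤ 3)).2]
  have i00 := (hF (by norm_num : 0 ≤ 3) (by norm_num : 0 ≤ 3)).1
  have i12 := (hF (by norm_num : 1 ≤ 3) (by norm_num : 2 ≤ 3)).1
  have i21 := (hF (by norm_num : 2 ≤ 3) (by norm_num : 1 ≤ 3)).1
  have i03 := (hF (by norm_num : 0 ≤ 3) (by norm_num : 3 ≤ 3)).1
  have i30 := (hF (by norm_num : 3 ≤ 3) (by norm_num : 0 ≤ 3)).1
  rw [← integral_const_mul, ← integral_const_mul, ← integral_const_mul,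
    ← integral_add_five i00 (i12.const_mul 3) (i21.const_mul 3) i03 i30]
  refine integral_congr_ae (Eventually.of_forall fun η => ?_)
  simp only
  push_cast
  ring

theorem fourier_derivProd (f g : L2) (ξ : ℝ) :
    𝓕 (derivProd f g : ℝ → ℂ) ξ = Complex.I * (2 * Real.pi * ξ : ℝ) * prodHat f g ξ := by
  have hi := fun i j => integrable_derivOp_mul i j f g
  have hF := fun {i j : ℕ} (hi : i ≤ 3) (hj : j ≤ 3) => fourier_derivOp_mul hi hj f g ξ
  rw [fourier_congr_ae (coeFn_derivProd f g), fourier_add_apply (hi 1 0) (hi 0 1), prodHat,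
    (hF (by norm_num : 0 ≤ 3) (by norm_num : 0 ≤ 3)).2,
    (hF (by norm_num : 1 ≤ 3) (by norm_num : 0 ≤ 3)).2,
    (hF (by norm_num : 0 ≤ 3) (by norm_num : 1 ≤ 3)).2]
  have i10 := (hF (by norm_num : 1 ≤ 3) (by norm_num : 0 ≤ 3)).1
  have i01 := (hF (by norm_num : 0 ≤ 3) (by norm_num : 1 ≤ 3)).1
  rw [← integral_const_mul, ← integral_add i10 i01]
  refine integral_congr_ae (Eventually.of_forall fun η => ?_)
  simp only
  push_cast
  ring

/-- `𝓕 (1 + ∂ₓ³)(fg)` as a bounded bilinear map on `L²`. -/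
noncomputable def bil : L2 →L[ℂ] L2 →L[ℂ] L2 :=
  (ContinuousLinearMap.compL ℂ L2 L2 L2
    (Lp.fourierTransformₗᵢ ℝ ℂ).toContinuousLinearEquiv.toContinuousLinearMap) ∘L leibnizTwo

/-- The bridge between the two roles of `(1+∂ₓ³)(fg)`: as an `L²` class it drives the evolution, and
as the Fourier integral of an `L¹` function it is subject to dispersive bounds. -/
theorem bil_ae_eq (f g : L2) :
    (bil f g : ℝ → ℂ) =ᵐ[volume] 𝓕 (leibnizOne f g : ℝ → ℂ) := by
  have h : (leibnizTwo f g : ℝ → ℂ) =ᵐ[volume] leibnizOne f g :=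
    (coeFn_leibnizTwo f g).trans (coeFn_leibnizOne f g).symm
  have e : bil f g = 𝓕 (leibnizTwo f g) := rfl
  rw [e]
  refine (fourier_ae_eq ((L1.integrable_coeFn _).congr h.symm)).trans
    (Eventually.of_forall fun ξ => fourier_congr_ae h ξ)

/-- The amplitude cancels the factor `1 + (ik)³` and leaves `ik`: the nonlinearity `∂ₓ(fg)` is
exactly `amp` applied to `bil`. -/
theorem amp_mul_bil_ae_eq (f g : L2) :
    (fun ξ => amp (2 * Real.pi * ξ) * bil f g ξ) =ᵐ[volume] 𝓕 (derivProd f g : ℝ → ℂ) := by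
  filter_upwards [bil_ae_eq f g] with ξ hξ
  rw [hξ, fourier_leibnizOne, fourier_derivProd, amp]
  rw [← mul_assoc, div_mul_cancel₀ _ (amp_denom_ne_zero (2 * Real.pi * ξ))]

/-! ### `H³` functions as elements of `L²` -/

theorem aestronglyMeasurable_fourierL2 (f : ℝ → ℝ) : AEStronglyMeasurable (fourierL2 f) volume := by
  unfold fourierL2
  split_ifs with h
  · exact Lp.aestronglyMeasurable _
  · exact aestronglyMeasurable_const

/-- The function `(1 + k²)^{3/2} f̂`. -/
noncomputable def weighted (f : ℝ → ℝ) (ξ : ℝ) : ℂ :=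
  (((1 + (2 * Real.pi * ξ) ^ 2) ^ ((3 : ℝ) / 2) : ℝ) : ℂ) * fourierL2 f ξ

open scoped Classical in
/-- The class of `(1 + k²)^{3/2} f̂` in `L²`. -/
noncomputable def wtransform (f : ℝ → ℝ) : L2 :=
  if h : MemLp (weighted f) 2 then h.toLp _ else 0

theorem memLp_of_sobolevNorm_lt_top {f : ℝ → ℝ} (hf : sobolevNorm 3 f < ⊤) : MemLp f 2 := by
  by_contra h
  rw [sobolevNorm, if_neg h] at hf
  exact lt_irrefl _ hf

theorem sobolevNorm_eq {f : ℝ → ℝ} (hf : MemLp f 2) :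
    sobolevNorm 3 f = eLpNorm (weighted f) 2 volume := by
  rw [sobolevNorm, if_pos hf]
  rfl

theorem memLp_weighted {f : ℝ → ℝ} (hf : sobolevNorm 3 f < ⊤) : MemLp (weighted f) 2 := by
  refine ⟨AEStronglyMeasurable.mul (Continuous.aestronglyMeasurable ?_)
    (aestronglyMeasurable_fourierL2 f), ?_⟩
  · refine Complex.continuous_ofReal.comp (Continuous.rpow_const (by fun_prop) fun x => Or.inr ?_)
    norm_num
  · rwa [← sobolevNorm_eq (memLp_of_sobolevNorm_lt_top hf)]

theorem coeFn_wtransform {f : ℝ → ℝ} (hf : sobolevNorm 3 f < ⊤) :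
    (wtransform f : ℝ → ℂ) =ᵐ[volume] weighted f := by
  rw [wtransform, dif_pos (memLp_weighted hf)]
  exact MemLp.coeFn_toLp _

theorem enorm_wtransform {f : ℝ → ℝ} (hf : sobolevNorm 3 f < ⊤) :
    ‖wtransform f‖ₑ = sobolevNorm 3 f := by
  rw [Lp.enorm_def, eLpNorm_congr_ae (coeFn_wtransform hf),
    sobolevNorm_eq (memLp_of_sobolevNorm_lt_top hf)]

theorem lam_one_cube_mul (k : ℝ) : lam 1 k ^ 3 * (1 + k ^ 2) ^ ((3 : ℝ) / 2) = 1 := by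
  have h : 0 < 1 + k ^ 2 := by positivity
  have e : (1 + k ^ 2) ^ ((3 : ℝ) / 2) = √(1 + k ^ 2) ^ 3 := by
    rw [Real.sqrt_eq_rpow, ← Real.rpow_natCast (n := 3), ← Real.rpow_mul h.le]
    norm_num
  rw [e, lam, one_mul, inv_pow, inv_mul_cancel₀ (by positivity)]

theorem sym_zero_mul_weighted (f : ℝ → ℝ) (ξ : ℝ) : sym 0 ξ * weighted f ξ = fourierL2 f ξ := by
  rw [sym, weighted, pow_zero, one_mul, ← mul_assoc, ← Complex.ofReal_mul, lam_one_cube_mul,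
    Complex.ofReal_one, one_mul]

theorem fourierL2_ae_eq {f : ℝ → ℝ} (hf : sobolevNorm 3 f < ⊤) :
    fourierL2 f =ᵐ[volume] fun ξ => sym 0 ξ * wtransform f ξ :=
  (coeFn_wtransform hf).mono fun ξ h => by dsimp only; rw [h, sym_zero_mul_weighted]

theorem memLp_ofReal {f : ℝ → ℝ} (hf : MemLp f 2) : MemLp (fun x => (f x : ℂ)) 2 := hf.ofReal

theorem fourierL2_eq {f : ℝ → ℝ} (hf : MemLp f 2) :
    fourierL2 f = (𝓕 ((memLp_ofReal hf).toLp _) : L2) := by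
  rw [fourierL2, dif_pos (memLp_ofReal hf)]

theorem mulOp_wtransform {f : ℝ → ℝ} (hf : sobolevNorm 3 f < ⊤) :
    mulOp (sym 0) (memLp_top_sym (by norm_num)) (wtransform f) =
      𝓕 ((memLp_ofReal (memLp_of_sobolevNorm_lt_top hf)).toLp _ : L2) := by
  refine Lp.ext ?_
  rw [← fourierL2_eq (memLp_of_sobolevNorm_lt_top hf)]
  exact (coeFn_mulOp _ _).trans (fourierL2_ae_eq hf).symm

theorem derivOp_zero_wtransform {f : ℝ → ℝ} (hf : sobolevNorm 3 f < ⊤) :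
    (derivOp 0 (wtransform f) : ℝ → ℂ) =ᵐ[volume] fun x => (f x : ℂ) := by
  rw [derivOp_apply (by norm_num), mulOp_wtransform hf, FourierTransform.fourierInv_fourier_eq]
  exact MemLp.coeFn_toLp _

theorem fourierL2_sub {f g : ℝ → ℝ} (hf : MemLp f 2) (hg : MemLp g 2) :
    fourierL2 (fun x => f x - g x) =ᵐ[volume] fun ξ => fourierL2 f ξ - fourierL2 g ξ := by
  have hfg : MemLp (fun x => f x - g x) 2 := hf.sub hg
  rw [fourierL2_eq hf, fourierL2_eq hg, fourierL2_eq hfg]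
  have e : (memLp_ofReal hfg).toLp _ = (memLp_ofReal hf).toLp _ - (memLp_ofReal hg).toLp _ := by
    rw [← MemLp.toLp_sub]
    exact MemLp.toLp_congr _ _ (Eventually.of_forall fun x => by simp)
  rw [e]
  have e2 : (𝓕 ((memLp_ofReal hf).toLp _ - (memLp_ofReal hg).toLp _ : L2) : L2) =
      𝓕 ((memLp_ofReal hf).toLp _ : L2) - 𝓕 ((memLp_ofReal hg).toLp _ : L2) :=
    map_sub (Lp.fourierTransformₗᵢ ℝ ℂ) _ _
  rw [e2]
  exact Lp.coeFn_sub _ _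

/-- `wtransform` is an isometry of `H³` into `L²`, so continuity in time in `H³` becomes norm
continuity of a curve in `L²`. -/
theorem sobolevNorm_sub {f g : ℝ → ℝ} (hf : sobolevNorm 3 f < ⊤) (hg : sobolevNorm 3 g < ⊤) :
    sobolevNorm 3 (fun x => f x - g x) = ‖wtransform f - wtransform g‖ₑ := by
  have hf2 := memLp_of_sobolevNorm_lt_top hf
  have hg2 := memLp_of_sobolevNorm_lt_top hg
  rw [sobolevNorm_eq (f := fun x => f x - g x) (hf2.sub hg2), Lp.enorm_def]
  refine eLpNorm_congr_ae ?_
  filter_upwards [fourierL2_sub hf2 hg2, coeFn_wtransform hf, coeFn_wtransform hg,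
    Lp.coeFn_sub (wtransform f) (wtransform g)] with ξ h1 h2 h3 h4
  rw [h4, Pi.sub_apply, h2, h3, weighted, weighted, weighted, ← mul_sub, h1]

theorem continuousOn_wtransform {T : ℝ} {u : ℝ → ℝ → ℝ} (hu : ContinuousInSobolev 3 T u) :
    ContinuousOn (fun t => wtransform (u t)) (Icc 0 T) := by
  intro t ht
  rw [ContinuousWithinAt, tendsto_iff_edist_tendsto_0]
  refine (hu.2 t ht).congr' ?_
  filter_upwards [self_mem_nhdsWithin] with t' ht'
  rw [sobolevNorm_sub (hu.1 t' ht') (hu.1 t ht), edist_eq_enorm_sub]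

/-! ### From the weak formulation to an equation in `L²` -/

/-- Multiplication by `-2πiξ` on Schwartz functions. -/
noncomputable def freqMul : 𝓢(ℝ, ℂ) →L[ℂ] 𝓢(ℝ, ℂ) :=
  SchwartzMap.smulLeftCLM ℂ (fun ξ : ℝ => -(Complex.I * (2 * Real.pi * ξ : ℝ)))

theorem freqMul_apply (ψ : 𝓢(ℝ, ℂ)) (ξ : ℝ) :
    freqMul ψ ξ = -(Complex.I * (2 * Real.pi * ξ : ℝ)) * ψ ξ := by
  rw [freqMul, SchwartzMap.smulLeftCLM_apply_apply (by fun_prop), smul_eq_mul]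

theorem deriv_fourier_schwartz (ψ : 𝓢(ℝ, ℂ)) :
    deriv (𝓕 (ψ : ℝ → ℂ)) = 𝓕 (freqMul ψ : ℝ → ℂ) := by
  have e : (fun x : ℝ => (-2 * Real.pi * Complex.I * x) • ψ x) = freqMul ψ := by
    ext x
    rw [freqMul_apply, smul_eq_mul]
    push_cast
    ring
  have h2 : Integrable fun x : ℝ => x • ψ x := by
    have h := ((freqMul ψ).integrable (μ := volume)).const_mul (Complex.I / (2 * Real.pi))
    refine h.congr (Eventually.of_forall fun x => ?_)
    have hpi : (Real.pi : ℂ) ≠ 0 := by exact_mod_cast Real.pi_ne_zero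
    dsimp only
    rw [freqMul_apply, Complex.real_smul]
    push_cast
    field_simp
    linear_combination (-(x : ℂ) * ψ x) * Complex.I_sq
  rw [Real.deriv_fourier (ψ.integrable (μ := volume)) h2, e]

theorem iteratedDeriv_two_fourier_schwartz (ψ : 𝓢(ℝ, ℂ)) :
    iteratedDeriv 2 (𝓕 (ψ : ℝ → ℂ)) = 𝓕 (freqMul (freqMul ψ) : ℝ → ℂ) := by
  rw [iteratedDeriv_succ, iteratedDeriv_one, deriv_fourier_schwartz, deriv_fourier_schwartz]

/-- Testing the equations against `𝓕 ψ` moves the Fourier transform onto the solution and leaves `ψ`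
as test function in frequency. -/
theorem integral_mul_fourier_schwartz {f : ℝ → ℝ} (hf : sobolevNorm 3 f < ⊤) (ψ : 𝓢(ℝ, ℂ)) :
    ∫ x, (f x : ℂ) * 𝓕 (ψ : ℝ → ℂ) x = ∫ ξ, sym 0 ξ * wtransform f ξ * ψ ξ := by
  have h := integral_fourier_mul_schwartz
    ((memLp_ofReal (memLp_of_sobolevNorm_lt_top hf)).toLp _) ψ
  rw [← mulOp_wtransform hf] at h
  calc _ = ∫ x, ((memLp_ofReal (memLp_of_sobolevNorm_lt_top hf)).toLp _ : L2) x *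
        𝓕 (ψ : ℝ → ℂ) x :=
        integral_congr_ae ((MemLp.coeFn_toLp _).mono fun x hx => by dsimp only; rw [hx])
    _ = _ := by
        rw [← h]
        exact integral_congr_ae ((coeFn_mulOp _ _).mono fun x hx => by dsimp only; rw [hx])

theorem integral_prod_mul_fourier_schwartz {f g : ℝ → ℝ} (hf : sobolevNorm 3 f < ⊤)
    (hg : sobolevNorm 3 g < ⊤) (ψ : 𝓢(ℝ, ℂ)) :
    ∫ x, ((f x * g x : ℝ) : ℂ) * 𝓕 (freqMul ψ : ℝ → ℂ) x =
      -∫ ξ, amp (2 * Real.pi * ξ) * bil (wtransform f) (wtransform g) ξ * ψ ξ := by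
  have hae : (fun x => derivOp 0 (wtransform f) x * derivOp 0 (wtransform g) x) =ᵐ[volume]
      fun x => ((f x * g x : ℝ) : ℂ) := by
    filter_upwards [derivOp_zero_wtransform hf, derivOp_zero_wtransform hg] with x h1 h2
    rw [h1, h2, Complex.ofReal_mul]
  have hi := (integrable_derivOp_mul 0 0 (wtransform f) (wtransform g)).congr hae
  rw [← integral_fourier_mul_eq_flip hi (freqMul ψ).integrable, ← integral_neg]
  refine integral_congr_ae ((amp_mul_bil_ae_eq (wtransform f) (wtransform g)).mono fun ξ hξ => ?_)
  dsimp only at hξ ⊢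
  rw [hξ, fourier_derivProd, ← fourier_congr_ae hae, freqMul_apply, prodHat]
  ring

/-- The pairing with a Schwartz function. -/
noncomputable def pairS (ψ : 𝓢(ℝ, ℂ)) : L2 →L[ℂ] ℂ := pairing.flip (ψ.toLp 2)

theorem pairS_apply (ψ : 𝓢(ℝ, ℂ)) (f : L2) : pairS ψ f = ∫ x, f x * ψ x := by
  rw [pairS, ContinuousLinearMap.flip_apply, pairing_apply]
  exact integral_congr_ae ((ψ.coeFn_toLp 2 volume).mono fun x hx => by dsimp only; rw [hx])

theorem eq_of_pairS_eq {f g : L2} (h : ∀ ψ, pairS ψ f = pairS ψ g) : f = g := by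
  refine Lp.ext (ae_eq_of_integral_mul_schwartz ((Lp.memLp f).locallyIntegrable (by norm_num))
    ((Lp.memLp g).locallyIntegrable (by norm_num)) fun ψ => ?_)
  rw [← pairS_apply, ← pairS_apply, h]

/-- The scalar fundamental theorem of calculus holds for every pairing, and the pairings separate
points of `L²`. Weak differentiability with a norm-continuous right-hand side is thus upgraded to
the integrated equation. -/
theorem eq_add_integral_of_pairS {T : ℝ} {y R : ℝ → L2} (hR : Continuous R)
    (h : ∀ ψ, ∀ t ∈ Icc 0 T, HasDerivWithinAt (fun t => pairS ψ (y t)) (pairS ψ (R t)) (Icc 0 T) t)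
    {t : ℝ} (ht : t ∈ Icc 0 T) : y t = y 0 + ∫ s in (0 : ℝ)..t, R s := by
  refine eq_of_pairS_eq fun ψ => ?_
  have hsub : Icc 0 t ⊆ Icc 0 T := Icc_subset_Icc_right ht.2
  have h1 := intervalIntegral.integral_eq_sub_of_hasDerivAt_of_le ht.1
    (f := fun t => pairS ψ (y t)) (f' := fun t => pairS ψ (R t))
    (fun s hs => ((h ψ s (hsub hs)).continuousWithinAt).mono hsub)
    (fun s hs => (h ψ s (hsub (Ioo_subset_Icc_self hs))).hasDerivAt
      (Icc_mem_nhds hs.1 (hs.2.trans_le ht.2)))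
    (((pairS ψ).continuous.comp hR).intervalIntegrable 0 t)
  rw [ContinuousLinearMap.intervalIntegral_comp_comm _ (hR.intervalIntegrable 0 t)] at h1
  rw [map_add, h1]
  ring

theorem hasDerivAt_of_pairS {T : ℝ} {y R : ℝ → L2} (hR : Continuous R)
    (h : ∀ ψ, ∀ t ∈ Icc 0 T, HasDerivWithinAt (fun t => pairS ψ (y t)) (pairS ψ (R t)) (Icc 0 T) t)
    {t : ℝ} (ht : t ∈ Ioo 0 T) : HasDerivAt y (R t) t := by
  have h1 : HasDerivAt (fun t => y 0 + ∫ s in (0 : ℝ)..t, R s) (R t) t :=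
    (hR.integral_hasStrictDerivAt 0 t).hasDerivAt.const_add _
  refine h1.congr_of_eventuallyEq ?_
  filter_upwards [Icc_mem_nhds ht.1 ht.2] with s hs
  exact eq_add_integral_of_pairS hR h hs

/-! ### The propagator and Duhamel's formula -/

theorem continuous_wave_freq {m : ℝ} (hm : 0 ≤ m) (x τ : ℝ) : Continuous (wave m x τ) :=
  (continuous_wave hm).comp (f := fun ξ : ℝ => (x, τ, ξ)) (by fun_prop)

theorem memLp_top_wave {m : ℝ} (hm : 0 ≤ m) (x τ : ℝ) : MemLp (wave m x τ) ∞ :=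
  memLp_top_of_le (continuous_wave_freq hm x τ) 1 fun _ => (norm_wave _ _ _ _).le

/-- The propagator `e^{-iτω}`. -/
noncomputable def prop (m : ℝ) (hm : 0 ≤ m) (τ : ℝ) : L2 →L[ℂ] L2 :=
  mulOp (wave m 0 τ) (memLp_top_wave hm 0 τ)

/-- The regularization `(1 - m∂ₓ²)⁻¹` makes the dispersion relation bounded. The generator is then a
bounded operator and the propagator is differentiable in operator norm. The size of this bound never
enters the final constants. -/
theorem abs_om_le {m : ℝ} (hm : 0 < m) (k : ℝ) : |om m k| ≤ (√m)⁻¹ := by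
  have hs : 0 < √m := Real.sqrt_pos.2 hm
  have h := lam_sq_mul hm.le k
  have hp := lam_pos hm.le k
  have h2 : |om m k * √m| ≤ 1 := by
    refine abs_le_one_iff_mul_self_le_one.2 ?_
    calc om m k * √m * (om m k * √m) = lam m k ^ 2 * (k ^ 2 * √m ^ 2) := by rw [om]; ring
      _ = lam m k ^ 2 * (1 + m * k ^ 2) - lam m k ^ 2 := by rw [Real.sq_sqrt hm.le]; ring
      _ ≤ 1 := by rw [h]; nlinarith
  rw [abs_mul, abs_of_pos hs] at h2
  rwa [← one_div, le_div_iff₀ hs]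

theorem memLp_top_om {m : ℝ} (hm : 0 < m) :
    MemLp (fun ξ : ℝ => -(Complex.I * (om m (2 * Real.pi * ξ) : ℝ))) ∞ := by
  have := continuous_om hm.le
  refine memLp_top_of_le (by fun_prop) (√m)⁻¹ fun ξ => ?_
  rw [norm_neg, norm_mul, Complex.norm_I, one_mul, Complex.norm_real]
  exact abs_om_le hm _

/-- The generator `-iω`. -/
noncomputable def gen (m : ℝ) (hm : 0 < m) : L2 →L[ℂ] L2 := mulOp _ (memLp_top_om hm)

theorem wave_zero_add (m τ h ξ : ℝ) :
    wave m 0 (τ + h) ξ = wave m 0 τ ξ * Complex.exp (h * -(Complex.I * (om m (2 * Real.pi * ξ) : ℝ))) := by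
  rw [wave, wave, osc, osc, ← Complex.exp_add]
  congr 1
  simp only [phase]
  push_cast
  ring

theorem hasDerivAt_prop {m : ℝ} (hm : 0 < m) (τ : ℝ) :
    HasDerivAt (fun τ => (prop m hm.le τ).restrictScalars ℝ)
      ((prop m hm.le τ ∘L gen m hm).restrictScalars ℝ) τ := by
  have hs : 0 < √m := Real.sqrt_pos.2 hm
  rw [hasDerivAt_iff_isLittleO_nhds_zero]
  -- The remainder is multiplication by `e^z - 1 - z` with `|z| ≤ |h|/√m`, hence quadratic in `h`
  -- once `|z| ≤ 1`.
  have hO : (fun h : ℝ => (prop m hm.le (τ + h)).restrictScalars ℝ -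
      (prop m hm.le τ).restrictScalars ℝ -
      h • (prop m hm.le τ ∘L gen m hm).restrictScalars ℝ) =O[𝓝 0] fun h : ℝ => h ^ 2 := by
    refine Asymptotics.IsBigO.of_bound ((√m)⁻¹ ^ 2) ?_
    have hev : ∀ᶠ h : ℝ in 𝓝 0, |h| < √m := by
      have := Metric.ball_mem_nhds (0 : ℝ) hs
      filter_upwards [this] with h hh
      simpa using hh
    filter_upwards [hev] with h hh
    refine ContinuousLinearMap.opNorm_le_bound _ (by positivity) fun f => ?_
    refine Lp.norm_le_mul_norm_of_ae_le_mul ?_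
    have e : ((prop m hm.le (τ + h)).restrictScalars ℝ - (prop m hm.le τ).restrictScalars ℝ -
        h • (prop m hm.le τ ∘L gen m hm).restrictScalars ℝ) f =
        prop m hm.le (τ + h) f - prop m hm.le τ f - h • prop m hm.le τ (gen m hm f) := rfl
    rw [e]
    filter_upwards [coeFn_mulOp (memLp_top_wave hm.le 0 (τ + h)) f,
      coeFn_mulOp (memLp_top_wave hm.le 0 τ) f,
      coeFn_mulOp (memLp_top_wave hm.le 0 τ) (gen m hm f), coeFn_mulOp (memLp_top_om hm) f,
      Lp.coeFn_sub (prop m hm.le (τ + h) f - prop m hm.le τ f) (h • prop m hm.le τ (gen m hm f)),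
      Lp.coeFn_sub (prop m hm.le (τ + h) f) (prop m hm.le τ f),
      Lp.coeFn_smul h (prop m hm.le τ (gen m hm f))] with ξ h1 h2 h3 h4 h5 h6 h7
    rw [h5, Pi.sub_apply, h6, Pi.sub_apply, h7, Pi.smul_apply, prop, prop, h1, h2, h3, gen, h4,
      wave_zero_add]
    set z : ℂ := h * -(Complex.I * (om m (2 * Real.pi * ξ) : ℝ)) with hz
    have hzn : ‖z‖ ≤ |h| * (√m)⁻¹ := by
      rw [hz, norm_mul, norm_neg, norm_mul, Complex.norm_I, one_mul, Complex.norm_real,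
        Complex.norm_real, Real.norm_eq_abs, Real.norm_eq_abs]
      exact mul_le_mul_of_nonneg_left (abs_om_le hm _) (abs_nonneg h)
    have hz1 : ‖z‖ ≤ 1 := by
      refine hzn.trans ?_
      rw [← div_eq_mul_inv, div_le_one hs]
      exact hh.le
    have e2 : wave m 0 τ ξ * Complex.exp z * f ξ - wave m 0 τ ξ * f ξ -
        h • (wave m 0 τ ξ * (-(Complex.I * (om m (2 * Real.pi * ξ) : ℝ)) * f ξ)) =
        wave m 0 τ ξ * (Complex.exp z - 1 - z) * f ξ := by
      rw [Complex.real_smul, hz]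
      ring
    rw [e2, norm_mul, norm_mul, norm_wave, one_mul]
    refine mul_le_mul_of_nonneg_right ((Complex.norm_exp_sub_one_sub_id_le hz1).trans ?_)
      (norm_nonneg _)
    calc ‖z‖ ^ 2 ≤ (|h| * (√m)⁻¹) ^ 2 := by gcongr
      _ = _ := by rw [mul_pow, sq_abs, Real.norm_of_nonneg (sq_nonneg h)]; ring
  exact hO.trans_isLittleO (Asymptotics.isLittleO_pow_id one_lt_two)

theorem prop_zero {m : ℝ} (hm : 0 ≤ m) (f : L2) : prop m hm 0 f = f := by
  refine Lp.ext ((coeFn_mulOp _ f).trans (Eventually.of_forall fun ξ => ?_))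
  simp [wave, osc, phase]

theorem continuous_prop {m : ℝ} (hm : 0 < m) :
    Continuous fun τ => (prop m hm.le τ).restrictScalars ℝ :=
  continuous_iff_continuousAt.2 fun τ => (hasDerivAt_prop hm τ).continuousAt

theorem continuous_prop_apply {m : ℝ} (hm : 0 < m) : Continuous fun p : ℝ × L2 => prop m hm.le p.1 p.2 :=
  ((continuous_prop hm).comp continuous_fst).clm_apply continuous_snd

/-- Duhamel's formula for `P' = κ(-iω)P + Q`. -/
theorem duhamel {m : ℝ} (hm : 0 < m) {κ T : ℝ} {P Q : ℝ → L2} (hQ : Continuous Q)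
    (hPc : ContinuousOn P (Icc 0 T))
    (hP : ∀ t ∈ Ioo 0 T, HasDerivAt P ((κ : ℂ) • gen m hm (P t) + Q t) t) {t : ℝ}
    (ht : t ∈ Icc 0 T) :
    P t = prop m hm.le (κ * t) (P 0) + ∫ s in (0 : ℝ)..t, prop m hm.le (κ * (t - s)) (Q s) := by
  -- Pulling `P s` forward to time `t` by the free flow cancels the two generator terms and leaves
  -- the source.
  have hd : ∀ s ∈ Ioo 0 t, HasDerivAt (fun s => prop m hm.le (κ * (t - s)) (P s))
      (prop m hm.le (κ * (t - s)) (Q s)) s := by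
    intro s hs
    have h1 : HasDerivAt (fun s => κ * (t - s)) (-κ) s := by
      simpa using ((hasDerivAt_id s).const_sub t).const_mul κ
    have h2 := (hasDerivAt_prop hm (κ * (t - s))).scomp s h1
    have h3 := h2.clm_apply (hP s ⟨hs.1, hs.2.trans_le ht.2⟩)
    refine h3.congr_deriv ?_
    change (-κ) • prop m hm.le (κ * (t - s)) (gen m hm (P s)) +
      prop m hm.le (κ * (t - s)) ((κ : ℂ) • gen m hm (P s) + Q s) = _
    rw [map_add, map_smul, neg_smul]
    exact neg_add_cancel_left _ _
  have hc : Continuous fun s => prop m hm.le (κ * (t - s)) (Q s) :=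
    (continuous_prop_apply hm).comp (f := fun s => (κ * (t - s), Q s)) (by fun_prop)
  have hc2 : ContinuousOn (fun s => prop m hm.le (κ * (t - s)) (P s)) (Icc 0 t) :=
    (continuous_prop_apply hm).comp_continuousOn (f := fun s => (κ * (t - s), P s))
      (ContinuousOn.prodMk (by fun_prop) (hPc.mono (Icc_subset_Icc_right ht.2)))
  have h := intervalIntegral.integral_eq_sub_of_hasDerivAt_of_le ht.1 hc2 hd
    (hc.intervalIntegrable 0 t)
  rw [h]
  simp [prop_zero]

/-! ### The two equations on the Fourier side -/

/-- The symbol `a(k) λ(k)^j` of the nonlinear terms. -/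
noncomputable def al (m : ℝ) (j : ℕ) (ξ : ℝ) : ℂ :=
  amp (2 * Real.pi * ξ) * ((lam m (2 * Real.pi * ξ) : ℝ) : ℂ) ^ j

theorem continuous_al {m : ℝ} (hm : 0 ≤ m) (j : ℕ) : Continuous (al m j) := by
  have := continuous_lam hm
  have := continuous_amp
  unfold al
  fun_prop

theorem norm_al_le {m : ℝ} (hm : 0 ≤ m) (j : ℕ) (ξ : ℝ) : ‖al m j ξ‖ ≤ ‖amp (2 * Real.pi * ξ)‖ := by
  rw [al, norm_mul, norm_pow, Complex.norm_real, Real.norm_of_nonneg (lam_pos hm _).le]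
  exact mul_le_of_le_one_right (norm_nonneg _)
    (pow_le_one₀ (lam_pos hm _).le (lam_le_one hm _))

theorem norm_al_le_one {m : ℝ} (hm : 0 ≤ m) (j : ℕ) (ξ : ℝ) : ‖al m j ξ‖ ≤ 1 :=
  (norm_al_le hm j ξ).trans (norm_amp_le_one _)

theorem memLp_top_al {m : ℝ} (hm : 0 ≤ m) (j : ℕ) : MemLp (al m j) ∞ :=
  memLp_top_of_le (continuous_al hm j) 1 (norm_al_le_one hm j)

/-- Multiplication by `al m j`. -/
noncomputable def alOp (m : ℝ) (hm : 0 ≤ m) (j : ℕ) : L2 →L[ℂ] L2 := mulOp _ (memLp_top_al hm j)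

theorem memLp_top_lam {m : ℝ} (hm : 0 ≤ m) : MemLp (fun ξ : ℝ => ((lam m (2 * Real.pi * ξ) : ℝ) : ℂ)) ∞ := by
  have := continuous_lam hm
  refine memLp_top_of_le (by fun_prop) 1 fun ξ => ?_
  rw [Complex.norm_real, Real.norm_of_nonneg (lam_pos hm _).le]
  exact lam_le_one hm _

/-- Multiplication by `λ`. -/
noncomputable def lamOp (m : ℝ) (hm : 0 ≤ m) : L2 →L[ℂ] L2 := mulOp _ (memLp_top_lam hm)

/-- The symbol `(1 + m k²)(1 + k²)^{-3/2}`. -/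
noncomputable def symM (m ξ : ℝ) : ℂ := ((1 + m * (2 * Real.pi * ξ) ^ 2 : ℝ) : ℂ) * sym 0 ξ

theorem memLp_top_symM {m : ℝ} (hm : 0 ≤ m) (hm1 : m ≤ 1) : MemLp (symM m) ∞ := by
  have hc := continuous_sym 0
  refine memLp_top_of_le (by unfold symM; fun_prop) 1 fun ξ => ?_
  have hp := lam_pos (m := 1) zero_le_one (2 * Real.pi * ξ)
  have h1 := lam_le_one (m := 1) zero_le_one (2 * Real.pi * ξ)
  have h2 := lam_sq_mul (m := 1) zero_le_one (2 * Real.pi * ξ)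
  rw [symM, norm_mul, sym, pow_zero, one_mul, Complex.norm_real, Complex.norm_real,
    Real.norm_of_nonneg (by positivity), Real.norm_of_nonneg (by positivity)]
  calc _ ≤ (1 + 1 * (2 * Real.pi * ξ) ^ 2) * lam 1 (2 * Real.pi * ξ) ^ 3 := by gcongr
    _ = (lam 1 (2 * Real.pi * ξ) ^ 2 * (1 + 1 * (2 * Real.pi * ξ) ^ 2)) * lam 1 (2 * Real.pi * ξ) := by
        ring
    _ ≤ 1 := by rw [h2, one_mul]; exact h1

/-- The Schwartz function whose Fourier transform is `ψ̂ - m ψ̂''`. -/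
noncomputable def momTest (m : ℝ) (ψ : 𝓢(ℝ, ℂ)) : 𝓢(ℝ, ℂ) := ψ - (m : ℂ) • freqMul (freqMul ψ)

theorem momTest_apply (m : ℝ) (ψ : 𝓢(ℝ, ℂ)) (ξ : ℝ) :
    momTest m ψ ξ = ((1 + m * (2 * Real.pi * ξ) ^ 2 : ℝ) : ℂ) * ψ ξ := by
  rw [momTest, sub_apply, smul_apply, freqMul_apply, freqMul_apply]
  push_cast
  rw [smul_eq_mul]
  linear_combination (-(m : ℂ) * (2 * Real.pi * ξ) ^ 2 * ψ ξ) * Complex.I_sq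

theorem fourier_momTest (m : ℝ) (ψ : 𝓢(ℝ, ℂ)) (x : ℝ) :
    𝓕 (momTest m ψ : ℝ → ℂ) x =
      𝓕 (ψ : ℝ → ℂ) x - m * iteratedDeriv 2 (𝓕 (ψ : ℝ → ℂ)) x := by
  have e : (momTest m ψ : ℝ → ℂ) = fun ξ => ψ ξ + (-(m : ℂ)) * freqMul (freqMul ψ) ξ := by
    ext ξ
    rw [momTest, sub_apply, smul_apply, smul_eq_mul]
    ring
  rw [e, fourier_add_apply ψ.integrable ((SchwartzMap.integrable _).const_mul _),
    fourier_const_mul_apply, iteratedDeriv_two_fourier_schwartz]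
  ring

theorem pairS_mulOp {θ : ℝ → ℂ} (hθ : MemLp θ ∞) (f : L2) (ψ : 𝓢(ℝ, ℂ)) :
    pairS ψ (mulOp θ hθ f) = ∫ ξ, θ ξ * f ξ * ψ ξ := by
  rw [pairS_apply]
  exact integral_congr_ae ((coeFn_mulOp hθ f).mono fun x hx => by dsimp only; rw [hx])

theorem integrable_mul_fourier_schwartz {f : ℝ → ℝ} (hf : MemLp f 2) (ψ : 𝓢(ℝ, ℂ)) :
    Integrable fun x => (f x : ℂ) * 𝓕 (ψ : ℝ → ℂ) x := by
  have h : MemLp (𝓕 (ψ : ℝ → ℂ) : ℝ → ℂ) 2 := by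
    rw [← SchwartzMap.fourier_coe]; exact SchwartzMap.memLp _ 2 volume
  exact (memLp_ofReal hf).integrable_mul h

theorem integrable_prod_mul_fourier_schwartz {f g : ℝ → ℝ} (hf : MemLp f 2) (hg : MemLp g 2)
    (ψ : 𝓢(ℝ, ℂ)) : Integrable fun x => ((f x * g x : ℝ) : ℂ) * 𝓕 (ψ : ℝ → ℂ) x := by
  have h : MemLp (𝓕 (ψ : ℝ → ℂ) : ℝ → ℂ) ∞ := by
    rw [← SchwartzMap.fourier_coe]; exact SchwartzMap.memLp _ ∞ volume
  have h1 : Integrable fun x => ((f x * g x : ℝ) : ℂ) := (hf.integrable_mul hg).ofReal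
  have := h.mul (r := 1) (memLp_one_iff_integrable.2 h1)
  exact memLp_one_iff_integrable.1 this

section solution

variable {ε μ T : ℝ} {ζ V : ℝ → ℝ → ℝ}

theorem sym_zero_freqMul (ψ : 𝓢(ℝ, ℂ)) (ξ : ℝ) (w : ℂ) :
    sym 0 ξ * w * freqMul ψ ξ = -(sym 1 ξ * w * ψ ξ) := by
  rw [freqMul_apply, sym, sym]
  ring

/-- Division by `ε` leaves `1/ε` on the linear term only; the nonlinear term `∂ₓ(ζV)` has
coefficient one and is rewritten through `amp` and `bil`. -/
theorem IsSolution.weak_mass (h : IsSolution ε μ T ζ V) (hε : 0 < ε) {m : ℝ} (hm : 0 ≤ m)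
    (ψ : 𝓢(ℝ, ℂ)) {t : ℝ} (ht : t ∈ Icc 0 T) :
    HasDerivWithinAt (fun t' => pairS ψ (mulOp (sym 0) (memLp_top_sym (by norm_num))
        (wtransform (ζ t'))))
      (pairS ψ (-((ε⁻¹ : ℂ) • mulOp (sym 1) (memLp_top_sym (by norm_num)) (wtransform (V t))) -
        alOp m hm 0 (bil (wtransform (ζ t)) (wtransform (V t))))) (Icc 0 T) t := by
  have hζ := h.continuous_zeta.1
  have hV := h.continuous_V.1
  have hεC : (ε : ℂ) ≠ 0 := by exact_mod_cast hε.ne'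
  have h1 := (h.mass (𝓕 ψ) t ht).const_mul (ε⁻¹ : ℂ)
  rw [SchwartzMap.fourier_coe, deriv_fourier_schwartz] at h1
  refine (h1.congr_deriv ?_).congr_of_mem (fun t' ht' => ?_) ht
  · have e : ∀ x, (((1 + ε * ζ t x) * V t x : ℝ) : ℂ) * 𝓕 (freqMul ψ : ℝ → ℂ) x =
        (V t x : ℂ) * 𝓕 (freqMul ψ : ℝ → ℂ) x +
        (ε : ℂ) * (((ζ t x * V t x : ℝ) : ℂ) * 𝓕 (freqMul ψ : ℝ → ℂ) x) := fun x => by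
      push_cast; ring
    simp_rw [e]
    rw [integral_add (integrable_mul_fourier_schwartz (memLp_of_sobolevNorm_lt_top (hV t ht)) _)
      ((integrable_prod_mul_fourier_schwartz (memLp_of_sobolevNorm_lt_top (hζ t ht))
        (memLp_of_sobolevNorm_lt_top (hV t ht)) _).const_mul _), integral_const_mul,
      integral_prod_mul_fourier_schwartz (hζ t ht) (hV t ht),
      integral_mul_fourier_schwartz (hV t ht), map_sub, map_neg, map_smul, alOp, pairS_mulOp,
      pairS_mulOp, smul_eq_mul]
    simp only [sym_zero_freqMul, integral_neg, al, pow_zero, mul_one]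
    field_simp
    ring
  · rw [pairS_mulOp, integral_mul_fourier_schwartz (hζ t' ht')]
    field_simp

/-- The unknown is `(1 - m∂ₓ²)V`, so that no operator has to be inverted in the weak form; the test
function `momTest` carries this factor. The coefficient `1/2` comes from `V∂ₓV = ∂ₓ(V²)/2`. -/
theorem IsSolution.weak_momentum (h : IsSolution ε μ T ζ V) (hε : 0 < ε) (hm : 0 ≤ μ / 3)
    (hm1 : μ / 3 ≤ 1) (ψ : 𝓢(ℝ, ℂ)) {t : ℝ} (ht : t ∈ Icc 0 T) :
    HasDerivWithinAt (fun t' => pairS ψ (mulOp (symM (μ / 3)) (memLp_top_symM hm hm1)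
        (wtransform (V t'))))
      (pairS ψ (-((ε⁻¹ : ℂ) • mulOp (sym 1) (memLp_top_sym (by norm_num)) (wtransform (ζ t))) -
        (2⁻¹ : ℂ) • alOp (μ / 3) hm 0 (bil (wtransform (V t)) (wtransform (V t))))) (Icc 0 T) t := by
  have hζ := h.continuous_zeta.1
  have hV := h.continuous_V.1
  have hεC : (ε : ℂ) ≠ 0 := by exact_mod_cast hε.ne'
  have h1 := (h.momentum (𝓕 ψ) t ht).const_mul (ε⁻¹ : ℂ)
  rw [SchwartzMap.fourier_coe, deriv_fourier_schwartz] at h1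
  refine (h1.congr_deriv ?_).congr_of_mem (fun t' ht' => ?_) ht
  · have e : ∀ x, ((ζ t x + ε * (V t x) ^ 2 / 2 : ℝ) : ℂ) * 𝓕 (freqMul ψ : ℝ → ℂ) x =
        (ζ t x : ℂ) * 𝓕 (freqMul ψ : ℝ → ℂ) x +
        (ε / 2 : ℂ) * (((V t x * V t x : ℝ) : ℂ) * 𝓕 (freqMul ψ : ℝ → ℂ) x) := fun x => by
      push_cast; ring
    simp_rw [e]
    rw [integral_add (integrable_mul_fourier_schwartz (memLp_of_sobolevNorm_lt_top (hζ t ht)) _)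
      ((integrable_prod_mul_fourier_schwartz (memLp_of_sobolevNorm_lt_top (hV t ht))
        (memLp_of_sobolevNorm_lt_top (hV t ht)) _).const_mul _), integral_const_mul,
      integral_prod_mul_fourier_schwartz (hV t ht) (hV t ht),
      integral_mul_fourier_schwartz (hζ t ht), map_sub, map_neg, map_smul, map_smul, alOp,
      pairS_mulOp, pairS_mulOp, smul_eq_mul, smul_eq_mul]
    simp only [sym_zero_freqMul, integral_neg, al, pow_zero, mul_one]
    field_simp
    ring
  · have e : ∀ x, (V t' x : ℂ) * (𝓕 (ψ : ℝ → ℂ) x - (μ / 3 : ℂ) * iteratedDeriv 2 (𝓕 (ψ : ℝ → ℂ)) x) =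
        (V t' x : ℂ) * 𝓕 (momTest (μ / 3) ψ : ℝ → ℂ) x := fun x => by
      rw [fourier_momTest]; push_cast; rfl
    simp_rw [e]
    rw [pairS_mulOp, integral_mul_fourier_schwartz (hV t' ht'), ← mul_assoc,
      inv_mul_cancel₀ hεC, one_mul]
    refine integral_congr_ae (Eventually.of_forall fun ξ => ?_)
    dsimp only
    rw [momTest_apply, symM]
    ring

end solution

/-! ### Riemann invariants -/

theorem mulOp_comm {θ η : ℝ → ℂ} (hθ : MemLp θ ∞) (hη : MemLp η ∞) (f : L2) :
    mulOp θ hθ (mulOp η hη f) = mulOp η hη (mulOp θ hθ f) := by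
  refine Lp.ext ?_
  filter_upwards [coeFn_mulOp hθ (mulOp η hη f), coeFn_mulOp hη f, coeFn_mulOp hθ f,
    coeFn_mulOp hη (mulOp θ hθ f)] with x h1 h2 h3 h4
  rw [h1, h2, h4, h3]
  ring

/-- The bilinear Duhamel integral with wave speed `κ`. -/
noncomputable def duh (m : ℝ) (hm : 0 ≤ m) (j : ℕ) (κ : ℝ) (f g : ℝ → L2) (t : ℝ) : L2 :=
  ∫ s in (0 : ℝ)..t, prop m hm (κ * (t - s)) (alOp m hm j (bil (f s) (g s)))

theorem continuous_duh_integrand {m : ℝ} (hm : 0 < m) (j : ℕ) (κ : ℝ) {f g : ℝ → L2}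
    (hf : Continuous f) (hg : Continuous g) (t : ℝ) :
    Continuous fun s => prop m hm.le (κ * (t - s)) (alOp m hm.le j (bil (f s) (g s))) :=
  (continuous_prop_apply hm).comp
    (f := fun s => (κ * (t - s), alOp m hm.le j (bil (f s) (g s)))) (by fun_prop)

theorem lamOp_alOp {m : ℝ} (hm : 0 ≤ m) (j : ℕ) (f : L2) :
    lamOp m hm (alOp m hm j f) = alOp m hm (j + 1) f := by
  refine Lp.ext ?_
  filter_upwards [coeFn_mulOp (memLp_top_lam hm) (alOp m hm j f),
    coeFn_mulOp (memLp_top_al hm j) f, coeFn_mulOp (memLp_top_al hm (j + 1)) f] with x h1 h2 h3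
  rw [lamOp, h1, alOp, alOp, h2, h3, al, al, pow_succ]
  ring

/-- Fourier multipliers commute with the propagator, so a factor `lam` only raises the exponent in
the nonlinear symbol. -/
theorem lamOp_duh {m : ℝ} (hm : 0 < m) (j : ℕ) (κ : ℝ) {f g : ℝ → L2}
    (hf : Continuous f) (hg : Continuous g) (t : ℝ) :
    lamOp m hm.le (duh m hm.le j κ f g t) = duh m hm.le (j + 1) κ f g t := by
  rw [duh, duh, ← ContinuousLinearMap.intervalIntegral_comp_comm _
    ((continuous_duh_integrand hm j κ hf hg t).intervalIntegrable 0 t)]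
  refine intervalIntegral.integral_congr fun s _ => ?_
  rw [lamOp, prop, mulOp_comm, ← lamOp, lamOp_alOp]

/-- The Riemann invariant `ζ̂ + σ λ⁻¹ V̂`. -/
noncomputable def riem (m : ℝ) (hm : 0 ≤ m) (hm1 : m ≤ 1) (σ : ℝ) : L2 × L2 →L[ℂ] L2 :=
  mulOp (sym 0) (memLp_top_sym (by norm_num)) ∘L ContinuousLinearMap.fst ℂ L2 L2 +
    -- Since `λ · symM = λ⁻¹ · sym 0`, the unbounded factor `λ⁻¹` is expressed by bounded
    -- multipliers.
    (σ : ℂ) • (lamOp m hm ∘L mulOp (symM m) (memLp_top_symM hm hm1)) ∘L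
      ContinuousLinearMap.snd ℂ L2 L2

theorem riem_apply {m : ℝ} (hm : 0 ≤ m) (hm1 : m ≤ 1) (σ : ℝ) (f g : L2) :
    riem m hm hm1 σ (f, g) = mulOp (sym 0) (memLp_top_sym (by norm_num)) f +
      (σ : ℂ) • lamOp m hm (mulOp (symM m) (memLp_top_symM hm hm1) g) := rfl

theorem sym_zero_eq_riem {m : ℝ} (hm : 0 ≤ m) (hm1 : m ≤ 1) (f g : L2) :
    mulOp (sym 0) (memLp_top_sym (by norm_num)) f =
      (2⁻¹ : ℂ) • (riem m hm hm1 1 (f, g) + riem m hm hm1 (-1) (f, g)) := by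
  rw [riem_apply, riem_apply]
  push_cast
  module

theorem lamOp_lamOp_symM {m : ℝ} (hm : 0 ≤ m) (hm1 : m ≤ 1) (f : L2) :
    lamOp m hm (lamOp m hm (mulOp (symM m) (memLp_top_symM hm hm1) f)) =
      mulOp (sym 0) (memLp_top_sym (by norm_num)) f := by
  refine Lp.ext ?_
  filter_upwards [coeFn_mulOp (memLp_top_lam hm) (lamOp m hm (mulOp (symM m) (memLp_top_symM hm hm1) f)),
    coeFn_mulOp (memLp_top_lam hm) (mulOp (symM m) (memLp_top_symM hm hm1) f),
    coeFn_mulOp (memLp_top_symM hm hm1) f,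
    coeFn_mulOp (memLp_top_sym (j := 0) (by norm_num)) f] with ξ h1 h2 h3 h4
  rw [lamOp] at h1 ⊢
  rw [h1, h2, h3, h4, symM]
  have h := lam_sq_mul hm (2 * Real.pi * ξ)
  have h' : ((lam m (2 * Real.pi * ξ) : ℝ) : ℂ) ^ 2 * ((1 + m * (2 * Real.pi * ξ) ^ 2 : ℝ) : ℂ) = 1 := by
    exact_mod_cast h
  linear_combination (sym 0 ξ * f ξ) * h'

theorem sym_zero_eq_lamOp_riem {m : ℝ} (hm : 0 ≤ m) (hm1 : m ≤ 1) (f g : L2) :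
    mulOp (sym 0) (memLp_top_sym (by norm_num)) g =
      (2⁻¹ : ℂ) • lamOp m hm (riem m hm hm1 1 (f, g) - riem m hm hm1 (-1) (f, g)) := by
  have e : riem m hm hm1 1 (f, g) - riem m hm hm1 (-1) (f, g) =
      (2 : ℂ) • lamOp m hm (mulOp (symM m) (memLp_top_symM hm hm1) g) := by
    rw [riem_apply, riem_apply]
    push_cast
    module
  rw [e, map_smul, lamOp_lamOp_symM hm hm1]
  module

/-- The diagonalization: `ω = kλ` and `ωλ⁻¹ = k`, and `σ² = 1`, so the linear part of the system
acts on each invariant as multiplication by `-iσω`. -/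
theorem gen_riem {m : ℝ} (hm : 0 < m) (hm1 : m ≤ 1) {σ : ℝ} (hσ : σ ^ 2 = 1) (f g : L2) :
    (σ : ℂ) • gen m hm (riem m hm.le hm1 σ (f, g)) =
      -(mulOp (sym 1) (memLp_top_sym (by norm_num)) g +
        (σ : ℂ) • lamOp m hm.le (mulOp (sym 1) (memLp_top_sym (by norm_num)) f)) := by
  have hσ' : (σ : ℂ) ^ 2 = 1 := by exact_mod_cast hσ
  have e : ∀ f : L2, gen m hm (mulOp (sym 0) (memLp_top_sym (by norm_num)) f) =
      -lamOp m hm.le (mulOp (sym 1) (memLp_top_sym (by norm_num)) f) := fun f => by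
    refine Lp.ext ?_
    filter_upwards [coeFn_mulOp (memLp_top_om hm) (mulOp (sym 0) (memLp_top_sym (by norm_num)) f),
      coeFn_mulOp (memLp_top_sym (j := 0) (by norm_num)) f,
      coeFn_mulOp (memLp_top_lam hm.le) (mulOp (sym 1) (memLp_top_sym (by norm_num)) f),
      coeFn_mulOp (memLp_top_sym (j := 1) (by norm_num)) f,
      Lp.coeFn_neg (lamOp m hm.le (mulOp (sym 1) (memLp_top_sym (by norm_num)) f))]
      with ξ h1 h2 h3 h4 h5
    rw [gen, h1, h2, h5, Pi.neg_apply, lamOp, h3, h4, sym, sym, om]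
    push_cast
    ring
  have e2 : gen m hm (lamOp m hm.le (mulOp (symM m) (memLp_top_symM hm.le hm1) g)) =
      -mulOp (sym 1) (memLp_top_sym (by norm_num)) g := by
    refine Lp.ext ?_
    filter_upwards [coeFn_mulOp (memLp_top_om hm)
        (lamOp m hm.le (mulOp (symM m) (memLp_top_symM hm.le hm1) g)),
      coeFn_mulOp (memLp_top_lam hm.le) (mulOp (symM m) (memLp_top_symM hm.le hm1) g),
      coeFn_mulOp (memLp_top_symM hm.le hm1) g,
      coeFn_mulOp (memLp_top_sym (j := 1) (by norm_num)) g,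
      Lp.coeFn_neg (mulOp (sym 1) (memLp_top_sym (by norm_num)) g)] with ξ h1 h2 h3 h4 h5
    rw [gen, h1, lamOp, h2, h3, h5, Pi.neg_apply, h4, symM, sym, sym, om]
    have h := lam_sq_mul hm.le (2 * Real.pi * ξ)
    have h' : ((lam m (2 * Real.pi * ξ) : ℝ) : ℂ) ^ 2 *
        ((1 + m * (2 * Real.pi * ξ) ^ 2 : ℝ) : ℂ) = 1 := by exact_mod_cast h
    push_cast at h' ⊢
    linear_combination (-(Complex.I * (2 * Real.pi * ξ) *
      (lam 1 (2 * Real.pi * ξ) : ℂ) ^ 3 * g ξ)) * h'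
  rw [riem_apply, map_add, map_smul, e, e2, smul_add, smul_smul, ← sq, hσ']
  module

/-- The weighted Fourier transforms of a solution form continuous curves in `L²`. -/
theorem IsSolution.exists_curves {ε μ T M : ℝ} {ζ V : ℝ → ℝ → ℝ} (h : IsSolution ε μ T ζ V)
    (hT : 0 < T) (hM : 0 < M)
    (hb : ∀ t ∈ Icc 0 T, sobolevNorm 3 (ζ t) + sobolevNorm 3 (V t) ≤ ENNReal.ofReal M) :
    ∃ z v : ℝ → L2, Continuous z ∧ Continuous v ∧ (∀ t, ‖z t‖ ≤ M) ∧ (∀ t, ‖v t‖ ≤ M) ∧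
      ∀ t ∈ Icc 0 T, z t = wtransform (ζ t) ∧ v t = wtransform (V t) := by
  -- The curves are extended by constants outside `[0, T]` through `projIcc`, which keeps continuity
  -- and the bound `M` for all times.
  have hc := fun u (hu : ContinuousInSobolev 3 T u) =>
    (continuousOn_iff_continuous_domRestrict.1 (continuousOn_wtransform hu)).comp
      (continuous_projIcc (h := hT.le))
  have hn : ∀ f : ℝ → ℝ, sobolevNorm 3 f < ⊤ → sobolevNorm 3 f ≤ ENNReal.ofReal M →
      ‖wtransform f‖ ≤ M := fun f hf hfM => by
    rw [← enorm_wtransform hf, ← ofReal_norm] at hfM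
    exact (ENNReal.ofReal_le_ofReal_iff hM.le).1 hfM
  refine ⟨_, _, hc ζ h.continuous_zeta, hc V h.continuous_V, fun t => ?_, fun t => ?_,
    fun t ht => ?_⟩
  · have ht := (projIcc 0 T hT.le t).2
    exact hn _ (h.continuous_zeta.1 _ ht) (le_self_add.trans (hb _ ht))
  · have ht := (projIcc 0 T hT.le t).2
    exact hn _ (h.continuous_V.1 _ ht) (le_add_self.trans (hb _ ht))
  · simp [projIcc_of_mem hT.le ht]

/-- Adding the mass equation and `σλ` times the momentum equation gives a scalar equation of speed
`σ/ε`. The source is `-∂ₓ(ζV) - (σ/2)λ∂ₓ(V²)` on the Fourier side, which explains the exponents 0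
and 1 of the two integrals. -/
theorem duhamel_riem {ε μ T : ℝ} {ζ V : ℝ → ℝ → ℝ} (h : IsSolution ε μ T ζ V) (hε : 0 < ε)
    (hm : 0 < μ / 3) (hm1 : μ / 3 ≤ 1) {z v : ℝ → L2} (hz : Continuous z) (hv : Continuous v)
    (hzv : ∀ t ∈ Icc 0 T, z t = wtransform (ζ t) ∧ v t = wtransform (V t))
    {σ : ℝ} (hσ : σ ^ 2 = 1) {t : ℝ} (ht : t ∈ Icc 0 T) :
    riem (μ / 3) hm.le hm1 σ (z t, v t) =
      prop (μ / 3) hm.le (σ * ε⁻¹ * t) (riem (μ / 3) hm.le hm1 σ (z 0, v 0)) -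
      duh (μ / 3) hm.le 0 (σ * ε⁻¹) z v t - (σ / 2 : ℂ) • duh (μ / 3) hm.le 1 (σ * ε⁻¹) v v t := by
  have h1 : ∀ s ∈ Ioo 0 T, HasDerivAt (fun s => mulOp (sym 0) (memLp_top_sym (by norm_num)) (z s))
      (-((ε⁻¹ : ℂ) • mulOp (sym 1) (memLp_top_sym (by norm_num)) (v s)) -
        alOp (μ / 3) hm.le 0 (bil (z s) (v s))) s := fun s hs =>
    hasDerivAt_of_pairS (y := fun s => mulOp (sym 0) (memLp_top_sym (by norm_num)) (z s))
      (R := fun s => -((ε⁻¹ : ℂ) • mulOp (sym 1) (memLp_top_sym (by norm_num)) (v s)) -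
        alOp (μ / 3) hm.le 0 (bil (z s) (v s))) (by fun_prop) (fun ψ t ht => by
      have := h.weak_mass hε hm.le ψ ht
      rw [← (hzv t ht).1, ← (hzv t ht).2] at this
      exact this.congr_of_mem (fun t' ht' => by rw [(hzv t' ht').1]) ht) hs
  have h2 : ∀ s ∈ Ioo 0 T, HasDerivAt (fun s => mulOp (symM (μ / 3)) (memLp_top_symM hm.le hm1) (v s))
      (-((ε⁻¹ : ℂ) • mulOp (sym 1) (memLp_top_sym (by norm_num)) (z s)) -
        (2⁻¹ : ℂ) • alOp (μ / 3) hm.le 0 (bil (v s) (v s))) s := fun s hs =>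
    hasDerivAt_of_pairS (y := fun s => mulOp (symM (μ / 3)) (memLp_top_symM hm.le hm1) (v s))
      (R := fun s => -((ε⁻¹ : ℂ) • mulOp (sym 1) (memLp_top_sym (by norm_num)) (z s)) -
        (2⁻¹ : ℂ) • alOp (μ / 3) hm.le 0 (bil (v s) (v s))) (by fun_prop) (fun ψ t ht => by
      have := h.weak_momentum hε hm.le hm1 ψ ht
      rw [← (hzv t ht).1, ← (hzv t ht).2] at this
      exact this.congr_of_mem (fun t' ht' => by rw [(hzv t' ht').2]) ht) hs
  have hd := duhamel hm (κ := σ * ε⁻¹) (T := T)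
    (P := fun s => riem (μ / 3) hm.le hm1 σ (z s, v s))
    (Q := fun s => -alOp (μ / 3) hm.le 0 (bil (z s) (v s)) -
      (σ / 2 : ℂ) • alOp (μ / 3) hm.le 1 (bil (v s) (v s))) (by fun_prop)
    (Continuous.continuousOn (by fun_prop)) (fun s hs => ?_) ht
  · rw [hd]
    have i1 := (continuous_duh_integrand hm 0 (σ * ε⁻¹) hz hv t).intervalIntegrable (μ := volume) 0 t
    have i3 : IntervalIntegrable (fun s => (σ / 2 : ℂ) • prop (μ / 3) hm.le (σ * ε⁻¹ * (t - s))
        (alOp (μ / 3) hm.le 1 (bil (v s) (v s)))) volume 0 t :=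
      ((continuous_duh_integrand hm 1 (σ * ε⁻¹) hv hv t).const_smul
        (σ / 2 : ℂ)).intervalIntegrable 0 t
    rw [duh, duh, ← intervalIntegral.integral_smul, sub_sub, ← intervalIntegral.integral_add i1 i3,
      sub_eq_add_neg, ← intervalIntegral.integral_neg]
    congr 1
    refine intervalIntegral.integral_congr fun s _ => ?_
    rw [map_sub, map_neg, map_smul]
    abel
  · have h3 := (h1 s hs).add ((((lamOp (μ / 3) hm.le).restrictScalars ℝ).hasFDerivAt.comp_hasDerivAt s
      (h2 s hs)).const_smul (σ : ℂ))
    refine h3.congr_deriv ?_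
    change _ + (σ : ℂ) • lamOp (μ / 3) hm.le _ = _
    have e : ((σ * ε⁻¹ : ℝ) : ℂ) • gen (μ / 3) hm (riem (μ / 3) hm.le hm1 σ (z s, v s)) =
        (ε⁻¹ : ℂ) • ((σ : ℂ) • gen (μ / 3) hm (riem (μ / 3) hm.le hm1 σ (z s, v s))) := by
      rw [smul_smul]; push_cast; rw [mul_comm]
    rw [e, gen_riem hm hm1 hσ, map_sub, map_neg, map_smul, map_smul, lamOp_alOp]
    module

/-! ### Bounds for the Duhamel integrals -/

theorem norm_amp_le_two_div (k : ℝ) : ‖amp k‖ ≤ 2 * (1 + k ^ 2)⁻¹ := by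
  rw [← div_eq_mul_inv, le_div_iff₀ (by positivity)]
  linarith [norm_amp_le_one k, sq_mul_norm_amp_le_one k]

theorem integrable_amp : Integrable fun ξ : ℝ => amp (2 * Real.pi * ξ) := by
  have hc := continuous_amp
  refine (integrable_inv_one_add_sq_two_pi.const_mul 2).mono'
    (Continuous.aestronglyMeasurable (by fun_prop)) (Eventually.of_forall fun ξ => ?_)
  exact norm_amp_le_two_div _

theorem integrable_al {m : ℝ} (hm : 0 ≤ m) (j : ℕ) : Integrable (al m j) :=
  integrable_amp.norm.mono' (continuous_al hm j).aestronglyMeasurable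
    (Eventually.of_forall fun ξ => norm_al_le hm j ξ)

theorem memLp_two_al {m : ℝ} (hm : 0 ≤ m) (j : ℕ) : MemLp (al m j) 2 := by
  refine (memLp_two_iff_integrable_sq_norm (continuous_al hm j).aestronglyMeasurable).2 ?_
  refine (integrable_al hm j).norm.mono' (by
    have := continuous_al hm j
    exact Continuous.aestronglyMeasurable (by fun_prop)) (Eventually.of_forall fun ξ => ?_)
  rw [Real.norm_of_nonneg (by positivity)]
  exact pow_le_of_le_one (norm_nonneg _) (norm_al_le_one hm j ξ) two_ne_zero

theorem memLp_mul_wave {m : ℝ} (hm : 0 ≤ m) {θ : ℝ → ℂ} {p : ℝ≥0∞} (hθ : MemLp θ p) (x τ : ℝ) :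
    MemLp (fun ξ => θ ξ * wave m x τ ξ) p := by
  refine hθ.mono (hθ.1.mul (continuous_wave_freq hm x τ).aestronglyMeasurable)
    (Eventually.of_forall fun ξ => ?_)
  rw [norm_mul, norm_wave, mul_one]

theorem integrable_mul_wave {m : ℝ} (hm : 0 ≤ m) {θ : ℝ → ℂ} (hθ : Integrable θ) (x τ : ℝ) :
    Integrable (fun ξ => θ ξ * wave m x τ ξ) :=
  memLp_one_iff_integrable.1 (memLp_mul_wave hm (memLp_one_iff_integrable.2 hθ) x τ)

/-- Evaluation at `x` of the inverse Fourier transform of `θ f`. -/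
noncomputable def evalAt (m : ℝ) (hm : 0 ≤ m) {θ : ℝ → ℂ} (hθ : MemLp θ 2) (x : ℝ) : L2 →L[ℂ] ℂ :=
  pairing ((memLp_mul_wave hm hθ x 0).toLp _)

theorem evalAt_apply {m : ℝ} (hm : 0 ≤ m) {θ : ℝ → ℂ} (hθ : MemLp θ 2) (x : ℝ) (f : L2) :
    evalAt m hm hθ x f = ∫ ξ, θ ξ * f ξ * wave m x 0 ξ := by
  rw [evalAt, pairing_apply]
  refine integral_congr_ae ((MemLp.coeFn_toLp (memLp_mul_wave hm hθ x 0)).mono fun ξ h => ?_)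
  dsimp only
  rw [h]
  ring

theorem wave_mul_wave (m x y τ s ξ : ℝ) : wave m x τ ξ * wave m y s ξ = wave m (x + y) (τ + s) ξ := by
  rw [wave, wave, wave, osc, osc, osc, ← Complex.exp_add]
  congr 1
  simp only [phase]
  push_cast
  ring

theorem evalAt_prop {m : ℝ} (hm : 0 ≤ m) {θ : ℝ → ℂ} (hθ : MemLp θ 2) (x τ : ℝ) (f : L2) :
    evalAt m hm hθ x (prop m hm τ f) = ∫ ξ, θ ξ * f ξ * wave m x τ ξ := by
  rw [evalAt_apply]
  refine integral_congr_ae ((coeFn_mulOp (memLp_top_wave hm 0 τ) f).mono fun ξ h => ?_)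
  have e := wave_mul_wave m 0 x τ 0 ξ
  rw [zero_add, add_zero] at e
  dsimp only
  rw [prop, h, ← e]
  ring

theorem fourierInv_eq_integral_wave (m : ℝ) (F : ℝ → ℂ) (x : ℝ) :
    𝓕⁻ F x = ∫ ξ, F ξ * wave m x 0 ξ := by
  rw [Real.fourierInv_eq']
  refine integral_congr_ae (Eventually.of_forall fun ξ => ?_)
  simp only [wave, osc, phase, smul_eq_mul, RCLike.inner_apply, conj_trivial]
  rw [mul_comm]
  congr 2
  push_cast
  ring

theorem fourier_wave (m x τ : ℝ) (θ : ℝ → ℂ) (y : ℝ) :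
    𝓕 (fun ξ => θ ξ * wave m x τ ξ) y = ∫ ξ, θ ξ * wave m (x - y) τ ξ := by
  rw [Real.fourier_eq']
  refine integral_congr_ae (Eventually.of_forall fun ξ => ?_)
  have e := wave_mul_wave m x (-y) τ 0 ξ
  rw [← sub_eq_add_neg, add_zero] at e
  dsimp only
  rw [← e, smul_eq_mul]
  have e2 : wave m (-y) 0 ξ = Complex.exp (((-2 * Real.pi * inner ℝ ξ y : ℝ) : ℂ) * Complex.I) := by
    simp only [wave, osc, phase, RCLike.inner_apply, conj_trivial]
    congr 1
    push_cast
    ring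
  rw [e2]
  ring

theorem fourierInv_wave (m x τ : ℝ) (θ : ℝ → ℂ) (y : ℝ) :
    𝓕⁻ (fun ξ => θ ξ * wave m x τ ξ) y = ∫ ξ, θ ξ * wave m (x + y) τ ξ := by
  rw [Real.fourierInv_eq_fourier_neg, fourier_wave, sub_neg_eq_add]

theorem norm_integral_mul_le_of_bound {f h : ℝ → ℂ} {B : ℝ} (hB : ∀ x, ‖f x‖ ≤ B)
    (hh : Integrable h) : ‖∫ x, f x * h x‖ ≤ B * ∫ x, ‖h x‖ := by
  rw [← integral_const_mul]
  refine norm_integral_le_of_norm_le (hh.norm.const_mul B) (Eventually.of_forall fun x => ?_)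
  rw [norm_mul]
  exact mul_le_mul_of_nonneg_right (hB x) (norm_nonneg _)

theorem norm_integral_mul_fourier_le {φ h : ℝ → ℂ} {B : ℝ} (hφ : Integrable φ) (hh : Integrable h)
    (hB : ∀ y, ‖𝓕 φ y‖ ≤ B) : ‖∫ ξ, φ ξ * 𝓕 h ξ‖ ≤ B * ∫ x, ‖h x‖ := by
  rw [← integral_fourier_mul_eq_flip hφ hh]
  exact norm_integral_mul_le_of_bound hB hh

theorem norm_integral_mul_fourierInv_le {φ h : ℝ → ℂ} {B : ℝ} (hφ : Integrable φ) (hh : Integrable h)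
    (hB : ∀ y, ‖𝓕⁻ φ y‖ ≤ B) : ‖∫ ξ, φ ξ * 𝓕⁻ h ξ‖ ≤ B * ∫ x, ‖h x‖ := by
  rw [← integral_fourierInv_mul_eq_flip hφ hh]
  exact norm_integral_mul_le_of_bound hB hh

theorem conj_fourier (h : ℝ → ℂ) (ξ : ℝ) :
    (starRingEnd ℂ) (𝓕 h ξ) = 𝓕⁻ (fun x => (starRingEnd ℂ) (h x)) ξ := by
  rw [Real.fourier_eq', Real.fourierInv_eq', ← integral_conj]
  refine integral_congr_ae (Eventually.of_forall fun x => ?_)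
  simp only [smul_eq_mul, map_mul, ← Complex.exp_conj, Complex.conj_I, Complex.conj_ofReal]
  congr 2
  push_cast
  ring

/-- Decay of the oscillatory kernel at all points gives decay of the nonlinear waves. -/
theorem norm_evalAt_prop_bil_le {m : ℝ} (hm : 0 ≤ m) (j : ℕ) {τ B : ℝ}
    (hB : ∀ x, ‖∫ ξ, al m j ξ * wave m x τ ξ‖ ≤ B) (x : ℝ) (f g : L2) :
    ‖evalAt m hm (memLp_two_al hm j) x (prop m hm τ (bil f g))‖ ≤ B * ‖leibnizOne f g‖ := by
  rw [evalAt_prop, L1.norm_eq_integral_norm]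
  have e : ∫ ξ, al m j ξ * bil f g ξ * wave m x τ ξ =
      ∫ ξ, (al m j ξ * wave m x τ ξ) * 𝓕 (leibnizOne f g : ℝ → ℂ) ξ := by
    refine integral_congr_ae ((bil_ae_eq f g).mono fun ξ h => ?_)
    dsimp only
    rw [h]
    ring
  rw [e]
  refine norm_integral_mul_fourier_le (integrable_mul_wave hm (integrable_al hm j) x τ)
    (L1.integrable_coeFn _) fun y => ?_
  rw [fourier_wave]
  exact hB _

theorem prop_alOp {m : ℝ} (hm : 0 ≤ m) (j : ℕ) (τ : ℝ) (f : L2) :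
    prop m hm τ (alOp m hm j f) = alOp m hm j (prop m hm τ f) := mulOp_comm _ _ _

/-- Almost orthogonality of nonlinear waves emitted at different times. -/
theorem norm_inner_prop_bil_le {m : ℝ} (hm : 0 ≤ m) {τ s B : ℝ}
    (hB : ∀ x, ‖∫ ξ, al m 0 ξ * wave m x (τ - s) ξ‖ ≤ B) (f g f' g' : L2) :
    ‖inner ℂ (prop m hm s (alOp m hm 0 (bil f' g'))) (prop m hm τ (alOp m hm 0 (bil f g)))‖ ≤
      B * ‖derivProd f' g'‖ * ‖leibnizOne f g‖ := by
  -- Only one copy of the amplitude is kept for the kernel. The other is absorbed by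
  -- `amp_mul_bil_ae_eq`, which turns `(1+∂ₓ³)(f'g')` into `∂ₓ(f'g')`, still in `L¹`. Both Fourier
  -- transforms are then moved onto the kernel, each at the cost of an `L¹` norm.
  have e : inner ℂ (prop m hm s (alOp m hm 0 (bil f' g'))) (prop m hm τ (alOp m hm 0 (bil f g))) =
      ∫ ξ, ((al m 0 ξ * wave m 0 (τ - s) ξ) *
        𝓕⁻ (fun x => (starRingEnd ℂ) (derivProd f' g' x)) ξ) * 𝓕 (leibnizOne f g : ℝ → ℂ) ξ := by
    rw [L2.inner_def]
    refine integral_congr_ae ?_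
    filter_upwards [coeFn_mulOp (memLp_top_wave hm 0 s) (alOp m hm 0 (bil f' g')),
      coeFn_mulOp (memLp_top_al hm 0) (bil f' g'),
      coeFn_mulOp (memLp_top_wave hm 0 τ) (alOp m hm 0 (bil f g)),
      coeFn_mulOp (memLp_top_al hm 0) (bil f g), bil_ae_eq f g, amp_mul_bil_ae_eq f' g']
      with ξ h1 h2 h3 h4 h5 h6
    rw [prop, prop, h1, h3, alOp, h2, h4, h5, ← conj_fourier, ← h6, RCLike.inner_apply, al]
    have e := wave_mul_conj m 0 τ 0 s ξ
    rw [sub_zero] at e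
    rw [← e]
    simp only [map_mul, pow_zero, mul_one]
    ring
  have hi : Integrable fun x => (starRingEnd ℂ) (derivProd f' g' x) :=
    Complex.conjCLE.toContinuousLinearMap.integrable_comp (L1.integrable_coeFn (derivProd f' g'))
  have hw := fun x => integrable_mul_wave hm (integrable_al hm 0) x (τ - s)
  rw [e, L1.norm_eq_integral_norm, L1.norm_eq_integral_norm]
  have hbd : ∀ ξ, ‖𝓕⁻ (fun x => (starRingEnd ℂ) (derivProd f' g' x)) ξ‖ ≤ ∫ x, ‖derivProd f' g' x‖ :=
    fun ξ => (norm_fourierInv_le _ ξ).trans (by simp)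
  have hc := continuous_fourierInv hi
  refine norm_integral_mul_fourier_le ?_ (L1.integrable_coeFn _) fun y => ?_
  · exact (hw 0).mul_bdd hc.aestronglyMeasurable (Eventually.of_forall hbd)
  · have e2 : (fun ξ => al m 0 ξ * wave m 0 (τ - s) ξ *
        𝓕⁻ (fun x => (starRingEnd ℂ) (derivProd f' g' x)) ξ) = fun ξ =>
        (al m 0 ξ * 𝓕⁻ (fun x => (starRingEnd ℂ) (derivProd f' g' x)) ξ) * wave m 0 (τ - s) ξ := by
      ext ξ; ring
    rw [e2, fourier_wave]
    have e3 : ∀ ξ, al m 0 ξ * 𝓕⁻ (fun x => (starRingEnd ℂ) (derivProd f' g' x)) ξ *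
        wave m (0 - y) (τ - s) ξ = (al m 0 ξ * wave m (0 - y) (τ - s) ξ) *
        𝓕⁻ (fun x => (starRingEnd ℂ) (derivProd f' g' x)) ξ := fun ξ => by ring
    simp_rw [e3]
    refine (norm_integral_mul_fourierInv_le (B := B) (hw _) hi fun y' => ?_).trans (le_of_eq ?_)
    · rw [fourierInv_wave]
      exact hB _
    · simp

theorem kernel_al {m : ℝ} (hm : 0 < m) (hm1 : m ≤ 1) {j : ℕ} (hj : j ≤ 2) {p : ℝ}
    (hp : p = 1 / 2 ∨ p = 1 / 3) {τ : ℝ} (hτ : τ ≠ 0) (x : ℝ) :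
    ‖∫ ξ, al m j ξ * wave m x τ ξ‖ ≤ 50000 * (m * |τ|) ^ (-p) := by
  rcases hp with rfl | rfl
  · exact norm_integral_comp_two_pi_le (kernel_amp_half hm hm1 hj x hτ)
  · exact norm_integral_comp_two_pi_le (kernel_amp_third hm hm1 hj x hτ)

theorem intervalIntegrable_sub_rpow {p : ℝ} (hp : p < 1) (t : ℝ) :
    IntervalIntegrable (fun s => (t - s) ^ (-p)) volume 0 t := by
  have h := (intervalIntegral.intervalIntegrable_rpow' (a := t) (b := 0) (r := -p)
    (by linarith)).comp_sub_left t
  simpa using h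

theorem integral_sub_rpow {p : ℝ} (hp : p < 1) (t : ℝ) :
    ∫ s in (0 : ℝ)..t, (t - s) ^ (-p) = t ^ (1 - p) / (1 - p) := by
  rw [intervalIntegral.integral_comp_sub_left (fun s => s ^ (-p)) t, sub_self, sub_zero,
    integral_rpow (Or.inl (by linarith)), show -p + 1 = 1 - p by ring,
    Real.zero_rpow (by linarith), sub_zero]

theorem intervalIntegrable_sub_rpow' {p : ℝ} (hp : p < 1) (s t : ℝ) :
    IntervalIntegrable (fun r => (r - s) ^ (-p)) volume s t := by
  have h := (intervalIntegral.intervalIntegrable_rpow' (a := 0) (b := t - s) (r := -p)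
    (by linarith)).comp_sub_right s
  simpa using h

theorem integral_sub_rpow' {p : ℝ} (hp : p < 1) (s t : ℝ) :
    ∫ r in s..t, (r - s) ^ (-p) = (t - s) ^ (1 - p) / (1 - p) := by
  rw [intervalIntegral.integral_comp_sub_right (fun s => s ^ (-p)) s, sub_self,
    integral_rpow (Or.inl (by linarith)), show -p + 1 = 1 - p by ring,
    Real.zero_rpow (by linarith), sub_zero]

theorem intervalIntegrable_abs_sub_rpow {p s t : ℝ} (hp : p < 1) (hs : s ∈ Icc 0 t) :
    IntervalIntegrable (fun r => |r - s| ^ (-p)) volume 0 t := by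
  refine IntervalIntegrable.trans (b := s) ?_ ?_
  · refine (intervalIntegrable_sub_rpow hp s).congr fun r hr => ?_
    rw [uIoc_of_le hs.1] at hr
    rw [abs_of_nonpos (by linarith [hr.2]), neg_sub]
  · refine (intervalIntegrable_sub_rpow' hp s t).congr fun r hr => ?_
    rw [uIoc_of_le hs.2] at hr
    rw [abs_of_nonneg (by linarith [hr.1])]

/-- Each side of `s` contributes at most `t^{1-p}/(1-p) ≤ 2t^{1-p}`. -/
theorem integral_abs_sub_rpow_le {p s t : ℝ} (hp : p ≤ 1 / 2) (hs : s ∈ Icc 0 t) :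
    ∫ r in (0 : ℝ)..t, |r - s| ^ (-p) ≤ 4 * t ^ (1 - p) := by
  have hp1 : p < 1 := by linarith
  have h0t : 0 ≤ t := hs.1.trans hs.2
  have hi := intervalIntegrable_abs_sub_rpow hp1 hs
  have hsub1 : uIcc 0 s ⊆ uIcc 0 t := by
    rw [uIcc_of_le hs.1, uIcc_of_le h0t]; exact Icc_subset_Icc_right hs.2
  have hsub2 : uIcc s t ⊆ uIcc 0 t := by
    rw [uIcc_of_le hs.2, uIcc_of_le h0t]; exact Icc_subset_Icc_left hs.1
  rw [← intervalIntegral.integral_add_adjacent_intervals (hi.mono_set hsub1) (hi.mono_set hsub2)]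
  have e1 : ∫ r in (0 : ℝ)..s, |r - s| ^ (-p) = ∫ r in (0 : ℝ)..s, (s - r) ^ (-p) := by
    refine intervalIntegral.integral_congr fun r hr => ?_
    rw [uIcc_of_le hs.1] at hr
    rw [abs_of_nonpos (by linarith [hr.2]), neg_sub]
  have e2 : ∫ r in s..t, |r - s| ^ (-p) = ∫ r in s..t, (r - s) ^ (-p) := by
    refine intervalIntegral.integral_congr fun r hr => ?_
    rw [uIcc_of_le hs.2] at hr
    rw [abs_of_nonneg (by linarith [hr.1])]
  rw [e1, e2, integral_sub_rpow hp1, integral_sub_rpow' hp1]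
  have h1 : s ^ (1 - p) ≤ t ^ (1 - p) := Real.rpow_le_rpow hs.1 hs.2 (by linarith)
  have h2 : (t - s) ^ (1 - p) ≤ t ^ (1 - p) :=
    Real.rpow_le_rpow (by linarith [hs.2]) (by linarith [hs.1]) (by linarith)
  have h3 : 0 ≤ t ^ (1 - p) := Real.rpow_nonneg h0t _
  rw [← add_div, div_le_iff₀ (by linarith)]
  nlinarith

theorem mul_abs_mul_rpow {m κ s : ℝ} (hm : 0 < m) (p : ℝ) :
    (m * |κ * s|) ^ (-p) = (m * |κ|) ^ (-p) * |s| ^ (-p) := by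
  rw [abs_mul, ← mul_assoc, Real.mul_rpow (by positivity) (abs_nonneg _)]

/-- The bilinear Duhamel integral without amplitude. -/
noncomputable def duhVec (m : ℝ) (hm : 0 ≤ m) (κ : ℝ) (f g : ℝ → L2) (t : ℝ) : L2 :=
  ∫ s in (0 : ℝ)..t, prop m hm (κ * (t - s)) (bil (f s) (g s))

theorem continuous_duhVec_integrand {m : ℝ} (hm : 0 < m) (κ : ℝ) {f g : ℝ → L2}
    (hf : Continuous f) (hg : Continuous g) :
    Continuous fun p : ℝ × ℝ => prop m hm.le (κ * (p.1 - p.2)) (bil (f p.2) (g p.2)) :=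
  (continuous_prop_apply hm).comp
    (f := fun p : ℝ × ℝ => (κ * (p.1 - p.2), bil (f p.2) (g p.2))) (by fun_prop)

theorem intervalIntegrable_duhVec {m : ℝ} (hm : 0 < m) (κ : ℝ) {f g : ℝ → L2}
    (hf : Continuous f) (hg : Continuous g) (t : ℝ) :
    IntervalIntegrable (fun s => prop m hm.le (κ * (t - s)) (bil (f s) (g s))) volume 0 t :=
  ((continuous_duhVec_integrand hm κ hf hg).comp (f := fun s : ℝ => (t, s))
    (by fun_prop)).intervalIntegrable 0 t

theorem duh_eq_alOp {m : ℝ} (hm : 0 < m) (j : ℕ) (κ : ℝ) {f g : ℝ → L2}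
    (hf : Continuous f) (hg : Continuous g) (t : ℝ) :
    duh m hm.le j κ f g t = alOp m hm.le j (duhVec m hm.le κ f g t) := by
  rw [duh, duhVec, ← ContinuousLinearMap.intervalIntegral_comp_comm _
    (intervalIntegrable_duhVec hm κ hf hg t)]
  exact intervalIntegral.integral_congr fun s _ => prop_alOp _ _ _ _

section bounds

variable {m κ M : ℝ} {f g : ℝ → L2}

theorem norm_bilinear_le {E : Type*} [NormedAddCommGroup E] [NormedSpace ℂ E]
    (B : L2 →L[ℂ] L2 →L[ℂ] E) (hfM : ∀ t, ‖f t‖ ≤ M)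
    (hgM : ∀ t, ‖g t‖ ≤ M) (s : ℝ) : ‖B (f s) (g s)‖ ≤ ‖B‖ * M ^ 2 := by
  have h0 : 0 ≤ M := (norm_nonneg _).trans (hfM 0)
  calc _ ≤ ‖B‖ * ‖f s‖ * ‖g s‖ := B.le_opNorm₂ _ _
    _ ≤ ‖B‖ * M * M := by have := hfM s; have := hgM s; gcongr
    _ = _ := by ring

/-- Evaluation at `x` after the smoothing symbol is a continuous functional on `L²`, so it passes
under the time integral. The decay `(m|κ|(t-s))^{-p}` is integrable in `s` because `p < 1`. -/
theorem norm_evalAt_duhVec_le (hm : 0 < m) (hm1 : m ≤ 1) {j : ℕ} (hj : j ≤ 2) {p : ℝ}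
    (hp : p = 1 / 2 ∨ p = 1 / 3) (hκ : κ ≠ 0) (hf : Continuous f) (hg : Continuous g)
    (hfM : ∀ t, ‖f t‖ ≤ M) (hgM : ∀ t, ‖g t‖ ≤ M) {t : ℝ} (ht : 0 ≤ t) (x : ℝ) :
    ‖evalAt m hm.le (memLp_two_al hm.le j) x (duhVec m hm.le κ f g t)‖ ≤
      100000 * ‖leibnizOne‖ * M ^ 2 * (m * |κ|) ^ (-p) * t ^ (1 - p) := by
  have hp2 : p ≤ 1 / 2 := by rcases hp with rfl | rfl <;> norm_num
  have hp1 : p < 1 := by linarith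
  rw [duhVec, ← ContinuousLinearMap.intervalIntegral_comp_comm _
    (intervalIntegrable_duhVec hm κ hf hg t)]
  set A := 50000 * (m * |κ|) ^ (-p) * (‖leibnizOne‖ * M ^ 2) with hA
  have hA0 : 0 ≤ A := by positivity
  refine (intervalIntegral.norm_integral_le_of_norm_le (g := fun s => A * (t - s) ^ (-p)) ht
    ?_ ((intervalIntegrable_sub_rpow hp1 t).const_mul A)).trans ?_
  · have hne : ∀ᵐ s : ℝ, s ≠ t := by simp [ae_iff]
    filter_upwards [hne] with s hs hst
    have hst' : 0 ≤ t - s := by linarith [hst.2]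
    refine (norm_evalAt_prop_bil_le hm.le j (kernel_al hm hm1 hj hp
      (mul_ne_zero hκ (sub_ne_zero.2 hs.symm))) x _ _).trans ?_
    rw [mul_abs_mul_rpow hm, abs_of_nonneg hst']
    have h1 := norm_bilinear_le leibnizOne hfM hgM s
    calc _ ≤ 50000 * ((m * |κ|) ^ (-p) * (t - s) ^ (-p)) * (‖leibnizOne‖ * M ^ 2) := by gcongr
      _ = _ := by rw [hA]; ring
  · rw [intervalIntegral.integral_const_mul, integral_sub_rpow hp1]
    have h3 : 0 ≤ t ^ (1 - p) := Real.rpow_nonneg ht _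
    have h4 : t ^ (1 - p) / (1 - p) ≤ 2 * t ^ (1 - p) := by
      rw [div_le_iff₀ (by linarith)]; nlinarith
    calc A * (t ^ (1 - p) / (1 - p)) ≤ A * (2 * t ^ (1 - p)) := by gcongr
      _ = _ := by rw [hA]; ring

/-- The squared norm is the double integral of inner products of waves emitted at times `r` and `s`,
each of size `(m|κ||r-s|)^{-p}` by `norm_inner_prop_bil_le`. Integrating in `r` gives `4t^{1-p}`,
and in `s` one more factor `t`. -/
theorem norm_sq_duh_zero_le (hm : 0 < m) (hm1 : m ≤ 1) {p : ℝ}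
    (hp : p = 1 / 2 ∨ p = 1 / 3) (hκ : κ ≠ 0) (hf : Continuous f) (hg : Continuous g)
    (hfM : ∀ t, ‖f t‖ ≤ M) (hgM : ∀ t, ‖g t‖ ≤ M) {t : ℝ} (ht : 0 ≤ t) :
    ‖duh m hm.le 0 κ f g t‖ ^ 2 ≤
      200000 * ‖leibnizOne‖ * ‖derivProd‖ * M ^ 4 * (m * |κ|) ^ (-p) * t ^ (2 - p) := by
  have hp2 : p ≤ 1 / 2 := by rcases hp with rfl | rfl <;> norm_num
  have hp0 : 0 ≤ p := by rcases hp with rfl | rfl <;> norm_num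
  have hp1 : p < 1 := by linarith
  set u : ℝ → L2 := fun s => prop m hm.le (κ * (t - s)) (alOp m hm.le 0 (bil (f s) (g s))) with hu
  have huc : Continuous u := continuous_duh_integrand hm 0 κ hf hg t
  have hD : duh m hm.le 0 κ f g t = ∫ s in (0 : ℝ)..t, u s := rfl
  set D := duh m hm.le 0 κ f g t
  set A := 50000 * (m * |κ|) ^ (-p) * (‖derivProd‖ * M ^ 2) * (‖leibnizOne‖ * M ^ 2) with hA
  have hA0 : 0 ≤ A := by positivity
  have hinner : ∀ w : L2, inner ℂ w D = ∫ s in (0 : ℝ)..t, inner ℂ w (u s) := fun w => by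
    rw [hD]
    exact ((innerSL ℂ w).intervalIntegral_comp_comm (huc.intervalIntegrable 0 t)).symm
  have hus : ∀ s ∈ Icc 0 t, ‖inner ℂ (u s) D‖ ≤ A * (4 * t ^ (1 - p)) := by
    intro s hs
    rw [hinner]
    refine (intervalIntegral.norm_integral_le_of_norm_le (g := fun r => A * |r - s| ^ (-p)) ht
      ?_ ((intervalIntegrable_abs_sub_rpow hp1 hs).const_mul A)).trans ?_
    · have hne : ∀ᵐ r : ℝ, r ≠ s := by simp [ae_iff]
      filter_upwards [hne] with r hr _
      have hdiff : κ * (t - r) - κ * (t - s) = κ * (s - r) := by ring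
      have hB := fun x => kernel_al hm hm1 (j := 0) (by norm_num) hp
        (τ := κ * (t - r) - κ * (t - s)) (by
          rw [hdiff]; exact mul_ne_zero hκ (sub_ne_zero.2 hr.symm)) x
      refine (norm_inner_prop_bil_le hm.le hB _ _ _ _).trans ?_
      rw [hdiff, mul_abs_mul_rpow hm, abs_sub_comm s r]
      have h1 := norm_bilinear_le leibnizOne hfM hgM r
      have h2 := norm_bilinear_le derivProd hfM hgM s
      calc _ ≤ 50000 * ((m * |κ|) ^ (-p) * |r - s| ^ (-p)) * (‖derivProd‖ * M ^ 2) *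
            (‖leibnizOne‖ * M ^ 2) := by gcongr
        _ = _ := by rw [hA]; ring
    · rw [intervalIntegral.integral_const_mul]
      exact mul_le_mul_of_nonneg_left (integral_abs_sub_rpow_le hp2 hs) hA0
  have h1 : ‖D‖ ^ 2 = ‖inner ℂ D D‖ := by
    rw [inner_self_eq_norm_sq_to_K, norm_pow]
    simp
  rw [h1, hinner]
  refine (intervalIntegral.norm_integral_le_of_norm_le_const
    (C := A * (4 * t ^ (1 - p))) fun s hs => ?_).trans (le_of_eq ?_)
  · rw [uIoc_of_le ht] at hs
    rw [← norm_inner_symm]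
    exact hus s ⟨hs.1.le, hs.2⟩
  · rw [sub_zero, abs_of_nonneg ht, hA]
    rcases ht.eq_or_lt with rfl | ht'
    · rw [Real.zero_rpow (by linarith : (2 - p) ≠ 0)]; simp
    · rw [show 2 - p = (1 - p) + 1 by ring, Real.rpow_add_one ht'.ne']
      ring

theorem norm_lamOp_le (hm : 0 ≤ m) (f : L2) : ‖lamOp m hm f‖ ≤ ‖f‖ := by
  refine (norm_mulOp_apply_le _ (c := 1) (fun ξ => ?_) f).trans (one_mul _).le
  rw [Complex.norm_real, Real.norm_of_nonneg (lam_pos hm _).le]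
  exact lam_le_one hm _

/-- Factors `lam ≤ 1` are contractions on `L²`, so the case `j = 0` suffices. -/
theorem norm_sq_duh_le (hm : 0 < m) (hm1 : m ≤ 1) (j : ℕ) {p : ℝ}
    (hp : p = 1 / 2 ∨ p = 1 / 3) (hκ : κ ≠ 0) (hf : Continuous f) (hg : Continuous g)
    (hfM : ∀ t, ‖f t‖ ≤ M) (hgM : ∀ t, ‖g t‖ ≤ M) {t : ℝ} (ht : 0 ≤ t) :
    ‖duh m hm.le j κ f g t‖ ^ 2 ≤
      200000 * ‖leibnizOne‖ * ‖derivProd‖ * M ^ 4 * (m * |κ|) ^ (-p) * t ^ (2 - p) := by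
  induction j with
  | zero => exact norm_sq_duh_zero_le hm hm1 hp hκ hf hg hfM hgM ht
  | succ j ih =>
    rw [← lamOp_duh hm j κ hf hg]
    exact (pow_le_pow_left₀ (norm_nonneg _) (norm_lamOp_le hm.le _) 2).trans ih

/-- The amplitude decays like `(1+k²)⁻¹ ≤ λ²`, enough to pay the inverse group velocity `λ⁻³` in the
smoothing estimate. -/
theorem norm_amp_sq_div_lam_le (hm : 0 ≤ m) (hm1 : m ≤ 1) (k : ℝ) :
    ‖amp k‖ ^ 2 / lam m k ^ 3 ≤ 4 := by
  have hp := lam_pos hm k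
  have h := lam_sq_mul hm k
  rw [div_le_iff₀ (by positivity)]
  have h1 := norm_amp_le_two_div k
  have hlam : (1 + k ^ 2)⁻¹ ≤ lam m k ^ 2 := by
    rw [lam_sq hm]
    gcongr
    nlinarith [sq_nonneg k]
  have h2 : ‖amp k‖ ≤ 2 * lam m k ^ 2 := h1.trans (by linarith)
  have h3 : lam m k ^ 4 ≤ lam m k ^ 3 :=
    pow_le_pow_of_le_one hp.le (lam_le_one hm k) (by norm_num)
  nlinarith [norm_nonneg (amp k)]

theorem ofReal_norm_sq_eq_lintegral (f : L2) :
    ENNReal.ofReal (‖f‖ ^ 2) = ∫⁻ ξ, ENNReal.ofReal (‖f ξ‖ ^ 2) := by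
  rw [ENNReal.ofReal_pow (norm_nonneg _), ofReal_norm, Lp.enorm_def,
    eLpNorm_eq_lintegral_rpow_enorm_toReal (by norm_num) (by norm_num), ← ENNReal.rpow_natCast,
    ← ENNReal.rpow_mul]
  norm_num

theorem lintegral_evalAt_prop_bil_le (hm : 0 < m) (hm1 : m ≤ 1) (j : ℕ) (hκ : κ ≠ 0)
    {T : ℝ} (hT : 0 < T) (x s : ℝ) (b : L2) :
    ∫⁻ t in Ioo 0 T, ENNReal.ofReal
      (‖evalAt m hm.le (memLp_two_al hm.le j) x (prop m hm.le (κ * (t - s)) b)‖ ^ 2) ≤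
      ENNReal.ofReal (3 * |κ|⁻¹ * (4 * ‖b‖ ^ 2)) := by
  have hint : Integrable fun ξ => al m j ξ * b ξ := (memLp_two_al hm.le j).integrable_mul (Lp.memLp b)
  -- The emission time `s` enters as a unimodular factor, which is absorbed into the data of
  -- `local_smoothing`.
  have hF1 := integrable_mul_wave hm.le hint 0 (-(κ * s))
  have h := local_smoothing hm.le hκ (N := 4 * ‖b‖ ^ 2) ?_ hF1 hT x
  · refine le_trans (le_of_eq (lintegral_congr fun t => ?_)) h
    rw [evalAt_prop]
    congr 3
    refine integral_congr_ae (Eventually.of_forall fun ξ => ?_)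
    have e := wave_mul_wave m 0 x (-(κ * s)) (κ * t) ξ
    rw [zero_add] at e
    dsimp only
    rw [mul_assoc _ (wave m 0 _ ξ), e]
    congr 2
    ring
  · rw [ENNReal.ofReal_mul (by norm_num), ofReal_norm_sq_eq_lintegral,
      ← lintegral_const_mul' _ _ ENNReal.ofReal_ne_top]
    refine lintegral_mono fun ξ => ?_
    rw [← ENNReal.ofReal_mul (by norm_num)]
    apply ENNReal.ofReal_le_ofReal
    rw [norm_mul, norm_wave, mul_one, norm_mul, mul_pow]
    have h1 := norm_amp_sq_div_lam_le hm.le hm1 (2 * Real.pi * ξ)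
    have hp := lam_pos hm.le (2 * Real.pi * ξ)
    have h2 := norm_al_le hm.le j ξ
    calc _ ≤ ‖amp (2 * Real.pi * ξ)‖ ^ 2 * ‖b ξ‖ ^ 2 / lam m (2 * Real.pi * ξ) ^ 3 := by gcongr
      _ = ‖amp (2 * Real.pi * ξ)‖ ^ 2 / lam m (2 * Real.pi * ξ) ^ 3 * ‖b ξ‖ ^ 2 := by ring
      _ ≤ _ := by gcongr

theorem enorm_intervalIntegral_sq_le {h : ℝ → ℂ} (hh : Continuous h) {t T : ℝ} (ht : t ∈ Icc 0 T) :
    ENNReal.ofReal (‖∫ s in (0 : ℝ)..t, h s‖ ^ 2) ≤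
      ENNReal.ofReal T * ∫⁻ s in Ioo 0 T, ENNReal.ofReal (‖h s‖ ^ 2) := by
  have h0T : 0 ≤ T := ht.1.trans ht.2
  have h1 : ‖∫ s in (0 : ℝ)..t, h s‖ₑ ≤ ∫⁻ s in Ioo 0 T, ‖h s‖ₑ := by
    rw [intervalIntegral.integral_of_le ht.1]
    refine (enorm_integral_le_lintegral_enorm _).trans ?_
    rw [restrict_Ioo_eq_restrict_Ioc]
    exact lintegral_mono_set (Ioc_subset_Ioc_right ht.2)
  have h2 : ∫⁻ s in Ioo 0 T, ‖h s‖ₑ ≤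
      (∫⁻ s in Ioo 0 T, (1 : ℝ≥0∞) ^ (2 : ℝ)) ^ (1 / 2 : ℝ) *
        (∫⁻ s in Ioo 0 T, ‖h s‖ₑ ^ (2 : ℝ)) ^ (1 / 2 : ℝ) := by
    have := ENNReal.lintegral_mul_le_Lp_mul_Lq (volume.restrict (Ioo 0 T)) Real.HolderConjugate.two_two
      (f := fun _ => 1) (g := fun s => ‖h s‖ₑ) aemeasurable_const hh.enorm.aemeasurable
    simpa using this
  have e : ∀ s, ENNReal.ofReal (‖h s‖ ^ 2) = ‖h s‖ₑ ^ (2 : ℝ) := fun s => by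
    rw [ENNReal.ofReal_pow (norm_nonneg _), ofReal_norm, ← ENNReal.rpow_natCast]; rfl
  simp_rw [e]
  rw [ENNReal.ofReal_pow (norm_nonneg _), ofReal_norm]
  refine (pow_le_pow_left' (h1.trans h2) 2).trans (le_of_eq ?_)
  rw [mul_pow, ← ENNReal.rpow_natCast, ← ENNReal.rpow_mul, ← ENNReal.rpow_natCast, ← ENNReal.rpow_mul]
  norm_num

/-- Cauchy–Schwarz in the emission time costs a factor `T`; after Tonelli each emitted wave is
covered by Kato smoothing, and integration over emission times costs the second `T`. -/
theorem lintegral_evalAt_duhVec_le (hm : 0 < m) (hm1 : m ≤ 1) (j : ℕ) (hκ : κ ≠ 0)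
    (hf : Continuous f) (hg : Continuous g) (hfM : ∀ t, ‖f t‖ ≤ M) (hgM : ∀ t, ‖g t‖ ≤ M)
    {T : ℝ} (hT : 0 < T) (x : ℝ) :
    ∫⁻ t in Ioo 0 T, ENNReal.ofReal
      (‖evalAt m hm.le (memLp_two_al hm.le j) x (duhVec m hm.le κ f g t)‖ ^ 2) ≤
      ENNReal.ofReal (12 * |κ|⁻¹ * T ^ 2 * (‖bil‖ * M ^ 2) ^ 2) := by
  set E := evalAt m hm.le (memLp_two_al hm.le j) x
  have hc : Continuous fun p : ℝ × ℝ => E (prop m hm.le (κ * (p.1 - p.2)) (bil (f p.2) (g p.2))) :=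
    E.continuous.comp (continuous_duhVec_integrand hm κ hf hg)
  have h1 : ∀ t ∈ Ioo 0 T, ENNReal.ofReal (‖E (duhVec m hm.le κ f g t)‖ ^ 2) ≤
      ENNReal.ofReal T * ∫⁻ s in Ioo 0 T, ENNReal.ofReal
        (‖E (prop m hm.le (κ * (t - s)) (bil (f s) (g s)))‖ ^ 2) := fun t ht => by
    rw [duhVec, ← ContinuousLinearMap.intervalIntegral_comp_comm _
      (intervalIntegrable_duhVec hm κ hf hg t)]
    exact enorm_intervalIntegral_sq_le (hc.comp (f := fun s : ℝ => (t, s)) (by fun_prop))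
      (Ioo_subset_Icc_self ht)
  calc _ ≤ ∫⁻ t in Ioo 0 T, ENNReal.ofReal T * ∫⁻ s in Ioo 0 T, ENNReal.ofReal
        (‖E (prop m hm.le (κ * (t - s)) (bil (f s) (g s)))‖ ^ 2) :=
        setLIntegral_mono' measurableSet_Ioo h1
    _ = ENNReal.ofReal T * ∫⁻ s in Ioo 0 T, ∫⁻ t in Ioo 0 T, ENNReal.ofReal
        (‖E (prop m hm.le (κ * (t - s)) (bil (f s) (g s)))‖ ^ 2) := by
        rw [lintegral_const_mul' _ _ ENNReal.ofReal_ne_top, lintegral_lintegral_swap]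
        exact (hc.norm.pow 2).measurable.ennreal_ofReal.aemeasurable
    _ ≤ ENNReal.ofReal T * ∫⁻ s in Ioo 0 T, ENNReal.ofReal (3 * |κ|⁻¹ * (4 * (‖bil‖ * M ^ 2) ^ 2)) := by
        gcongr with s
        refine (lintegral_evalAt_prop_bil_le hm hm1 j hκ hT x s _).trans ?_
        have := norm_bilinear_le bil hfM hgM s
        apply ENNReal.ofReal_le_ofReal
        gcongr
    _ = _ := by
        rw [setLIntegral_const, Real.volume_Ioo, sub_zero, ← ENNReal.ofReal_mul (by positivity),
          ← ENNReal.ofReal_mul hT.le]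
        congr 1
        ring

end bounds

/-! ### The matrix exponential -/

/-- The symbol has eigenvectors `(1, ±λ)` with eigenvalues `±iω`; the eigenvector matrix is
invertible also at `k = 0`, as `λ` never vanishes. -/
theorem exp_smul_symbolA {μ : ℝ} (hμ : 0 ≤ μ / 3) (τ k : ℝ) :
    NormedSpace.exp ((τ : ℂ) • symbolA μ k) =
      !![1, 1; (lam (μ / 3) k : ℂ), -(lam (μ / 3) k : ℂ)] *
        Matrix.diagonal ![Complex.exp (Complex.I * (τ * om (μ / 3) k : ℝ)),
          Complex.exp (-(Complex.I * (τ * om (μ / 3) k : ℝ)))] *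
        !![2⁻¹, 2⁻¹ * (lam (μ / 3) k : ℂ)⁻¹; 2⁻¹, -(2⁻¹ * (lam (μ / 3) k : ℂ)⁻¹)] := by
  have hl : (lam (μ / 3) k : ℂ) ≠ 0 := by exact_mod_cast (lam_pos hμ k).ne'
  have hs : (lam (μ / 3) k : ℂ) ^ 2 * ((1 + μ / 3 * k ^ 2 : ℝ) : ℂ) = 1 := by
    exact_mod_cast lam_sq_mul hμ k
  have hd : ((1 + μ / 3 * k ^ 2 : ℝ) : ℂ) ≠ 0 := fun h => by simp [h] at hs
  let U : (Matrix (Fin 2) (Fin 2) ℂ)ˣ :=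
    { val := !![1, 1; (lam (μ / 3) k : ℂ), -(lam (μ / 3) k : ℂ)]
      inv := !![2⁻¹, 2⁻¹ * (lam (μ / 3) k : ℂ)⁻¹; 2⁻¹, -(2⁻¹ * (lam (μ / 3) k : ℂ)⁻¹)]
      val_inv := by
        ext i j
        fin_cases i <;> fin_cases j <;> simp [Matrix.mul_apply, Fin.sum_univ_two] <;> field_simp <;>
          norm_num
      inv_val := by
        ext i j
        fin_cases i <;> fin_cases j <;> simp [Matrix.mul_apply, Fin.sum_univ_two] <;> field_simp <;>
          norm_num }
  have hA : (τ : ℂ) • symbolA μ k = (U : Matrix (Fin 2) (Fin 2) ℂ) *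
      Matrix.diagonal ![Complex.I * (τ * om (μ / 3) k : ℝ), -(Complex.I * (τ * om (μ / 3) k : ℝ))] *
      (U⁻¹ : (Matrix (Fin 2) (Fin 2) ℂ)ˣ) := by
    have h2 : Complex.I * k / ((1 + μ / 3 * k ^ 2 : ℝ) : ℂ) = Complex.I * k * (lam (μ / 3) k : ℂ) ^ 2 := by
      rw [div_eq_iff hd]
      linear_combination (-(Complex.I * k)) * hs
    rw [symbolA, h2]
    change _ = !![1, 1; (lam (μ / 3) k : ℂ), -(lam (μ / 3) k : ℂ)] * _ *
      !![2⁻¹, 2⁻¹ * (lam (μ / 3) k : ℂ)⁻¹; 2⁻¹, -(2⁻¹ * (lam (μ / 3) k : ℂ)⁻¹)]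
    ext i j
    fin_cases i <;> fin_cases j <;>
      simp [Matrix.mul_apply, Fin.sum_univ_two, om, Matrix.vecMul_diagonal] <;> field_simp <;> ring
  rw [hA, Matrix.exp_units_conj, Matrix.exp_diagonal]
  congr 3
  ext i
  rw [Pi.coe_exp, ← Complex.exp_eq_exp_ℂ]
  fin_cases i <;> simp

theorem exp_smul_symbolA_mulVec {μ : ℝ} (hμ : 0 ≤ μ / 3) (t ξ : ℝ) (a b : ℂ) :
    NormedSpace.exp (((-t : ℝ) : ℂ) • symbolA μ (2 * Real.pi * ξ)) *ᵥ ![a, b] =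
      ![2⁻¹ * ((a + (lam (μ / 3) (2 * Real.pi * ξ) : ℂ)⁻¹ * b) * wave (μ / 3) 0 t ξ) +
          2⁻¹ * ((a - (lam (μ / 3) (2 * Real.pi * ξ) : ℂ)⁻¹ * b) * wave (μ / 3) 0 (-t) ξ),
        2⁻¹ * ((lam (μ / 3) (2 * Real.pi * ξ) : ℂ) *
            (a + (lam (μ / 3) (2 * Real.pi * ξ) : ℂ)⁻¹ * b) * wave (μ / 3) 0 t ξ) -
          2⁻¹ * ((lam (μ / 3) (2 * Real.pi * ξ) : ℂ) *
            (a - (lam (μ / 3) (2 * Real.pi * ξ) : ℂ)⁻¹ * b) * wave (μ / 3) 0 (-t) ξ)] := by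
  have e1 : Complex.exp (Complex.I * ((-t * om (μ / 3) (2 * Real.pi * ξ) : ℝ) : ℂ)) =
      wave (μ / 3) 0 t ξ := by
    simp only [wave, osc, phase]; congr 2; push_cast; ring
  have e2 : Complex.exp (-(Complex.I * ((-t * om (μ / 3) (2 * Real.pi * ξ) : ℝ) : ℂ))) =
      wave (μ / 3) 0 (-t) ξ := by
    simp only [wave, osc, phase, ← mul_neg]; congr 2; push_cast; ring
  rw [exp_smul_symbolA hμ, e1, e2]
  ext i
  fin_cases i <;>
    simp [Matrix.mulVec, Matrix.mul_apply, dotProduct, Fin.sum_univ_two, Matrix.vecMul_diagonal] <;> ring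

/-! ### Pointwise representation of the solution -/

/-- `u` is a pointwise version of the inverse Fourier transform of `w`. -/
def IsInv (w : L2) (u : ℝ → ℂ) : Prop := ((𝓕⁻ w : L2) : ℝ → ℂ) =ᵐ[volume] u

theorem IsInv.add {w w' : L2} {u u' : ℝ → ℂ} (h : IsInv w u) (h' : IsInv w' u') :
    IsInv (w + w') (fun x => u x + u' x) := by
  have e : (𝓕⁻ (w + w') : L2) = 𝓕⁻ w + 𝓕⁻ w' := map_add (Lp.fourierTransformₗᵢ ℝ ℂ).symm w w'
  rw [IsInv, e]
  exact (Lp.coeFn_add _ _).trans (EventuallyEq.add h h')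

theorem IsInv.smul {w : L2} {u : ℝ → ℂ} (c : ℂ) (h : IsInv w u) :
    IsInv (c • w) (fun x => c * u x) := by
  have e : (𝓕⁻ (c • w) : L2) = c • 𝓕⁻ w := map_smul (Lp.fourierTransformₗᵢ ℝ ℂ).symm c w
  rw [IsInv, e]
  exact (Lp.coeFn_smul _ _).trans (EventuallyEq.const_smul h c)

theorem isInv_of_integrable {w : L2} (m : ℝ) (hw : Integrable w) :
    IsInv w (fun x => ∫ ξ, w ξ * wave m x 0 ξ) :=
  (fourierInv_ae_eq hw).trans (Eventually.of_forall fun x => fourierInv_eq_integral_wave m _ x)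

theorem isInv_prop {m : ℝ} (hm : 0 ≤ m) {w : L2} (hw : Integrable w) (τ : ℝ) :
    IsInv (prop m hm τ w) (fun x => ∫ ξ, w ξ * wave m x τ ξ) := by
  have hae := coeFn_mulOp (memLp_top_wave hm 0 τ) w
  have hi : Integrable (prop m hm τ w) := by
    refine (integrable_mul_wave hm hw 0 τ).congr (hae.symm.mono fun ξ h => ?_)
    dsimp only at h ⊢
    rw [prop, ← h, mul_comm]
  refine (isInv_of_integrable m hi).trans (Eventually.of_forall fun x => ?_)
  refine integral_congr_ae (hae.mono fun ξ h => ?_)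
  have e := wave_mul_wave m 0 x τ 0 ξ
  rw [zero_add, add_zero] at e
  dsimp only
  rw [prop, h, ← e]
  ring

/-- Links the two descriptions of the Duhamel term: the `L²` element carries the energy bound, the
evaluation at each `x` the sup and smoothing bounds. -/
theorem isInv_duh {m : ℝ} (hm : 0 < m) (j : ℕ) (κ : ℝ) {f g : ℝ → L2}
    (hf : Continuous f) (hg : Continuous g) (t : ℝ) :
    IsInv (duh m hm.le j κ f g t)
      (fun x => evalAt m hm.le (memLp_two_al hm.le j) x (duhVec m hm.le κ f g t)) := by
  rw [duh_eq_alOp hm j κ hf hg]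
  have hae := coeFn_mulOp (memLp_top_al hm.le j) (duhVec m hm.le κ f g t)
  have hi : Integrable (alOp m hm.le j (duhVec m hm.le κ f g t)) :=
    ((memLp_two_al hm.le j).integrable_mul (Lp.memLp (duhVec m hm.le κ f g t))).congr hae.symm
  refine (isInv_of_integrable m hi).trans (Eventually.of_forall fun x => ?_)
  dsimp only
  rw [evalAt_apply]
  refine integral_congr_ae (hae.mono fun ξ h => ?_)
  dsimp only
  rw [alOp, h]

theorem lam_mul_symM_eq {m : ℝ} (hm : 0 ≤ m) (ξ : ℝ) :
    (lam m (2 * Real.pi * ξ) : ℂ) * symM m ξ = (lam m (2 * Real.pi * ξ) : ℂ)⁻¹ * sym 0 ξ := by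
  have hl : (lam m (2 * Real.pi * ξ) : ℂ) ≠ 0 := by exact_mod_cast (lam_pos hm _).ne'
  have hs : (lam m (2 * Real.pi * ξ) : ℂ) ^ 2 * ((1 + m * (2 * Real.pi * ξ) ^ 2 : ℝ) : ℂ) = 1 := by
    exact_mod_cast lam_sq_mul hm _
  rw [eq_inv_mul_iff_mul_eq₀ hl, symM]
  linear_combination (sym 0 ξ) * hs

theorem coeFn_riem {m : ℝ} (hm : 0 ≤ m) (hm1 : m ≤ 1) (σ : ℝ) (f g : L2) :
    (riem m hm hm1 σ (f, g) : ℝ → ℂ) =ᵐ[volume] fun ξ => sym 0 ξ * f ξ +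
      σ * ((lam m (2 * Real.pi * ξ) : ℂ)⁻¹ * (sym 0 ξ * g ξ)) := by
  rw [riem_apply]
  filter_upwards [Lp.coeFn_add (mulOp (sym 0) (memLp_top_sym (by norm_num)) f)
      ((σ : ℂ) • lamOp m hm (mulOp (symM m) (memLp_top_symM hm hm1) g)),
    coeFn_mulOp (memLp_top_sym (j := 0) (by norm_num)) f,
    Lp.coeFn_smul (σ : ℂ) (lamOp m hm (mulOp (symM m) (memLp_top_symM hm hm1) g)),
    coeFn_mulOp (memLp_top_lam hm) (mulOp (symM m) (memLp_top_symM hm hm1) g),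
    coeFn_mulOp (memLp_top_symM hm hm1) g] with ξ h1 h2 h3 h4 h5
  rw [h1, Pi.add_apply, h2, h3, Pi.smul_apply, lamOp, h4, h5, smul_eq_mul, ← mul_assoc _ (symM m ξ),
    lam_mul_symM_eq hm]
  ring

/-- For `m ≤ 1` a factor `λ⁻¹` costs at most one of the three factors `(1+k²)^{-1/2}` provided by
`H³`, uniformly in `m`. -/
theorem inv_lam_mul_lam_one_le {m : ℝ} (hm : 0 ≤ m) (hm1 : m ≤ 1) (k : ℝ) :
    (lam m k)⁻¹ * lam 1 k ≤ 1 := by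
  have hp := lam_pos hm k
  rw [inv_mul_le_iff₀ hp, mul_one]
  refine abs_le_of_sq_le_sq' ?_ hp.le |>.2
  rw [lam_sq hm, lam_sq zero_le_one]
  gcongr

theorem norm_sym_zero (ξ : ℝ) : ‖sym 0 ξ‖ = lam 1 (2 * Real.pi * ξ) ^ 3 := by
  rw [sym, pow_zero, one_mul, Complex.norm_real,
    Real.norm_of_nonneg (pow_nonneg (lam_pos zero_le_one _).le 3)]

/-- The Riemann invariants decay two powers better than `L²`. -/
theorem norm_riem_le {m : ℝ} (hm : 0 ≤ m) (hm1 : m ≤ 1) {σ : ℝ} (hσ : |σ| = 1) (f g : L2) :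
    ∀ᵐ ξ : ℝ, ‖riem m hm hm1 σ (f, g) ξ‖ ≤ lam 1 (2 * Real.pi * ξ) ^ 2 * (‖f ξ‖ + ‖g ξ‖) := by
  filter_upwards [coeFn_riem hm hm1 σ f g] with ξ h
  have hp := lam_pos hm (2 * Real.pi * ξ)
  have hp1 := lam_pos (m := 1) zero_le_one (2 * Real.pi * ξ)
  have h1 := lam_le_one (m := 1) zero_le_one (2 * Real.pi * ξ)
  have h2 := inv_lam_mul_lam_one_le hm hm1 (2 * Real.pi * ξ)
  rw [h]
  refine (norm_add_le _ _).trans ?_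
  rw [norm_mul, norm_mul, norm_mul, norm_mul, norm_sym_zero, Complex.norm_real, Real.norm_eq_abs, hσ,
    one_mul, norm_inv, Complex.norm_real, Real.norm_of_nonneg hp.le, mul_add]
  refine add_le_add ?_ ?_
  · gcongr ?_ * _
    exact pow_le_pow_of_le_one hp1.le h1 (by norm_num)
  · rw [← mul_assoc]
    gcongr ?_ * _
    calc _ = ((lam m (2 * Real.pi * ξ))⁻¹ * lam 1 (2 * Real.pi * ξ)) * lam 1 (2 * Real.pi * ξ) ^ 2 := by
          ring
      _ ≤ 1 * lam 1 (2 * Real.pi * ξ) ^ 2 := by gcongr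
      _ = _ := one_mul _

theorem integrable_riem {m : ℝ} (hm : 0 ≤ m) (hm1 : m ≤ 1) {σ : ℝ} (hσ : |σ| = 1) (f g : L2) :
    Integrable (riem m hm hm1 σ (f, g)) := by
  have hi : Integrable fun ξ => lam 1 (2 * Real.pi * ξ) * (‖f ξ‖ + ‖g ξ‖) :=
    memLp_two_lam_one.integrable_mul ((Lp.memLp f).norm.add (Lp.memLp g).norm)
  refine hi.mono' (Lp.aestronglyMeasurable _) ((norm_riem_le hm hm1 hσ f g).mono fun ξ h => ?_)
  have hp1 := lam_pos (m := 1) zero_le_one (2 * Real.pi * ξ)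
  refine h.trans ?_
  gcongr ?_ * _
  exact pow_le_of_le_one hp1.le (lam_le_one zero_le_one _) two_ne_zero

theorem integrable_lamOp {m : ℝ} (hm : 0 ≤ m) {f : L2} (hf : Integrable f) :
    Integrable (lamOp m hm f) := by
  refine hf.norm.mono' (Lp.aestronglyMeasurable _)
    ((coeFn_mulOp (memLp_top_lam hm) f).mono fun ξ h => ?_)
  rw [lamOp, h, norm_mul, Complex.norm_real, Real.norm_of_nonneg (lam_pos hm _).le]
  exact mul_le_of_le_one_left (norm_nonneg _) (lam_le_one hm _)

/-- The solution `e^{-iκtω(D)} w` of the linear flow. -/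
noncomputable def packet (m κ : ℝ) (w : L2) (t x : ℝ) : ℂ := ∫ ξ, w ξ * wave m x (κ * t) ξ

/-- The nonlinear part of a Riemann invariant (`j = 0`), and its image under `lamOp` (`j = 1`). -/
noncomputable def correction (m : ℝ) (hm : 0 ≤ m) (ε : ℝ) (z v : ℝ → L2) (j : ℕ) (σ t x : ℝ) : ℂ :=
  (-1 : ℂ) * evalAt m hm (memLp_two_al hm j) x (duhVec m hm (σ * ε⁻¹) z v t) +
    -(σ / 2 : ℂ) * evalAt m hm (memLp_two_al hm (j + 1)) x (duhVec m hm (σ * ε⁻¹) v v t)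

/-- The components of the linear flow. -/
noncomputable def linPart (m : ℝ) (hm : 0 ≤ m) (hm1 : m ≤ 1) (ε : ℝ) (f g : L2) (t x : ℝ) :
    EuclideanSpace ℂ (Fin 2) :=
  !₂[2⁻¹ * (packet m ε⁻¹ (riem m hm hm1 1 (f, g)) t x +
      packet m (-ε⁻¹) (riem m hm hm1 (-1) (f, g)) t x),
    2⁻¹ * (packet m ε⁻¹ (lamOp m hm (riem m hm hm1 1 (f, g))) t x -
      packet m (-ε⁻¹) (lamOp m hm (riem m hm hm1 (-1) (f, g))) t x)]

/-- The nonlinear counterpart of `linPart`. The second component uses `j = 1` because `V̂` is `λ/2`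
times the difference of the two invariants. -/
noncomputable def corrPart (m : ℝ) (hm : 0 ≤ m) (ε : ℝ) (z v : ℝ → L2) (t x : ℝ) :
    EuclideanSpace ℂ (Fin 2) :=
  !₂[2⁻¹ * (correction m hm ε z v 0 1 t x + correction m hm ε z v 0 (-1) t x),
    2⁻¹ * (correction m hm ε z v 1 1 t x - correction m hm ε z v 1 (-1) t x)]

theorem integral_mul_wave_ae {m : ℝ} (hm : 0 ≤ m) {w w' : L2} (hw : Integrable w)
    (hw' : Integrable w') {F : ℝ → ℂ} {τ τ' x : ℝ} (c : ℂ)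
    (hF : ∀ᵐ ξ, F ξ = 2⁻¹ * (w ξ * wave m 0 τ ξ) + c * (w' ξ * wave m 0 τ' ξ)) :
    𝓕⁻ F x = 2⁻¹ * (∫ ξ, w ξ * wave m x τ ξ) + c * ∫ ξ, w' ξ * wave m x τ' ξ := by
  rw [fourierInv_eq_integral_wave m, ← integral_const_mul, ← integral_const_mul,
    ← integral_add ((integrable_mul_wave hm hw x τ).const_mul _)
      ((integrable_mul_wave hm hw' x τ').const_mul _)]
  refine integral_congr_ae (hF.mono fun ξ h => ?_)
  have e := wave_mul_wave m 0 x τ 0 ξ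
  have e' := wave_mul_wave m 0 x τ' 0 ξ
  rw [zero_add, add_zero] at e e'
  dsimp only
  rw [h, ← e, ← e']
  ring

theorem linearFlow_eq_linPart {ε μ : ℝ} (hm : 0 ≤ μ / 3) (hm1 : μ / 3 ≤ 1) {f g : ℝ → ℝ}
    (hf : sobolevNorm 3 f < ⊤) (hg : sobolevNorm 3 g < ⊤) (t x : ℝ) :
    linearFlow μ (-(t / ε)) f g x =
      linPart (μ / 3) hm hm1 ε (wtransform f) (wtransform g) t x := by
  have hr : ∀ σ : ℝ, |σ| = 1 → Integrable (riem (μ / 3) hm hm1 σ (wtransform f, wtransform g)) :=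
    fun σ hσ => integrable_riem hm hm1 hσ _ _
  have i1 := hr 1 (by norm_num)
  have i2 := hr (-1) (by norm_num)
  have key : ∀ σ : ℝ, ∀ᵐ ξ : ℝ, riem (μ / 3) hm hm1 σ (wtransform f, wtransform g) ξ =
      fourierL2 f ξ + σ * ((lam (μ / 3) (2 * Real.pi * ξ) : ℂ)⁻¹ * fourierL2 g ξ) := fun σ => by
    filter_upwards [coeFn_riem hm hm1 σ (wtransform f) (wtransform g), fourierL2_ae_eq hf,
      fourierL2_ae_eq hg] with ξ h1 h2 h3
    rw [h1, h2, h3]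
  have hlam : ∀ σ : ℝ, ∀ᵐ ξ : ℝ,
      lamOp (μ / 3) hm (riem (μ / 3) hm hm1 σ (wtransform f, wtransform g)) ξ =
        lam (μ / 3) (2 * Real.pi * ξ) *
          (fourierL2 f ξ + σ * ((lam (μ / 3) (2 * Real.pi * ξ) : ℂ)⁻¹ * fourierL2 g ξ)) := fun σ => by
    filter_upwards [coeFn_mulOp (memLp_top_lam hm)
      (riem (μ / 3) hm hm1 σ (wtransform f, wtransform g)), key σ] with ξ h1 h2
    rw [lamOp, h1, h2]
  have ht : ε⁻¹ * t = t / ε := by rw [div_eq_inv_mul]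
  have ht' : -ε⁻¹ * t = -(t / ε) := by rw [div_eq_inv_mul, neg_mul]
  unfold linearFlow linPart packet
  rw [ht, ht']
  congr 1
  ext i
  fin_cases i
  · refine (integral_mul_wave_ae hm i1 i2 (2⁻¹ : ℂ) ?_).trans (mul_add _ _ _).symm
    filter_upwards [key 1, key (-1)] with ξ h1 h2
    rw [exp_smul_symbolA_mulVec hm, h1, h2]
    simp only [Fin.zero_eta, Matrix.cons_val_zero]
    push_cast
    ring
  · refine (integral_mul_wave_ae hm (integrable_lamOp hm i1) (integrable_lamOp hm i2)
      (τ := t / ε) (τ' := -(t / ε)) (-2⁻¹ : ℂ) ?_).trans ?_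
    · filter_upwards [hlam 1, hlam (-1)] with ξ h1 h2
      rw [exp_smul_symbolA_mulVec hm, h1, h2]
      simp only [Fin.mk_one, Matrix.cons_val_one, Matrix.cons_val_zero]
      push_cast
      ring
    · simp only [Fin.mk_one, Matrix.cons_val_one, Matrix.cons_val_zero]
      ring

theorem lamOp_prop {m : ℝ} (hm : 0 ≤ m) (τ : ℝ) (w : L2) :
    lamOp m hm (prop m hm τ w) = prop m hm τ (lamOp m hm w) := mulOp_comm _ _ _

section representation

variable {ε μ T : ℝ} {ζ V : ℝ → ℝ → ℝ} {z v : ℝ → L2}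

theorem isInv_riem (h : IsSolution ε μ T ζ V) (hε : 0 < ε) (hm : 0 < μ / 3) (hm1 : μ / 3 ≤ 1)
    (hz : Continuous z) (hv : Continuous v)
    (hzv : ∀ t ∈ Icc 0 T, z t = wtransform (ζ t) ∧ v t = wtransform (V t)) {σ : ℝ} (hσ : |σ| = 1)
    {t : ℝ} (ht : t ∈ Icc 0 T) :
    IsInv (riem (μ / 3) hm.le hm1 σ (z t, v t)) (fun x =>
      packet (μ / 3) (σ * ε⁻¹) (riem (μ / 3) hm.le hm1 σ (z 0, v 0)) t x +
        correction (μ / 3) hm.le ε z v 0 σ t x) := by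
  have hσ2 : σ ^ 2 = 1 := by rw [← sq_abs, hσ, one_pow]
  have e : riem (μ / 3) hm.le hm1 σ (z t, v t) =
      prop (μ / 3) hm.le (σ * ε⁻¹ * t) (riem (μ / 3) hm.le hm1 σ (z 0, v 0)) +
        ((-1 : ℂ) • duh (μ / 3) hm.le 0 (σ * ε⁻¹) z v t +
          (-(σ / 2 : ℂ)) • duh (μ / 3) hm.le 1 (σ * ε⁻¹) v v t) := by
    rw [duhamel_riem h hε hm hm1 hz hv hzv hσ2 ht]
    module
  rw [e]
  exact (isInv_prop hm.le (integrable_riem hm.le hm1 hσ _ _) _).add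
    (((isInv_duh hm 0 _ hz hv t).smul _).add ((isInv_duh hm 1 _ hv hv t).smul _))

theorem isInv_lamOp_riem (h : IsSolution ε μ T ζ V) (hε : 0 < ε) (hm : 0 < μ / 3)
    (hm1 : μ / 3 ≤ 1) (hz : Continuous z) (hv : Continuous v)
    (hzv : ∀ t ∈ Icc 0 T, z t = wtransform (ζ t) ∧ v t = wtransform (V t)) {σ : ℝ} (hσ : |σ| = 1)
    {t : ℝ} (ht : t ∈ Icc 0 T) :
    IsInv (lamOp (μ / 3) hm.le (riem (μ / 3) hm.le hm1 σ (z t, v t))) (fun x =>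
      packet (μ / 3) (σ * ε⁻¹) (lamOp (μ / 3) hm.le (riem (μ / 3) hm.le hm1 σ (z 0, v 0))) t x +
        correction (μ / 3) hm.le ε z v 1 σ t x) := by
  have hσ2 : σ ^ 2 = 1 := by rw [← sq_abs, hσ, one_pow]
  have e : lamOp (μ / 3) hm.le (riem (μ / 3) hm.le hm1 σ (z t, v t)) =
      prop (μ / 3) hm.le (σ * ε⁻¹ * t) (lamOp (μ / 3) hm.le (riem (μ / 3) hm.le hm1 σ (z 0, v 0))) +
        ((-1 : ℂ) • duh (μ / 3) hm.le 1 (σ * ε⁻¹) z v t +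
          (-(σ / 2 : ℂ)) • duh (μ / 3) hm.le 2 (σ * ε⁻¹) v v t) := by
    rw [duhamel_riem h hε hm hm1 hz hv hzv hσ2 ht, map_sub, map_sub, map_smul, lamOp_prop,
      lamOp_duh hm 0 _ hz hv, lamOp_duh hm 1 _ hv hv]
    module
  rw [e]
  exact (isInv_prop hm.le (integrable_lamOp hm.le (integrable_riem hm.le hm1 hσ _ _)) _).add
    (((isInv_duh hm 1 _ hz hv t).smul _).add ((isInv_duh hm 2 _ hv hv t).smul _))

theorem isInv_wtransform {f : ℝ → ℝ} (hf : sobolevNorm 3 f < ⊤) :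
    IsInv (mulOp (sym 0) (memLp_top_sym (by norm_num)) (wtransform f)) (fun x => (f x : ℂ)) := by
  rw [IsInv, ← derivOp_apply (by norm_num)]
  exact derivOp_zero_wtransform hf

/-- Half the sum of the invariants is `ζ̂`, and `λ/2` times their difference is `V̂`. Inserting
Duhamel's formula and inverting the Fourier transform splits the solution exactly into free and
nonlinear parts. -/
theorem state_ae_eq (h : IsSolution ε μ T ζ V) (hε : 0 < ε) (hm : 0 < μ / 3)
    (hm1 : μ / 3 ≤ 1) (hz : Continuous z) (hv : Continuous v)
    (hzv : ∀ t ∈ Icc 0 T, z t = wtransform (ζ t) ∧ v t = wtransform (V t))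
    {t : ℝ} (ht : t ∈ Icc 0 T) :
    state ζ V t =ᵐ[volume] fun x =>
      linPart (μ / 3) hm.le hm1 ε (z 0) (v 0) t x + corrPart (μ / 3) hm.le ε z v t x := by
  have a1 := isInv_riem h hε hm hm1 hz hv hzv (σ := 1) (by norm_num) ht
  have a2 := isInv_riem h hε hm hm1 hz hv hzv (σ := -1) (by norm_num) ht
  have b1 := isInv_lamOp_riem h hε hm hm1 hz hv hzv (σ := 1) (by norm_num) ht
  have b2 := isInv_lamOp_riem h hε hm hm1 hz hv hzv (σ := -1) (by norm_num) ht
  have A := (a1.add a2).smul (2⁻¹ : ℂ)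
  have B := (b1.add (b2.smul (-1 : ℂ))).smul (2⁻¹ : ℂ)
  rw [← sym_zero_eq_riem, (hzv t ht).1] at A
  rw [neg_one_smul, ← sub_eq_add_neg, ← map_sub, ← sym_zero_eq_lamOp_riem, (hzv t ht).2] at B
  have A' := (isInv_wtransform (h.continuous_zeta.1 t ht)).symm.trans A
  have B' := (isInv_wtransform (h.continuous_V.1 t ht)).symm.trans B
  filter_upwards [A', B'] with x hA hB
  rw [state, hA, hB]
  ext i
  fin_cases i
  · simp [linPart, corrPart]; ring
  · simp [linPart, corrPart]; ring

end representation

/-! ### Estimates for the linear part -/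

theorem norm_sq_pair_le (a b c d : ℂ) :
    ‖(!₂[2⁻¹ * (a + b), 2⁻¹ * (c - d)] : EuclideanSpace ℂ (Fin 2))‖ ^ 2 ≤
      ‖a‖ ^ 2 + ‖b‖ ^ 2 + ‖c‖ ^ 2 + ‖d‖ ^ 2 := by
  have h1 : ‖(2⁻¹ : ℂ) * (a + b)‖ ≤ (‖a‖ + ‖b‖) / 2 := by
    rw [norm_mul, norm_inv, Complex.norm_ofNat]
    linarith [norm_add_le a b]
  have h2 : ‖(2⁻¹ : ℂ) * (c - d)‖ ≤ (‖c‖ + ‖d‖) / 2 := by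
    rw [norm_mul, norm_inv, Complex.norm_ofNat]
    linarith [norm_sub_le c d]
  have h3 := pow_le_pow_left₀ (norm_nonneg _) h1 2
  have h4 := pow_le_pow_left₀ (norm_nonneg _) h2 2
  rw [EuclideanSpace.norm_sq_eq, Fin.sum_univ_two]
  change ‖(2⁻¹ : ℂ) * (a + b)‖ ^ 2 + ‖(2⁻¹ : ℂ) * (c - d)‖ ^ 2 ≤ _
  nlinarith [sq_nonneg (‖a‖ - ‖b‖), sq_nonneg (‖c‖ - ‖d‖), sq_nonneg (‖a‖), sq_nonneg (‖b‖),
    sq_nonneg (‖c‖), sq_nonneg (‖d‖)]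

theorem norm_pair_le {a b c d : ℂ} {B : ℝ} (ha : ‖a‖ ≤ B) (hb : ‖b‖ ≤ B) (hc : ‖c‖ ≤ B)
    (hd : ‖d‖ ≤ B) :
    ‖(!₂[2⁻¹ * (a + b), 2⁻¹ * (c - d)] : EuclideanSpace ℂ (Fin 2))‖ ≤ 2 * B := by
  have hB := (norm_nonneg a).trans ha
  refine abs_le_of_sq_le_sq' ((norm_sq_pair_le a b c d).trans ?_) (by positivity) |>.2
  have h1 := pow_le_pow_left₀ (norm_nonneg _) ha 2
  have h2 := pow_le_pow_left₀ (norm_nonneg _) hb 2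
  have h3 := pow_le_pow_left₀ (norm_nonneg _) hc 2
  have h4 := pow_le_pow_left₀ (norm_nonneg _) hd 2
  linarith

theorem enorm_pair_le {a b c d : ℂ} {B : ℝ≥0∞} (ha : ‖a‖ₑ ≤ B) (hb : ‖b‖ₑ ≤ B) (hc : ‖c‖ₑ ≤ B)
    (hd : ‖d‖ₑ ≤ B) :
    ‖(!₂[2⁻¹ * (a + b), 2⁻¹ * (c - d)] : EuclideanSpace ℂ (Fin 2))‖ₑ ≤ 2 * B := by
  rcases eq_or_ne B ⊤ with rfl | hB
  · simp
  have key : ∀ w : ℂ, ‖w‖ₑ ≤ B → ‖w‖ ≤ B.toReal := fun w hw => by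
    rw [← toReal_enorm]
    exact ENNReal.toReal_mono hB hw
  rw [← ofReal_norm]
  refine (ENNReal.ofReal_le_ofReal
    (norm_pair_le (key a ha) (key b hb) (key c hc) (key d hd))).trans_eq ?_
  rw [ENNReal.ofReal_mul zero_le_two, ENNReal.ofReal_toReal hB, ENNReal.ofReal_ofNat]

theorem lintegral_norm_sq_pair_le {α : Type*} [MeasurableSpace α] {ν : Measure α} {a b c d : α → ℂ}
    (ha : Measurable a) (hb : Measurable b) (hc : Measurable c) {N : ℝ} (hN : 0 ≤ N)
    (ia : ∫⁻ x, ENNReal.ofReal (‖a x‖ ^ 2) ∂ν ≤ ENNReal.ofReal N)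
    (ib : ∫⁻ x, ENNReal.ofReal (‖b x‖ ^ 2) ∂ν ≤ ENNReal.ofReal N)
    (ic : ∫⁻ x, ENNReal.ofReal (‖c x‖ ^ 2) ∂ν ≤ ENNReal.ofReal N)
    (id : ∫⁻ x, ENNReal.ofReal (‖d x‖ ^ 2) ∂ν ≤ ENNReal.ofReal N) :
    ∫⁻ x, ENNReal.ofReal (‖(!₂[2⁻¹ * (a x + b x), 2⁻¹ * (c x - d x)] :
      EuclideanSpace ℂ (Fin 2))‖ ^ 2) ∂ν ≤ ENNReal.ofReal (4 * N) := by
  have e : ENNReal.ofReal (4 * N) = ENNReal.ofReal N + ENNReal.ofReal N + ENNReal.ofReal N +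
      ENNReal.ofReal N := by
    rw [← ENNReal.ofReal_add, ← ENNReal.ofReal_add, ← ENNReal.ofReal_add] <;> try positivity
    ring_nf
  have m : ∀ {u : α → ℂ}, Measurable u → Measurable fun x => ENNReal.ofReal (‖u x‖ ^ 2) :=
    fun hu => (hu.norm.pow_const 2).ennreal_ofReal
  calc _ ≤ ∫⁻ x, (ENNReal.ofReal (‖a x‖ ^ 2) + ENNReal.ofReal (‖b x‖ ^ 2) +
        ENNReal.ofReal (‖c x‖ ^ 2) + ENNReal.ofReal (‖d x‖ ^ 2)) ∂ν := by
        refine lintegral_mono fun x => (ENNReal.ofReal_le_ofReal (norm_sq_pair_le _ _ _ _)).trans_eq ?_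
        rw [ENNReal.ofReal_add, ENNReal.ofReal_add, ENNReal.ofReal_add] <;> positivity
    _ = ∫⁻ x, ENNReal.ofReal (‖a x‖ ^ 2) ∂ν + ∫⁻ x, ENNReal.ofReal (‖b x‖ ^ 2) ∂ν +
        ∫⁻ x, ENNReal.ofReal (‖c x‖ ^ 2) ∂ν + ∫⁻ x, ENNReal.ofReal (‖d x‖ ^ 2) ∂ν := by
        have m1 := m ha
        have m2 := m hb
        have m3 := m hc
        rw [lintegral_add_left (by fun_prop), lintegral_add_left (by fun_prop),
          lintegral_add_left (by fun_prop)]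
    _ ≤ _ := by rw [e]; gcongr

theorem IsInv.lintegral_eq {w : L2} {u : ℝ → ℂ} (h : IsInv w u) :
    ∫⁻ x, ENNReal.ofReal (‖u x‖ ^ 2) = ENNReal.ofReal (‖w‖ ^ 2) := by
  have e : ‖(𝓕⁻ w : L2)‖ = ‖w‖ := (Lp.fourierTransformₗᵢ ℝ ℂ).symm.norm_map w
  rw [← e, ofReal_norm_sq_eq_lintegral]
  exact lintegral_congr_ae (h.mono fun x hx => by dsimp only; rw [hx])

section linear

variable {m κ M : ℝ} {f g w : L2}

/-- The decay `(1+k²)⁻¹` of the invariants beyond `L²` absorbs any weight `ρ ≤ (1+k²)²`. It serves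
the energy bound with `ρ = 1`, Strichartz with `ρ = 1+k²` and smoothing with `ρ = λ⁻³`. -/
theorem lintegral_weight_le (hf : ‖f‖ ≤ M) (hg : ‖g‖ ≤ M)
    (hw : ∀ᵐ ξ : ℝ, ‖w ξ‖ ≤ lam 1 (2 * Real.pi * ξ) ^ 2 * (‖f ξ‖ + ‖g ξ‖)) {ρ : ℝ → ℝ}
    (hρ0 : ∀ ξ, 0 ≤ ρ ξ) (hρ : ∀ ξ, lam 1 (2 * Real.pi * ξ) ^ 4 * ρ ξ ≤ 1) :
    ∫⁻ ξ, ENNReal.ofReal (‖w ξ‖ ^ 2 * ρ ξ) ≤ ENNReal.ofReal ((2 * M) ^ 2) := by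
  have hm : ∀ u : L2, AEMeasurable (fun ξ => ENNReal.ofReal (‖u ξ‖ ^ 2)) := fun u =>
    ((Lp.aestronglyMeasurable u).norm.aemeasurable.pow_const 2).ennreal_ofReal
  have two : ∀ a b : ℝ, 0 ≤ a → 0 ≤ b →
      2 * ENNReal.ofReal a + 2 * ENNReal.ofReal b = ENNReal.ofReal (2 * a + 2 * b) := fun a b ha hb => by
    rw [ENNReal.ofReal_add (by positivity) (by positivity), ENNReal.ofReal_mul zero_le_two,
      ENNReal.ofReal_mul zero_le_two, ENNReal.ofReal_ofNat]
  calc _ ≤ ∫⁻ ξ, (2 * ENNReal.ofReal (‖f ξ‖ ^ 2) + 2 * ENNReal.ofReal (‖g ξ‖ ^ 2)) := by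
        refine lintegral_mono_ae (hw.mono fun ξ h => ?_)
        rw [two _ _ (by positivity) (by positivity)]
        refine ENNReal.ofReal_le_ofReal ?_
        calc _ ≤ (lam 1 (2 * Real.pi * ξ) ^ 2 * (‖f ξ‖ + ‖g ξ‖)) ^ 2 * ρ ξ := by
              have := hρ0 ξ
              gcongr
          _ = lam 1 (2 * Real.pi * ξ) ^ 4 * ρ ξ * (‖f ξ‖ + ‖g ξ‖) ^ 2 := by ring
          _ ≤ 1 * (‖f ξ‖ + ‖g ξ‖) ^ 2 := by
              gcongr
              exact hρ ξ
          _ ≤ _ := by nlinarith [sq_nonneg (‖f ξ‖ - ‖g ξ‖)]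
    _ = 2 * ENNReal.ofReal (‖f‖ ^ 2) + 2 * ENNReal.ofReal (‖g‖ ^ 2) := by
        rw [lintegral_add_left' ((hm f).const_mul 2), lintegral_const_mul'' _ (hm f),
          lintegral_const_mul'' _ (hm g), ofReal_norm_sq_eq_lintegral, ofReal_norm_sq_eq_lintegral]
    _ ≤ _ := by
        rw [two _ _ (by positivity) (by positivity)]
        refine ENNReal.ofReal_le_ofReal ?_
        have h1 := pow_le_pow_left₀ (norm_nonneg _) hf 2
        have h2 := pow_le_pow_left₀ (norm_nonneg _) hg 2
        linarith

theorem lam_one_pow_le_one (n : ℕ) (k : ℝ) : lam 1 k ^ n ≤ 1 :=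
  pow_le_one₀ (lam_pos zero_le_one k).le (lam_le_one zero_le_one k)

theorem norm_le_of_weight (hf : ‖f‖ ≤ M) (hg : ‖g‖ ≤ M)
    (hw : ∀ᵐ ξ : ℝ, ‖w ξ‖ ≤ lam 1 (2 * Real.pi * ξ) ^ 2 * (‖f ξ‖ + ‖g ξ‖)) : ‖w‖ ≤ 2 * M := by
  have h := lintegral_weight_le hf hg hw (ρ := fun _ => 1) (fun _ => zero_le_one)
    (fun ξ => by simpa using lam_one_pow_le_one 4 _)
  simp only [mul_one] at h
  rw [← ofReal_norm_sq_eq_lintegral, ENNReal.ofReal_le_ofReal_iff (by positivity)] at h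
  exact abs_le_of_sq_le_sq' h (by linarith [(norm_nonneg f).trans hf]) |>.2

theorem packet_strichartz (hm : 0 < m) (hm1 : m ≤ 1) (hκ : κ ≠ 0) (hf : ‖f‖ ≤ M) (hg : ‖g‖ ≤ M)
    (hw : ∀ᵐ ξ : ℝ, ‖w ξ‖ ≤ lam 1 (2 * Real.pi * ξ) ^ 2 * (‖f ξ‖ + ‖g ξ‖)) (hi : Integrable w)
    (T : ℝ) :
    ∃ S : ℝ → ℝ≥0∞, Measurable S ∧ (∀ t x, ‖packet m κ w t x‖ₑ ≤ S t) ∧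
      ∫⁻ t in Ioo 0 T, S t ^ 6 ≤ ENNReal.ofReal (600000 ^ 3 * (m * |κ|)⁻¹ * (2 * M) ^ 6) := by
  refine strichartz hm hm1 hκ (lintegral_weight_le hf hg hw (fun ξ => by positivity) fun ξ => ?_) hi T
  have h := lam_sq_mul zero_le_one (2 * Real.pi * ξ)
  rw [one_mul] at h
  calc _ = lam 1 (2 * Real.pi * ξ) ^ 2 *
        (lam 1 (2 * Real.pi * ξ) ^ 2 * (1 + (2 * Real.pi * ξ) ^ 2)) := by ring
    _ ≤ 1 := by rw [h, mul_one]; exact lam_one_pow_le_one 2 _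

theorem packet_smoothing (hm : 0 ≤ m) (hm1 : m ≤ 1) (hκ : κ ≠ 0) (hf : ‖f‖ ≤ M) (hg : ‖g‖ ≤ M)
    (hw : ∀ᵐ ξ : ℝ, ‖w ξ‖ ≤ lam 1 (2 * Real.pi * ξ) ^ 2 * (‖f ξ‖ + ‖g ξ‖)) (hi : Integrable w)
    {T : ℝ} (hT : 0 < T) (x : ℝ) :
    ∫⁻ t in Ioo 0 T, ENNReal.ofReal (‖packet m κ w t x‖ ^ 2) ≤
      ENNReal.ofReal (3 * |κ|⁻¹ * (2 * M) ^ 2) := by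
  refine local_smoothing hm hκ ?_ hi hT x
  simp only [div_eq_mul_inv]
  refine lintegral_weight_le hf hg hw
    (fun ξ => inv_nonneg.2 (pow_nonneg (lam_pos hm _).le 3)) fun ξ => ?_
  have hp := lam_pos hm (2 * Real.pi * ξ)
  have hp1 := lam_pos (m := 1) zero_le_one (2 * Real.pi * ξ)
  calc _ = lam 1 (2 * Real.pi * ξ) *
        ((lam m (2 * Real.pi * ξ))⁻¹ * lam 1 (2 * Real.pi * ξ)) ^ 3 := by ring
    _ ≤ 1 * 1 ^ 3 := by
        gcongr
        · exact lam_le_one zero_le_one _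
        · exact inv_lam_mul_lam_one_le hm hm1 _
    _ = 1 := by norm_num

theorem packet_energy (hm : 0 ≤ m) (hf : ‖f‖ ≤ M) (hg : ‖g‖ ≤ M)
    (hw : ∀ᵐ ξ : ℝ, ‖w ξ‖ ≤ lam 1 (2 * Real.pi * ξ) ^ 2 * (‖f ξ‖ + ‖g ξ‖)) (hi : Integrable w)
    (t : ℝ) : ∫⁻ x, ENNReal.ofReal (‖packet m κ w t x‖ ^ 2) ≤ ENNReal.ofReal ((2 * M) ^ 2) := by
  have h : IsInv (prop m hm (κ * t) w) (packet m κ w t) := isInv_prop hm hi (κ * t)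
  rw [h.lintegral_eq]
  have h1 : ‖prop m hm (κ * t) w‖ ≤ 1 * ‖w‖ := norm_mulOp_apply_le _ (fun ξ => (norm_wave _ _ _ _).le) w
  rw [one_mul] at h1
  exact ENNReal.ofReal_le_ofReal
    (pow_le_pow_left₀ (norm_nonneg _) (h1.trans (norm_le_of_weight hf hg hw)) 2)

theorem continuous_packet (hm : 0 ≤ m) (κ : ℝ) (hi : Integrable w) :
    Continuous fun p : ℝ × ℝ => packet m κ w p.1 p.2 :=
  (continuous_integral_wave hm hi).comp
    (continuous_snd.prodMk (continuous_const.mul continuous_fst))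

theorem norm_lamOp_riem_le (hm : 0 ≤ m) (hm1 : m ≤ 1) {σ : ℝ} (hσ : |σ| = 1) (f g : L2) :
    ∀ᵐ ξ : ℝ, ‖lamOp m hm (riem m hm hm1 σ (f, g)) ξ‖ ≤
      lam 1 (2 * Real.pi * ξ) ^ 2 * (‖f ξ‖ + ‖g ξ‖) := by
  filter_upwards [norm_riem_le hm hm1 hσ f g,
    coeFn_mulOp (memLp_top_lam hm) (riem m hm hm1 σ (f, g))] with ξ h1 h2
  rw [lamOp, h2, norm_mul, Complex.norm_real, Real.norm_of_nonneg (lam_pos hm _).le]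
  exact (mul_le_of_le_one_left (norm_nonneg _) (lam_le_one hm _)).trans h1

theorem measurable_linPart (hm : 0 ≤ m) (hm1 : m ≤ 1) (ε : ℝ) (f g : L2) :
    Measurable fun p : ℝ × ℝ => linPart m hm hm1 ε f g p.1 p.2 := by
  have i1 := integrable_riem hm hm1 (σ := 1) (by norm_num) f g
  have i2 := integrable_riem hm hm1 (σ := -1) (by norm_num) f g
  have c1 := continuous_packet hm ε⁻¹ i1
  have c2 := continuous_packet hm (-ε⁻¹) i2
  have c3 := continuous_packet hm ε⁻¹ (integrable_lamOp hm i1)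
  have c4 := continuous_packet hm (-ε⁻¹) (integrable_lamOp hm i2)
  refine Continuous.measurable ((PiLp.continuous_toLp 2 _).comp (continuous_pi fun i => ?_))
  fin_cases i
  · exact continuous_const.mul (c1.add c2)
  · exact continuous_const.mul (c3.sub c4)

theorem linPart_strichartz (hm : 0 < m) (hm1 : m ≤ 1) {ε : ℝ} (hε : 0 < ε) (hf : ‖f‖ ≤ M)
    (hg : ‖g‖ ≤ M) (T : ℝ) :
    ∃ S : ℝ → ℝ≥0∞, Measurable S ∧ (∀ t x, ‖linPart m hm.le hm1 ε f g t x‖ₑ ≤ S t) ∧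
      ∫⁻ t in Ioo 0 T, S t ^ 6 ≤ ENNReal.ofReal ((4000000 * M) ^ 6 * (ε / m)) := by
  have hκ : ε⁻¹ ≠ 0 := inv_ne_zero hε.ne'
  have i1 := integrable_riem hm.le hm1 (σ := 1) (by norm_num) f g
  have i2 := integrable_riem hm.le hm1 (σ := -1) (by norm_num) f g
  have n1 := norm_riem_le hm.le hm1 (σ := 1) (by norm_num) f g
  have n2 := norm_riem_le hm.le hm1 (σ := -1) (by norm_num) f g
  have n3 := norm_lamOp_riem_le hm.le hm1 (σ := 1) (by norm_num) f g
  have n4 := norm_lamOp_riem_le hm.le hm1 (σ := -1) (by norm_num) f g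
  obtain ⟨S1, m1, b1, e1⟩ := packet_strichartz hm hm1 hκ hf hg n1 i1 T
  obtain ⟨S2, m2, b2, e2⟩ := packet_strichartz hm hm1 (neg_ne_zero.2 hκ) hf hg n2 i2 T
  obtain ⟨S3, m3, b3, e3⟩ := packet_strichartz hm hm1 hκ hf hg n3 (integrable_lamOp hm.le i1) T
  obtain ⟨S4, m4, b4, e4⟩ :=
    packet_strichartz hm hm1 (neg_ne_zero.2 hκ) hf hg n4 (integrable_lamOp hm.le i2) T
  have hpos := hε
  have ha : (m * |ε⁻¹|)⁻¹ = ε / m := by rw [abs_of_pos (inv_pos.2 hε), mul_inv, inv_inv, mul_comm]; rfl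
  rw [abs_neg] at e2 e4
  rw [ha] at e1 e2 e3 e4
  refine ⟨fun t => 2 * (S1 t + S2 t + S3 t + S4 t),
    (((m1.add m2).add m3).add m4).const_mul 2, fun t x => ?_, ?_⟩
  · refine enorm_pair_le ((b1 t x).trans ?_) ((b2 t x).trans ?_) ((b3 t x).trans ?_)
      ((b4 t x).trans ?_)
    · rw [add_assoc, add_assoc]; exact le_self_add
    · rw [add_assoc, add_comm (S1 t), add_assoc]; exact le_self_add
    · rw [add_comm _ (S3 t), add_assoc]; exact le_self_add
    · exact le_add_self
  -- The sum is at most four times the maximum, and `262144 = (2·4)⁶`.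
  · have key : ∀ a b c d : ℝ≥0∞, (2 * (a + b + c + d)) ^ 6 ≤
        262144 * (a ^ 6 + b ^ 6 + c ^ 6 + d ^ 6) := fun a b c d => by
      have h1 : a + b + c + d ≤ 4 * max (max a b) (max c d) := by
        calc _ ≤ max (max a b) (max c d) + max (max a b) (max c d) + max (max a b) (max c d) +
              max (max a b) (max c d) := by
              gcongr
              · exact (le_max_left _ _).trans (le_max_left _ _)
              · exact (le_max_right _ _).trans (le_max_left _ _)
              · exact (le_max_left _ _).trans (le_max_right _ _)
              · exact (le_max_right _ _).trans (le_max_right _ _)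
          _ = _ := by ring
      have h2 : (max (max a b) (max c d)) ^ 6 ≤ a ^ 6 + b ^ 6 + c ^ 6 + d ^ 6 := by
        rcases max_choice (max a b) (max c d) with h | h <;> rw [h]
        · rcases max_choice a b with h | h <;> rw [h]
          · rw [add_assoc, add_assoc]; exact le_self_add
          · rw [add_assoc, add_comm (a ^ 6), add_assoc]; exact le_self_add
        · rcases max_choice c d with h | h <;> rw [h]
          · rw [add_comm _ (c ^ 6), add_assoc]; exact le_self_add
          · exact le_add_self
      calc _ ≤ (2 * (4 * max (max a b) (max c d))) ^ 6 := by gcongr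
        _ = 262144 * (max (max a b) (max c d)) ^ 6 := by ring
        _ ≤ _ := by gcongr
    refine (lintegral_mono fun t => key _ _ _ _).trans ?_
    rw [lintegral_const_mul _ (by fun_prop), lintegral_add_left (by fun_prop),
      lintegral_add_left (by fun_prop), lintegral_add_left (by fun_prop)]
    refine (mul_le_mul_right (add_le_add (add_le_add (add_le_add e1 e2) e3) e4) _).trans ?_
    have hc : (0 : ℝ) ≤ 600000 ^ 3 * (ε / m) * (2 * M) ^ 6 := by positivity
    rw [← ENNReal.ofReal_add hc hc, ← ENNReal.ofReal_add (by positivity) hc,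
      ← ENNReal.ofReal_add (by positivity) hc, ← ENNReal.ofReal_ofNat 262144,
      ← ENNReal.ofReal_mul (by norm_num)]
    refine ENNReal.ofReal_le_ofReal ?_
    have hy : (0 : ℝ) ≤ M ^ 6 * (ε / m) := by positivity
    linarith

theorem linPart_smoothing (hm : 0 ≤ m) (hm1 : m ≤ 1) {ε : ℝ} (hε : 0 < ε) (hf : ‖f‖ ≤ M)
    (hg : ‖g‖ ≤ M) {T : ℝ} (hT : 0 < T) (x : ℝ) :
    ∫⁻ t in Ioo 0 T, ENNReal.ofReal (‖linPart m hm hm1 ε f g t x‖ ^ 2) ≤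
      ENNReal.ofReal (48 * ε * M ^ 2) := by
  have hκ : ε⁻¹ ≠ 0 := inv_ne_zero hε.ne'
  have i1 := integrable_riem hm hm1 (σ := 1) (by norm_num) f g
  have i2 := integrable_riem hm hm1 (σ := -1) (by norm_num) f g
  have n1 := norm_riem_le hm hm1 (σ := 1) (by norm_num) f g
  have n2 := norm_riem_le hm hm1 (σ := -1) (by norm_num) f g
  have n3 := norm_lamOp_riem_le hm hm1 (σ := 1) (by norm_num) f g
  have n4 := norm_lamOp_riem_le hm hm1 (σ := -1) (by norm_num) f g
  have j1 := integrable_lamOp hm i1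
  have j2 := integrable_lamOp hm i2
  have e1 := packet_smoothing hm hm1 hκ hf hg n1 i1 hT x
  have e2 := packet_smoothing hm hm1 (neg_ne_zero.2 hκ) hf hg n2 i2 hT x
  have e3 := packet_smoothing hm hm1 hκ hf hg n3 j1 hT x
  have e4 := packet_smoothing hm hm1 (neg_ne_zero.2 hκ) hf hg n4 j2 hT x
  rw [abs_neg] at e2 e4
  rw [abs_of_pos (inv_pos.2 hε), inv_inv] at e1 e2 e3 e4
  have mk : ∀ {κ : ℝ} {w : L2}, Integrable w → Measurable fun t => packet m κ w t x := fun {κ w} hi =>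
    ((continuous_packet hm κ hi).comp (continuous_id.prodMk continuous_const)).measurable
  refine (lintegral_norm_sq_pair_le (mk i1) (mk i2) (mk j1) (by positivity) e1 e2 e3 e4).trans ?_
  exact ENNReal.ofReal_le_ofReal (by linarith)

theorem linPart_energy (hm : 0 ≤ m) (hm1 : m ≤ 1) (ε : ℝ) (hf : ‖f‖ ≤ M)
    (hg : ‖g‖ ≤ M) (t : ℝ) :
    ∫⁻ x, ENNReal.ofReal (‖linPart m hm hm1 ε f g t x‖ ^ 2) ≤ ENNReal.ofReal ((4 * M) ^ 2) := by
  have i1 := integrable_riem hm hm1 (σ := 1) (by norm_num) f g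
  have i2 := integrable_riem hm hm1 (σ := -1) (by norm_num) f g
  have n1 := norm_riem_le hm hm1 (σ := 1) (by norm_num) f g
  have n2 := norm_riem_le hm hm1 (σ := -1) (by norm_num) f g
  have n3 := norm_lamOp_riem_le hm hm1 (σ := 1) (by norm_num) f g
  have n4 := norm_lamOp_riem_le hm hm1 (σ := -1) (by norm_num) f g
  have j1 := integrable_lamOp hm i1
  have j2 := integrable_lamOp hm i2
  have mk : ∀ {κ : ℝ} {w : L2}, Integrable w → Measurable fun x => packet m κ w t x := fun {κ w} hi =>
    ((continuous_packet hm κ hi).comp (continuous_const.prodMk continuous_id)).measurable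
  refine (lintegral_norm_sq_pair_le (mk i1) (mk i2) (mk j1) (by positivity)
    (packet_energy hm hf hg n1 i1 t) (packet_energy hm hf hg n2 i2 t)
    (packet_energy hm hf hg n3 j1 t) (packet_energy hm hf hg n4 j2 t)).trans ?_
  exact ENNReal.ofReal_le_ofReal (by linarith)

end linear

/-! ### Estimates for the nonlinear part -/

/-- The constant in the estimates of the nonlinear part. -/
noncomputable def bilConst : ℝ := 1000000 * (1 + ‖leibnizOne‖ + ‖derivProd‖ + ‖bil‖)

theorem norm_leibnizOne_le : 1000000 * ‖leibnizOne‖ ≤ bilConst := by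
  unfold bilConst
  have h1 := norm_nonneg derivProd
  have h2 := norm_nonneg bil
  linarith

theorem norm_derivProd_le : 1000000 * ‖derivProd‖ ≤ bilConst := by
  unfold bilConst
  have h1 := norm_nonneg leibnizOne
  have h2 := norm_nonneg bil
  linarith

theorem norm_bil_le : 1000000 * ‖bil‖ ≤ bilConst := by
  unfold bilConst
  have h1 := norm_nonneg leibnizOne
  have h2 := norm_nonneg derivProd
  linarith

theorem bilConst_pos : 0 < bilConst := by
  unfold bilConst
  have h1 := norm_nonneg leibnizOne
  have h2 := norm_nonneg derivProd
  have h3 := norm_nonneg bil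
  linarith

theorem continuous_duhVec {m : ℝ} (hm : 0 < m) (κ : ℝ) {f g : ℝ → L2} (hf : Continuous f)
    (hg : Continuous g) : Continuous (duhVec m hm.le κ f g) :=
  intervalIntegral.continuous_parametric_intervalIntegral_of_continuous
    (continuous_duhVec_integrand hm κ hf hg) continuous_id

theorem continuous_evalAt {m : ℝ} (hm : 0 ≤ m) {θ : ℝ → ℂ} (hθ : MemLp θ 2) (f : L2) :
    Continuous fun x => evalAt m hm hθ x f := by
  have hi : Integrable fun ξ => θ ξ * f ξ := hθ.integrable_mul (Lp.memLp f)
  refine (continuous_fourierInv hi).congr fun x => ?_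
  rw [fourierInv_eq_integral_wave m, evalAt_apply]

/-- Separate continuity already gives joint measurability (a Carathéodory function), which Tonelli's
theorem requires; joint continuity is not needed. -/
theorem measurable_of_continuous_of_continuous {F : ℝ → ℝ → ℂ} (h1 : ∀ t, Continuous (F t))
    (h2 : ∀ x, Continuous fun t => F t x) : Measurable fun p : ℝ × ℝ => F p.1 p.2 := by
  have h := measurable_uncurry_of_continuous_of_measurable (u := fun x t => F t x) h1
    fun x => (h2 x).measurable
  exact h.comp measurable_swap

theorem measurable_evalAt_duhVec {m : ℝ} (hm : 0 < m) (j : ℕ) (κ : ℝ) {f g : ℝ → L2}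
    (hf : Continuous f) (hg : Continuous g) :
    Measurable fun p : ℝ × ℝ =>
      evalAt m hm.le (memLp_two_al hm.le j) p.2 (duhVec m hm.le κ f g p.1) :=
  measurable_of_continuous_of_continuous
    (F := fun t x => evalAt m hm.le (memLp_two_al hm.le j) x (duhVec m hm.le κ f g t))
    (fun t => continuous_evalAt hm.le (memLp_two_al hm.le j) (duhVec m hm.le κ f g t))
    (fun x => (evalAt m hm.le (memLp_two_al hm.le j) x).continuous.comp
      (continuous_duhVec hm κ hf hg))

section correction

variable {m ε M : ℝ} {z v : ℝ → L2}

theorem measurable_correction (hm : 0 < m) (hz : Continuous z) (hv : Continuous v) (j : ℕ) (σ : ℝ) :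
    Measurable fun p : ℝ × ℝ => correction m hm.le ε z v j σ p.1 p.2 :=
  ((measurable_evalAt_duhVec hm j _ hz hv).const_mul _).add
    ((measurable_evalAt_duhVec hm (j + 1) _ hv hv).const_mul _)

theorem norm_correction_le (hm : 0 < m) (j : ℕ) {σ : ℝ} (hσ : |σ| = 1) (t x : ℝ) :
    ‖correction m hm.le ε z v j σ t x‖ ≤
      ‖evalAt m hm.le (memLp_two_al hm.le j) x (duhVec m hm.le (σ * ε⁻¹) z v t)‖ +
      ‖evalAt m hm.le (memLp_two_al hm.le (j + 1)) x (duhVec m hm.le (σ * ε⁻¹) v v t)‖ := by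
  refine (norm_add_le _ _).trans (add_le_add ?_ ?_)
  · rw [norm_mul, norm_neg, norm_one, one_mul]
  · rw [norm_mul, norm_neg, norm_div, Complex.norm_real, Real.norm_eq_abs, hσ, Complex.norm_ofNat]
    exact mul_le_of_le_one_left (norm_nonneg _) (by norm_num)

theorem lintegral_correction_le {α : Type*} [MeasurableSpace α] {ν : Measure α} (hm : 0 < m) (j : ℕ)
    {σ : ℝ} (hσ : |σ| = 1) {t x : α → ℝ} {N : ℝ} (hN : 0 ≤ N)
    (hmeas : Measurable fun a =>
      evalAt m hm.le (memLp_two_al hm.le j) (x a) (duhVec m hm.le (σ * ε⁻¹) z v (t a)))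
    (h1 : ∫⁻ a, ENNReal.ofReal (‖evalAt m hm.le (memLp_two_al hm.le j) (x a)
      (duhVec m hm.le (σ * ε⁻¹) z v (t a))‖ ^ 2) ∂ν ≤ ENNReal.ofReal N)
    (h2 : ∫⁻ a, ENNReal.ofReal (‖evalAt m hm.le (memLp_two_al hm.le (j + 1)) (x a)
      (duhVec m hm.le (σ * ε⁻¹) v v (t a))‖ ^ 2) ∂ν ≤ ENNReal.ofReal N) :
    ∫⁻ a, ENNReal.ofReal (‖correction m hm.le ε z v j σ (t a) (x a)‖ ^ 2) ∂ν ≤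
      ENNReal.ofReal (4 * N) := by
  have hp : Measurable fun a => ENNReal.ofReal (‖evalAt m hm.le (memLp_two_al hm.le j) (x a)
      (duhVec m hm.le (σ * ε⁻¹) z v (t a))‖ ^ 2) := (hmeas.norm.pow_const 2).ennreal_ofReal
  calc _ ≤ ∫⁻ a, 2 * (ENNReal.ofReal (‖evalAt m hm.le (memLp_two_al hm.le j) (x a)
        (duhVec m hm.le (σ * ε⁻¹) z v (t a))‖ ^ 2) +
        ENNReal.ofReal (‖evalAt m hm.le (memLp_two_al hm.le (j + 1)) (x a)
        (duhVec m hm.le (σ * ε⁻¹) v v (t a))‖ ^ 2)) ∂ν := by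
        refine lintegral_mono fun a => ?_
        dsimp only
        have h := pow_le_pow_left₀ (norm_nonneg _)
          (norm_correction_le (ε := ε) (z := z) (v := v) hm j hσ (t a) (x a)) 2
        rw [← ENNReal.ofReal_add (by positivity) (by positivity)]
        refine (ENNReal.ofReal_le_ofReal (h.trans add_sq_le)).trans_eq ?_
        rw [ENNReal.ofReal_mul zero_le_two, ENNReal.ofReal_ofNat]
    _ ≤ 2 * (ENNReal.ofReal N + ENNReal.ofReal N) := by
        rw [lintegral_const_mul' _ _ (by norm_num), lintegral_add_left hp]
        gcongr
    _ = _ := by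
        rw [← ENNReal.ofReal_add hN hN, ← two_mul, show 4 * N = 2 * (2 * N) by ring,
          ENNReal.ofReal_mul zero_le_two (q := 2 * N), ENNReal.ofReal_ofNat]

theorem mul_abs_inv_rpow (hm : 0 < m) (hε : 0 < ε) {σ : ℝ} (hσ : |σ| = 1) (p : ℝ) :
    (m * |σ * ε⁻¹|) ^ (-p) = (ε / m) ^ p := by
  rw [abs_mul, hσ, one_mul, abs_of_pos (inv_pos.2 hε), Real.rpow_neg (by positivity),
    ← Real.inv_rpow (by positivity), mul_inv, inv_inv, mul_comm, div_eq_mul_inv]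

theorem correction_sup (hm : 0 < m) (hm1 : m ≤ 1) (hε : 0 < ε) (hz : Continuous z)
    (hv : Continuous v) (hzM : ∀ t, ‖z t‖ ≤ M) (hvM : ∀ t, ‖v t‖ ≤ M) {p : ℝ}
    (hp : p = 1 / 2 ∨ p = 1 / 3) {j : ℕ} (hj : j ≤ 1) {σ : ℝ} (hσ : |σ| = 1) {t : ℝ} (ht : 0 ≤ t)
    (x : ℝ) : ‖correction m hm.le ε z v j σ t x‖ ≤
      2 * (100000 * ‖leibnizOne‖ * M ^ 2 * (ε / m) ^ p * t ^ (1 - p)) := by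
  have hκ : σ * ε⁻¹ ≠ 0 := mul_ne_zero (fun h => by simp [h] at hσ) (inv_ne_zero hε.ne')
  have h1 := norm_evalAt_duhVec_le hm hm1 (j := j) (by lia) hp hκ hz hv hzM hvM ht x
  have h2 := norm_evalAt_duhVec_le hm hm1 (j := j + 1) (by lia) hp hκ hv hv hvM hvM ht x
  rw [mul_abs_inv_rpow hm hε hσ] at h1 h2
  linarith [norm_correction_le (ε := ε) (z := z) (v := v) hm j hσ t x]

theorem correction_energy (hm : 0 < m) (hm1 : m ≤ 1) (hε : 0 < ε) (hz : Continuous z)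
    (hv : Continuous v) (hzM : ∀ t, ‖z t‖ ≤ M) (hvM : ∀ t, ‖v t‖ ≤ M) {p : ℝ}
    (hp : p = 1 / 2 ∨ p = 1 / 3) (j : ℕ) {σ : ℝ} (hσ : |σ| = 1) {t : ℝ} (ht : 0 ≤ t) :
    ∫⁻ x, ENNReal.ofReal (‖correction m hm.le ε z v j σ t x‖ ^ 2) ≤
      ENNReal.ofReal (4 * (200000 * ‖leibnizOne‖ * ‖derivProd‖ * M ^ 4 * (ε / m) ^ p *
        t ^ (2 - p))) := by
  have hκ : σ * ε⁻¹ ≠ 0 := mul_ne_zero (fun h => by simp [h] at hσ) (inv_ne_zero hε.ne')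
  refine lintegral_correction_le hm j hσ (by positivity)
    (continuous_evalAt hm.le _ _).measurable ?_ ?_
  · rw [(isInv_duh hm j _ hz hv t).lintegral_eq, ← mul_abs_inv_rpow hm hε hσ]
    exact ENNReal.ofReal_le_ofReal (norm_sq_duh_le hm hm1 j hp hκ hz hv hzM hvM ht)
  · rw [(isInv_duh hm (j + 1) _ hv hv t).lintegral_eq, ← mul_abs_inv_rpow hm hε hσ]
    exact ENNReal.ofReal_le_ofReal (norm_sq_duh_le hm hm1 (j + 1) hp hκ hv hv hvM hvM ht)

theorem correction_smoothing (hm : 0 < m) (hm1 : m ≤ 1) (hε : 0 < ε) (hz : Continuous z)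
    (hv : Continuous v) (hzM : ∀ t, ‖z t‖ ≤ M) (hvM : ∀ t, ‖v t‖ ≤ M) (j : ℕ) {σ : ℝ}
    (hσ : |σ| = 1) {T : ℝ} (hT : 0 < T) (x : ℝ) :
    ∫⁻ t in Ioo 0 T, ENNReal.ofReal (‖correction m hm.le ε z v j σ t x‖ ^ 2) ≤
      ENNReal.ofReal (4 * (12 * ε * T ^ 2 * (‖bil‖ * M ^ 2) ^ 2)) := by
  have hκ : σ * ε⁻¹ ≠ 0 := mul_ne_zero (fun h => by simp [h] at hσ) (inv_ne_zero hε.ne')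
  have ha : |σ * ε⁻¹|⁻¹ = ε := by rw [abs_mul, hσ, one_mul, abs_of_pos (inv_pos.2 hε), inv_inv]
  have h1 := lintegral_evalAt_duhVec_le hm hm1 j hκ hz hv hzM hvM hT x
  have h2 := lintegral_evalAt_duhVec_le hm hm1 (j + 1) hκ hv hv hvM hvM hT x
  rw [ha] at h1 h2
  exact lintegral_correction_le hm j hσ (t := fun t => t) (x := fun _ => x) (by positivity)
    ((evalAt m hm.le (memLp_two_al hm.le j) x).continuous.comp
      (continuous_duhVec hm _ hz hv)).measurable h1 h2

theorem measurable_corrPart (hm : 0 < m) (hz : Continuous z) (hv : Continuous v) :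
    Measurable fun p : ℝ × ℝ => corrPart m hm.le ε z v p.1 p.2 := by
  refine (PiLp.continuous_toLp 2 _).measurable.comp (measurable_pi_lambda _ fun i => ?_)
  fin_cases i
  · exact ((measurable_correction hm hz hv 0 1).add
      (measurable_correction hm hz hv 0 (-1))).const_mul _
  · exact ((measurable_correction hm hz hv 1 1).sub
      (measurable_correction hm hz hv 1 (-1))).const_mul _

theorem corrPart_sup (hm : 0 < m) (hm1 : m ≤ 1) (hε : 0 < ε) (hz : Continuous z)
    (hv : Continuous v) (hzM : ∀ t, ‖z t‖ ≤ M) (hvM : ∀ t, ‖v t‖ ≤ M) {p : ℝ}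
    (hp : p = 1 / 2 ∨ p = 1 / 3) {t : ℝ} (ht : 0 ≤ t) (x : ℝ) :
    ‖corrPart m hm.le ε z v t x‖ ≤ bilConst * M ^ 2 * (ε / m) ^ p * t ^ (1 - p) := by
  have k : ∀ j ≤ 1, ∀ σ : ℝ, |σ| = 1 → ‖correction m hm.le ε z v j σ t x‖ ≤ _ :=
    fun j hj σ hσ => correction_sup hm hm1 hε hz hv hzM hvM hp hj hσ ht x
  refine (norm_pair_le (k 0 (by norm_num) 1 (by norm_num)) (k 0 (by norm_num) (-1) (by norm_num))
    (k 1 le_rfl 1 (by norm_num)) (k 1 le_rfl (-1) (by norm_num))).trans ?_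
  have hc := norm_leibnizOne_le
  have h0 := norm_nonneg leibnizOne
  calc _ = (400000 * ‖leibnizOne‖) * M ^ 2 * (ε / m) ^ p * t ^ (1 - p) := by ring
    _ ≤ _ := by
        gcongr
        linarith

theorem measurable_correction_comp {α : Type*} [MeasurableSpace α] (hm : 0 < m)
    (hz : Continuous z) (hv : Continuous v) {t x : α → ℝ} (ht : Measurable t) (hx : Measurable x)
    (j : ℕ) (σ : ℝ) : Measurable fun a => correction m hm.le ε z v j σ (t a) (x a) := by
  have h1 := measurable_correction (ε := ε) hm hz hv j σ
  have h2 := h1.comp (ht.prodMk hx)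
  exact h2

theorem lintegral_corrPart_le {α : Type*} [MeasurableSpace α] {ν : Measure α} (hm : 0 < m)
    (hz : Continuous z) (hv : Continuous v) {t x : α → ℝ} (ht : Measurable t) (hx : Measurable x)
    {N : ℝ} (hN : 0 ≤ N)
    (h : ∀ j, ∀ σ : ℝ, |σ| = 1 →
      ∫⁻ a, ENNReal.ofReal (‖correction m hm.le ε z v j σ (t a) (x a)‖ ^ 2) ∂ν ≤ ENNReal.ofReal N) :
    ∫⁻ a, ENNReal.ofReal (‖corrPart m hm.le ε z v (t a) (x a)‖ ^ 2) ∂ν ≤ ENNReal.ofReal (4 * N) := by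
  have mk := measurable_correction_comp (ε := ε) hm hz hv ht hx
  unfold corrPart
  exact lintegral_norm_sq_pair_le (mk 0 1) (mk 0 (-1)) (mk 1 1) hN
    (h 0 1 (by norm_num)) (h 0 (-1) (by norm_num)) (h 1 1 (by norm_num)) (h 1 (-1) (by norm_num))

theorem corrPart_energy (hm : 0 < m) (hm1 : m ≤ 1) (hε : 0 < ε) (hz : Continuous z)
    (hv : Continuous v) (hzM : ∀ t, ‖z t‖ ≤ M) (hvM : ∀ t, ‖v t‖ ≤ M) {p : ℝ}
    (hp : p = 1 / 2 ∨ p = 1 / 3) {t : ℝ} (ht : 0 ≤ t) :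
    ∫⁻ x, ENNReal.ofReal (‖corrPart m hm.le ε z v t x‖ ^ 2) ≤
      ENNReal.ofReal ((bilConst * M ^ 2 * (ε / m) ^ (p / 2) * t ^ (1 - p / 2)) ^ 2) := by
  refine (lintegral_corrPart_le hm hz hv measurable_const measurable_id (by positivity)
    fun j σ hσ => correction_energy hm hm1 hε hz hv hzM hvM hp j hσ ht).trans
      (ENNReal.ofReal_le_ofReal ?_)
  have hc := norm_leibnizOne_le
  have hc' := norm_derivProd_le
  have h0 := norm_nonneg leibnizOne
  have h0' := norm_nonneg derivProd
  have e1 : ((ε / m) ^ (p / 2)) ^ 2 = (ε / m) ^ p := by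
    rw [← Real.rpow_mul_natCast (by positivity)]
    congr 1; push_cast; ring
  have e2 : (t ^ (1 - p / 2)) ^ 2 = t ^ (2 - p) := by
    rw [← Real.rpow_mul_natCast ht]
    congr 1; push_cast; ring
  -- `3200000 = 4·4·200000`: one factor 4 for the two terms of a `correction`, one for the four
  -- corrections.
  have hcc : 3200000 * ‖leibnizOne‖ * ‖derivProd‖ ≤ bilConst ^ 2 := by
    nlinarith [mul_le_mul hc hc' (by positivity) bilConst_pos.le, mul_nonneg h0 h0']
  calc _ = (3200000 * ‖leibnizOne‖ * ‖derivProd‖) * M ^ 4 * (ε / m) ^ p * t ^ (2 - p) := by ring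
    _ ≤ bilConst ^ 2 * M ^ 4 * (ε / m) ^ p * t ^ (2 - p) := by gcongr
    _ = _ := by rw [← e1, ← e2]; ring

theorem corrPart_smoothing (hm : 0 < m) (hm1 : m ≤ 1) (hε : 0 < ε) (hz : Continuous z)
    (hv : Continuous v) (hzM : ∀ t, ‖z t‖ ≤ M) (hvM : ∀ t, ‖v t‖ ≤ M) {T : ℝ} (hT : 0 < T) (x : ℝ) :
    ∫⁻ t in Ioo 0 T, ENNReal.ofReal (‖corrPart m hm.le ε z v t x‖ ^ 2) ≤
      ENNReal.ofReal (ε * (bilConst * M ^ 2 * T) ^ 2) := by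
  refine (lintegral_corrPart_le hm hz hv measurable_id measurable_const (by positivity)
    fun j σ hσ => correction_smoothing hm hm1 hε hz hv hzM hvM j hσ hT x).trans
      (ENNReal.ofReal_le_ofReal ?_)
  have hc := norm_bil_le
  have h0 := norm_nonneg bil
  -- `192 = 4·4·12`, with the same two factors 4.
  have hcc : 192 * ‖bil‖ ^ 2 ≤ bilConst ^ 2 := by
    nlinarith [mul_le_mul hc hc (by positivity) bilConst_pos.le, mul_nonneg h0 h0]
  calc _ = (192 * ‖bil‖ ^ 2) * (ε * M ^ 4 * T ^ 2) := by ring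
    _ ≤ bilConst ^ 2 * (ε * M ^ 4 * T ^ 2) := by gcongr
    _ = _ := by ring

end correction

/-! ### Interpolation and mixed norms -/

theorem toReal_one_div (r : ℝ≥0∞) : (1 / r).toReal = r.toReal⁻¹ := by
  rw [one_div, ENNReal.toReal_inv]

theorem ofReal_norm_sq {E : Type*} [NormedAddCommGroup E] (x : E) :
    ENNReal.ofReal (‖x‖ ^ 2) = ‖x‖ₑ ^ 2 := by
  rw [← ofReal_norm, ENNReal.ofReal_pow (norm_nonneg _)]

/-- Interpolation between `L²` and a pointwise bound. -/
theorem eLpNorm_le_interpolate {E : Type*} [NormedAddCommGroup E] {f : ℝ → E}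
    (hf : AEStronglyMeasurable f) {A B : ℝ≥0∞} (hA : ∀ x, ‖f x‖ₑ ≤ A)
    (hB : ∫⁻ x, ‖f x‖ₑ ^ 2 ≤ B ^ 2) {r : ℝ≥0∞} (hr : 2 ≤ r) :
    eLpNorm f r volume ≤ A ^ (1 - 2 * (1 / r).toReal) * B ^ (2 * (1 / r).toReal) := by
  rw [toReal_one_div]
  rcases eq_or_ne r ⊤ with rfl | hr'
  · simp only [ENNReal.toReal_top, inv_zero, mul_zero, sub_zero, ENNReal.rpow_one,
      ENNReal.rpow_zero, mul_one, eLpNorm_exponent_top]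
    exact eLpNormEssSup_le_of_ae_enorm_bound (Eventually.of_forall hA)
  have h2 : 2 ≤ r.toReal := by simpa using ENNReal.toReal_mono hr' hr
  have hp : 0 < r.toReal := by linarith
  rw [eLpNorm_eq_lintegral_rpow_enorm_toReal (by rintro rfl; simp at hr) hr', one_div]
  have h1 : ∫⁻ x, ‖f x‖ₑ ^ r.toReal ≤ A ^ (r.toReal - 2) * B ^ 2 := by
    calc _ ≤ ∫⁻ x, A ^ (r.toReal - 2) * ‖f x‖ₑ ^ 2 := by
          refine lintegral_mono fun x => ?_
          have e : ‖f x‖ₑ ^ r.toReal = ‖f x‖ₑ ^ (r.toReal - 2) * ‖f x‖ₑ ^ 2 := by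
            rw [← ENNReal.rpow_natCast, ← ENNReal.rpow_add_of_nonneg _ _ (by linarith) (by norm_num)]
            congr 1; push_cast; ring
          rw [e]
          exact mul_le_mul_left (ENNReal.rpow_le_rpow (hA x) (by linarith)) _
      _ = A ^ (r.toReal - 2) * ∫⁻ x, ‖f x‖ₑ ^ 2 :=
          lintegral_const_mul'' _ (hf.enorm.pow_const 2)
      _ ≤ _ := by gcongr
  calc _ ≤ (A ^ (r.toReal - 2) * B ^ 2) ^ r.toReal⁻¹ := ENNReal.rpow_le_rpow h1 (by positivity)
    _ = _ := by
        rw [ENNReal.mul_rpow_of_nonneg _ _ (by positivity), ← ENNReal.rpow_mul,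
          ← ENNReal.rpow_natCast, ← ENNReal.rpow_mul]
        congr 2
        field_simp

theorem ofReal_rpow_mul_rpow {x y a b : ℝ} (hx : 0 ≤ x) (hy : 0 ≤ y) (ha : 0 ≤ a) (hb : 0 ≤ b) :
    ENNReal.ofReal x ^ a * ENNReal.ofReal y ^ b = ENNReal.ofReal (x ^ a * y ^ b) := by
  rw [ENNReal.ofReal_rpow_of_nonneg hx ha, ENNReal.ofReal_rpow_of_nonneg hy hb,
    ENNReal.ofReal_mul (by positivity)]

theorem toReal_one_div_le_half {r : ℝ≥0∞} (hr : 2 ≤ r) : (1 / r).toReal ≤ 1 / 2 := by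
  have h : 1 / r ≤ 1 / 2 := ENNReal.div_le_div_left hr 1
  refine (ENNReal.toReal_mono (by simp) h).trans_eq ?_
  simp

theorem eLpNorm_le_of_forall_le {G : ℝ → ℝ≥0∞} {T K : ℝ} (hT : 0 < T) (hK : 0 ≤ K) (q : ℝ≥0∞)
    (h : ∀ t ∈ Ioo 0 T, G t ≤ ENNReal.ofReal K) :
    eLpNorm G q (volume.restrict (Ioo 0 T)) ≤ ENNReal.ofReal (K * T ^ (1 / q).toReal) := by
  refine (eLpNorm_le_of_ae_enorm_bound (C := ENNReal.ofReal K)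
    ((ae_restrict_iff' measurableSet_Ioo).2 (Eventually.of_forall h))).trans_eq ?_
  rw [Measure.restrict_apply_univ, Real.volume_Ioo, sub_zero, smul_eq_mul, toReal_one_div,
    ENNReal.ofReal_rpow_of_pos hT, ENNReal.ofReal_mul hK]

theorem measurable_left_of_prod {E : Type*} [MeasurableSpace E] {F : ℝ → ℝ → E}
    (h : Measurable fun p : ℝ × ℝ => F p.1 p.2) (t : ℝ) : Measurable (F t) :=
  h.comp measurable_prodMk_left

theorem measurable_right_of_prod {E : Type*} [MeasurableSpace E] {F : ℝ → ℝ → E}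
    (h : Measurable fun p : ℝ × ℝ => F p.1 p.2) (x : ℝ) : Measurable fun t => F t x :=
  h.comp measurable_prodMk_right

section

variable {m ε M T : ℝ} {z v : ℝ → L2}

/-- With `b = 1/r`, interpolating the gains `p` in `L^∞` and `p/2` in `L²` gives `p(1-2b) +
(p/2)(2b) = p - pb`; the time exponent is one minus this gain. -/
theorem eLpNorm_corrPart_le (hm : 0 < m) (hm1 : m ≤ 1) (hε : 0 < ε) (hz : Continuous z)
    (hv : Continuous v) (hzM : ∀ t, ‖z t‖ ≤ M) (hvM : ∀ t, ‖v t‖ ≤ M) {p : ℝ}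
    (hp : p = 1 / 2 ∨ p = 1 / 3) {t : ℝ} (ht : 0 < t) {r : ℝ≥0∞} (hr : 2 ≤ r) :
    eLpNorm (corrPart m hm.le ε z v t) r volume ≤
      ENNReal.ofReal (bilConst * M ^ 2 * (ε / m) ^ (p - p * (1 / r).toReal) *
        t ^ (1 - (p - p * (1 / r).toReal))) := by
  have hK := bilConst_pos
  have hmeas : Measurable (corrPart m hm.le ε z v t) :=
    measurable_left_of_prod (F := corrPart m hm.le ε z v) (measurable_corrPart (ε := ε) hm hz hv) t
  have hb := toReal_one_div_le_half hr
  have hb0 : 0 ≤ (1 / r).toReal := ENNReal.toReal_nonneg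
  set b := (1 / r).toReal
  have hX : 0 < ε / m := by positivity
  refine (eLpNorm_le_interpolate hmeas.aestronglyMeasurable
    (A := ENNReal.ofReal (bilConst * M ^ 2 * (ε / m) ^ p * t ^ (1 - p)))
    (B := ENNReal.ofReal (bilConst * M ^ 2 * (ε / m) ^ (p / 2) * t ^ (1 - p / 2)))
    (fun x => ?_) ?_ hr).trans_eq ?_
  · rw [← ofReal_norm]
    exact ENNReal.ofReal_le_ofReal (corrPart_sup hm hm1 hε hz hv hzM hvM hp ht.le x)
  · simp only [← ofReal_norm_sq]
    rw [← ENNReal.ofReal_pow (by positivity)]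
    exact corrPart_energy hm hm1 hε hz hv hzM hvM hp ht.le
  · change _ ^ (1 - 2 * b) * _ ^ (2 * b) = _
    rw [ofReal_rpow_mul_rpow (by positivity) (by positivity) (by linarith) (by linarith)]
    congr 1
    have hD0 : 0 ≤ bilConst * M ^ 2 := by positivity
    generalize bilConst * M ^ 2 = D at hD0 ⊢
    have hD : D ^ (1 - 2 * b) * D ^ (2 * b) = D := by
      rw [← Real.rpow_add_of_nonneg hD0 (by linarith) (by linarith), sub_add_cancel,
        Real.rpow_one]
    rw [Real.mul_rpow (by positivity) (by positivity), Real.mul_rpow (by positivity) (by positivity),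
      Real.mul_rpow (by positivity) (by positivity), Real.mul_rpow (by positivity) (by positivity),
      ← Real.rpow_mul hX.le, ← Real.rpow_mul hX.le, ← Real.rpow_mul ht.le, ← Real.rpow_mul ht.le]
    have hXe : (ε / m) ^ (p * (1 - 2 * b)) * (ε / m) ^ (p / 2 * (2 * b)) = (ε / m) ^ (p - p * b) := by
      rw [← Real.rpow_add hX]; congr 1; ring
    have hte : t ^ ((1 - p) * (1 - 2 * b)) * t ^ ((1 - p / 2) * (2 * b)) = t ^ (1 - (p - p * b)) := by
      rw [← Real.rpow_add ht]; congr 1; ring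
    rw [← hXe, ← hte]
    conv_rhs => rw [← hD]
    ring

/-- The nonlinear part in the mixed norms. -/
theorem mixedNorm_corrPart_le (hm : 0 < m) (hm1 : m ≤ 1) (hε : 0 < ε) (hz : Continuous z)
    (hv : Continuous v) (hzM : ∀ t, ‖z t‖ ≤ M) (hvM : ∀ t, ‖v t‖ ≤ M) {p : ℝ}
    (hp : p = 1 / 2 ∨ p = 1 / 3) (hT : 0 < T) {q r : ℝ≥0∞} (hr : 2 ≤ r)
    (hqr : (1 / q).toReal + p * (1 / r).toReal = p / 2) :
    mixedNorm T q r (corrPart m hm.le ε z v) ≤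
      ENNReal.ofReal (bilConst * M ^ 2 * (ε / m) ^ (p / 2 + (1 / q).toReal) * T ^ (1 - p / 2)) := by
  have hK := bilConst_pos
  have ha : (0 : ℝ) ≤ (1 / q).toReal := ENNReal.toReal_nonneg
  have hb : (0 : ℝ) ≤ (1 / r).toReal := ENNReal.toReal_nonneg
  have hp2 : p ≤ 1 / 2 ∧ 0 ≤ p := by rcases hp with rfl | rfl <;> norm_num
  -- Admissibility converts the spatial gain into `p/2 + 1/q`. The `L^q` norm over `(0, T)` then
  -- restores exactly `T^{1/q}`, so the power of `T` no longer depends on `q`.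
  have e : p - p * (1 / r).toReal = p / 2 + (1 / q).toReal := by linarith
  have e2 : 0 ≤ 1 - (p / 2 + (1 / q).toReal) := by nlinarith [mul_nonneg hp2.2 hb]
  have hX : 0 < ε / m := by positivity
  refine (eLpNorm_le_of_forall_le hT (K := bilConst * M ^ 2 * (ε / m) ^ (p / 2 + (1 / q).toReal) *
    T ^ (1 - (p / 2 + (1 / q).toReal))) (by positivity) q fun t ht => ?_).trans_eq ?_
  · refine (eLpNorm_corrPart_le hm hm1 hε hz hv hzM hvM hp ht.1 hr).trans
      (ENNReal.ofReal_le_ofReal ?_)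
    rw [e]
    have := ht.1.le
    gcongr
    exact ht.2.le
  · rw [mul_assoc _ (T ^ _) (T ^ _), ← Real.rpow_add hT]
    congr 3
    ring

/-- The linear part in the mixed norms. -/
theorem mixedNorm_linPart_le {f g : L2} (hm : 0 < m) (hm1 : m ≤ 1) (hε : 0 < ε) (hM : 0 < M)
    (hf : ‖f‖ ≤ M) (hg : ‖g‖ ≤ M) {q r : ℝ≥0∞} (hq : 2 ≤ q) (hr : 2 ≤ r)
    (hqr : (1 / q).toReal + 1 / 3 * (1 / r).toReal = 1 / 6) :
    ∃ G : ℝ → ℝ≥0∞, Measurable G ∧ (∀ t, eLpNorm (linPart m hm.le hm1 ε f g t) r volume ≤ G t) ∧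
      eLpNorm G q (volume.restrict (Ioo 0 T)) ≤
        ENNReal.ofReal (4000000 * M * (ε / m) ^ (1 / q).toReal) := by
  obtain ⟨S, hS, hbound, hint⟩ := linPart_strichartz hm hm1 hε hf hg T
  have ha : (0 : ℝ) ≤ (1 / q).toReal := ENNReal.toReal_nonneg
  have hb : (0 : ℝ) ≤ (1 / r).toReal := ENNReal.toReal_nonneg
  have hX : 0 < ε / m := by positivity
  have e1 : 1 - 2 * (1 / r).toReal = 6 * (1 / q).toReal := by linarith
  have e2 : 2 * (1 / r).toReal = 1 - 6 * (1 / q).toReal := by linarith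
  have e3 : 0 ≤ 1 - 6 * (1 / q).toReal := by linarith
  set Q : ℝ := 4000000 * M with hQ
  have hQ0 : 0 < Q := by positivity
  -- Admissibility reads `1 - 2/r = 6/q`, so the `q`-th power of the interpolated bound contains
  -- exactly `S⁶`. The bound is kept as an explicit measurable majorant in `t`.
  refine ⟨fun t => S t ^ (6 * (1 / q).toReal) * ENNReal.ofReal Q ^ (1 - 6 * (1 / q).toReal),
    (hS.pow_const _).mul_const _, fun t => ?_, ?_⟩
  · have hmeas : Measurable (linPart m hm.le hm1 ε f g t) :=
      measurable_left_of_prod (F := linPart m hm.le hm1 ε f g) (measurable_linPart hm.le hm1 ε f g) t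
    have h := eLpNorm_le_interpolate hmeas.aestronglyMeasurable (B := ENNReal.ofReal Q) (hbound t)
      ?_ hr
    · rwa [e1, e2] at h
    · simp only [← ofReal_norm_sq]
      rw [← ENNReal.ofReal_pow hQ0.le]
      refine (linPart_energy hm.le hm1 ε hf hg t).trans (ENNReal.ofReal_le_ofReal ?_)
      gcongr
      rw [hQ]
      linarith
  · rcases eq_or_ne q ⊤ with rfl | hq'
    · simp only [ENNReal.div_top, ENNReal.toReal_zero, mul_zero, ENNReal.rpow_zero, sub_zero,
        ENNReal.rpow_one, one_mul, Real.rpow_zero, mul_one, eLpNorm_exponent_top]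
      exact eLpNormEssSup_le_of_ae_enorm_bound (Eventually.of_forall fun t => le_rfl)
    have hq0 : 0 < q.toReal := by
      have : 2 ≤ q.toReal := by simpa using ENNReal.toReal_mono hq' hq
      linarith
    rw [eLpNorm_eq_lintegral_rpow_enorm_toReal (by rintro rfl; simp at hq) hq']
    rw [toReal_one_div] at *
    set a := q.toReal⁻¹ with hadef
    have ha0 : 0 < a := inv_pos.2 hq0
    have haq : a * q.toReal = 1 := inv_mul_cancel₀ hq0.ne'
    rw [one_div, ← hadef]
    have key : ∀ t, ‖S t ^ (6 * a) * ENNReal.ofReal Q ^ (1 - 6 * a)‖ₑ ^ q.toReal =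
        S t ^ 6 * ENNReal.ofReal Q ^ ((1 - 6 * a) * q.toReal) := fun t => by
      rw [enorm_eq_self, ENNReal.mul_rpow_of_nonneg _ _ hq0.le, ← ENNReal.rpow_mul,
        ← ENNReal.rpow_mul, mul_assoc, haq, mul_one]
      norm_num
    simp only [key]
    rw [lintegral_mul_const _ (hS.pow_const 6)]
    calc _ ≤ (ENNReal.ofReal (Q ^ 6 * (ε / m)) * ENNReal.ofReal Q ^ ((1 - 6 * a) * q.toReal)) ^ a :=
          ENNReal.rpow_le_rpow (mul_le_mul_left hint _) ha0.le
      _ = ENNReal.ofReal (Q ^ 6 * (ε / m)) ^ a * ENNReal.ofReal Q ^ (1 - 6 * a) := by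
          rw [ENNReal.mul_rpow_of_nonneg _ _ ha0.le, ← ENNReal.rpow_mul,
            mul_assoc (1 - 6 * a), mul_comm q.toReal a, haq, mul_one]
      _ = _ := by
          rw [ofReal_rpow_mul_rpow (by positivity) hQ0.le ha0.le e3]
          congr 1
          rw [Real.mul_rpow (by positivity) hX.le, ← Real.rpow_natCast, ← Real.rpow_mul hQ0.le,
            mul_right_comm, ← Real.rpow_add hQ0]
          norm_num

/-- The local smoothing estimate for the sum of the linear and the nonlinear parts. -/
theorem lintegral_gaussian_le {f g : L2} (hm : 0 < m) (hm1 : m ≤ 1) (hε : 0 < ε) (hT : 0 < T)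
    (hf : ‖f‖ ≤ M) (hg : ‖g‖ ≤ M) (hz : Continuous z)
    (hv : Continuous v) (hzM : ∀ t, ‖z t‖ ≤ M) (hvM : ∀ t, ‖v t‖ ≤ M) (x₀ : ℝ) :
    ∫⁻ t in Ioo 0 T, ∫⁻ x, ENNReal.ofReal (Real.exp (-2 * (x - x₀) ^ 2)) *
      ‖linPart m hm.le hm1 ε f g t x + corrPart m hm.le ε z v t x‖ₑ ^ 2 ≤
      ENNReal.ofReal (2 * ε * (96 * M ^ 2 + 2 * (bilConst * M ^ 2 * T) ^ 2)) := by
  have hl := measurable_linPart hm.le hm1 ε f g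
  have hc := measurable_corrPart (ε := ε) hm hz hv
  have hmeas : Measurable fun p : ℝ × ℝ => ENNReal.ofReal (Real.exp (-2 * (p.2 - x₀) ^ 2)) *
      ‖linPart m hm.le hm1 ε f g p.1 p.2 + corrPart m hm.le ε z v p.1 p.2‖ₑ ^ 2 := by
    have h1 : Measurable fun p : ℝ × ℝ => ENNReal.ofReal (Real.exp (-2 * (p.2 - x₀) ^ 2)) := by
      fun_prop
    exact h1.mul ((hl.add hc).enorm.pow_const 2)
  -- After Tonelli the time integral at fixed `x` is bounded uniformly in `x` by smoothing, and the
  -- Gaussian has mass at most 2.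
  rw [lintegral_lintegral_swap hmeas.aemeasurable]
  have hx : ∀ x, ∫⁻ t in Ioo 0 T, ‖linPart m hm.le hm1 ε f g t x + corrPart m hm.le ε z v t x‖ₑ ^ 2 ≤
      ENNReal.ofReal (ε * (96 * M ^ 2 + 2 * (bilConst * M ^ 2 * T) ^ 2)) := fun x => by
    have hlx : Measurable fun t => linPart m hm.le hm1 ε f g t x :=
      measurable_right_of_prod (F := linPart m hm.le hm1 ε f g) hl x
    have hlm : Measurable fun t => ENNReal.ofReal (‖linPart m hm.le hm1 ε f g t x‖ ^ 2) :=
      (hlx.norm.pow_const 2).ennreal_ofReal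
    calc _ ≤ ∫⁻ t in Ioo 0 T, 2 * (ENNReal.ofReal (‖linPart m hm.le hm1 ε f g t x‖ ^ 2) +
          ENNReal.ofReal (‖corrPart m hm.le ε z v t x‖ ^ 2)) := by
          refine lintegral_mono fun t => ?_
          dsimp only
          rw [← ofReal_norm_sq, ← ENNReal.ofReal_add (by positivity) (by positivity)]
          have h := pow_le_pow_left₀ (norm_nonneg _)
            (norm_add_le (linPart m hm.le hm1 ε f g t x) (corrPart m hm.le ε z v t x)) 2
          refine (ENNReal.ofReal_le_ofReal (h.trans add_sq_le)).trans_eq ?_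
          rw [ENNReal.ofReal_mul zero_le_two, ENNReal.ofReal_ofNat]
      _ = 2 * ((∫⁻ t in Ioo 0 T, ENNReal.ofReal (‖linPart m hm.le hm1 ε f g t x‖ ^ 2)) +
          ∫⁻ t in Ioo 0 T, ENNReal.ofReal (‖corrPart m hm.le ε z v t x‖ ^ 2)) := by
          rw [lintegral_const_mul' _ _ (by norm_num), lintegral_add_left hlm]
      _ ≤ 2 * (ENNReal.ofReal (48 * ε * M ^ 2) + ENNReal.ofReal (ε * (bilConst * M ^ 2 * T) ^ 2)) := by
          gcongr
          · exact linPart_smoothing hm.le hm1 hε hf hg hT x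
          · exact corrPart_smoothing hm hm1 hε hz hv hzM hvM hT x
      _ = _ := by
          rw [← ENNReal.ofReal_add (by positivity) (by positivity), ← ENNReal.ofReal_ofNat 2,
            ← ENNReal.ofReal_mul zero_le_two]
          congr 1
          ring
  have hgi : Integrable fun x : ℝ => Real.exp (-2 * (x - x₀) ^ 2) :=
    (integrable_exp_neg_mul_sq zero_lt_two).comp_sub_right x₀
  have hg2 : ∫⁻ x : ℝ, ENNReal.ofReal (Real.exp (-2 * (x - x₀) ^ 2)) ≤ ENNReal.ofReal 2 := by
    rw [← ofReal_integral_eq_lintegral_ofReal hgi (Eventually.of_forall fun x => (Real.exp_pos _).le),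
      integral_sub_right_eq_self (fun x : ℝ => Real.exp (-2 * x ^ 2)), integral_gaussian]
    refine ENNReal.ofReal_le_ofReal (Real.sqrt_le_iff.2 ⟨zero_le_two, ?_⟩)
    linarith [Real.pi_lt_four]
  calc _ ≤ ∫⁻ x, ENNReal.ofReal (Real.exp (-2 * (x - x₀) ^ 2)) *
        ENNReal.ofReal (ε * (96 * M ^ 2 + 2 * (bilConst * M ^ 2 * T) ^ 2)) := by
        refine lintegral_mono fun x => ?_
        dsimp only
        rw [lintegral_const_mul' _ _ ENNReal.ofReal_ne_top]
        exact mul_le_mul_right (hx x) _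
    _ ≤ ENNReal.ofReal 2 * ENNReal.ofReal (ε * (96 * M ^ 2 + 2 * (bilConst * M ^ 2 * T) ^ 2)) := by
        rw [lintegral_mul_const' _ _ ENNReal.ofReal_ne_top]
        gcongr
    _ = _ := by
        rw [← ENNReal.ofReal_mul zero_le_two]
        congr 1
        ring

end

theorem mixedNorm_congr {T : ℝ} {q r : ℝ≥0∞} {W W' : ℝ → ℝ → EuclideanSpace ℂ (Fin 2)}
    (h : ∀ t ∈ Ioo 0 T, W t =ᵐ[volume] W' t) : mixedNorm T q r W = mixedNorm T q r W' :=
  eLpNorm_congr_ae ((ae_restrict_iff' measurableSet_Ioo).2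
    (Eventually.of_forall fun t ht => eLpNorm_congr_ae (h t ht)))

/-- Passing from `m = μ/3` back to `μ` costs `3^e ≤ 3`. -/
theorem div_div_three_rpow_le {ε μ e : ℝ} (hε : 0 < ε) (hμ : 0 < μ) (he1 : e ≤ 1) :
    (ε / (μ / 3)) ^ e ≤ 3 * (ε / μ) ^ e := by
  rw [show ε / (μ / 3) = 3 * (ε / μ) by field_simp, Real.mul_rpow (by norm_num) (by positivity)]
  gcongr
  calc (3 : ℝ) ^ e ≤ 3 ^ (1 : ℝ) := Real.rpow_le_rpow_of_exponent_le (by norm_num) he1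
    _ = 3 := Real.rpow_one 3

theorem eLpNorm_two_sq {α E : Type*} [MeasurableSpace α] {ν : Measure α} [ENorm E] (f : α → E) :
    eLpNorm f 2 ν ^ 2 = ∫⁻ x, ‖f x‖ₑ ^ 2 ∂ν := by
  have h := eLpNorm_nnreal_pow_eq_lintegral (μ := ν) (f := f) (p := 2) two_ne_zero
  simpa using h

theorem toReal_mul_one_div (n : ℕ) (r : ℝ≥0∞) :
    (1 / ((n : ℝ≥0∞) * r)).toReal = (n : ℝ)⁻¹ * (1 / r).toReal := by
  rw [toReal_one_div, toReal_one_div, ENNReal.toReal_mul, ENNReal.toReal_natCast, mul_inv]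

theorem toReal_admissible {q r : ℝ≥0∞} (hq : 2 ≤ q) (hr : 2 ≤ r) (n : ℕ) (hn : n ≠ 0) {c : ℝ≥0∞}
    (h : 1 / q + 1 / ((n : ℝ≥0∞) * r) = c) :
    (1 / q).toReal + (n : ℝ)⁻¹ * (1 / r).toReal = c.toReal := by
  rw [← h, ENNReal.toReal_add, toReal_mul_one_div]
  · rw [one_div]
    exact ENNReal.inv_ne_top.2 (by rintro rfl; simp at hq)
  · rw [one_div]
    refine ENNReal.inv_ne_top.2 (mul_ne_zero (by exact_mod_cast hn) ?_)
    rintro rfl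
    simp at hr

end Boussinesq

/-! ### The four estimates -/

theorem theorem2p1 :
    ∃ C : ℝ, 0 < C ∧
      ∀ M T ε μ : ℝ, 0 < M → 0 < T → 0 < ε → ε ≤ 1 → 0 < μ → μ ≤ 1 →
      ∀ ζ V : ℝ → ℝ → ℝ, Boussinesq.IsSolution ε μ T ζ V →
      (∀ t ∈ Icc 0 T,
        Boussinesq.sobolevNorm 3 (ζ t) + Boussinesq.sobolevNorm 3 (V t) ≤ ENNReal.ofReal M) →
      (∀ q r : ℝ≥0∞, 2 ≤ q → 2 ≤ r → 1 / q + 1 / (2 * r) = 1 / 4 →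
        Boussinesq.mixedNorm T q r
            (fun t x => Boussinesq.state ζ V t x -
              Boussinesq.linearFlow μ (-(t / ε)) (ζ 0) (V 0) x) ≤
          ENNReal.ofReal ((ε / μ) ^ ((1 / 4 : ℝ) + (1 / q).toReal) * M ^ 2 *
            T ^ (3 / 4 : ℝ) * C)) ∧
      (∀ q r : ℝ≥0∞, 2 ≤ q → 2 ≤ r → 1 / q + 1 / (3 * r) = 1 / 6 →
        Boussinesq.mixedNorm T q r
            (fun t x => Boussinesq.state ζ V t x -
              Boussinesq.linearFlow μ (-(t / ε)) (ζ 0) (V 0) x) ≤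
          ENNReal.ofReal ((ε / μ) ^ ((1 / 6 : ℝ) + (1 / q).toReal) * M ^ 2 *
            T ^ (5 / 6 : ℝ) * C)) ∧
      (∀ q r : ℝ≥0∞, 2 ≤ q → 2 ≤ r → 1 / q + 1 / (3 * r) = 1 / 6 →
        Boussinesq.mixedNorm T q r (Boussinesq.state ζ V) ≤
          ENNReal.ofReal ((ε / μ) ^ (1 / q).toReal *
            (M + M ^ 2 * T ^ (5 / 6 : ℝ) * (ε / μ) ^ (1 / 6 : ℝ)) * C)) ∧
      (⨆ x₀ : ℝ, Boussinesq.mixedNorm T 2 2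
            (fun t x => Real.exp (-(x - x₀) ^ 2) • Boussinesq.state ζ V t x)) ≤
        ENNReal.ofReal (ε ^ (1 / 2 : ℝ) * (M + M ^ 2 * T) * C) := by
  have hK := Boussinesq.bilConst_pos
  -- `12000000 = 3·4000000` covers the linear Strichartz constant and `3 * bilConst` the nonlinear
  -- part, the factor 3 coming from `div_div_three_rpow_le`.
  refine ⟨12000000 + 3 * Boussinesq.bilConst, by positivity, ?_⟩
  intro M T ε μ hM hT hε _ hμ hμ1 ζ V h hb
  set K := Boussinesq.bilConst
  obtain ⟨z, v, hz, hv, hzM, hvM, hzv⟩ := h.exists_curves hT hM hb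
  have hm : 0 < μ / 3 := by positivity
  have hm1 : μ / 3 ≤ 1 := by linarith
  have h0 : (0 : ℝ) ∈ Icc 0 T := ⟨le_rfl, hT.le⟩
  have hstate : ∀ t ∈ Ioo 0 T, Boussinesq.state ζ V t =ᵐ[volume] fun x =>
      Boussinesq.linPart (μ / 3) hm.le hm1 ε (z 0) (v 0) t x +
        Boussinesq.corrPart (μ / 3) hm.le ε z v t x := fun t ht =>
    Boussinesq.state_ae_eq h hε hm hm1 hz hv hzv (Ioo_subset_Icc_self ht)
  have hdiff : ∀ t ∈ Ioo 0 T, (fun x => Boussinesq.state ζ V t x -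
      Boussinesq.linearFlow μ (-(t / ε)) (ζ 0) (V 0) x) =ᵐ[volume]
        Boussinesq.corrPart (μ / 3) hm.le ε z v t := fun t ht => by
    filter_upwards [hstate t ht] with x hx
    rw [hx, Boussinesq.linearFlow_eq_linPart hm.le hm1 (h.continuous_zeta.1 0 h0)
      (h.continuous_V.1 0 h0), (hzv 0 h0).1, (hzv 0 h0).2, add_sub_cancel_left]
  have hcorr : ∀ p : ℝ, (p = 1 / 2 ∨ p = 1 / 3) → ∀ q r : ℝ≥0∞, 2 ≤ q → 2 ≤ r →
      (1 / q).toReal + p * (1 / r).toReal = p / 2 →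
      Boussinesq.mixedNorm T q r (Boussinesq.corrPart (μ / 3) hm.le ε z v) ≤
        ENNReal.ofReal ((ε / μ) ^ (p / 2 + (1 / q).toReal) * M ^ 2 * T ^ (1 - p / 2) * (3 * K)) := by
    intro p hp q r hq hr hqr
    refine (Boussinesq.mixedNorm_corrPart_le hm hm1 hε hz hv hzM hvM hp hT hr hqr).trans
      (ENNReal.ofReal_le_ofReal ?_)
    have hq2 := Boussinesq.toReal_one_div_le_half hq
    have he : p / 2 + (1 / q).toReal ≤ 1 := by rcases hp with rfl | rfl <;> linarith
    calc _ ≤ K * M ^ 2 * (3 * (ε / μ) ^ (p / 2 + (1 / q).toReal)) * T ^ (1 - p / 2) := by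
          gcongr
          exact Boussinesq.div_div_three_rpow_le hε hμ he
      _ = _ := by ring
  have adm2 : ∀ q r : ℝ≥0∞, 2 ≤ q → 2 ≤ r → 1 / q + 1 / (2 * r) = 1 / 4 →
      (1 / q).toReal + 1 / 2 * (1 / r).toReal = 1 / 4 := fun q r hq hr hqr => by
    simpa using Boussinesq.toReal_admissible hq hr 2 two_ne_zero hqr
  have adm3 : ∀ q r : ℝ≥0∞, 2 ≤ q → 2 ≤ r → 1 / q + 1 / (3 * r) = 1 / 6 →
      (1 / q).toReal + 1 / 3 * (1 / r).toReal = 1 / 6 := fun q r hq hr hqr => by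
    simpa using Boussinesq.toReal_admissible hq hr 3 three_ne_zero hqr
  refine ⟨fun q r hq hr hqr => ?_, fun q r hq hr hqr => ?_, fun q r hq hr hqr => ?_, ?_⟩
  · rw [Boussinesq.mixedNorm_congr hdiff]
    refine (hcorr (1 / 2) (Or.inl rfl) q r hq hr ?_).trans (ENNReal.ofReal_le_ofReal ?_)
    · rw [adm2 q r hq hr hqr]; norm_num
    · rw [show (1 / 2 : ℝ) / 2 = 1 / 4 by norm_num, show (1 : ℝ) - 1 / 4 = 3 / 4 by norm_num]
      gcongr
      linarith
  · rw [Boussinesq.mixedNorm_congr hdiff]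
    refine (hcorr (1 / 3) (Or.inr rfl) q r hq hr ?_).trans (ENNReal.ofReal_le_ofReal ?_)
    · rw [adm3 q r hq hr hqr]; norm_num
    · rw [show (1 / 3 : ℝ) / 2 = 1 / 6 by norm_num, show (1 : ℝ) - 1 / 6 = 5 / 6 by norm_num]
      gcongr
      linarith
  · have hadm := adm3 q r hq hr hqr
    have hq2 := Boussinesq.toReal_one_div_le_half hq
    obtain ⟨G, hG, hlin, hGq⟩ := Boussinesq.mixedNorm_linPart_le (T := T) hm hm1 hε hM (hzM 0) (hvM 0)
      hq hr hadm
    have hc := Boussinesq.measurable_corrPart (ε := ε) hm hz hv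
    have hl := Boussinesq.measurable_linPart hm.le hm1 ε (z 0) (v 0)
    obtain ⟨N, hN, hcN⟩ : ∃ N : ℝ, N = K * M ^ 2 * (ε / (μ / 3)) ^ (1 / 6 + (1 / q).toReal) *
        T ^ (1 - (1 / 6 + (1 / q).toReal)) ∧ ∀ t ∈ Ioo 0 T,
          eLpNorm (Boussinesq.corrPart (μ / 3) hm.le ε z v t) r volume ≤ ENNReal.ofReal N := by
      refine ⟨_, rfl, fun t ht => (Boussinesq.eLpNorm_corrPart_le hm hm1 hε hz hv hzM hvM
        (Or.inr rfl) ht.1 hr).trans (ENNReal.ofReal_le_ofReal ?_)⟩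
      have := ht.1.le
      rw [show 1 / 3 - 1 / 3 * (1 / r).toReal = 1 / 6 + (1 / q).toReal by linarith]
      gcongr
      · linarith
      · exact ht.2.le
    have hN0 : 0 ≤ N := by rw [hN]; positivity
    rw [Boussinesq.mixedNorm_congr hstate]
    -- The triangle inequality in `L^q` is applied to the measurable majorants `G` and `N`, which
    -- avoids the measurability in `t` of the spatial norms themselves.
    calc _ ≤ eLpNorm (G + fun _ => ENNReal.ofReal N) q (volume.restrict (Ioo 0 T)) := by
          refine eLpNorm_mono_enorm_ae ((ae_restrict_iff' measurableSet_Ioo).2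
            (Eventually.of_forall fun t ht => ?_))
          rw [enorm_eq_self, enorm_eq_self, Pi.add_apply]
          refine (eLpNorm_add_le
            (Boussinesq.measurable_left_of_prod
              (F := Boussinesq.linPart (μ / 3) hm.le hm1 ε (z 0) (v 0)) hl t).aestronglyMeasurable
            (Boussinesq.measurable_left_of_prod
              (F := Boussinesq.corrPart (μ / 3) hm.le ε z v) hc t).aestronglyMeasurable
            (one_le_two.trans hr)).trans (add_le_add (hlin t) (hcN t ht))
      _ ≤ eLpNorm G q (volume.restrict (Ioo 0 T)) +
          eLpNorm (fun _ => ENNReal.ofReal N) q (volume.restrict (Ioo 0 T)) :=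
        eLpNorm_add_le hG.aestronglyMeasurable aestronglyMeasurable_const (one_le_two.trans hq)
      _ ≤ ENNReal.ofReal (4000000 * M * (ε / (μ / 3)) ^ (1 / q).toReal) +
          ENNReal.ofReal (N * T ^ (1 / q).toReal) :=
        add_le_add hGq (Boussinesq.eLpNorm_le_of_forall_le hT hN0 q fun t _ => le_rfl)
      _ ≤ _ := by
        rw [← ENNReal.ofReal_add (by positivity) (by positivity)]
        refine ENNReal.ofReal_le_ofReal ?_
        have ha : (ε / (μ / 3)) ^ (1 / q).toReal ≤ 3 * (ε / μ) ^ (1 / q).toReal :=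
          Boussinesq.div_div_three_rpow_le hε hμ (by linarith)
        have hb' : (ε / (μ / 3)) ^ (1 / 6 + (1 / q).toReal) ≤
            3 * ((ε / μ) ^ (1 / q).toReal * (ε / μ) ^ (1 / 6 : ℝ)) := by
          rw [← Real.rpow_add (by positivity), add_comm _ (1 / 6 : ℝ)]
          exact Boussinesq.div_div_three_rpow_le hε hμ (by linarith)
        have hNT : N * T ^ (1 / q).toReal =
            K * M ^ 2 * (ε / (μ / 3)) ^ (1 / 6 + (1 / q).toReal) * T ^ (5 / 6 : ℝ) := by
          rw [hN, mul_assoc _ (T ^ _) (T ^ _), ← Real.rpow_add hT]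
          congr 2
          ring
        rw [hNT]
        calc _ ≤ 4000000 * M * (3 * (ε / μ) ^ (1 / q).toReal) +
              K * M ^ 2 * (3 * ((ε / μ) ^ (1 / q).toReal * (ε / μ) ^ (1 / 6 : ℝ))) *
                T ^ (5 / 6 : ℝ) := by gcongr
          _ = (ε / μ) ^ (1 / q).toReal * (M * 12000000 +
              M ^ 2 * T ^ (5 / 6 : ℝ) * (ε / μ) ^ (1 / 6 : ℝ) * (3 * K)) := by ring
          _ ≤ (ε / μ) ^ (1 / q).toReal * (M * (12000000 + 3 * K) +
              M ^ 2 * T ^ (5 / 6 : ℝ) * (ε / μ) ^ (1 / 6 : ℝ) * (12000000 + 3 * K)) := by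
            gcongr <;> linarith
          _ = _ := by ring
  · refine iSup_le fun x₀ => ?_
    have hcongr : ∀ t ∈ Ioo 0 T,
        (fun x => Real.exp (-(x - x₀) ^ 2) • Boussinesq.state ζ V t x) =ᵐ[volume] fun x =>
          Real.exp (-(x - x₀) ^ 2) • (Boussinesq.linPart (μ / 3) hm.le hm1 ε (z 0) (v 0) t x +
            Boussinesq.corrPart (μ / 3) hm.le ε z v t x) := fun t ht =>
      (hstate t ht).mono fun x hx => by dsimp only; rw [hx]
    -- For `q = r = 2` the squared mixed norm is an iterated integral of the squared modulus, with
    -- weight `e^{-2(x-x₀)²}`.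
    rw [Boussinesq.mixedNorm_congr hcongr, Boussinesq.mixedNorm,
      ← ENNReal.pow_le_pow_left_iff two_ne_zero, Boussinesq.eLpNorm_two_sq]
    simp only [enorm_eq_self, Boussinesq.eLpNorm_two_sq, enorm_smul, mul_pow]
    have hexp : ∀ x : ℝ, ‖Real.exp (-(x - x₀) ^ 2)‖ₑ ^ 2 =
        ENNReal.ofReal (Real.exp (-2 * (x - x₀) ^ 2)) := fun x => by
      rw [← Boussinesq.ofReal_norm_sq, Real.norm_of_nonneg (Real.exp_pos _).le, ← Real.exp_nat_mul]
      congr 2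
      push_cast
      ring
    simp only [hexp]
    refine (Boussinesq.lintegral_gaussian_le hm hm1 hε hT (hzM 0) (hvM 0) hz hv hzM hvM x₀).trans ?_
    rw [← ENNReal.ofReal_pow (by positivity)]
    refine ENNReal.ofReal_le_ofReal ?_
    have hs : (ε ^ (1 / 2 : ℝ)) ^ 2 = ε := by
      rw [← Real.sqrt_eq_rpow, Real.sq_sqrt hε.le]
    have hs' : (ε ^ (1 / 2 : ℝ) * (M + M ^ 2 * T) * (12000000 + 3 * K)) ^ 2 =
        ε * ((M + M ^ 2 * T) * (12000000 + 3 * K)) ^ 2 := by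
      rw [mul_assoc, mul_pow, hs]
    rw [hs']
    change 2 * ε * (96 * M ^ 2 + 2 * (K * M ^ 2 * T) ^ 2) ≤ _
    have e : (12000000 * M + 3 * K * (M ^ 2 * T)) ^ 2 ≤ ((M + M ^ 2 * T) * (12000000 + 3 * K)) ^ 2 := by
      have : 0 < M ^ 2 * T := by positivity
      gcongr
      nlinarith [mul_pos hM hK]
    -- The squares on the right dominate termwise, `192 ≤ 12000000²` and `4 ≤ 9`, and the cross term
    -- is positive.
    have e' : 2 * (96 * M ^ 2 + 2 * (K * M ^ 2 * T) ^ 2) ≤ (12000000 * M + 3 * K * (M ^ 2 * T)) ^ 2 := by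
      have : 0 < M * (K * (M ^ 2 * T)) := by positivity
      nlinarith [sq_nonneg M, sq_nonneg (K * (M ^ 2 * T))]
    calc _ = ε * (2 * (96 * M ^ 2 + 2 * (K * M ^ 2 * T) ^ 2)) := by ring
      _ ≤ ε * ((M + M ^ 2 * T) * (12000000 + 3 * K)) ^ 2 := by
        gcongr
        exact e'.trans e
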